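/- **Proposition 2.3.** Let $M$ be a connected open subset of a Riemann surface $R$ and let $X=(x_1,x_2,x_3)\colon M\to\mathbb R^3$ be a smooth conformal immersion that is minimal (its mean curvature vanishes) and complete (every divergent curve in $M$ has infinite length in the induced metric). Let $J$ denote the rotation by $\pi/2$ in the tangent planes of $M$, let $N$ be the positively oriented unit normal of $X$, and let $\Phi=dX-i\,dX\circ J$ be the $\mathbb C^3$-valued form of type $(1,0)$ with $dX=\operatorname{Re}\Phi$, i.e. $X=\operatorname{Re}\int\Phi$. The conjugate surface is the multi-valued map $X^*=\operatorname{Re}\int(-i\Phi)=\operatorname{Im}\int\Phi$ on $M$. A *puncture* of $M$ is a point $p\in R\setminus M$ with a punctured neighbourhood contained in $M$; a closed curve is *in the homology class of* $p$ if it is homologous in $M$ (in $H_1(M;\mathbb Z)$) to a small positively oriented coordinate circle around $p$. The *flux* of $X$ along a closed piecewise $C^1$ curve $\gamma\colon[0,1]\to M$ is $$\operatorname{Flux}([\gamma])=\int_\gamma \operatorname{Rot}_{\pi/2}\Big(\frac{d(X\circ\gamma)}{ds}\Big)\,ds=\int_0^1 N(\gamma(t))\times (X\circ\gamma)'(t)\,dt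 .$$ Say that the end of $X$ at a puncture $p$ has *logarithmic growth* $\alpha$ if $X$ maps some punctured neighbourhood of $p$ onto the graph $x_3=u(x_1,x_2)$ of a function $u$ over the exterior $\{\rho>r\}$ of a disk of radius $r>0$ in the $(x_1,x_2)$-plane, where $\rho=(x_1^2+x_2^2)^{1/2}$ and, for some constants $\beta,\gamma_1,\gamma_2$, $$u(x_1,x_2)=\alpha\log\rho+\beta+\rho^{-2}(\gamma_1x_1+\gamma_2x_2)+O(\rho^{-2}).$$ The end is *flat* if it has logarithmic growth $0$. The puncture $p$ represents a *vertical embedded end of finite total curvature* if on some punctured neighbourhood of $p$ in $M$ the map $X$ is one-to-one and has finite total curvature $\int|K|\,dA<\infty$, and $N$ tends to $(0,0,1)$ or to $(0,0,-1)$ at $p$. Then the branches of $X^*$ are conformal immersions, and: (i) For every closed curve $\gamma$ in $M$, $\operatorname{Flux}([\gamma])=-\operatorname{Period}_\gamma X^*$. Here the period is $\operatorname{Re}\oint_\gamma(-i\Phi)$; moreover $X^*$ can be continued along $\gamma$, and $\operatorname{Flux}([\gamma])$ is also minus the increment along $\gamma$ of every continuation of $X^*$ along $\gamma$. (ii) At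 every puncture $p$ of $M$ the form $\Phi$ has a residue (the coefficient of $z^{-1}$ in its Laurent expansion), and if $\gamma$ is in the homology class of $p$, then $\operatorname{Flux}([\gamma])=-2\pi\operatorname{Res}_p\Phi$. (iii) If $p$ represents a vertical embedded end of finite total curvature, then this end has a logarithmic growth $\alpha$, and for every $\gamma$ in the homology class of $p$ $$\operatorname{Flux}([\gamma])=(0,0,2\pi\alpha).$$ In particular this flux is vertical, and it is zero if and only if the end is flat. (iv) Suppose that $R$ is compact, that $M=R\setminus\{p_1,\dots,p_r\}$, that $X$ is an embedding, and that $\int_M|K|\,dA<\infty$. Then there is a rotation $A$ of $\mathbb R^3$ such that for every $j$ the end of $A\circ X$ at $p_j$ has a logarithmic growth, and for every rotation $A$ for which these ends have logarithmic growths $\alpha_1,\dots,\alpha_r$, $$\sum_{j=1}^r\alpha_j=0 .$$ -/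

import Mathlib

open Set Filter Topology MeasureTheory
open scoped Manifold ContDiff ENNReal RealInnerProductSpace

noncomputable section

/-- Euclidean three-space. -/
abbrev E3 := EuclideanSpace ℝ (Fin 3)

/-- The vector product of `E3`. -/
def cross (a b : E3) : E3 := WithLp.toLp 2 (crossProduct a.ofLp b.ofLp)

section Surface

variable {R : Type*} [TopologicalSpace R] [ChartedSpace ℂ R]

/-! Throughout, `R` is a Riemann surface: a one-dimensional complex manifold. The tangent space at
`q` is Mathlib's, i.e. it is `ℂ`, identified by means of the preferred chart at `q`. As changes of
charts are holomorphic, multiplication by `Complex.I` is the rotation by `π / 2` of the tangent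
space. -/

/-- The real differential `dX_q` of `X : R → ℝ³`. -/
def differential (X : R → E3) (q : R) : ℂ →L[ℝ] E3 :=
  mfderiv 𝓘(ℝ, ℂ) 𝓘(ℝ, E3) X q

/-- `X` is a smooth conformal immersion on the open set `U`. -/
def IsConformalImmersionOn (X : R → E3) (U : Set R) : Prop :=
  ContMDiffOn 𝓘(ℝ, ℂ) 𝓘(ℝ, E3) ∞ X U ∧ ∀ q ∈ U, IsConformalMap (differential X q)

/-- `X_u × X_v` at `q`, where `u + i v` is the preferred complex coordinate at `q`. -/
def normalVector (X : R → E3) (q : R) : E3 :=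
  cross (differential X q 1) (differential X q Complex.I)

/-- The Gauss map: the unit normal that is positive for the orientation of `R`. -/
def gaussMap (X : R → E3) (q : R) : E3 := ‖normalVector X q‖⁻¹ • normalVector X q

/-- The mean curvature `H = tr S / 2`, where the shape operator `S` is given by `dX ∘ S = dN`, so
that `N_u × X_v + X_u × N_v = (tr S) X_u × X_v`. -/
def meanCurvature (X : R → E3) (q : R) : ℝ :=
  ⟪cross (differential (gaussMap X) q 1) (differential X q Complex.I) +
      cross (differential X q 1) (differential (gaussMap X) q Complex.I), normalVector X q⟫ /
    (2 * ‖normalVector X q‖ ^ 2)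

/-- The Gauss curvature `K = det S`, where `dX ∘ S = dN`, so that
`N_u × N_v = (det S) X_u × X_v`. -/
def gaussCurvature (X : R → E3) (q : R) : ℝ :=
  ⟪cross (differential (gaussMap X) q 1) (differential (gaussMap X) q Complex.I), normalVector X q⟫ /
    ‖normalVector X q‖ ^ 2

/-- `X` is minimal on `U`: its mean curvature vanishes identically. -/
def IsMinimalOn (X : R → E3) (U : Set R) : Prop := ∀ q ∈ U, meanCurvature X q = 0

/-- The velocity of a curve `γ` in `R` at time `t`. -/
def velocity (γ : ℝ → R) (t : ℝ) : ℂ := mfderiv 𝓘(ℝ, ℝ) 𝓘(ℝ, ℂ) γ t (1 : ℝ)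

/-- The metric induced by `X` on `M` is complete: every divergent curve `δ : [0, 1) → M`, that is,
one that leaves every compact subset of `M`, has infinite length. -/
def IsCompleteOn (X : R → E3) (M : Set R) : Prop :=
  ∀ δ : ℝ → R, ContMDiffOn 𝓘(ℝ, ℝ) 𝓘(ℝ, ℂ) 1 δ (Ico 0 1) → MapsTo δ (Ico 0 1) M →
    (∀ K : Set R, IsCompact K → K ⊆ M → ∀ᶠ t in 𝓝[<] (1 : ℝ), δ t ∉ K) →
    ∫⁻ t in Ico (0 : ℝ) 1, ‖differential X (δ t) (velocity δ t)‖ₑ = ⊤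

/-- The area density `|∂_u X × ∂_v X|` of `X` in the chart `φ`. -/
def areaDensity (X : R → E3) (φ : OpenPartialHomeomorph R ℂ) (z : ℂ) : ℝ :=
  ‖cross (fderiv ℝ (X ∘ φ.symm) z 1) (fderiv ℝ (X ∘ φ.symm) z Complex.I)‖

/-- The total absolute curvature `∫_S |K| dA` of `X` on a subset `S` of the surface: the supremum of
`∑ ∫_{A_i} |K| dA` over the finite families of disjoint measurable pieces `A_i` of `S`, each
described in a chart. -/
def totalAbsCurvature (X : R → E3) (S : Set R) : ℝ≥0∞ :=
  ⨆ (n : ℕ) (c : Fin n → R) (A : Fin n → Set ℂ)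
    (_ : (∀ i, MeasurableSet (A i) ∧ A i ⊆ (chartAt ℂ (c i)).target ∧
        (chartAt ℂ (c i)).symm '' A i ⊆ S) ∧
      Pairwise fun i j =>
        Disjoint ((chartAt ℂ (c i)).symm '' A i) ((chartAt ℂ (c j)).symm '' A j)),
    ∑ i, ∫⁻ z in A i, ENNReal.ofReal
      (|gaussCurvature X ((chartAt ℂ (c i)).symm z)| * areaDensity X (chartAt ℂ (c i)) z)

/-- `γ`, restricted to `[0, 1]`, is a closed piecewise `C¹` curve in `M`. -/
def IsClosedCurveIn (M : Set R) (γ : ℝ → R) : Prop :=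
  MapsTo γ (Icc 0 1) M ∧ γ 0 = γ 1 ∧
    ∃ (n : ℕ) (τ : ℕ → ℝ), Monotone τ ∧ τ 0 = 0 ∧ τ n = 1 ∧
      ∀ i < n, ContMDiffOn 𝓘(ℝ, ℝ) 𝓘(ℝ, ℂ) 1 γ (Icc (τ i) (τ (i + 1)))

/-- The flux `∫ Rot_{π/2} (dγ/ds) ds` of `X ∘ γ`. The rotation by `π / 2` in the tangent plane is
`w ↦ N × w`. -/
def flux (X : R → E3) (γ : ℝ → R) : E3 :=
  ∫ t in (0 : ℝ)..1, cross (gaussMap X (γ t)) (differential X (γ t) (velocity γ t))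

/-- `X = Re ∫ Φ` on `M`, for the `ℂ³`-valued form `Φ` of type (1, 0): the differential of `X` is
the real part of `Φ`. -/
def IsRealPartOfIntegralOn (X : R → E3) (Φ : R → ℂ →L[ℂ] (Fin 3 → ℂ)) (M : Set R) : Prop :=
  ∀ q ∈ M, MDifferentiableAt 𝓘(ℝ, ℂ) 𝓘(ℝ, E3) X q ∧
    ∀ (v : ℂ) (j : Fin 3), differential X q v j = (Φ q v j).re

/-- The form of the conjugate surface, which is minus the associate surface with form `i Φ`. -/
def conjugateForm (Φ : R → ℂ →L[ℂ] (Fin 3 → ℂ)) : R → ℂ →L[ℂ] (Fin 3 → ℂ) :=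
  fun q => -(Complex.I • Φ q)

/-- The period `Re ∮_γ Ψ` along `γ` of the multi-valued map `Re ∫ Ψ`. -/
def period (Ψ : R → ℂ →L[ℂ] (Fin 3 → ℂ)) (γ : ℝ → R) : E3 :=
  WithLp.toLp 2 fun j => (∫ t in (0 : ℝ)..1, Ψ (γ t) (velocity γ t) j).re

/-- `Y` is obtained by following a branch of the multi-valued map `Re ∫ Ψ` on `M` continuously
along `γ`. -/
def IsContinuationAlong (Ψ : R → ℂ →L[ℂ] (Fin 3 → ℂ)) (M : Set R) (γ : ℝ → R) (Y : ℝ → E3) :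
    Prop :=
  ∀ t ∈ Icc (0 : ℝ) 1, ∃ (U : Set R) (F : R → E3), IsOpen U ∧ γ t ∈ U ∧ U ⊆ M ∧
    IsRealPartOfIntegralOn F Ψ U ∧ ∀ᶠ s in 𝓝[Icc 0 1] t, Y s = F (γ s)

/-- The boundaries of singular 2-chains in `M`, in the free abelian group on the paths: the
subgroup generated by the boundaries of the singular triangles in `M`. -/
def singularBoundaries (M : Set R) : AddSubgroup ((unitInterval → R) →₀ ℤ) :=
  AddSubgroup.closure {b | ∃ σ : ℝ × ℝ → R,
    ContinuousOn σ {x | 0 ≤ x.1 ∧ 0 ≤ x.2 ∧ x.1 + x.2 ≤ 1} ∧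
    MapsTo σ {x | 0 ≤ x.1 ∧ 0 ≤ x.2 ∧ x.1 + x.2 ≤ 1} M ∧
    b = Finsupp.single (fun t : unitInterval => σ (1 - (t : ℝ), (t : ℝ))) 1
      - Finsupp.single (fun t : unitInterval => σ (0, (t : ℝ))) 1
      + Finsupp.single (fun t : unitInterval => σ ((t : ℝ), 0)) 1}

/-- The closed curves `γ` and `c` in `M` (on `[0, 1]`) are homologous in `M`: they have the same
class in the singular homology group `H₁(M; ℤ)`. -/
def AreHomologousIn (M : Set R) (γ c : ℝ → R) : Prop :=
  Finsupp.single (fun t : unitInterval => γ t) 1 - Finsupp.single (fun t : unitInterval => c t) 1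
    ∈ singularBoundaries M

/-- `p` is a puncture of `M`: a point outside `M`, a punctured neighbourhood of which lies
in `M`. -/
def IsPuncture (M : Set R) (p : R) : Prop := p ∉ M ∧ M ∈ 𝓝[≠] p

/-- The positively oriented coordinate circle of radius `r` around `p`. -/
def coordCircle (p : R) (r : ℝ) (t : ℝ) : R :=
  (chartAt ℂ p).symm (circleMap (chartAt ℂ p p) r (2 * Real.pi * t))

/-- The closed curve `γ` is in the homology class of the puncture `p` of `M`: it is homologous in
`M` to a positively oriented circle that bounds a coordinate disk, centred at `p` and contained
in `M` except for its centre. -/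
def InHomologyClassOfPuncture (M : Set R) (p : R) (γ : ℝ → R) : Prop :=
  ∃ r : ℝ, 0 < r ∧ Metric.closedBall (chartAt ℂ p p) r ⊆ (chartAt ℂ p).target ∧
    (∀ z ∈ Metric.closedBall (chartAt ℂ p p) r, z ≠ chartAt ℂ p p →
      (chartAt ℂ p).symm z ∈ M) ∧
    AreHomologousIn M γ (coordCircle p r)

/-- `c` is the residue at `z₀` of a function with an isolated singularity: the coefficient of
`(z - z₀)⁻¹` in its Laurent expansion. -/
def IsResidue (f : ℂ → ℂ) (z₀ c : ℂ) : Prop :=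
  ∃ (a : ℤ → ℂ) (r : ℝ), 0 < r ∧ a (-1) = c ∧
    ∀ z, z ≠ z₀ → ‖z - z₀‖ < r → HasSum (fun n : ℤ => a n * (z - z₀) ^ n) (f z)

/-- `c` is the residue of the form `Φ` at `p`. In the chart `φ` at `p` the form is `f dz` with
`f z = Φ (dφ⁻¹ (∂/∂z))`. -/
def IsFormResidue (Φ : R → ℂ →L[ℂ] (Fin 3 → ℂ)) (p : R) (c : Fin 3 → ℂ) : Prop :=
  ∀ j, IsResidue
    (fun z => Φ ((chartAt ℂ p).symm z)
      (mfderiv 𝓘(ℂ, ℂ) 𝓘(ℂ, ℂ) (chartAt ℂ p).symm z (1 : ℂ)) j)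
    (chartAt ℂ p p) (c j)

/-- The puncture `p` of `M` represents a vertical embedded end of finite total curvature of `X`. -/
def IsVerticalEmbeddedEnd (X : R → E3) (M : Set R) (p : R) : Prop :=
  IsPuncture M p ∧
  (∃ D : Set R, IsOpen D ∧ p ∈ D ∧ D \ {p} ⊆ M ∧ InjOn X (D \ {p}) ∧
    totalAbsCurvature X (D \ {p}) < ⊤) ∧
  (Tendsto (gaussMap X) (𝓝[≠] p) (𝓝 !₂[0, 0, 1]) ∨
    Tendsto (gaussMap X) (𝓝[≠] p) (𝓝 !₂[0, 0, -1]))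

/-- The end of `X` at the puncture `p` has logarithmic growth `α`: some punctured neighbourhood of
`p` is mapped onto the graph of a function `u` over the exterior of a disk in the
`(x₁, x₂)`-plane, and
`u (x₁, x₂) = α log ρ + β + ρ⁻² (γ₁ x₁ + γ₂ x₂) + O(ρ⁻²)` with `ρ² = x₁² + x₂²`. -/
def HasLogGrowth (X : R → E3) (M : Set R) (p : R) (α : ℝ) : Prop :=
  ∃ (W : Set R) (r : ℝ) (u : ℝ → ℝ → ℝ) (β γ₁ γ₂ C : ℝ),
    W ∈ 𝓝 p ∧ W \ {p} ⊆ M ∧ 0 < r ∧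
    X '' (W \ {p}) = {y : E3 | r < √(y 0 ^ 2 + y 1 ^ 2) ∧ y 2 = u (y 0) (y 1)} ∧
    ∀ x₁ x₂ : ℝ, r < √(x₁ ^ 2 + x₂ ^ 2) →
      |u x₁ x₂ - (α * Real.log √(x₁ ^ 2 + x₂ ^ 2) + β
        + (γ₁ * x₁ + γ₂ * x₂) / (x₁ ^ 2 + x₂ ^ 2))| ≤ C / (x₁ ^ 2 + x₂ ^ 2)

/-- A flat (planar) end: an end of logarithmic growth zero. -/
def IsFlatEnd (X : R → E3) (M : Set R) (p : R) : Prop := HasLogGrowth X M p 0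

end Surface

end

/-! Conformality makes the Laplacian of X in a chart normal to the surface, and vanishing mean
curvature kills the normal component, so X is harmonic (`laplacian_eq_zero_of_conformal`) and Φ is
holomorphic. Since N × dX = dX ∘ J = Re(iΦ), the flux is the integral of −Re(−iΦ), that is, minus
the period of the conjugate surface. A holomorphic form can be integrated over every singular
triangle (`IsHolomorphicFormOn.exists_isContinuationOn`), so increments of continuations depend on
the homology class only. Around a puncture this leaves a coordinate circle and the residue theorem;
the residue is real because X itself has no period.

The description of an embedded end is local. On a punctured disc put f = φ₀ − iσφ₁ and g = φ₂ / f,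
with the sign σ = ±1 for which g(0) = 0. Completeness passes to the metric |f| |dz|, and the main
point is that f then has a pole (`IsCompleteEnd.exists_eq_zpow_mul`). On the universal covering, a
half plane, ∫ f dz is a local homeomorphism; completeness permits the lifting of all segments up to
a length that does not depend on the starting point near the puncture, which inverts the map on
discs of fixed radius, and the Schwarz lemma bounds 1 / f.

Knowing the pole, one expands the horizontal coordinate W. Single-valuedness excludes a simple pole
of f, and in a suitable C¹ coordinate s one has W = κ s⁻ⁿ (`IsMinimalEnd.exists_coordinate`). Two
points of a small circle that differ by the rotation by 2π / n have equal heights, so an embedded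
end has n = 1. Now f g² is holomorphic and f g has at most a simple pole; the horizontal residues
vanish, the vertical one is a real number a, and the height is a log |s| plus a linear term plus
O(|s|²). As |s| = |κ| / ρ, the end has logarithmic growth −a, which is the asserted relation with
the flux (`IsPlaneEnd.exists_logGrowth`).

For the global statement, finite total curvature means that the Gauss image of a small punctured
disc has small area, so the Gauss map in stereographic coordinates omits a compact set K of positive
area. The Cauchy transform of K composed with it is bounded and holomorphic and has a limit; hence
so has the Gauss map (`exists_tendsto_of_omits`, `IsPlaneEnd.exists_tendsto_planeGauss`). Each end
contains a graph of sublinear growth over its limit tangent plane, and two such graphs over planes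
that are not parallel intersect (`ContainsSublinearGraph.inter_nonempty`). Embeddedness therefore
makes the limit normals parallel, and one rotation makes all of them vertical; conversely,
logarithmic growths for a rotation A force the rotated normals to be vertical. Each α is then minus
the third component of the rotated residue, and the residues sum to zero on a compact surface
(`sum_residue_eq_zero`), by a partition of unity and Stokes' theorem for ∂̄ in the charts. -/

noncomputable section

/-! ### Coordinate expressions of functions, forms and curves -/

section ChartCalculus

variable {R : Type*} [TopologicalSpace R] [ChartedSpace ℂ R]

/-- A holomorphic map, considered as a real differentiable one. -/
theorem HasMFDerivAt.real_of_complex {S : Type*} [TopologicalSpace S] [ChartedSpace ℂ S]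
    {g : S → R} {x : S} {L : ℂ →L[ℂ] ℂ} (h : HasMFDerivAt 𝓘(ℂ, ℂ) 𝓘(ℂ, ℂ) g x L) :
    HasMFDerivAt 𝓘(ℝ, ℂ) 𝓘(ℝ, ℂ) g x (L.restrictScalars ℝ : ℂ →L[ℝ] ℂ) := by
  refine ⟨h.1, ?_⟩
  have h2 := h.2
  simp only [modelWithCornersSelf_coe, range_id] at h2 ⊢
  exact HasFDerivWithinAt.restrictScalars ℝ h2

/-- The derivative at `z` of the change of coordinates from `e` to the preferred chart at
`e.symm z`. -/
def coordScale (e : OpenPartialHomeomorph R ℂ) (z : ℂ) : ℂ :=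
  mfderiv 𝓘(ℂ, ℂ) 𝓘(ℂ, ℂ) e.symm z (1 : ℂ)

/-- The coefficient of the form `Φ` in the chart `e`. -/
def formCoeff (Φ : R → ℂ →L[ℂ] (Fin 3 → ℂ)) (e : OpenPartialHomeomorph R ℂ) (z : ℂ) : Fin 3 → ℂ :=
  Φ (e.symm z) (coordScale e z)

variable [IsManifold 𝓘(ℂ, ℂ) ω R]

theorem hasMFDerivAt_chart_symm (p : R) {z : ℂ} (hz : z ∈ (chartAt ℂ p).target) :
    HasMFDerivAt 𝓘(ℂ, ℂ) 𝓘(ℂ, ℂ) (chartAt ℂ p).symm z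
      (ContinuousLinearMap.toSpanSingleton ℂ (coordScale (chartAt ℂ p) z) : ℂ →L[ℂ] ℂ) := by
  have h := ((mdifferentiable_chart (I := 𝓘(ℂ, ℂ)) p).mdifferentiableAt_symm hz).hasMFDerivAt
  let L : ℂ →L[ℂ] ℂ := mfderiv 𝓘(ℂ, ℂ) 𝓘(ℂ, ℂ) (chartAt ℂ p).symm z
  have e : ContinuousLinearMap.toSpanSingleton ℂ (coordScale (chartAt ℂ p) z) = L :=
    ContinuousLinearMap.ext_ring ((ContinuousLinearMap.toSpanSingleton_apply ..).trans (one_smul _ _))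
  rw [e]
  exact h

theorem hasMFDerivAt_real_chart_symm (p : R) {z : ℂ} (hz : z ∈ (chartAt ℂ p).target) :
    HasMFDerivAt 𝓘(ℝ, ℂ) 𝓘(ℝ, ℂ) (chartAt ℂ p).symm z
      ((ContinuousLinearMap.toSpanSingleton ℂ (coordScale (chartAt ℂ p) z)).restrictScalars ℝ :
        ℂ →L[ℝ] ℂ) :=
  (hasMFDerivAt_chart_symm p hz).real_of_complex

theorem coordScale_ne_zero (p : R) {z : ℂ} (hz : z ∈ (chartAt ℂ p).target) :
    coordScale (chartAt ℂ p) z ≠ 0 := by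
  have h := (mdifferentiable_chart (I := 𝓘(ℂ, ℂ)) p).symm.mfderiv_injective
    (x := z) (by simpa using hz)
  intro h0
  let L : ℂ →L[ℂ] ℂ := mfderiv 𝓘(ℂ, ℂ) 𝓘(ℂ, ℂ) (chartAt ℂ p).symm z
  have h1 : L 1 = L 0 := by rw [map_zero]; exact h0
  exact (one_ne_zero : (1 : ℂ) ≠ 0) (h h1)

variable {F : Type*} [NormedAddCommGroup F] [NormedSpace ℝ F]

theorem hasFDerivAt_comp_chart_symm {Y : R → F} (p : R) {z : ℂ} (hz : z ∈ (chartAt ℂ p).target)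
    {L : ℂ →L[ℝ] F} (hY : HasMFDerivAt 𝓘(ℝ, ℂ) 𝓘(ℝ, F) Y ((chartAt ℂ p).symm z) L) :
    HasFDerivAt (Y ∘ (chartAt ℂ p).symm)
      (L.comp ((ContinuousLinearMap.toSpanSingleton ℂ
        (coordScale (chartAt ℂ p) z)).restrictScalars ℝ)) z :=
  (hY.comp z (hasMFDerivAt_real_chart_symm p hz)).hasFDerivAt

/-- `differential` refers to the preferred chart of each single point, which changes with the point.
A computation in one fixed chart therefore carries the nonzero factor `coordScale`. -/
theorem fderiv_comp_chart_symm {Y : R → E3} (p : R) {z : ℂ} (hz : z ∈ (chartAt ℂ p).target)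
    (hY : MDifferentiableAt 𝓘(ℝ, ℂ) 𝓘(ℝ, E3) Y ((chartAt ℂ p).symm z)) (v : ℂ) :
    fderiv ℝ (Y ∘ (chartAt ℂ p).symm) z v =
      differential Y ((chartAt ℂ p).symm z) (coordScale (chartAt ℂ p) z * v) := by
  rw [(hasFDerivAt_comp_chart_symm p hz hY.hasMFDerivAt).fderiv]
  simp [differential, mul_comm]
  rfl

/-- The real smooth structure underlying a complex one. -/
theorem isManifold_real (n : WithTop ℕ∞) : IsManifold 𝓘(ℝ, ℂ) n R := by
  have h : IsManifold 𝓘(ℝ, ℂ) ω R := by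
    -- Complex analytic transition maps are real analytic, so the same atlas serves.
    refine isManifold_of_contDiffOn 𝓘(ℝ, ℂ) ω R fun e e' he he' => ?_
    have h := (contDiffGroupoid ω 𝓘(ℂ, ℂ)).compatible he he'
    rw [contDiffGroupoid, mem_groupoid_of_pregroupoid, contDiffPregroupoid] at h
    exact h.1.restrict_scalars ℝ
  exact IsManifold.of_le (le_top : n ≤ ω)

theorem MDifferentiableAt.of_chart {Y : R → F} (p : R) {z : ℂ} (hz : z ∈ (chartAt ℂ p).target)
    (hY : DifferentiableAt ℝ (Y ∘ (chartAt ℂ p).symm) z) :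
    MDifferentiableAt 𝓘(ℝ, ℂ) 𝓘(ℝ, F) Y ((chartAt ℂ p).symm z) := by
  have : IsManifold 𝓘(ℝ, ℂ) 1 R := isManifold_real 1
  have h1 : MDifferentiableAt 𝓘(ℝ, ℂ) 𝓘(ℝ, ℂ) (chartAt ℂ p) ((chartAt ℂ p).symm z) :=
    (mdifferentiable_chart (I := 𝓘(ℝ, ℂ)) p).mdifferentiableAt ((chartAt ℂ p).map_target hz)
  have h2 : MDifferentiableAt 𝓘(ℝ, ℂ) 𝓘(ℝ, F) (Y ∘ (chartAt ℂ p).symm)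
      (chartAt ℂ p ((chartAt ℂ p).symm z)) := by
    rw [(chartAt ℂ p).right_inv hz]
    exact hY.mdifferentiableAt
  refine (h2.comp _ h1).congr_of_eventuallyEq ?_
  filter_upwards [(chartAt ℂ p).open_source.mem_nhds ((chartAt ℂ p).map_target hz)] with w hw
  simp [hw]

/-- The domain of the coordinate expressions in the chart at `p` of functions on `M`. -/
def chartDomain (M : Set R) (p : R) : Set ℂ := (chartAt ℂ p).target ∩ (chartAt ℂ p).symm ⁻¹' M

omit [IsManifold 𝓘(ℂ, ℂ) ω R] in
theorem isOpen_chartDomain {M : Set R} (hM : IsOpen M) (p : R) : IsOpen (chartDomain M p) :=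
  (chartAt ℂ p).isOpen_inter_preimage_symm hM

theorem contMDiffOn_iff_chart {M : Set R} (hM : IsOpen M) {n : WithTop ℕ∞} {Y : R → F} :
    ContMDiffOn 𝓘(ℝ, ℂ) 𝓘(ℝ, F) n Y M ↔
      ∀ p, ContDiffOn ℝ n (Y ∘ (chartAt ℂ p).symm) (chartDomain M p) := by
  have : IsManifold 𝓘(ℝ, ℂ) n R := isManifold_real n
  constructor
  · intro h p
    have h1 := (contMDiffOn_chart_symm (I := 𝓘(ℝ, ℂ)) (n := n) (x := p)).mono
      (inter_subset_left (t := (chartAt ℂ p).symm ⁻¹' M))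
    exact (h.comp h1 fun z hz => hz.2).contDiffOn
  · intro h q hq
    have h1 := contMDiffOn_chart (I := 𝓘(ℝ, ℂ)) (n := n) (x := q)
    have h2 := (h q).contMDiffOn.comp (h1.mono (inter_subset_left (t := M)))
      (fun w hw => ⟨(chartAt ℂ q).map_source hw.1, by simpa [hw.1] using hw.2⟩)
    have h3 : (chartAt ℂ q).source ∩ M ∈ 𝓝 q :=
      inter_mem (chart_source_mem_nhds ℂ q) (hM.mem_nhds hq)
    refine ((h2.contMDiffAt h3).congr_of_eventuallyEq ?_).contMDiffWithinAt
    filter_upwards [h3] with w hw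
    simp [hw.1]

theorem restrictScalars_comp_toSpanSingleton_one (a b : ℂ) :
    (((ContinuousLinearMap.toSpanSingleton ℂ a).restrictScalars ℝ).comp
      (ContinuousLinearMap.toSpanSingleton ℝ b)) 1 = a * b := by
  simp [mul_comm]

/-- The velocity of a curve in a chart. -/
theorem velocity_eq_coordScale_mul {γ : ℝ → R} {t : ℝ} (p : R)
    (hγ : MDifferentiableAt 𝓘(ℝ, ℝ) 𝓘(ℝ, ℂ) γ t) (ht : γ t ∈ (chartAt ℂ p).source) :
    HasDerivAt (chartAt ℂ p ∘ γ) (deriv (chartAt ℂ p ∘ γ) t) t ∧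
    velocity γ t = coordScale (chartAt ℂ p) (chartAt ℂ p (γ t)) * deriv (chartAt ℂ p ∘ γ) t := by
  have : IsManifold 𝓘(ℝ, ℂ) 1 R := isManifold_real 1
  have h1 : MDifferentiableAt 𝓘(ℝ, ℂ) 𝓘(ℝ, ℂ) (chartAt ℂ p) (γ t) :=
    (mdifferentiable_chart (I := 𝓘(ℝ, ℂ)) p).mdifferentiableAt ht
  have h2 : DifferentiableAt ℝ (chartAt ℂ p ∘ γ) t := (h1.comp t hγ).differentiableAt
  refine ⟨h2.hasDerivAt, ?_⟩
  have h3 := hasMFDerivAt_real_chart_symm p ((chartAt ℂ p).map_source ht)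
  have h4 := h3.comp t h2.hasDerivAt.hasFDerivAt.hasMFDerivAt
  have h5 := h4.congr_of_eventuallyEq (f₁ := γ) (by
    filter_upwards [hγ.continuousAt.preimage_mem_nhds ((chartAt ℂ p).open_source.mem_nhds ht)]
      with s hs
    simp [show γ s ∈ (chartAt ℂ p).source from hs])
  rw [velocity, h5.mfderiv]
  exact restrictScalars_comp_toSpanSingleton_one _ _

/-- A differentiable curve in a chart gives a differentiable curve in the surface. -/
theorem mdifferentiableAt_chart_symm_comp {c : ℝ → ℂ} {t : ℝ} (p : R) (hc : DifferentiableAt ℝ c t)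
    (ht : c t ∈ (chartAt ℂ p).target) :
    MDifferentiableAt 𝓘(ℝ, ℝ) 𝓘(ℝ, ℂ) ((chartAt ℂ p).symm ∘ c) t ∧
    velocity ((chartAt ℂ p).symm ∘ c) t = coordScale (chartAt ℂ p) (c t) * deriv c t := by
  have h3 := hasMFDerivAt_real_chart_symm p ht
  have h4 := h3.comp t hc.hasDerivAt.hasFDerivAt.hasMFDerivAt
  refine ⟨h4.mdifferentiableAt, ?_⟩
  rw [velocity, h4.mfderiv]
  exact restrictScalars_comp_toSpanSingleton_one _ _

end ChartCalculus

/-! ### Identities for the vector product -/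

section Cross

theorem inner_E3 (a b : E3) : ⟪a, b⟫ = a 0 * b 0 + a 1 * b 1 + a 2 * b 2 := by
  simp [PiLp.inner_apply, Fin.sum_univ_three]
  ring

theorem cross_apply_zero (a b : E3) : cross a b 0 = a 1 * b 2 - a 2 * b 1 := by
  simp [cross, cross_apply]

theorem cross_apply_one (a b : E3) : cross a b 1 = a 2 * b 0 - a 0 * b 2 := by
  simp [cross, cross_apply]

theorem cross_apply_two (a b : E3) : cross a b 2 = a 0 * b 1 - a 1 * b 0 := by
  simp [cross, cross_apply]

theorem E3.ext {a b : E3} (h0 : a 0 = b 0) (h1 : a 1 = b 1) (h2 : a 2 = b 2) : a = b := by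
  ext i
  fin_cases i <;> assumption

/-- The vector product as a continuous bilinear map. -/
def crossL : E3 →L[ℝ] E3 →L[ℝ] E3 :=
  LinearMap.toContinuousLinearMap
    ((LinearMap.toContinuousLinearMap : (E3 →ₗ[ℝ] E3) ≃ₗ[ℝ] (E3 →L[ℝ] E3)).toLinearMap.comp
      (LinearMap.mk₂ ℝ cross
        (by intros; apply E3.ext <;> simp [cross_apply_zero, cross_apply_one, cross_apply_two] <;> ring)
        (by intros; apply E3.ext <;> simp [cross_apply_zero, cross_apply_one, cross_apply_two] <;> ring)
        (by intros; apply E3.ext <;> simp [cross_apply_zero, cross_apply_one, cross_apply_two] <;> ring)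
        (by intros; apply E3.ext <;> simp [cross_apply_zero, cross_apply_one, cross_apply_two] <;> ring)))

theorem crossL_apply (a b : E3) : crossL a b = cross a b := rfl

theorem inner_cross_cross (a b c d : E3) :
    ⟪cross a b, cross c d⟫ = ⟪a, c⟫ * ⟪b, d⟫ - ⟪a, d⟫ * ⟪b, c⟫ := by
  simp only [inner_E3, cross_apply_zero, cross_apply_one, cross_apply_two]
  ring

theorem inner_cross_self_left (a b : E3) : ⟪cross a b, a⟫ = 0 := by
  simp only [inner_E3, cross_apply_zero, cross_apply_one, cross_apply_two]
  ring

theorem inner_cross_self_right (a b : E3) : ⟪cross a b, b⟫ = 0 := by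
  simp only [inner_E3, cross_apply_zero, cross_apply_one, cross_apply_two]
  ring

theorem cross_cross_left (a b c : E3) : cross (cross a b) c = ⟪a, c⟫ • b - ⟪b, c⟫ • a := by
  apply E3.ext <;> simp only [inner_E3, cross_apply_zero, cross_apply_one, cross_apply_two,
    PiLp.sub_apply, PiLp.smul_apply, smul_eq_mul] <;> ring

/-- Cramer's rule for the frame `a, b, a × b`. -/
theorem inner_cross_smul (a b y : E3) :
    ⟪cross a b, cross a b⟫ • y =
      ⟪y, a⟫ • cross b (cross a b) + ⟪y, b⟫ • cross (cross a b) a + ⟪y, cross a b⟫ • cross a b := by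
  apply E3.ext <;> simp only [inner_E3, cross_apply_zero, cross_apply_one, cross_apply_two,
    PiLp.add_apply, PiLp.smul_apply, smul_eq_mul] <;> ring

theorem map_mul_one (L : ℂ →L[ℝ] E3) (c : ℂ) : L c = c.re • L 1 + c.im • L Complex.I := by
  conv_lhs => rw [show c = c.re • (1 : ℂ) + c.im • Complex.I by
    simp [Complex.re_add_im]]
  rw [map_add, map_smul, map_smul]

theorem map_mul_I (L : ℂ →L[ℝ] E3) (c : ℂ) :
    L (c * Complex.I) = -c.im • L 1 + c.re • L Complex.I := by
  rw [map_mul_one]; simp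

/-- The map `(u, v) ↦ L u × K v + K u × L v` is alternating on a real plane, so multiplication by
`c` scales it by its determinant, which is |c|². This is why the numerator of the mean curvature has
an invariant zero set. -/
theorem cross_rotate (L K : ℂ →L[ℝ] E3) (c : ℂ) :
    cross (L c) (K (c * Complex.I)) + cross (K c) (L (c * Complex.I)) =
      ‖c‖ ^ 2 • (cross (L 1) (K Complex.I) + cross (K 1) (L Complex.I)) := by
  rw [map_mul_one L c, map_mul_one K c, map_mul_I L, map_mul_I K, ← Complex.normSq_eq_norm_sq,
    Complex.normSq_apply]
  apply E3.ext <;> simp only [cross_apply_zero, cross_apply_one, cross_apply_two,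
    PiLp.add_apply, PiLp.smul_apply, smul_eq_mul] <;> ring

theorem cross_rotate_self (L : ℂ →L[ℝ] E3) (c : ℂ) :
    cross (L c) (L (c * Complex.I)) = ‖c‖ ^ 2 • cross (L 1) (L Complex.I) := by
  rw [map_mul_one L c, map_mul_I L, ← Complex.normSq_eq_norm_sq, Complex.normSq_apply]
  apply E3.ext <;> simp only [cross_apply_zero, cross_apply_one, cross_apply_two,
    PiLp.add_apply, PiLp.smul_apply, smul_eq_mul] <;> ring

end Cross

/-! ### Conformal maps with vanishing mean curvature are harmonic -/

section PlaneMaps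

/-- The vector `x_u × x_v` of a map `x` on a plane domain. -/
def planeNormal (x : ℂ → E3) (z : ℂ) : E3 := cross (fderiv ℝ x z 1) (fderiv ℝ x z Complex.I)

/-- The Gauss map of a map on a plane domain. -/
def planeGauss (x : ℂ → E3) (z : ℂ) : E3 := ‖planeNormal x z‖⁻¹ • planeNormal x z

/-- The map `x` has a conformal differential at `z`. -/
def PlaneConformalAt (x : ℂ → E3) (z : ℂ) : Prop := IsConformalMap (fderiv ℝ x z)

theorem PlaneConformalAt.exists_inner {x : ℂ → E3} {z : ℂ} (h : PlaneConformalAt x z) :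
    ∃ c : ℝ, 0 < c ∧ ⟪fderiv ℝ x z 1, fderiv ℝ x z 1⟫ = c ∧
      ⟪fderiv ℝ x z Complex.I, fderiv ℝ x z Complex.I⟫ = c ∧
      ⟪fderiv ℝ x z 1, fderiv ℝ x z Complex.I⟫ = 0 := by
  obtain ⟨c, hc, h⟩ := (isConformalMap_iff _).1 h
  refine ⟨c, hc, ?_, ?_, ?_⟩ <;> rw [h] <;> simp [Complex.inner]

theorem PlaneConformalAt.inner_planeNormal_pos {x : ℂ → E3} {z : ℂ} (h : PlaneConformalAt x z) :
    0 < ⟪planeNormal x z, planeNormal x z⟫ := by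
  obtain ⟨c, hc, h1, h2, h3⟩ := h.exists_inner
  rw [planeNormal, inner_cross_cross, h1, h2, h3]
  simp; positivity

theorem PlaneConformalAt.planeNormal_ne_zero {x : ℂ → E3} {z : ℂ} (h : PlaneConformalAt x z) :
    planeNormal x z ≠ 0 := by
  intro h0
  have := h.inner_planeNormal_pos
  simp [h0] at this

theorem ContDiffAt.planeNormal {x : ℂ → E3} {z : ℂ} {m n : WithTop ℕ∞} (h : ContDiffAt ℝ n x z)
    (hmn : m + 1 ≤ n) : ContDiffAt ℝ m (planeNormal x) z := by
  have h1 := h.fderiv_right hmn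
  exact (crossL.contDiff.contDiffAt.comp z (h1.clm_apply contDiffAt_const)).clm_apply
    (h1.clm_apply contDiffAt_const)

theorem ContDiffAt.planeGauss {x : ℂ → E3} {z : ℂ} {m n : WithTop ℕ∞} (h : ContDiffAt ℝ n x z)
    (hmn : m + 1 ≤ n) (hc : PlaneConformalAt x z) : ContDiffAt ℝ m (planeGauss x) z :=
  ((h.planeNormal hmn).norm ℝ hc.planeNormal_ne_zero |>.inv
    (norm_ne_zero_iff.2 hc.planeNormal_ne_zero)).smul (h.planeNormal hmn)

theorem inner_planeGauss_eq_zero (x : ℂ → E3) (z v : ℂ) : ⟪planeGauss x z, fderiv ℝ x z v⟫ = 0 := by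
  rw [map_mul_one, planeGauss, real_inner_smul_left, inner_add_right, inner_smul_right,
    inner_smul_right, planeNormal, inner_cross_self_left, inner_cross_self_right]
  simp

/-- A conformal immersion with vanishing mean curvature is harmonic. -/
theorem laplacian_eq_zero_of_conformal {x : ℂ → E3} {z : ℂ} (hx : ContDiffAt ℝ 3 x z)
    (hc : ∀ᶠ w in 𝓝 z, PlaneConformalAt x w)
    (hH : ⟪cross (fderiv ℝ (planeGauss x) z 1) (fderiv ℝ x z Complex.I) +
      cross (fderiv ℝ x z 1) (fderiv ℝ (planeGauss x) z Complex.I), planeNormal x z⟫ = 0) :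
    Laplacian.laplacian x z = 0 := by
  have hz := hc.self_of_nhds
  have hd : DifferentiableAt ℝ (fderiv ℝ x) z :=
    (hx.fderiv_right (m := 2) (by norm_num)).differentiableAt (by norm_num)
  have hN : DifferentiableAt ℝ (planeGauss x) z :=
    (hx.planeGauss (m := 2) (by norm_num) hz).differentiableAt (by norm_num)
  set B := fderiv ℝ (fderiv ℝ x) z with hB
  set N' := fderiv ℝ (planeGauss x) z with hN'
  have hsymm : B Complex.I 1 = B 1 Complex.I :=
    (hx.isSymmSndFDerivAt (by simp; norm_num)) _ _
  have happ : ∀ v, HasFDerivAt (fun w => fderiv ℝ x w v) (B.flip v) z := fun v => by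
    have := hd.hasFDerivAt.clm_apply (hasFDerivAt_const v z)
    simpa using this
  -- Write x₁, x_I for the derivatives of x in the directions 1 and i. The relations |x₁| = |x_I|
  -- and ⟨x₁, x_I⟩ = 0 hold near z and may be differentiated: this is `e1` and `e2`.
  have e1 : ∀ u, 2 * ⟪fderiv ℝ x z 1, B u 1⟫ = 2 * ⟪fderiv ℝ x z Complex.I, B u Complex.I⟫ := by
    intro u
    have h1 := (happ 1).inner ℝ (happ 1)
    have h2 := (happ Complex.I).inner ℝ (happ Complex.I)
    have h3 := (h1.congr_of_eventuallyEq (f₁ := fun w => ⟪fderiv ℝ x w Complex.I,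
      fderiv ℝ x w Complex.I⟫) (by
        filter_upwards [hc] with w hw
        obtain ⟨c, _, k1, k2, _⟩ := hw.exists_inner
        rw [k1, k2])).unique h2
    have := congrArg (fun L : ℂ →L[ℝ] ℝ => L u) h3
    simp [fderivInnerCLM_apply] at this
    rw [real_inner_comm (fderiv ℝ x z 1), real_inner_comm (fderiv ℝ x z Complex.I)] at this
    linarith
  have e2 : ∀ u, ⟪fderiv ℝ x z 1, B u Complex.I⟫ + ⟪fderiv ℝ x z Complex.I, B u 1⟫ = 0 := by
    intro u
    have h1 := (happ 1).inner ℝ (happ Complex.I)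
    have h3 := (h1.congr_of_eventuallyEq (f₁ := fun w => (0 : ℝ)) (by
        filter_upwards [hc] with w hw
        obtain ⟨c, _, k1, k2, k3⟩ := hw.exists_inner
        rw [k3])).unique (hasFDerivAt_const _ _)
    have := congrArg (fun L : ℂ →L[ℝ] ℝ => L u) h3
    simp [fderivInnerCLM_apply] at this
    rw [real_inner_comm (fderiv ℝ x z Complex.I)] at this
    linarith
  -- Differentiating ⟨N, x_v⟩ = 0 trades derivatives of the Gauss map for second derivatives of x.
  have e3 : ∀ u v, ⟪N' u, fderiv ℝ x z v⟫ = - ⟪planeGauss x z, B u v⟫ := by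
    intro u v
    have h1 := hN.hasFDerivAt.inner ℝ (happ v)
    have h3 := (h1.congr_of_eventuallyEq (f₁ := fun w => (0 : ℝ)) (by
        filter_upwards with w
        rw [inner_planeGauss_eq_zero])).unique (hasFDerivAt_const _ _)
    have := congrArg (fun L : ℂ →L[ℝ] ℝ => L u) h3
    simp [fderivInnerCLM_apply] at this
    rw [← hN'] at this
    linarith
  obtain ⟨c, hc0, c1, c2, c3⟩ := hz.exists_inner
  have hlap : Laplacian.laplacian x z = B 1 1 + B Complex.I Complex.I := by
    rw [InnerProductSpace.laplacian_eq_iteratedFDeriv_complexPlane]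
    simp [iteratedFDeriv_two_apply]
    rfl
  rw [hlap]
  set y := B 1 1 + B Complex.I Complex.I
  -- Conformality alone kills the tangential components of the Laplacian, for instance ⟨x₁₁, x₁⟩ =
  -- ⟨x₁_I, x_I⟩ = −⟨x_II, x₁⟩.
  have y1 : ⟪y, fderiv ℝ x z 1⟫ = 0 := by
    have := e1 1; have := e2 Complex.I
    rw [real_inner_comm, inner_add_right]
    rw [hsymm] at *
    linarith
  have y2 : ⟪y, fderiv ℝ x z Complex.I⟫ = 0 := by
    have := e1 Complex.I; have := e2 1
    rw [real_inner_comm, inner_add_right]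
    rw [hsymm] at *
    linarith
  -- The expression in `hH` equals −c ⟨N, y⟩ with c = |x₁|².
  have y3 : ⟪y, planeNormal x z⟫ = 0 := by
    have h4 : ⟪planeGauss x z, y⟫ = 0 := by
      rw [planeNormal, inner_add_left, inner_cross_cross, inner_cross_cross, c1, c2, c3,
        real_inner_comm (fderiv ℝ x z 1) (fderiv ℝ x z Complex.I), c3, e3 1 1,
        e3 Complex.I Complex.I] at hH
      rw [inner_add_right]
      have : c * (⟪planeGauss x z, B 1 1⟫ + ⟪planeGauss x z, B Complex.I Complex.I⟫) = 0 := by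
        linarith
      exact (mul_eq_zero.1 this).resolve_left hc0.ne'
    rw [planeGauss, real_inner_smul_left] at h4
    rw [real_inner_comm]
    exact (mul_eq_zero.1 h4).resolve_left (inv_ne_zero (norm_ne_zero_iff.2 hz.planeNormal_ne_zero))
  have key := inner_cross_smul (fderiv ℝ x z 1) (fderiv ℝ x z Complex.I) y
  rw [y1, y2] at key
  change ⟪planeNormal x z, planeNormal x z⟫ • y = _ + ⟪y, planeNormal x z⟫ • _ at key
  rw [y3] at key
  simp only [zero_smul, add_zero] at key
  exact (smul_eq_zero.1 key).resolve_left hz.inner_planeNormal_pos.ne'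

end PlaneMaps

/-! ### The immersion and its holomorphic form in a chart -/

section SurfaceInChart

variable {R : Type*} [TopologicalSpace R] [ChartedSpace ℂ R] [IsManifold 𝓘(ℂ, ℂ) ω R]
  {M : Set R} {X : R → E3}

omit [IsManifold 𝓘(ℂ, ℂ) ω R] in
theorem IsConformalImmersionOn.mdifferentiableAt (hX : IsConformalImmersionOn X M) (hM : IsOpen M)
    {q : R} (hq : q ∈ M) : MDifferentiableAt 𝓘(ℝ, ℂ) 𝓘(ℝ, E3) X q :=
  (hX.1.contMDiffAt (hM.mem_nhds hq)).mdifferentiableAt (by simp)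

theorem IsConformalImmersionOn.contDiffOn_chart (hX : IsConformalImmersionOn X M) (hM : IsOpen M)
    (p : R) : ContDiffOn ℝ ∞ (X ∘ (chartAt ℂ p).symm) (chartDomain M p) :=
  (contMDiffOn_iff_chart hM).1 hX.1 p

theorem IsConformalImmersionOn.contDiffAt_chart (hX : IsConformalImmersionOn X M) (hM : IsOpen M)
    (p : R) {z : ℂ} (hz : z ∈ chartDomain M p) : ContDiffAt ℝ ∞ (X ∘ (chartAt ℂ p).symm) z :=
  (hX.contDiffOn_chart hM p).contDiffAt ((isOpen_chartDomain hM p).mem_nhds hz)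

theorem IsConformalImmersionOn.fderiv_chart (hX : IsConformalImmersionOn X M) (hM : IsOpen M)
    (p : R) {z : ℂ} (hz : z ∈ chartDomain M p) (v : ℂ) :
    fderiv ℝ (X ∘ (chartAt ℂ p).symm) z v =
      differential X ((chartAt ℂ p).symm z) (coordScale (chartAt ℂ p) z * v) :=
  fderiv_comp_chart_symm p hz.1 (hX.mdifferentiableAt hM hz.2) v

theorem IsConformalImmersionOn.planeConformalAt (hX : IsConformalImmersionOn X M) (hM : IsOpen M)
    (p : R) {z : ℂ} (hz : z ∈ chartDomain M p) :
    PlaneConformalAt (X ∘ (chartAt ℂ p).symm) z := by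
  obtain ⟨c, hc, h⟩ := (isConformalMap_iff _).1 (hX.2 _ hz.2)
  refine (isConformalMap_iff _).2 ⟨c * ‖coordScale (chartAt ℂ p) z‖ ^ 2, ?_, fun u v => ?_⟩
  · have := norm_pos_iff.2 (coordScale_ne_zero p hz.1)
    positivity
  · rw [hX.fderiv_chart hM p hz, hX.fderiv_chart hM p hz, h, ← Complex.normSq_eq_norm_sq,
      Complex.normSq_apply]
    simp [Complex.inner]
    ring

theorem IsConformalImmersionOn.planeNormal_chart (hX : IsConformalImmersionOn X M) (hM : IsOpen M)
    (p : R) {z : ℂ} (hz : z ∈ chartDomain M p) :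
    planeNormal (X ∘ (chartAt ℂ p).symm) z =
      ‖coordScale (chartAt ℂ p) z‖ ^ 2 • normalVector X ((chartAt ℂ p).symm z) := by
  rw [planeNormal, hX.fderiv_chart hM p hz, hX.fderiv_chart hM p hz, mul_one, cross_rotate_self]
  rfl

theorem IsConformalImmersionOn.gaussMap_chart (hX : IsConformalImmersionOn X M) (hM : IsOpen M)
    (p : R) {z : ℂ} (hz : z ∈ chartDomain M p) :
    gaussMap X ((chartAt ℂ p).symm z) = planeGauss (X ∘ (chartAt ℂ p).symm) z := by
  have h0 : ‖coordScale (chartAt ℂ p) z‖ ≠ 0 := norm_ne_zero_iff.2 (coordScale_ne_zero p hz.1)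
  rw [planeGauss, hX.planeNormal_chart hM p hz, gaussMap, norm_smul, smul_smul, mul_inv]
  congr 1
  simp
  field_simp

theorem IsConformalImmersionOn.gaussMap_chart_eventuallyEq (hX : IsConformalImmersionOn X M)
    (hM : IsOpen M) (p : R) {z : ℂ} (hz : z ∈ chartDomain M p) :
    gaussMap X ∘ (chartAt ℂ p).symm =ᶠ[𝓝 z] planeGauss (X ∘ (chartAt ℂ p).symm) := by
  filter_upwards [(isOpen_chartDomain hM p).mem_nhds hz] with w hw using hX.gaussMap_chart hM p hw

theorem IsConformalImmersionOn.mdifferentiableAt_gaussMap (hX : IsConformalImmersionOn X M)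
    (hM : IsOpen M) {q : R} (hq : q ∈ M) : MDifferentiableAt 𝓘(ℝ, ℂ) 𝓘(ℝ, E3) (gaussMap X) q := by
  have hq' : (chartAt ℂ q).symm (chartAt ℂ q q) = q := (chartAt ℂ q).left_inv (mem_chart_source ℂ q)
  have hz : chartAt ℂ q q ∈ chartDomain M q := ⟨mem_chart_target ℂ q, by simpa [hq'] using hq⟩
  rw [← hq']
  refine MDifferentiableAt.of_chart q hz.1 ?_
  refine DifferentiableAt.congr_of_eventuallyEq ?_ (hX.gaussMap_chart_eventuallyEq hM q hz)
  exact ((hX.contDiffAt_chart hM q hz).planeGauss (m := 1) (by norm_num; exact ENat.LEInfty.out)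
    (hX.planeConformalAt hM q hz)).differentiableAt (by simp)

theorem IsConformalImmersionOn.fderiv_planeGauss_chart (hX : IsConformalImmersionOn X M)
    (hM : IsOpen M) (p : R) {z : ℂ} (hz : z ∈ chartDomain M p) (v : ℂ) :
    fderiv ℝ (planeGauss (X ∘ (chartAt ℂ p).symm)) z v =
      differential (gaussMap X) ((chartAt ℂ p).symm z) (coordScale (chartAt ℂ p) z * v) := by
  rw [← (hX.gaussMap_chart_eventuallyEq hM p hz).fderiv_eq]
  exact fderiv_comp_chart_symm p hz.1 (hX.mdifferentiableAt_gaussMap hM hz.2) v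

/-- A minimal conformal immersion is harmonic in every chart. -/
theorem IsConformalImmersionOn.harmonicAt_chart (hX : IsConformalImmersionOn X M) (hM : IsOpen M)
    (hmin : IsMinimalOn X M) (p : R) {z : ℂ} (hz : z ∈ chartDomain M p) :
    InnerProductSpace.HarmonicAt (X ∘ (chartAt ℂ p).symm) z := by
  refine ⟨(hX.contDiffAt_chart hM p hz).of_le ENat.LEInfty.out, ?_⟩
  filter_upwards [(isOpen_chartDomain hM p).mem_nhds hz] with w hw
  refine laplacian_eq_zero_of_conformal ((hX.contDiffAt_chart hM p hw).of_le ENat.LEInfty.out) ?_ ?_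
  · filter_upwards [(isOpen_chartDomain hM p).mem_nhds hw] with w' hw'
      using hX.planeConformalAt hM p hw'
  · rw [hX.fderiv_planeGauss_chart hM p hw, hX.fderiv_planeGauss_chart hM p hw,
      hX.fderiv_chart hM p hw, hX.fderiv_chart hM p hw, hX.planeNormal_chart hM p hw, mul_one,
      add_comm, cross_rotate, real_inner_smul_left, real_inner_smul_right]
    have h := hmin _ hw.2
    -- A quotient with denominator zero is zero by convention. In that case the numerator is an
    -- inner product with the zero vector and vanishes too.
    rw [meanCurvature, div_eq_zero_iff] at h
    rcases h with h | h
    · rw [add_comm, h]; simp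
    · have : ‖normalVector X ((chartAt ℂ p).symm w)‖ = 0 := by simpa using h
      rw [norm_eq_zero.1 this]; simp

/-- The integrand of the total curvature in a chart. -/
theorem IsConformalImmersionOn.gaussCurvature_mul_areaDensity (hX : IsConformalImmersionOn X M)
    (hM : IsOpen M) (p : R) {z : ℂ} (hz : z ∈ chartDomain M p) :
    |gaussCurvature X ((chartAt ℂ p).symm z)| * areaDensity X (chartAt ℂ p) z =
      |⟪cross (fderiv ℝ (planeGauss (X ∘ (chartAt ℂ p).symm)) z 1)
        (fderiv ℝ (planeGauss (X ∘ (chartAt ℂ p).symm)) z Complex.I),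
        planeGauss (X ∘ (chartAt ℂ p).symm) z⟫| := by
  have h0 : 0 < ‖coordScale (chartAt ℂ p) z‖ := norm_pos_iff.2 (coordScale_ne_zero p hz.1)
  have hn : 0 < ‖normalVector X ((chartAt ℂ p).symm z)‖ := by
    rw [norm_pos_iff]
    intro h
    have h1 := hX.planeNormal_chart hM p hz
    rw [h, smul_zero] at h1
    exact (hX.planeConformalAt hM p hz).planeNormal_ne_zero h1
  rw [← hX.gaussMap_chart hM p hz, hX.fderiv_planeGauss_chart hM p hz,
    hX.fderiv_planeGauss_chart hM p hz, mul_one, cross_rotate_self]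
  have h1 : areaDensity X (chartAt ℂ p) z =
      ‖coordScale (chartAt ℂ p) z‖ ^ 2 * ‖normalVector X ((chartAt ℂ p).symm z)‖ := by
    change ‖planeNormal (X ∘ (chartAt ℂ p).symm) z‖ = _
    rw [hX.planeNormal_chart hM p hz, norm_smul]
    simp
  rw [h1, gaussCurvature, gaussMap, real_inner_smul_left, real_inner_smul_right, abs_div, abs_mul,
    abs_mul, abs_of_pos (inv_pos.2 hn), abs_of_pos (by positivity : 0 < ‖coordScale (chartAt ℂ p) z‖ ^ 2),
    abs_of_pos (by positivity : 0 < ‖normalVector X ((chartAt ℂ p).symm z)‖ ^ 2)]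
  field_simp

omit [IsManifold 𝓘(ℂ, ℂ) ω R] in
/-- Rotation by `π / 2` in the tangent plane. -/
theorem IsConformalImmersionOn.cross_gaussMap_differential (hX : IsConformalImmersionOn X M)
    {q : R} (hq : q ∈ M) (v : ℂ) :
    cross (gaussMap X q) (differential X q v) = differential X q (Complex.I * v) := by
  obtain ⟨c, hc, h⟩ := (isConformalMap_iff _).1 (hX.2 _ hq)
  have h11 := h 1 1
  have h12 := h 1 Complex.I
  have h22 := h Complex.I Complex.I
  simp [Complex.inner] at h11 h12 h22
  rw [← real_inner_self_eq_norm_sq] at h11 h22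
  set a := differential X q 1
  set b := differential X q Complex.I
  -- As |a|² = |b|² = c and a ⊥ b, the area factor is also c. Hence N = c⁻¹ a × b, and the formula
  -- for double products gives N × a = b and N × b = −a.
  have hn : ‖normalVector X q‖ = c := by
    have : ‖normalVector X q‖ ^ 2 = c ^ 2 := by
      rw [← real_inner_self_eq_norm_sq]
      change ⟪cross a b, cross a b⟫ = _
      rw [inner_cross_cross, h11, h22, h12]; ring
    exact (sq_eq_sq₀ (norm_nonneg _) hc.le).1 this
  rw [mul_comm, map_mul_I, gaussMap, hn]
  change crossL (c⁻¹ • cross a b) (differential X q v) = _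
  rw [map_mul_one (differential X q) v, map_smul, smul_apply, crossL_apply,
    cross_cross_left, inner_add_right, inner_add_right, inner_smul_right, inner_smul_right,
    inner_smul_right, inner_smul_right, h11, h22, h12, real_inner_comm, h12, mul_zero, mul_zero,
    zero_add, add_zero, smul_sub, smul_smul, smul_smul]
  have e1 : c⁻¹ * (v.re * c) = v.re := by field_simp
  have e2 : c⁻¹ * (v.im * c) = v.im := by field_simp
  rw [e1, e2, neg_smul]
  abel

variable {Φ : R → ℂ →L[ℂ] (Fin 3 → ℂ)}

theorem IsRealPartOfIntegralOn.fderiv_chart {Y : R → E3} (hY : IsRealPartOfIntegralOn Y Φ M) (p : R)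
    {z : ℂ} (hz : z ∈ chartDomain M p) (v : ℂ) (j : Fin 3) :
    fderiv ℝ (Y ∘ (chartAt ℂ p).symm) z v j = (formCoeff Φ (chartAt ℂ p) z j * v).re := by
  obtain ⟨h1, h2⟩ := hY _ hz.2
  rw [fderiv_comp_chart_symm p hz.1 h1, h2, formCoeff, mul_comm (coordScale _ _), ← smul_eq_mul,
    map_smul]
  simp [mul_comm]

theorem IsRealPartOfIntegralOn.differentiableAt_chart {Y : R → E3}
    (hY : IsRealPartOfIntegralOn Y Φ M) (p : R) {z : ℂ} (hz : z ∈ chartDomain M p) :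
    DifferentiableAt ℝ (Y ∘ (chartAt ℂ p).symm) z :=
  (hasFDerivAt_comp_chart_symm p hz.1 (hY _ hz.2).1.hasMFDerivAt).differentiableAt

/-- A form of type (1, 0) is recovered from its real part, because the real part of its value at i v
is minus the imaginary part of its value at v. -/
theorem IsRealPartOfIntegralOn.formCoeff_eq {Y : R → E3} (hY : IsRealPartOfIntegralOn Y Φ M) (p : R)
    {z : ℂ} (hz : z ∈ chartDomain M p) (j : Fin 3) :
    formCoeff Φ (chartAt ℂ p) z j = (fderiv ℝ (Y ∘ (chartAt ℂ p).symm) z 1 j : ℂ) -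
      Complex.I * (fderiv ℝ (Y ∘ (chartAt ℂ p).symm) z Complex.I j : ℂ) := by
  rw [hY.fderiv_chart p hz, hY.fderiv_chart p hz]
  apply Complex.ext <;> simp

/-- The form of a minimal surface is holomorphic. -/
theorem IsConformalImmersionOn.differentiableOn_formCoeff (hX : IsConformalImmersionOn X M)
    (hM : IsOpen M) (hmin : IsMinimalOn X M) (hΦ : IsRealPartOfIntegralOn X Φ M) (p : R)
    (j : Fin 3) :
    DifferentiableOn ℂ (fun z => formCoeff Φ (chartAt ℂ p) z j) (chartDomain M p) := by
  intro z hz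
  -- The Cauchy–Riemann equations of x_u − i x_v are the harmonicity of x and the symmetry of its
  -- second derivatives.
  have hh := (hX.harmonicAt_chart hM hmin p hz).comp_CLM (EuclideanSpace.proj (𝕜 := ℝ) j)
  refine ((HarmonicAt.differentiableAt_complex_partial hh).congr_of_eventuallyEq ?_).differentiableWithinAt
  filter_upwards [(isOpen_chartDomain hM p).mem_nhds hz] with w hw
  rw [hΦ.formCoeff_eq p hw, fderiv_comp _ (ContinuousLinearMap.differentiableAt _)
    (hΦ.differentiableAt_chart p hw), ContinuousLinearMap.fderiv]
  rfl

/-- The real part of Σ (x_u − i x_v)² is |x_u|² − |x_v|² and the imaginary part is −2⟨x_u, x_v⟩;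
both vanish by conformality. -/
theorem IsConformalImmersionOn.sum_formCoeff_sq (hX : IsConformalImmersionOn X M)
    (hM : IsOpen M) (hΦ : IsRealPartOfIntegralOn X Φ M) (p : R) {z : ℂ} (hz : z ∈ chartDomain M p) :
    formCoeff Φ (chartAt ℂ p) z 0 ^ 2 + formCoeff Φ (chartAt ℂ p) z 1 ^ 2 +
      formCoeff Φ (chartAt ℂ p) z 2 ^ 2 = 0 := by
  obtain ⟨c, hc, h1, h2, h3⟩ := (hX.planeConformalAt hM p hz).exists_inner
  simp only [inner_E3] at h1 h2 h3
  simp only [hΦ.formCoeff_eq p hz]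
  apply Complex.ext <;> simp [pow_two] <;> linarith

theorem IsConformalImmersionOn.formCoeff_ne_zero (hX : IsConformalImmersionOn X M)
    (hM : IsOpen M) (hΦ : IsRealPartOfIntegralOn X Φ M) (p : R) {z : ℂ} (hz : z ∈ chartDomain M p) :
    formCoeff Φ (chartAt ℂ p) z ≠ 0 := by
  obtain ⟨c, hc, h1, h2, h3⟩ := (hX.planeConformalAt hM p hz).exists_inner
  intro h0
  have : fderiv ℝ (X ∘ (chartAt ℂ p).symm) z 1 = 0 := by
    ext j
    rw [hΦ.fderiv_chart p hz, h0]; simp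
  rw [this] at h1
  simp at h1
  exact hc.ne h1

/-- The branches of the conjugate surface are conformal immersions. -/
theorem IsConformalImmersionOn.conjugate (hX : IsConformalImmersionOn X M)
    (hM : IsOpen M) (hΦ : IsRealPartOfIntegralOn X Φ M) {U : Set R} {F : R → E3} (hU : IsOpen U)
    (hUM : U ⊆ M) (hF : IsRealPartOfIntegralOn F (conjugateForm Φ) U) :
    IsConformalImmersionOn F U := by
  -- Re(−iΦ(v)) = Re Φ(−iv): a branch has the differential of X precomposed with the rotation by
  -- −π/2, hence the same induced metric.
  have hd : ∀ q ∈ U, ∀ v, differential F q v = differential X q (-Complex.I * v) := by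
    intro q hq v
    ext j
    rw [(hF q hq).2, (hΦ q (hUM hq)).2, ← smul_eq_mul, map_smul]
    simp [conjugateForm]
  have hdom : ∀ p, chartDomain U p ⊆ chartDomain M p := fun p z hz => ⟨hz.1, hUM hz.2⟩
  constructor
  · rw [contMDiffOn_iff_chart hU]
    intro p
    have hfd : ∀ z ∈ chartDomain U p, ∀ v, fderiv ℝ (F ∘ (chartAt ℂ p).symm) z v =
        fderiv ℝ (X ∘ (chartAt ℂ p).symm) z (-Complex.I * v) := by
      intro z hz v
      rw [hX.fderiv_chart hM p (hdom p hz), fderiv_comp_chart_symm p hz.1 (hF _ hz.2).1,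
        hd _ hz.2]
      congr 1; ring
    have hopen := isOpen_chartDomain hU p
    -- Differentiability with a smooth derivative suffices, because `∞ + 1 = ∞`.
    refine (contDiffOn_succ_iff_fderiv_of_isOpen (n := ((⊤ : ℕ∞) : WithTop ℕ∞)) hopen).2 ?_
    refine ⟨fun z hz => (hF.differentiableAt_chart p hz).differentiableWithinAt, by simp, ?_⟩
    have h1 : ContDiffOn ℝ ∞ (fderiv ℝ (X ∘ (chartAt ℂ p).symm)) (chartDomain U p) :=
      ((hX.contDiffOn_chart hM p).fderiv_of_isOpen (isOpen_chartDomain hM p) (by rfl)).mono (hdom p)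
    have h2 : ContDiffOn ℝ ∞ (fun z => (fderiv ℝ (X ∘ (chartAt ℂ p).symm) z).comp
        ((ContinuousLinearMap.mul ℝ ℂ (-Complex.I)))) (chartDomain U p) :=
      h1.clm_comp contDiffOn_const
    refine h2.congr fun z hz => ?_
    ext1 v
    rw [hfd z hz]
    simp
  · intro q hq
    obtain ⟨c, hc, h⟩ := (isConformalMap_iff _).1 (hX.2 _ (hUM hq))
    refine (isConformalMap_iff _).2 ⟨c, hc, fun u v => ?_⟩
    rw [hd q hq, hd q hq, h]
    simp only [Complex.inner, map_mul, map_neg, Complex.conj_I]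
    ring_nf
    simp

end SurfaceInChart

/-! ### Continuation of primitives of a holomorphic form -/

section Primitives

theorem eq_of_locally_eq_of_isPreconnected {α β : Type*} [TopologicalSpace α] {T : Set α}
    (hT : IsPreconnected T) {g : α → β} (h : ∀ x ∈ T, ∀ᶠ y in 𝓝[T] x, g y = g x) {x y : α}
    (hx : x ∈ T) (hy : y ∈ T) : g x = g y := by
  have : PreconnectedSpace T := isPreconnected_iff_preconnectedSpace.1 hT
  have hl : IsLocallyConstant (fun z : T => g z) := by
    rw [IsLocallyConstant.iff_eventually_eq]
    rintro ⟨z, hz⟩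
    have := h z hz
    rw [nhdsWithin_eq_map_subtype_coe hz, eventually_map] at this
    exact this
  exact hl.apply_eq_of_preconnectedSpace ⟨x, hx⟩ ⟨y, hy⟩

/-- A discrete Poincaré lemma on convex sets. -/
theorem exists_potential_of_cocycle {E V : Type*} [NormedAddCommGroup E] [NormedSpace ℝ E]
    [AddCommGroup V] {T : Set E} (hT : Convex ℝ T) (h0 : (0 : E) ∈ T)
    (hb : Bornology.IsBounded T) {δ : ℝ} (hδ : 0 < δ) (w : E → E → V)
    (hw : ∀ x ∈ T, ∀ y ∈ T, ∀ z ∈ T, dist x y < δ → dist y z < δ → dist x z < δ →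
      w x y + w y z = w x z) :
    ∃ (G : E → V) (η : ℝ), 0 < η ∧ ∀ x ∈ T, ∀ y ∈ T, dist x y < η → G y = G x + w x y := by
  obtain ⟨B, hB⟩ := hb.exists_norm_le
  obtain ⟨N, hN⟩ := exists_nat_gt (max 0 (B / (δ / 3)))
  have hN0 : 0 < (N : ℝ) := lt_of_le_of_lt (le_max_left _ _) hN
  have hNB : B / N < δ / 3 := by
    have h1 := lt_of_le_of_lt (le_max_right _ _) hN
    rw [div_lt_iff₀ (by positivity)] at h1 ⊢
    linarith
  have hmem : ∀ x ∈ T, ∀ k : ℕ, k ≤ N → ((k : ℝ) / N) • x ∈ T := by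
    intro x hx k hk
    have := hT.starConvex h0 |>.smul_mem hx (t := (k : ℝ) / N) (by positivity)
      (by rw [div_le_one hN0]; exact_mod_cast hk)
    exact this
  -- The potential sums `w` over `N` equal steps of the segment from 0 to x, each shorter than δ /
  -- 3.
  refine ⟨fun x => ∑ k ∈ Finset.range N, w (((k : ℝ) / N) • x) ((((k + 1 : ℕ) : ℝ) / N) • x), δ / 3,
    by positivity, fun x hx y hy hxy => ?_⟩
  have hstep : ∀ x ∈ T, ∀ k : ℕ, dist (((k : ℝ) / N) • x) ((((k + 1 : ℕ) : ℝ) / N) • x) < δ / 3 := by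
    intro x hx k
    rw [dist_eq_norm, ← sub_smul, norm_smul]
    have : (k : ℝ) / N - ((k + 1 : ℕ) : ℝ) / N = -(1 / N) := by push_cast; ring
    rw [this, norm_neg, Real.norm_of_nonneg (by positivity), one_div_mul_eq_div]
    exact lt_of_le_of_lt (by gcongr; exact hB x hx) hNB
  have hcross : ∀ k : ℕ, k ≤ N → dist (((k : ℝ) / N) • x) (((k : ℝ) / N) • y) < δ / 3 := by
    intro k hk
    rw [dist_eq_norm, ← smul_sub, norm_smul, ← dist_eq_norm, Real.norm_of_nonneg (by positivity)]
    refine lt_of_le_of_lt (mul_le_of_le_one_left dist_nonneg ?_) hxy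
    rw [div_le_one hN0]; exact_mod_cast hk
  -- The segments to x and y bound a thin ladder. From one rung to the next a quadrilateral is cut
  -- into two triangles with sides shorter than δ, where the cocycle relation applies.
  have hind : ∀ n : ℕ, n ≤ N →
      ∑ k ∈ Finset.range n, w (((k : ℝ) / N) • y) ((((k + 1 : ℕ) : ℝ) / N) • y) =
      ∑ k ∈ Finset.range n, w (((k : ℝ) / N) • x) ((((k + 1 : ℕ) : ℝ) / N) • x) +
        w (((n : ℝ) / N) • x) (((n : ℝ) / N) • y) := by
    intro n
    induction n with
    | zero =>
      intro _
      have := hw 0 h0 0 h0 0 h0 (by simpa using hδ) (by simpa using hδ) (by simpa using hδ)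
      simp only [add_eq_left] at this
      simp [this]
    | succ n ih =>
      intro hn
      rw [Finset.sum_range_succ, Finset.sum_range_succ, ih (by omega), add_assoc, add_assoc]
      congr 1
      have hxn := hmem x hx n (by omega)
      have hyn := hmem y hy n (by omega)
      have hxn1 := hmem x hx (n + 1) hn
      have hyn1 := hmem y hy (n + 1) hn
      have d1 := hcross n (by omega)
      have d2 := hcross (n + 1) hn
      have d3 := hstep x hx n
      have d4 := hstep y hy n
      have d5 : dist (((n : ℝ) / N) • x) ((((n + 1 : ℕ) : ℝ) / N) • y) < δ := by
        have := dist_triangle (((n : ℝ) / N) • x) (((n : ℝ) / N) • y) ((((n + 1 : ℕ) : ℝ) / N) • y)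
        linarith
      rw [hw _ hxn _ hyn _ hyn1 (by linarith) (by linarith) d5,
        hw _ hxn _ hxn1 _ hyn1 (by linarith) (by linarith) d5]
  have := hind N le_rfl
  rwa [div_self hN0.ne', one_smul, one_smul] at this

variable {R : Type*} [TopologicalSpace R] [ChartedSpace ℂ R] [IsManifold 𝓘(ℂ, ℂ) ω R]
  {M : Set R} {Φ Ψ : R → ℂ →L[ℂ] (Fin 3 → ℂ)}

/-- The form `Φ` of type (1, 0) is holomorphic on `M`. -/
def IsHolomorphicFormOn (Φ : R → ℂ →L[ℂ] (Fin 3 → ℂ)) (M : Set R) : Prop :=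
  ∀ p j, DifferentiableOn ℂ (fun z => formCoeff Φ (chartAt ℂ p) z j) (chartDomain M p)

omit [IsManifold 𝓘(ℂ, ℂ) ω R] in
theorem formCoeff_conjugateForm (e : OpenPartialHomeomorph R ℂ) (z : ℂ) (j : Fin 3) :
    formCoeff (conjugateForm Φ) e z j = -Complex.I * formCoeff Φ e z j := by
  simp [formCoeff, conjugateForm]

omit [IsManifold 𝓘(ℂ, ℂ) ω R] in
theorem IsHolomorphicFormOn.conjugateForm (h : IsHolomorphicFormOn Φ M) :
    IsHolomorphicFormOn (conjugateForm Φ) M := fun p j => by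
  simp only [formCoeff_conjugateForm]
  exact (h p j).const_mul _

theorem mdifferentiableAt_and_differential_of_chart {F : R → E3} (p : R) {z : ℂ}
    (hz : z ∈ (chartAt ℂ p).target) (hF : DifferentiableAt ℝ (F ∘ (chartAt ℂ p).symm) z)
    (h : ∀ v j, fderiv ℝ (F ∘ (chartAt ℂ p).symm) z v j =
      (formCoeff Ψ (chartAt ℂ p) z j * v).re) :
    MDifferentiableAt 𝓘(ℝ, ℂ) 𝓘(ℝ, E3) F ((chartAt ℂ p).symm z) ∧
    ∀ (v : ℂ) (j : Fin 3), differential F ((chartAt ℂ p).symm z) v j =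
      (Ψ ((chartAt ℂ p).symm z) v j).re := by
  have hd := MDifferentiableAt.of_chart p hz hF
  refine ⟨hd, fun v j => ?_⟩
  have h0 := coordScale_ne_zero p hz
  have h1 := h (v / coordScale (chartAt ℂ p) z) j
  rw [fderiv_comp_chart_symm p hz hd, mul_div_cancel₀ _ h0] at h1
  rw [h1, formCoeff, mul_comm]
  congr 1
  rw [← smul_eq_mul, ← Pi.smul_apply, ← map_smul, smul_eq_mul, div_mul_cancel₀ _ h0]

theorem IsHolomorphicFormOn.exists_local_primitive (hΨ : IsHolomorphicFormOn Ψ M) (hM : IsOpen M)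
    {q : R} (hq : q ∈ M) : ∃ (U : Set R) (F : R → E3), IsOpen U ∧ q ∈ U ∧ U ⊆ M ∧
      IsRealPartOfIntegralOn F Ψ U := by
  set e := chartAt ℂ q with he
  have hq' : e.symm (e q) = q := e.left_inv (mem_chart_source ℂ q)
  have hz : e q ∈ chartDomain M q := ⟨mem_chart_target ℂ q, by
    change e.symm (e q) ∈ M; rwa [hq']⟩
  obtain ⟨r, hr, hball⟩ := Metric.isOpen_iff.1 (isOpen_chartDomain hM q) _ hz
  have hex : ∀ j, ∃ g : ℂ → ℂ, ∀ z ∈ Metric.ball (e q) r, HasDerivAt g (formCoeff Ψ e z j) z :=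
    fun j => ((hΨ q j).mono hball).isExactOn_ball
  choose g hg using hex
  let F : R → E3 := fun q' => WithLp.toLp 2 fun j => (g j (e q')).re
  refine ⟨e.source ∩ e ⁻¹' Metric.ball (e q) r, F, e.isOpen_inter_preimage Metric.isOpen_ball,
    ⟨mem_chart_source ℂ q, Metric.mem_ball_self hr⟩, ?_, ?_⟩
  · rintro w ⟨hw1, hw2⟩
    have := (hball hw2).2
    rwa [mem_preimage, e.left_inv hw1] at this
  · rintro w ⟨hw1, hw2⟩
    have hd : HasFDerivAt (F ∘ e.symm) ((PiLp.continuousLinearEquiv 2 ℝ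
        (fun _ : Fin 3 => ℝ)).symm.toContinuousLinearMap.comp (ContinuousLinearMap.pi fun j =>
        Complex.reCLM.comp ((ContinuousLinearMap.toSpanSingleton ℂ
          (formCoeff Ψ e (e w) j)).restrictScalars ℝ))) (e w) := by
      have h1 : HasFDerivAt (fun z => fun j => (g j z).re) (ContinuousLinearMap.pi fun j =>
        Complex.reCLM.comp ((ContinuousLinearMap.toSpanSingleton ℂ
          (formCoeff Ψ e (e w) j)).restrictScalars ℝ)) (e w) := by
        rw [hasFDerivAt_pi]
        intro j
        exact Complex.reCLM.hasFDerivAt.comp (e w)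
          ((hg j _ hw2).hasFDerivAt.restrictScalars ℝ)
      have h2 := (PiLp.continuousLinearEquiv 2 ℝ
        (fun _ : Fin 3 => ℝ)).symm.toContinuousLinearMap.hasFDerivAt.comp (e w) h1
      refine h2.congr_of_eventuallyEq ?_
      filter_upwards [e.open_target.mem_nhds (e.map_source hw1)] with z hz
      simp only [F, Function.comp_apply, e.right_inv hz]
      rfl
    have := mdifferentiableAt_and_differential_of_chart (F := F) (Ψ := Ψ) q (e.map_source hw1)
      hd.differentiableAt (by
        intro v j
        rw [hd.fderiv]
        simp [mul_comm]
        rfl)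
    rwa [e.left_inv hw1] at this

/-- Both maps have differential Re Ψ, so the difference has zero derivative on a coordinate disc. -/
theorem IsRealPartOfIntegralOn.sub_locally_const {U V : Set R} {F G : R → E3}
    (hF : IsRealPartOfIntegralOn F Ψ U) (hG : IsRealPartOfIntegralOn G Ψ V) (hU : IsOpen U)
    (hV : IsOpen V) {q : R} (hq : q ∈ U ∩ V) : ∀ᶠ q' in 𝓝 q, F q' - G q' = F q - G q := by
  set e := chartAt ℂ q with he
  have hq' : e.symm (e q) = q := e.left_inv (mem_chart_source ℂ q)
  have hz : e q ∈ chartDomain (U ∩ V) q := ⟨mem_chart_target ℂ q, by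
    change e.symm (e q) ∈ U ∩ V; rwa [hq']⟩
  obtain ⟨r, hr, hball⟩ := Metric.isOpen_iff.1 (isOpen_chartDomain (hU.inter hV) q) _ hz
  have hconst : ∀ z ∈ Metric.ball (e q) r, (F ∘ e.symm - G ∘ e.symm) z =
      (F ∘ e.symm - G ∘ e.symm) (e q) := by
    intro z hz
    refine Convex.is_const_of_fderivWithin_eq_zero (𝕜 := ℝ) (convex_ball (e q) r) ?_ ?_ hz
      (Metric.mem_ball_self hr)
    · intro w hw
      have hw' := hball hw
      exact ((hF.differentiableAt_chart q ⟨hw'.1, hw'.2.1⟩).sub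
        (hG.differentiableAt_chart q ⟨hw'.1, hw'.2.2⟩)).differentiableWithinAt
    · intro w hw
      have hw' := hball hw
      rw [fderivWithin_of_isOpen Metric.isOpen_ball hw,
        fderiv_sub (hF.differentiableAt_chart q ⟨hw'.1, hw'.2.1⟩)
          (hG.differentiableAt_chart q ⟨hw'.1, hw'.2.2⟩)]
      ext v j
      have h1 := hF.fderiv_chart q (z := w) ⟨hw'.1, hw'.2.1⟩ v j
      have h2 := hG.fderiv_chart q (z := w) ⟨hw'.1, hw'.2.2⟩ v j
      simp only [sub_apply, PiLp.sub_apply]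
      rw [h1, h2]; simp
  filter_upwards [(e.isOpen_inter_preimage (Metric.isOpen_ball (x := e q) (ε := r))).mem_nhds
    ⟨mem_chart_source ℂ q, Metric.mem_ball_self hr⟩] with w hw
  have := hconst _ hw.2
  simpa [e.left_inv hw.1, hq'] using this

/-- `G` follows a branch of the multi-valued map `Re ∫ Ψ` along the map `σ` on `T`. -/
def IsContinuationOn {E : Type*} [TopologicalSpace E] (Ψ : R → ℂ →L[ℂ] (Fin 3 → ℂ)) (M : Set R)
    (σ : E → R) (T : Set E) (G : E → E3) : Prop :=
  ∀ x ∈ T, ∃ (U : Set R) (F : R → E3), IsOpen U ∧ σ x ∈ U ∧ U ⊆ M ∧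
    IsRealPartOfIntegralOn F Ψ U ∧ ∀ᶠ y in 𝓝[T] x, G y = F (σ y)

theorem IsContinuationOn.sub_eq {E : Type*} [TopologicalSpace E] {σ : E → R} {T : Set E}
    {G G' : E → E3} (hσ : ContinuousOn σ T) (hT : IsPreconnected T)
    (hG : IsContinuationOn Ψ M σ T G) (hG' : IsContinuationOn Ψ M σ T G') {x y : E} (hx : x ∈ T)
    (hy : y ∈ T) : G x - G' x = G y - G' y := by
  refine eq_of_locally_eq_of_isPreconnected (g := fun x => G x - G' x) hT ?_ hx hy
  intro x hx
  obtain ⟨U, F, hU, hxU, -, hF, hGF⟩ := hG x hx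
  obtain ⟨U', F', hU', hxU', -, hF', hGF'⟩ := hG' x hx
  have h := (hσ x hx).eventually (hF.sub_locally_const hF' hU hU' ⟨hxU, hxU'⟩)
  filter_upwards [hGF, hGF', h] with y h1 h2 h3
  rw [h1, h2, h3, hGF.self_of_nhdsWithin hx, hGF'.self_of_nhdsWithin hx]

/-- A Lebesgue number δ of the covering of T by preimages of domains of local primitives attaches to
each x a primitive that is defined along σ on the δ-ball around x. Its increments between nearby
points do not depend on the choice, as primitives differ by constants. They form a cocycle, whose
potential is the continuation. Intervals and singular triangles are treated at once. -/
theorem IsHolomorphicFormOn.exists_isContinuationOn (hΨ : IsHolomorphicFormOn Ψ M) (hM : IsOpen M)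
    {E : Type*} [NormedAddCommGroup E] [NormedSpace ℝ E] {T : Set E} (hT : Convex ℝ T)
    (hTc : IsCompact T) (h0 : (0 : E) ∈ T) {σ : E → R} (hσ : ContinuousOn σ T)
    (hσM : MapsTo σ T M) : ∃ G : E → E3, IsContinuationOn Ψ M σ T G := by
  have hloc : ∀ x : T, ∃ (U : Set R) (F : R → E3), IsOpen U ∧ σ x ∈ U ∧ U ⊆ M ∧
      IsRealPartOfIntegralOn F Ψ U := fun x => hΨ.exists_local_primitive hM (hσM x.2)
  choose U F hU hxU hUM hF using hloc
  have hO : ∀ x : T, ∃ O : Set E, IsOpen O ∧ (x : E) ∈ O ∧ O ∩ T ⊆ σ ⁻¹' U x := fun x =>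
    mem_nhdsWithin.1 ((hσ x x.2).preimage_mem_nhdsWithin ((hU x).mem_nhds (hxU x)))
  choose O hOo hxO hOU using hO
  obtain ⟨δ, hδ, hleb⟩ := lebesgue_number_lemma_of_metric hTc hOo
    (fun x hx => mem_iUnion.2 ⟨⟨x, hx⟩, hxO ⟨x, hx⟩⟩)
  have hleb' : ∀ x : E, ∃ i : T, x ∈ T → Metric.ball x δ ⊆ O i := by
    intro x
    by_cases hx : x ∈ T
    · obtain ⟨i, hi⟩ := hleb x hx
      exact ⟨i, fun _ => hi⟩
    · exact ⟨⟨0, h0⟩, fun h => absurd h hx⟩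
  choose i hi using hleb'
  have hmemU : ∀ x ∈ T, ∀ y ∈ T, dist x y < δ → σ y ∈ U (i x) := fun x hx y hy hxy =>
    hOU _ ⟨hi x hx (by rwa [Metric.mem_ball, dist_comm]), hy⟩
  -- The part of T in both balls is convex, hence connected, so the locally constant difference of
  -- the two primitives along σ is constant on it.
  have key : ∀ x ∈ T, ∀ x' ∈ T, ∀ y ∈ T, ∀ z ∈ T, dist x y < δ → dist x z < δ → dist x' y < δ →
      dist x' z < δ → F (i x) (σ z) - F (i x') (σ z) = F (i x) (σ y) - F (i x') (σ y) := by
    intro x hx x' hx' y hy z hz hxy hxz hxy' hxz'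
    have hconv : Convex ℝ (T ∩ (Metric.ball x δ ∩ Metric.ball x' δ)) :=
      hT.inter ((convex_ball _ _).inter (convex_ball _ _))
    refine eq_of_locally_eq_of_isPreconnected
      (g := fun y => F (i x) (σ y) - F (i x') (σ y)) hconv.isPreconnected ?_
      ⟨hz, by rwa [Metric.mem_ball, dist_comm], by rwa [Metric.mem_ball, dist_comm]⟩
      ⟨hy, by rwa [Metric.mem_ball, dist_comm], by rwa [Metric.mem_ball, dist_comm]⟩
    rintro w ⟨hw, hw1, hw2⟩
    rw [Metric.mem_ball, dist_comm] at hw1 hw2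
    exact ((hσ w hw).mono inter_subset_left).eventually ((hF (i x)).sub_locally_const (hF (i x'))
      (hU _) (hU _) ⟨hmemU x hx w hw hw1, hmemU x' hx' w hw hw2⟩)
  obtain ⟨G, η, hη, hG⟩ := exists_potential_of_cocycle hT h0 hTc.isBounded hδ
    (fun x y => F (i x) (σ y) - F (i x) (σ x)) (by
      intro x hx y hy z hz hxy hyz hxz
      have := key x hx y hy y hy z hz hxy hxz (by simpa using hδ) hyz
      have h2 : F (i x) (σ z) - F (i x) (σ y) = F (i y) (σ z) - F (i y) (σ y) := by
        rw [sub_eq_sub_iff_sub_eq_sub]; exact this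
      rw [← h2]; abel)
  refine ⟨G, fun x hx => ?_⟩
  -- Near x the potential is the primitive attached to x, shifted by a constant.
  refine ⟨U (i x), fun q => F (i x) q + (G x - F (i x) (σ x)), hU _,
    hmemU x hx x hx (by simpa using hδ), hUM _, ?_, ?_⟩
  · intro q hq
    obtain ⟨h1, h2⟩ := hF (i x) q hq
    have h3 := (h1.hasMFDerivAt).add (hasMFDerivAt_const (I := 𝓘(ℝ, ℂ)) (G x - F (i x) (σ x)) q)
    refine ⟨h3.mdifferentiableAt, fun v j => ?_⟩
    have h4 : differential (fun q => F (i x) q + (G x - F (i x) (σ x))) q =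
        differential (F (i x)) q := by
      exact h3.mfderiv.trans (add_zero _)
    rw [h4, h2]
  · filter_upwards [self_mem_nhdsWithin, nhdsWithin_le_nhds (Metric.ball_mem_nhds x hη)] with y hy hxy
    rw [hG x hx y hy (by rwa [dist_comm])]
    abel

end Primitives

/-! ### Homology invariance, periods and the flux -/

section FluxAndPeriods

variable {R : Type*} [TopologicalSpace R] [ChartedSpace ℂ R] [IsManifold 𝓘(ℂ, ℂ) ω R]
  {M : Set R} {Φ Ψ : R → ℂ →L[ℂ] (Fin 3 → ℂ)} {X : R → E3} {γ : ℝ → R}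

omit [IsManifold 𝓘(ℂ, ℂ) ω R] in
theorem IsContinuationAlong.congr {γ' : ℝ → R} {Y : ℝ → E3} (h : EqOn γ γ' (Icc 0 1))
    (hY : IsContinuationAlong Ψ M γ Y) : IsContinuationAlong Ψ M γ' Y := by
  intro t ht
  obtain ⟨U, F, hU, htU, hUM, hF, hev⟩ := hY t ht
  refine ⟨U, F, hU, h ht ▸ htU, hUM, hF, ?_⟩
  filter_upwards [hev, self_mem_nhdsWithin] with s hs hs'
  rw [hs, h hs']

omit [IsManifold 𝓘(ℂ, ℂ) ω R] in
/-- The restriction of a continuation on a convex set to a curve. -/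
theorem IsContinuationOn.along {E : Type*} [TopologicalSpace E] {σ : E → R} {T : Set E} {G : E → E3}
    (hG : IsContinuationOn Ψ M σ T G) {c : ℝ → E} (hc : ContinuousOn c (Icc 0 1))
    (hcT : MapsTo c (Icc 0 1) T) : IsContinuationAlong Ψ M (σ ∘ c) (G ∘ c) := by
  intro t ht
  obtain ⟨U, F, hU, htU, hUM, hF, hev⟩ := hG (c t) (hcT ht)
  exact ⟨U, F, hU, htU, hUM, hF, ((hc t ht).tendsto_nhdsWithin hcT).eventually hev⟩

open Classical in
/-- The increment of the continuations of `Re ∫ Ψ` along a path, if there are any. -/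
def pathIncrement (Ψ : R → ℂ →L[ℂ] (Fin 3 → ℂ)) (M : Set R) (c : unitInterval → R) : E3 :=
  if h : ∃ Y, IsContinuationAlong Ψ M (c ∘ projIcc 0 1 zero_le_one) Y then
    h.choose 1 - h.choose 0 else 0

theorem IsContinuationAlong.sub_eq {Y Y' : ℝ → E3} (hγ : ContinuousOn γ (Icc 0 1))
    (hY : IsContinuationAlong Ψ M γ Y) (hY' : IsContinuationAlong Ψ M γ Y') :
    Y 1 - Y 0 = Y' 1 - Y' 0 := by
  have := IsContinuationOn.sub_eq (G := Y) (G' := Y') hγ isPreconnected_Icc hY hY'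
    (right_mem_Icc.2 zero_le_one) (left_mem_Icc.2 zero_le_one)
  rw [sub_eq_sub_iff_sub_eq_sub]; exact this

theorem pathIncrement_eq {Y : ℝ → E3} (hγ : ContinuousOn γ (Icc 0 1))
    (hY : IsContinuationAlong Ψ M γ Y) : pathIncrement Ψ M (fun t => γ t) = Y 1 - Y 0 := by
  have heq : EqOn γ ((fun t : unitInterval => γ t) ∘ projIcc 0 1 zero_le_one) (Icc 0 1) := by
    intro t ht
    simp [projIcc_of_mem _ ht]
  have h : ∃ Y, IsContinuationAlong Ψ M
      ((fun t : unitInterval => γ t) ∘ projIcc 0 1 zero_le_one) Y := ⟨Y, hY.congr heq⟩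
  rw [pathIncrement, dif_pos h]
  exact (h.choose_spec.congr heq.symm).sub_eq hγ hY

/-- The sum of the increments over the paths of a chain. -/
def chainIncrement (Ψ : R → ℂ →L[ℂ] (Fin 3 → ℂ)) (M : Set R) :
    ((unitInterval → R) →₀ ℤ) →+ E3 :=
  Finsupp.liftAddHom fun c => (smulAddHom ℤ E3).flip (pathIncrement Ψ M c)

omit [IsManifold 𝓘(ℂ, ℂ) ω R] in
theorem chainIncrement_single (c : unitInterval → R) :
    chainIncrement Ψ M (Finsupp.single c 1) = pathIncrement Ψ M c := by
  simp [chainIncrement]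

/-- A continuation over a singular triangle restricts to continuations along its three edges, and
their increments cancel around the boundary. Hence every generator of the boundaries lies in the
kernel of the increment homomorphism. -/
theorem chainIncrement_eq_zero_of_mem (hΨ : IsHolomorphicFormOn Ψ M) (hM : IsOpen M)
    {b : (unitInterval → R) →₀ ℤ} (hb : b ∈ singularBoundaries M) : chainIncrement Ψ M b = 0 := by
  have hle : singularBoundaries M ≤ (chainIncrement Ψ M).ker := by
    rw [singularBoundaries, AddSubgroup.closure_le]
    rintro b ⟨σ, hσ, hσM, rfl⟩
    set T : Set (ℝ × ℝ) := {x | 0 ≤ x.1 ∧ 0 ≤ x.2 ∧ x.1 + x.2 ≤ 1} with hTdef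
    have hTconv : Convex ℝ T := by
      rintro ⟨a, b⟩ ⟨h1, h2, h3⟩ ⟨c, d⟩ ⟨h4, h5, h6⟩ s t hs ht hst
      simp only at h1 h2 h3 h4 h5 h6
      refine ⟨?_, ?_, ?_⟩ <;> simp
      · positivity
      · positivity
      · nlinarith
    have hTc : IsCompact T := by
      refine (isCompact_Icc (a := ((0 : ℝ), (0 : ℝ))) (b := (1, 1))).of_isClosed_subset ?_ ?_
      · exact (isClosed_le continuous_const continuous_fst).inter
          ((isClosed_le continuous_const continuous_snd).inter
            (isClosed_le (continuous_fst.add continuous_snd) continuous_const))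
      · rintro ⟨a, b⟩ ⟨h1, h2, h3⟩
        simp only at h1 h2 h3
        exact ⟨⟨h1, h2⟩, ⟨by change a ≤ 1; linarith, by change b ≤ 1; linarith⟩⟩
    obtain ⟨G, hG⟩ := hΨ.exists_isContinuationOn hM hTconv hTc (by simp [hTdef]) hσ hσM
    have hedge : ∀ c : ℝ → ℝ × ℝ, Continuous c → MapsTo c (Icc 0 1) T →
        pathIncrement Ψ M (fun t : unitInterval => σ (c t)) = G (c 1) - G (c 0) := fun c hc hcT =>
      pathIncrement_eq (γ := σ ∘ c) (hσ.comp hc.continuousOn hcT) (hG.along hc.continuousOn hcT)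
    have e1 := hedge (fun t => (1 - t, t)) (by fun_prop) (fun t ht => ⟨by simpa using ht.2, ht.1, by simp⟩)
    have e2 := hedge (fun t => (0, t)) (by fun_prop) (fun t ht => ⟨by simp, ht.1, by simpa using ht.2⟩)
    have e3 := hedge (fun t => (t, 0)) (by fun_prop) (fun t ht => ⟨ht.1, by simp, by simpa using ht.2⟩)
    rw [SetLike.mem_coe, AddMonoidHom.mem_ker, map_add, map_sub, chainIncrement_single,
      chainIncrement_single, chainIncrement_single, e1, e2, e3]
    simp
  exact hle hb

/-- Homologous curves have the same increments. -/
theorem AreHomologousIn.increment_eq (hΨ : IsHolomorphicFormOn Ψ M) (hM : IsOpen M) {c : ℝ → R}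
    (h : AreHomologousIn M γ c) (hγ : ContinuousOn γ (Icc 0 1)) (hc : ContinuousOn c (Icc 0 1))
    {Y Z : ℝ → E3} (hY : IsContinuationAlong Ψ M γ Y) (hZ : IsContinuationAlong Ψ M c Z) :
    Y 1 - Y 0 = Z 1 - Z 0 := by
  have := chainIncrement_eq_zero_of_mem hΨ hM h
  rw [map_sub, chainIncrement_single, chainIncrement_single, pathIncrement_eq hγ hY,
    pathIncrement_eq hc hZ] at this
  exact sub_eq_zero.1 this

omit [IsManifold 𝓘(ℂ, ℂ) ω R] in
theorem IsClosedCurveIn.continuousOn (hγ : IsClosedCurveIn M γ) : ContinuousOn γ (Icc 0 1) := by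
  obtain ⟨-, -, n, τ, hτ, h0, h1, hs⟩ := hγ
  have : ∀ k ≤ n, ContinuousOn γ (Icc (τ 0) (τ k)) := by
    intro k
    induction k with
    | zero => intro _; simp
    | succ k ih =>
      intro hk
      rw [← Icc_union_Icc_eq_Icc (hτ (Nat.zero_le k)) (hτ (Nat.le_succ k))]
      exact (ih (by omega)).union_of_isClosed (hs k hk).continuousOn isClosed_Icc isClosed_Icc
  have := this n le_rfl
  rwa [h0, h1] at this

/-- A form along a curve in a chart. -/
theorem form_velocity (p : R) {t : ℝ} (hγ : MDifferentiableAt 𝓘(ℝ, ℝ) 𝓘(ℝ, ℂ) γ t)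
    (ht : γ t ∈ (chartAt ℂ p).source) (j : Fin 3) :
    Ψ (γ t) (velocity γ t) j =
      formCoeff Ψ (chartAt ℂ p) (chartAt ℂ p (γ t)) j * deriv (chartAt ℂ p ∘ γ) t := by
  rw [(velocity_eq_coordScale_mul p hγ ht).2, formCoeff, (chartAt ℂ p).left_inv ht, mul_comm,
    ← smul_eq_mul, map_smul]
  simp [mul_comm]

/-- The integrand of a holomorphic form along a `C¹` curve is integrable. -/
theorem IsHolomorphicFormOn.integrableOn_velocity (hΨ : IsHolomorphicFormOn Ψ M) (hM : IsOpen M)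
    {a b : ℝ} (hab : a < b) (hγ : ContMDiffOn 𝓘(ℝ, ℝ) 𝓘(ℝ, ℂ) 1 γ (Icc a b))
    (hγM : MapsTo γ (Icc a b) M) (j : Fin 3) :
    IntegrableOn (fun t => Ψ (γ t) (velocity γ t) j) (Icc a b) := by
  refine LocallyIntegrableOn.integrableOn_isCompact (fun t₀ ht₀ => ?_) isCompact_Icc
  have : IsManifold 𝓘(ℝ, ℂ) 1 R := isManifold_real 1
  set e := chartAt ℂ (γ t₀) with he
  obtain ⟨O, hO, ht₀O, hOs⟩ := mem_nhdsWithin.1 ((hγ.continuousOn t₀ ht₀).preimage_mem_nhdsWithin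
    ((e.open_source.inter hM).mem_nhds ⟨mem_chart_source ℂ _, hγM ht₀⟩))
  have hc : ContDiffOn ℝ 1 (e ∘ γ) (Icc a b ∩ O) := by
    have h1 := (contMDiffOn_chart (I := 𝓘(ℝ, ℂ)) (n := 1) (x := γ t₀)).comp
      (hγ.mono (inter_subset_left (t := O))) (fun t ht => (hOs ⟨ht.2, ht.1⟩).1)
    exact h1.contDiffOn
  have hud : UniqueDiffOn ℝ (Icc a b ∩ O) := (uniqueDiffOn_Icc hab).inter hO
  have hmeas : MeasurableSet (Icc a b ∩ O) := measurableSet_Icc.inter hO.measurableSet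
  -- `velocity` is a two-sided derivative and carries no information at the end points of a piece.
  -- The derivative within the piece is continuous up to the ends and differs from it at most there,
  -- on a null set.
  have hcont : ContinuousOn (fun t => formCoeff Ψ e (e (γ t)) j *
      derivWithin (e ∘ γ) (Icc a b ∩ O) t) (Icc a b ∩ O) := by
    refine ContinuousOn.mul ?_ (hc.continuousOn_derivWithin hud le_rfl)
    refine (hΨ (γ t₀) j).continuousOn.comp hc.continuousOn fun t ht => ?_
    have := hOs ⟨ht.2, ht.1⟩
    exact ⟨e.map_source this.1, by
      change e.symm (e (γ t)) ∈ M
      rw [e.left_inv this.1]; exact this.2⟩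
  obtain ⟨s, hs, hint⟩ : IntegrableAtFilter (fun t => formCoeff Ψ e (e (γ t)) j *
      derivWithin (e ∘ γ) (Icc a b ∩ O) t) (𝓝[Icc a b ∩ O] t₀) :=
    hcont.integrableAt_nhdsWithin hmeas ⟨ht₀, ht₀O⟩
  refine ⟨s ∩ (Icc a b ∩ O), ?_, (hint.mono_set inter_subset_left).congr_fun_ae ?_⟩
  · have : 𝓝[Icc a b] t₀ = 𝓝[Icc a b ∩ O] t₀ := (nhdsWithin_inter_of_mem'
      (mem_nhdsWithin_of_mem_nhds (hO.mem_nhds ht₀O))).symm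
    rw [this]
    exact inter_mem hs self_mem_nhdsWithin
  · refine ae_restrict_of_ae_restrict_of_subset inter_subset_right ?_
    refine (ae_restrict_iff' hmeas).2 ?_
    filter_upwards [compl_mem_ae_iff.2 (measure_singleton a),
      compl_mem_ae_iff.2 (measure_singleton b)] with t hta htb ht
    have ht' : Icc a b ∈ 𝓝 t := Icc_mem_nhds (lt_of_le_of_ne ht.1.1 (Ne.symm hta))
      (lt_of_le_of_ne ht.1.2 htb)
    have hmd : MDifferentiableAt 𝓘(ℝ, ℝ) 𝓘(ℝ, ℂ) γ t :=
      ((hγ t ht.1).contMDiffAt ht').mdifferentiableAt (by simp)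
    rw [form_velocity (γ t₀) hmd (hOs ⟨ht.2, ht.1⟩).1,
      derivWithin_of_mem_nhds (inter_mem ht' (hO.mem_nhds ht.2))]

theorem IsHolomorphicFormOn.intervalIntegrable_velocity (hΨ : IsHolomorphicFormOn Ψ M)
    (hM : IsOpen M) {a b : ℝ} (hab : a ≤ b) (hγ : ContMDiffOn 𝓘(ℝ, ℝ) 𝓘(ℝ, ℂ) 1 γ (Icc a b))
    (hγM : MapsTo γ (Icc a b) M) (j : Fin 3) :
    IntervalIntegrable (fun t => Ψ (γ t) (velocity γ t) j) volume a b := by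
  -- The partition points need not be distinct, so a piece may be a single point.
  rcases hab.eq_or_lt with rfl | hab'
  · simp
  · rw [intervalIntegrable_iff_integrableOn_Icc_of_le hab]
    exact hΨ.integrableOn_velocity hM hab' hγ hγM j

theorem IsClosedCurveIn.intervalIntegrable_velocity (hγ : IsClosedCurveIn M γ) (hM : IsOpen M)
    (hΨ : IsHolomorphicFormOn Ψ M) (j : Fin 3) :
    IntervalIntegrable (fun t => Ψ (γ t) (velocity γ t) j) volume 0 1 := by
  obtain ⟨hγM, -, n, τ, hτ, h0, h1, hs⟩ := hγ
  rw [← h0, ← h1]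
  refine IntervalIntegrable.trans_iterate fun k hk => ?_
  refine hΨ.intervalIntegrable_velocity hM (hτ (Nat.le_succ k)) (hs k hk) (hγM.mono_left ?_) j
  exact Icc_subset_Icc (h0 ▸ hτ (Nat.zero_le k)) (h1 ▸ hτ hk)

theorem period_apply (hM : IsOpen M) (hΨ : IsHolomorphicFormOn Ψ M) (hγ : IsClosedCurveIn M γ)
    (j : Fin 3) : period Ψ γ j = ∫ t in (0 : ℝ)..1, (Ψ (γ t) (velocity γ t) j).re := by
  exact (Complex.reCLM.intervalIntegral_comp_comm (hγ.intervalIntegrable_velocity hM hΨ j)).symm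

/-- The period is the increment of every continuation. -/
theorem IsContinuationAlong.period_eq (hM : IsOpen M) (hΨ : IsHolomorphicFormOn Ψ M)
    (hγ : IsClosedCurveIn M γ) {Y : ℝ → E3} (hY : IsContinuationAlong Ψ M γ Y) :
    period Ψ γ = Y 1 - Y 0 := by
  ext j
  rw [period_apply hM hΨ hγ]
  have hint := hγ.intervalIntegrable_velocity hM hΨ j
  have hcont := hγ.continuousOn
  obtain ⟨hγM, -, n, τ, hτ, h0, h1, hs⟩ := hγ
  have hsub : ∀ k < n, Icc (τ k) (τ (k + 1)) ⊆ Icc 0 1 := fun k hk =>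
    Icc_subset_Icc (h0 ▸ hτ (Nat.zero_le k)) (h1 ▸ hτ hk)
  have hint' : ∀ k < n, IntervalIntegrable (fun t => (Ψ (γ t) (velocity γ t) j).re) volume
      (τ k) (τ (k + 1)) := by
    intro k hk
    have := hΨ.intervalIntegrable_velocity hM (hτ (Nat.le_succ k)) (hs k hk)
      (hγM.mono_left (hsub k hk)) j
    exact ⟨this.1.re, this.2.re⟩
  -- The fundamental theorem of calculus on one piece: locally Y is F ∘ γ with dF = Re Ψ. The pieces
  -- then telescope.
  have hpiece : ∀ k < n, ∫ t in τ k..τ (k + 1), (Ψ (γ t) (velocity γ t) j).re =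
      Y (τ (k + 1)) j - Y (τ k) j := by
    intro k hk
    refine intervalIntegral.integral_eq_sub_of_hasDerivAt_of_le (hτ (Nat.le_succ k)) ?_ ?_
      (hint' k hk) (f := fun t => Y t j)
    · intro t ht
      obtain ⟨U, F, hU, htU, hUM, hF, hev⟩ := hY t (hsub k hk ht)
      have h2 : ContinuousWithinAt (fun s => F (γ s) j) (Icc 0 1) t :=
        (EuclideanSpace.proj (𝕜 := ℝ) j : E3 →L[ℝ] ℝ).continuous.continuousAt.comp_continuousWithinAt
          ((hF _ htU).1.continuousAt.comp_continuousWithinAt (hcont t (hsub k hk ht)))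
      refine (h2.congr_of_eventuallyEq ?_ ?_).mono (hsub k hk)
      · filter_upwards [hev] with s hs using by rw [hs]
      · rw [hev.self_of_nhdsWithin (hsub k hk ht)]
    · intro t ht
      obtain ⟨U, F, hU, htU, hUM, hF, hev⟩ := hY t (hsub k hk (Ioo_subset_Icc_self ht))
      have hnhds : Icc (τ k) (τ (k + 1)) ∈ 𝓝 t := Icc_mem_nhds ht.1 ht.2
      rw [nhdsWithin_eq_nhds.2 (mem_of_superset hnhds (hsub k hk))] at hev
      have hmd : MDifferentiableAt 𝓘(ℝ, ℝ) 𝓘(ℝ, ℂ) γ t :=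
        ((hs k hk t (Ioo_subset_Icc_self ht)).contMDiffAt hnhds).mdifferentiableAt (by simp)
      obtain ⟨hFd, hFΨ⟩ := hF _ htU
      have h3 : HasDerivAt (F ∘ γ) (differential F (γ t) (velocity γ t)) t := by
        have : HasFDerivAt (F ∘ γ) ((differential F (γ t)).comp
            (mfderiv 𝓘(ℝ, ℝ) 𝓘(ℝ, ℂ) γ t : ℝ →L[ℝ] ℂ)) t :=
          (hFd.hasMFDerivAt.comp t hmd.hasMFDerivAt).hasFDerivAt
        exact this.hasDerivAt
      have h4 := (EuclideanSpace.proj (𝕜 := ℝ) j : E3 →L[ℝ] ℝ).hasFDerivAt.comp_hasDerivAt t h3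
      have h5 : HasDerivAt (fun s => F (γ s) j) ((Ψ (γ t) (velocity γ t) j).re) t := by
        rw [← hFΨ]; exact h4
      refine h5.congr_of_eventuallyEq ?_
      filter_upwards [hev] with s hs using by rw [hs]
  have hsum := intervalIntegral.sum_integral_adjacent_intervals (μ := volume) hint'
  rw [Finset.sum_congr rfl (fun k hk => hpiece k (Finset.mem_range.1 hk)),
    Finset.sum_range_sub (fun k => Y (τ k) j), h0, h1] at hsum
  rw [← hsum]
  simp

/-- The flux is minus the period of the conjugate surface. -/
theorem IsConformalImmersionOn.flux_eq (hX : IsConformalImmersionOn X M) (hM : IsOpen M)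
    (hΦ : IsRealPartOfIntegralOn X Φ M) (hhol : IsHolomorphicFormOn Φ M)
    (hγ : IsClosedCurveIn M γ) : flux X γ = -period (conjugateForm Φ) γ := by
  -- N × dX(v) = dX(iv) = Re(iΦ(v)) = −Re(−iΦ(v)).
  have hpt : ∀ t ∈ Icc (0 : ℝ) 1, ∀ j,
      cross (gaussMap X (γ t)) (differential X (γ t) (velocity γ t)) j =
      -(conjugateForm Φ (γ t) (velocity γ t) j).re := by
    intro t ht j
    rw [hX.cross_gaussMap_differential (hγ.1 ht), (hΦ _ (hγ.1 ht)).2, ← smul_eq_mul, map_smul]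
    simp [conjugateForm]
  have hint : ∀ j, IntervalIntegrable (fun t => (conjugateForm Φ (γ t) (velocity γ t) j).re)
      volume 0 1 := fun j => by
    have := hγ.intervalIntegrable_velocity hM hhol.conjugateForm j
    exact ⟨this.1.re, this.2.re⟩
  ext j
  rw [PiLp.neg_apply, period_apply hM hhol.conjugateForm hγ, ← intervalIntegral.integral_neg, flux,
    intervalIntegral.integral_of_le zero_le_one, intervalIntegral.integral_of_le zero_le_one,
    eval_integral_piLp]
  · refine setIntegral_congr_fun measurableSet_Ioc fun t ht => ?_
    exact hpt t (Ioc_subset_Icc_self ht) j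
  · intro i
    refine IntegrableOn.congr_fun (hint i).neg.1 (fun t ht => ?_) measurableSet_Ioc
    exact (hpt t (Ioc_subset_Icc_self ht) i).symm

theorem IsHolomorphicFormOn.exists_isContinuationAlong (hΨ : IsHolomorphicFormOn Ψ M)
    (hM : IsOpen M) (hγ : IsClosedCurveIn M γ) : ∃ Y, IsContinuationAlong Ψ M γ Y :=
  hΨ.exists_isContinuationOn hM (convex_Icc 0 1) isCompact_Icc (left_mem_Icc.2 zero_le_one)
    hγ.continuousOn hγ.1

theorem AreHomologousIn.period_eq (hΨ : IsHolomorphicFormOn Ψ M) (hM : IsOpen M) {c : ℝ → R}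
    (h : AreHomologousIn M γ c) (hγ : IsClosedCurveIn M γ) (hc : IsClosedCurveIn M c) :
    period Ψ γ = period Ψ c := by
  obtain ⟨Y, hY⟩ := hΨ.exists_isContinuationAlong hM hγ
  obtain ⟨Z, hZ⟩ := hΨ.exists_isContinuationAlong hM hc
  rw [hY.period_eq hM hΨ hγ, hZ.period_eq hM hΨ hc]
  exact h.increment_eq hΨ hM hγ.continuousOn hc.continuousOn hY hZ

end FluxAndPeriods

/-! ### Laurent expansion and residues at isolated singularities -/

section Residues

theorem HasSum.congr_both {ι : Type*} {f g : ι → ℂ} {a b : ℂ} (h : HasSum f a)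
    (hfg : ∀ n, g n = f n) (hab : b = a) : HasSum g b := by
  rw [hab, funext hfg]; exact h

theorem circleIntegral_mul_const (f : ℂ → ℂ) (a c : ℂ) (r : ℝ) :
    (∮ z in C(c, r), f z * a) = (∮ z in C(c, r), f z) * a := by
  simp_rw [mul_comm _ a]
  exact circleIntegral.integral_const_mul a f c r

open Complex in
/-- Cauchy's formula on an annulus. -/
theorem circleIntegral_sub_circleIntegral_eq {f : ℂ → ℂ} {z₀ z : ℂ} {R r ρ : ℝ} (hρ : 0 < ρ)
    (hρz : ρ < ‖z - z₀‖) (hzr : ‖z - z₀‖ < r) (hrR : r < R)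
    (hf : DifferentiableOn ℂ f (Metric.ball z₀ R \ {z₀})) :
    (∮ w in C(z₀, r), (w - z)⁻¹ * f w) - (∮ w in C(z₀, ρ), (w - z)⁻¹ * f w) =
      2 * Real.pi * I * f z := by
  have hopen : IsOpen (Metric.ball z₀ R \ {z₀}) := Metric.isOpen_ball.sdiff isClosed_singleton
  have hz : Metric.ball z₀ R \ {z₀} ∈ 𝓝 z := hopen.mem_nhds ⟨by
    rw [Metric.mem_ball, dist_eq_norm]; linarith, by
    rintro rfl; simp at hρz; linarith⟩
  -- The difference quotient (f(w) − f(z)) / (w − z) extends holomorphically over w = z, so it has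
  -- equal integrals over the two circles. Only the larger circle winds around z.
  have hg : DifferentiableOn ℂ (dslope f z) (Metric.ball z₀ R \ {z₀}) :=
    (Complex.differentiableOn_dslope hz).2 hf
  have hann : Metric.closedBall z₀ r \ Metric.ball z₀ ρ ⊆ Metric.ball z₀ R \ {z₀} := by
    rintro w ⟨h1, h2⟩
    rw [Metric.mem_closedBall] at h1
    refine ⟨Metric.mem_ball.2 (by linarith), ?_⟩
    rintro rfl
    exact h2 (Metric.mem_ball_self hρ)
  have h1 : (∮ w in C(z₀, r), dslope f z w) = ∮ w in C(z₀, ρ), dslope f z w := by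
    refine circleIntegral_eq_of_differentiable_on_annulus_off_countable hρ (by linarith)
      countable_empty (hg.continuousOn.mono hann) fun w hw => ?_
    refine hg.differentiableAt (hopen.mem_nhds (hann ⟨Metric.ball_subset_closedBall hw.1.1,
      fun h => hw.1.2 (Metric.ball_subset_closedBall h)⟩))
  have hsphere : ∀ s, 0 < s → s < R → s ≠ ‖z - z₀‖ → (∮ w in C(z₀, s), dslope f z w) =
      (∮ w in C(z₀, s), (w - z)⁻¹ * f w) - (∮ w in C(z₀, s), (w - z)⁻¹) * f z := by
    intro s hs hsR hsz
    have hne : ∀ w ∈ Metric.sphere z₀ s, w ≠ z := by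
      rintro w hw rfl
      rw [Metric.mem_sphere, dist_eq_norm] at hw
      exact hsz hw.symm
    have hsub : Metric.sphere z₀ s ⊆ Metric.ball z₀ R \ {z₀} := by
      intro w hw
      rw [Metric.mem_sphere] at hw
      refine ⟨by rw [Metric.mem_ball]; linarith, ?_⟩
      rintro rfl
      simp at hw; linarith
    have hc1 : ContinuousOn (fun w => (w - z)⁻¹) (Metric.sphere z₀ s) :=
      (continuousOn_id.sub continuousOn_const).inv₀ fun w hw => sub_ne_zero.2 (hne w hw)
    have hc2 : ContinuousOn f (Metric.sphere z₀ s) := hf.continuousOn.mono hsub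
    rw [← circleIntegral_mul_const, ← circleIntegral.integral_sub]
    · refine circleIntegral.integral_congr hs.le fun w hw => ?_
      rw [dslope_of_ne _ (hne w hw), slope_def_field]
      have := sub_ne_zero.2 (hne w hw)
      field_simp
    · exact (hc1.mul hc2).circleIntegrable hs.le
    · exact (hc1.mul continuousOn_const).circleIntegrable hs.le
  rw [hsphere r (by linarith) hrR (by linarith), hsphere ρ hρ (by linarith) (by linarith)] at h1
  have i1 : (∮ w in C(z₀, r), (w - z)⁻¹) = 2 * Real.pi * I :=
    circleIntegral.integral_sub_inv_of_mem_ball (by rwa [Metric.mem_ball, dist_eq_norm])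
  have i2 : (∮ w in C(z₀, ρ), (w - z)⁻¹) = 0 := by
    have hne : ∀ w ∈ Metric.closedBall z₀ ρ, w - z ≠ 0 := by
      intro w hw h
      rw [Metric.mem_closedBall, dist_eq_norm, sub_eq_zero.1 h] at hw
      linarith
    refine Complex.circleIntegral_eq_zero_of_differentiable_on_off_countable hρ.le countable_empty
      ((continuousOn_id.sub continuousOn_const).inv₀ hne) fun w hw => ?_
    exact (differentiableAt_id.sub_const z).inv (hne w (Metric.ball_subset_closedBall hw.1))
  rw [i1, i2] at h1
  linear_combination h1

open Complex in
/-- The geometric expansion of the Cauchy integral outside of the circle. -/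
theorem hasSum_circleIntegral_of_lt {f : ℂ → ℂ} {z₀ z : ℂ} {ρ : ℝ} (hρ : 0 < ρ)
    (hρz : ρ < ‖z - z₀‖) (hf : ContinuousOn f (Metric.sphere z₀ ρ)) :
    HasSum (fun n : ℕ => ∮ w in C(z₀, ρ), (w - z₀) ^ n * f w * ((z - z₀) ^ (n + 1))⁻¹)
      (-∮ w in C(z₀, ρ), (w - z)⁻¹ * f w) := by
  obtain ⟨B, hB⟩ := (isCompact_sphere z₀ ρ).exists_bound_of_continuousOn hf
  have hz : z - z₀ ≠ 0 := by
    intro h; rw [h] at hρz; simp at hρz; linarith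
  rw [show (-∮ w in C(z₀, ρ), (w - z)⁻¹ * f w) = ∮ w in C(z₀, ρ), (z - w)⁻¹ * f w by
    rw [← neg_one_mul, ← circleIntegral.integral_const_mul]
    congr 1; ext w; rw [← neg_sub w z, inv_neg]; ring]
  simp only [circleIntegral]
  have hcm : ∀ θ, circleMap z₀ ρ θ ∈ Metric.sphere z₀ ρ := fun θ => circleMap_mem_sphere z₀ hρ.le θ
  have hfc : Continuous fun θ => f (circleMap z₀ ρ θ) :=
    hf.comp_continuous (continuous_circleMap z₀ ρ) hcm
  -- On the circle the ratio |w − z₀| / |z − z₀| is the constant ρ / |z − z₀| < 1, so a convergent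
  -- geometric series dominates.
  refine intervalIntegral.hasSum_integral_of_dominated_convergence
    (fun n _ => ρ * ((ρ / ‖z - z₀‖) ^ n * (B / ‖z - z₀‖))) ?_ ?_ ?_ ?_ ?_
  · intro n
    refine Continuous.aestronglyMeasurable ?_
    simp only [deriv_circleMap]
    exact ((continuous_circleMap 0 ρ).mul continuous_const).smul
      (((((continuous_circleMap z₀ ρ).sub continuous_const).pow n).mul hfc).mul continuous_const)
  · intro n
    filter_upwards with θ _
    rw [smul_eq_mul, norm_mul, norm_mul, norm_mul, norm_inv, norm_pow, norm_pow, deriv_circleMap]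
    have h1 : ‖circleMap z₀ ρ θ - z₀‖ = ρ := by simp [abs_of_pos hρ]
    have h2 := hB _ (hcm θ)
    have hz' : 0 < ‖z - z₀‖ := norm_pos_iff.2 hz
    rw [h1, norm_mul, norm_circleMap_zero, abs_of_pos hρ, norm_I, mul_one, div_pow]
    have : ρ ^ n * ‖f (circleMap z₀ ρ θ)‖ * (‖z - z₀‖ ^ (n + 1))⁻¹ ≤
      ρ ^ n * B * (‖z - z₀‖ ^ (n + 1))⁻¹ := by gcongr
    calc _ ≤ ρ * (ρ ^ n * B * (‖z - z₀‖ ^ (n + 1))⁻¹) := by gcongr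
      _ = _ := by rw [pow_succ]; field_simp
  · filter_upwards with θ _
    refine Summable.mul_left _ (Summable.mul_right _ (summable_geometric_of_lt_one (by positivity) ?_))
    rwa [div_lt_one (by linarith)]
  · exact intervalIntegrable_const
  · filter_upwards with θ _
    refine HasSum.const_smul _ ?_
    have h1 : ‖circleMap z₀ ρ θ - z₀‖ = ρ := by simp [abs_of_pos hρ]
    have h2 : ‖(circleMap z₀ ρ θ - z₀) / (z - z₀)‖ < 1 := by
      rw [norm_div, h1, div_lt_one (by linarith)]; exact hρz
    have h3 := (hasSum_geometric_of_norm_lt_one h2).mul_right ((z - z₀)⁻¹ * f (circleMap z₀ ρ θ))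
    have hne : z - circleMap z₀ ρ θ ≠ 0 := by
      intro h
      rw [sub_eq_zero.1 h, h1] at hρz
      linarith
    refine h3.congr_both (fun n => ?_) ?_
    · rw [div_pow, pow_succ]; field_simp
    · have : 1 - (circleMap z₀ ρ θ - z₀) / (z - z₀) = (z - circleMap z₀ ρ θ) / (z - z₀) := by
        field_simp; ring
      rw [this]; field_simp

open Complex in
/-- A function with an isolated singularity has a residue. -/
theorem exists_isResidue {f : ℂ → ℂ} {z₀ : ℂ} {R : ℝ} (hR : 0 < R)
    (hf : DifferentiableOn ℂ f (Metric.ball z₀ R \ {z₀})) : ∃ c, IsResidue f z₀ c := by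
  have hopen : IsOpen (Metric.ball z₀ R \ {z₀}) := Metric.isOpen_ball.sdiff isClosed_singleton
  have hsph : ∀ s, 0 < s → s < R → Metric.sphere z₀ s ⊆ Metric.ball z₀ R \ {z₀} := by
    intro s hs hsR w hw
    rw [Metric.mem_sphere] at hw
    refine ⟨by rw [Metric.mem_ball]; linarith, ?_⟩
    rintro rfl
    simp at hw; linarith
  -- The Laurent coefficients as integrals over one circle. By `hindep` the radius is immaterial:
  -- the nonnegative powers use R / 2, the negative ones a circle inside |z − z₀|.
  set a : ℤ → ℂ := fun n => (2 * Real.pi * I)⁻¹ * ∮ w in C(z₀, R / 2), (w - z₀) ^ (-n - 1) * f w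
    with ha
  have hindep : ∀ (n : ℤ) (s : ℝ), 0 < s → s < R / 2 →
      (∮ w in C(z₀, R / 2), (w - z₀) ^ n * f w) = ∮ w in C(z₀, s), (w - z₀) ^ n * f w := by
    intro n s hs hsR
    have hg : DifferentiableOn ℂ (fun w => (w - z₀) ^ n * f w) (Metric.ball z₀ R \ {z₀}) :=
      DifferentiableOn.mul (fun w hw => ((differentiableAt_id.sub_const z₀).zpow
        (Or.inl (sub_ne_zero.2 hw.2))).differentiableWithinAt) hf
    have hann : Metric.closedBall z₀ (R / 2) \ Metric.ball z₀ s ⊆ Metric.ball z₀ R \ {z₀} := by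
      rintro w ⟨h1, h2⟩
      rw [Metric.mem_closedBall] at h1
      refine ⟨Metric.mem_ball.2 (by linarith), ?_⟩
      rintro rfl
      exact h2 (Metric.mem_ball_self hs)
    refine circleIntegral_eq_of_differentiable_on_annulus_off_countable hs (by linarith)
      countable_empty (hg.continuousOn.mono hann) fun w hw => ?_
    refine hg.differentiableAt (hopen.mem_nhds (hann ⟨Metric.ball_subset_closedBall hw.1.1,
      fun h => hw.1.2 (Metric.ball_subset_closedBall h)⟩))
  refine ⟨a (-1), a, R / 2, by positivity, rfl, fun z hz hzR => ?_⟩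
  have hz' : 0 < ‖z - z₀‖ := norm_pos_iff.2 (sub_ne_zero.2 hz)
  obtain ⟨ρ, hρ, hρz⟩ := exists_between hz'
  have key := circleIntegral_sub_circleIntegral_eq hρ hρz hzR (by linarith : R / 2 < R) hf
  have hI : (2 * Real.pi * I : ℂ) ≠ 0 := by simp [Real.pi_ne_zero]
  have e1 : HasSum (fun n : ℕ => a n * (z - z₀) ^ (n : ℤ))
      ((2 * Real.pi * I)⁻¹ * ∮ w in C(z₀, R / 2), (w - z)⁻¹ * f w) := by
    have hci : CircleIntegrable f z₀ (R / 2) :=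
      (hf.continuousOn.mono (hsph _ (by positivity) (by linarith))).circleIntegrable (by positivity)
    have h := (hasSum_two_pi_I_cauchyPowerSeries_integral hci (w := z - z₀) hzR).mul_left
      ((2 * Real.pi * I)⁻¹)
    refine h.congr_both (fun n => ?_) ?_
    · simp only [ha]
      rw [mul_assoc, ← circleIntegral_mul_const]
      congr 1
      refine circleIntegral.integral_congr (by positivity) fun w hw => ?_
      have hw0 : w - z₀ ≠ 0 := sub_ne_zero.2 (hsph _ (by positivity) (by linarith) hw).2
      simp only [smul_eq_mul, zpow_natCast]
      rw [show (-(n : ℤ) - 1) = -((n + 1 : ℕ) : ℤ) by push_cast; ring, zpow_neg, zpow_natCast,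
        div_pow, pow_succ]
      field_simp
    · simp
  have e2 : HasSum (fun n : ℕ => a (-(n + 1)) * (z - z₀) ^ (-(n + 1 : ℤ)))
      ((2 * Real.pi * I)⁻¹ * (-∮ w in C(z₀, ρ), (w - z)⁻¹ * f w)) := by
    have h := (hasSum_circleIntegral_of_lt hρ hρz
      (hf.continuousOn.mono (hsph ρ hρ (by linarith)))).mul_left ((2 * Real.pi * I)⁻¹)
    refine h.congr_both (fun n => ?_) rfl
    simp only [ha]
    rw [hindep _ ρ hρ (by linarith), mul_assoc, ← circleIntegral_mul_const]
    congr 2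
    ext w
    rw [show (-(-((n : ℤ) + 1)) - 1) = (n : ℤ) by ring, zpow_natCast,
      show (-((n : ℤ) + 1)) = -((n + 1 : ℕ) : ℤ) by push_cast; ring, zpow_neg, zpow_natCast]
  have := HasSum.of_nat_of_neg_add_one (f := fun n : ℤ => a n * (z - z₀) ^ n) e1 e2
  refine this.congr_both (fun _ => rfl) ?_
  rw [← mul_add, ← sub_eq_add_neg, key]
  field_simp

open Complex in
/-- The residue theorem for small circles. -/
theorem IsResidue.circleIntegral_eq {f : ℂ → ℂ} {z₀ c : ℂ} (h : IsResidue f z₀ c) :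
    ∃ r : ℝ, 0 < r ∧ ∀ ρ, 0 < ρ → ρ < r → (∮ z in C(z₀, ρ), f z) = 2 * Real.pi * I * c := by
  obtain ⟨a, r, hr, rfl, hsum⟩ := h
  refine ⟨r, hr, fun ρ hρ hρr => ?_⟩
  have hcm : ∀ θ, ‖circleMap z₀ ρ θ - z₀‖ = ρ := fun θ => by simp [abs_of_pos hρ]
  have hne : ∀ θ, circleMap z₀ ρ θ ≠ z₀ := fun θ => circleMap_ne_center hρ.ne'
  -- The moduli of the terms are constant on the circle, so convergence at one point of it dominates
  -- the series on the whole circle.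
  have hs : Summable fun n : ℤ => ‖a n‖ * ρ ^ n := by
    have := (hsum _ (hne 0) (by rw [hcm]; exact hρr)).summable.norm
    simpa only [norm_mul, norm_zpow, hcm] using this
  have h1 : HasSum (fun n : ℤ => ∮ z in C(z₀, ρ), a n * (z - z₀) ^ n) (∮ z in C(z₀, ρ), f z) := by
    simp only [circleIntegral]
    refine intervalIntegral.hasSum_integral_of_dominated_convergence
      (fun n _ => ρ * (‖a n‖ * ρ ^ n)) ?_ ?_ ?_ ?_ ?_
    · intro n
      refine Continuous.aestronglyMeasurable ?_
      simp only [deriv_circleMap]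
      refine ((continuous_circleMap 0 ρ).mul continuous_const).smul (continuous_const.mul ?_)
      exact ((continuous_circleMap z₀ ρ).sub continuous_const).zpow₀ n
        fun θ => Or.inl (sub_ne_zero.2 (hne θ))
    · intro n
      filter_upwards with θ _
      rw [norm_smul, norm_mul, norm_zpow, hcm, deriv_circleMap, norm_mul, norm_circleMap_zero,
        abs_of_pos hρ, norm_I, mul_one]
    · filter_upwards with θ _ using hs.mul_left _
    · exact intervalIntegrable_const
    · filter_upwards with θ _
      exact (hsum _ (hne θ) (by rw [hcm]; exact hρr)).const_smul _
  have h2 : HasSum (fun n : ℤ => ∮ z in C(z₀, ρ), a n * (z - z₀) ^ n)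
      (2 * Real.pi * I * a (-1)) := by
    refine (hasSum_single (f := fun n : ℤ => ∮ z in C(z₀, ρ), a n * (z - z₀) ^ n) (-1) ?_).congr_both
      (fun _ => rfl) ?_
    rotate_left
    · rw [circleIntegral.integral_const_mul]
      simp only [zpow_neg_one]
      rw [circleIntegral.integral_sub_center_inv _ hρ.ne']
      ring
    · intro n hn
      rw [circleIntegral.integral_const_mul, circleIntegral.integral_sub_zpow_of_ne hn, mul_zero]
  exact h1.unique h2

end Residues

/-! ### Residues of the form and the flux around a puncture -/

section ResiduesOfForms

variable {R : Type*} [TopologicalSpace R] [ChartedSpace ℂ R] [IsManifold 𝓘(ℂ, ℂ) ω R]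
  {M : Set R} {Φ Ψ : R → ℂ →L[ℂ] (Fin 3 → ℂ)} {X : R → E3} {γ : ℝ → R}

theorem coordCircle_contMDiff {p : R} {r : ℝ} (hr : 0 < r)
    (hball : Metric.closedBall (chartAt ℂ p p) r ⊆ (chartAt ℂ p).target) :
    ContMDiff 𝓘(ℝ, ℝ) 𝓘(ℝ, ℂ) 1 (coordCircle p r) := by
  have : IsManifold 𝓘(ℝ, ℂ) 1 R := isManifold_real 1
  have h1 := contMDiffOn_chart_symm (I := 𝓘(ℝ, ℂ)) (n := 1) (x := p)
  have h2 : ContDiff ℝ 1 fun t : ℝ => circleMap (chartAt ℂ p p) r (2 * Real.pi * t) :=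
    (contDiff_circleMap _ _).comp (contDiff_const.mul contDiff_id)
  exact h1.comp_contMDiff h2.contMDiff fun t => hball (circleMap_mem_closedBall _ hr.le _)

theorem coordCircle_isClosedCurveIn {p : R} {r : ℝ} (hr : 0 < r)
    (hball : Metric.closedBall (chartAt ℂ p p) r ⊆ (chartAt ℂ p).target)
    (hM : ∀ z ∈ Metric.closedBall (chartAt ℂ p p) r, z ≠ chartAt ℂ p p →
      (chartAt ℂ p).symm z ∈ M) : IsClosedCurveIn M (coordCircle p r) := by
  -- The partition has the single piece [0, 1]; `min k 1` prolongs it monotonically.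
  refine ⟨fun t _ => hM _ (circleMap_mem_closedBall _ hr.le _) (circleMap_ne_center hr.ne'), ?_,
    1, fun k => (min k 1 : ℕ), ?_, by simp, by simp, fun i _ =>
      (coordCircle_contMDiff hr hball).contMDiffOn⟩
  · simp [coordCircle, circleMap]
  · intro a b hab
    change ((min a 1 : ℕ) : ℝ) ≤ ((min b 1 : ℕ) : ℝ)
    exact_mod_cast min_le_min_right 1 hab

theorem period_coordCircle {p : R} {r : ℝ}
    (hr : 0 < r) (hball : Metric.closedBall (chartAt ℂ p p) r ⊆ (chartAt ℂ p).target)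
    (j : Fin 3) :
    period Ψ (coordCircle p r) j =
      (∮ z in C(chartAt ℂ p p, r), formCoeff Ψ (chartAt ℂ p) z j).re := by
  change (∫ t in (0 : ℝ)..1, Ψ (coordCircle p r t) (velocity (coordCircle p r) t) j).re = _
  congr 1
  have hd : ∀ t, HasDerivAt (fun t : ℝ => circleMap (chartAt ℂ p p) r (2 * Real.pi * t))
      ((2 * Real.pi : ℝ) • deriv (circleMap (chartAt ℂ p p) r) (2 * Real.pi * t)) t := by
    intro t
    have h1 : HasDerivAt (fun t : ℝ => 2 * Real.pi * t) (2 * Real.pi) t := by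
      simpa using (hasDerivAt_id t).const_mul (2 * Real.pi)
    exact (differentiable_circleMap _ _ _).hasDerivAt.scomp t h1
  have hint : ∀ t : ℝ, Ψ (coordCircle p r t) (velocity (coordCircle p r) t) j =
      (2 * Real.pi : ℝ) • (fun θ => deriv (circleMap (chartAt ℂ p p) r) θ •
        formCoeff Ψ (chartAt ℂ p) (circleMap (chartAt ℂ p p) r θ) j) (2 * Real.pi * t) := by
    intro t
    have hmem : circleMap (chartAt ℂ p p) r (2 * Real.pi * t) ∈ (chartAt ℂ p).target :=
      hball (circleMap_mem_closedBall _ hr.le _)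
    have h2 := (mdifferentiableAt_chart_symm_comp p (hd t).differentiableAt hmem).2
    change Ψ _ (velocity ((chartAt ℂ p).symm ∘
      fun t : ℝ => circleMap (chartAt ℂ p p) r (2 * Real.pi * t)) t) j = _
    rw [h2, (hd t).deriv, mul_comm, ← smul_eq_mul, map_smul]
    simp only [formCoeff, Pi.smul_apply, smul_eq_mul, Complex.real_smul, coordCircle]
    ring
  simp_rw [hint]
  rw [intervalIntegral.integral_smul, intervalIntegral.smul_integral_comp_mul_left (fun θ =>
    deriv (circleMap (chartAt ℂ p p) r) θ • formCoeff Ψ (chartAt ℂ p)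
      (circleMap (chartAt ℂ p p) r θ) j)]
  simp [circleIntegral]

/-- The period of `dX` vanishes. -/
theorem IsRealPartOfIntegralOn.period_eq_zero (hM : IsOpen M) (hΦ : IsRealPartOfIntegralOn X Φ M)
    (hhol : IsHolomorphicFormOn Φ M) (hγ : IsClosedCurveIn M γ) : period Φ γ = 0 := by
  -- X is itself a global branch of Re ∫ Φ.
  have hY : IsContinuationAlong Φ M γ (X ∘ γ) := fun t ht =>
    ⟨M, X, hM, hγ.1 ht, subset_rfl, hΦ, Eventually.of_forall fun _ => rfl⟩
  rw [hY.period_eq hM hhol hγ, Function.comp_apply, Function.comp_apply, hγ.2.1, sub_self]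

omit [IsManifold 𝓘(ℂ, ℂ) ω R] in
theorem IsPuncture.exists_ball {p : R} (hp : IsPuncture M p) : ∃ r > 0,
    Metric.ball (chartAt ℂ p p) r ⊆ (chartAt ℂ p).target ∧
    Metric.ball (chartAt ℂ p p) r \ {chartAt ℂ p p} ⊆ chartDomain M p := by
  set e := chartAt ℂ p with he
  have h1 : e.symm (e p) = p := e.left_inv (mem_chart_source ℂ p)
  obtain ⟨O, hO, hpO, hOM⟩ := mem_nhdsWithin.1 hp.2
  have hopen : IsOpen (e.target ∩ e.symm ⁻¹' O) := e.isOpen_inter_preimage_symm hO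
  obtain ⟨r, hr, hb⟩ := Metric.isOpen_iff.1 hopen (e p) ⟨mem_chart_target ℂ p, by
    change e.symm (e p) ∈ O; rwa [h1]⟩
  refine ⟨r, hr, fun z hz => (hb hz).1, fun z hz => ⟨(hb hz.1).1, hOM ⟨(hb hz.1).2, ?_⟩⟩⟩
  intro hzp
  refine hz.2 ?_
  have : e (e.symm z) = e p := congrArg e hzp
  rw [e.right_inv (hb hz.1).1] at this
  exact this

theorem IsPuncture.exists_isFormResidue {p : R} (hp : IsPuncture M p)
    (hhol : IsHolomorphicFormOn Φ M) : ∃ c, IsFormResidue Φ p c := by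
  obtain ⟨r, hr, -, hb⟩ := hp.exists_ball
  choose c hc using fun j => exists_isResidue hr ((hhol p j).mono hb)
  exact ⟨c, hc⟩

omit [IsManifold 𝓘(ℂ, ℂ) ω R] in
/-- The integral of a form over a coordinate circle is given by the residue. -/
theorem IsFormResidue.circleIntegral_eq {p : R} {c : Fin 3 → ℂ} (hc : IsFormResidue Φ p c)
    (hM : IsOpen M) (hhol : IsHolomorphicFormOn Φ M) {r : ℝ} (hr : 0 < r)
    (hball : Metric.closedBall (chartAt ℂ p p) r ⊆ (chartAt ℂ p).target)
    (hrM : ∀ z ∈ Metric.closedBall (chartAt ℂ p p) r, z ≠ chartAt ℂ p p →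
      (chartAt ℂ p).symm z ∈ M) (j : Fin 3) :
    (∮ z in C(chartAt ℂ p p, r), formCoeff Φ (chartAt ℂ p) z j) =
      2 * Real.pi * Complex.I * c j := by
  obtain ⟨r', hr', h⟩ := IsResidue.circleIntegral_eq (hc j)
  obtain ⟨ρ, hρ, hρr⟩ := exists_between (lt_min hr hr')
  have hann : Metric.closedBall (chartAt ℂ p p) r \ Metric.ball (chartAt ℂ p p) ρ ⊆
      chartDomain M p := by
    rintro w ⟨h1, h2⟩
    refine ⟨hball h1, hrM w h1 ?_⟩
    rintro rfl
    exact h2 (Metric.mem_ball_self hρ)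
  have := h ρ hρ (lt_of_lt_of_le hρr (min_le_right _ _))
  refine Eq.trans ?_ this
  refine Complex.circleIntegral_eq_of_differentiable_on_annulus_off_countable hρ
    (hρr.le.trans (min_le_left _ _)) countable_empty ((hhol p j).continuousOn.mono hann)
    fun w hw => ?_
  exact (hhol p j).differentiableAt ((isOpen_chartDomain hM p).mem_nhds
    (hann ⟨Metric.ball_subset_closedBall hw.1.1,
      fun h => hw.1.2 (Metric.ball_subset_closedBall h)⟩))

/-- The flux around a puncture is given by the residue, which is real. -/
theorem IsConformalImmersionOn.flux_eq_residue (hX : IsConformalImmersionOn X M) (hM : IsOpen M)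
    (hΦ : IsRealPartOfIntegralOn X Φ M) (hhol : IsHolomorphicFormOn Φ M) {p : R}
    {c : Fin 3 → ℂ} (hc : IsFormResidue Φ p c) (hγ : IsClosedCurveIn M γ)
    (hhom : InHomologyClassOfPuncture M p γ) (j : Fin 3) :
    ((flux X γ j : ℝ) : ℂ) = -2 * (Real.pi : ℂ) * c j := by
  obtain ⟨r, hr, hball, hrM, hh⟩ := hhom
  have hcirc := coordCircle_isClosedCurveIn hr hball hrM
  have h1 := hc.circleIntegral_eq hM hhol hr hball hrM j
  have h2 := period_coordCircle (Ψ := Φ) hr hball j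
  -- The vanishing period of dX says that 2πi c has real part zero. Thus the residue is real, which
  -- gives the equation of complex numbers and not only of real parts.
  rw [hΦ.period_eq_zero hM hhol hcirc, h1] at h2
  have h3 := period_coordCircle (Ψ := conjugateForm Φ) hr hball j
  simp only [formCoeff_conjugateForm] at h3
  rw [circleIntegral.integral_const_mul, h1] at h3
  rw [hX.flux_eq hM hΦ hhol hγ, hh.period_eq hhol.conjugateForm hM hγ hcirc, PiLp.neg_apply, h3]
  apply Complex.ext
  · simp
  · simp [Real.pi_ne_zero] at h2 ⊢
    exact h2

end ResiduesOfForms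

/-! ### Lifting segments through a holomorphic local homeomorphism -/

section CompleteEnds

/-- The metric `|f| |dz|` on the punctured disc of radius `r` is complete at the puncture. -/
structure IsCompleteEnd (f : ℂ → ℂ) (r : ℝ) : Prop where
  pos : 0 < r
  diff : DifferentiableOn ℂ f (Metric.ball 0 r \ {0})
  ne_zero : ∀ z ∈ Metric.ball (0 : ℂ) r \ {0}, f z ≠ 0
  complete : ∀ (δ δ' : ℝ → ℂ) (B : ℝ), (∀ t ∈ Ico (0 : ℝ) 1, HasDerivWithinAt δ (δ' t) (Ico 0 1) t) →
    ContinuousOn δ' (Ico 0 1) → MapsTo δ (Ico 0 1) (Metric.ball 0 r \ {0}) →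
    (∀ t ∈ Ico (0 : ℝ) 1, ‖f (δ t) * δ' t‖ ≤ B) → ¬ Tendsto δ (𝓝[<] 1) (𝓝 0)

theorem isOpen_puncturedBall (r : ℝ) : IsOpen (Metric.ball (0 : ℂ) r \ {0}) :=
  Metric.isOpen_ball.sdiff isClosed_singleton

theorem exp_mem_puncturedBall {r : ℝ} (hr : 0 < r) {s : ℂ} (hs : s.re < Real.log r) :
    Complex.exp s ∈ Metric.ball (0 : ℂ) r \ {0} := by
  refine ⟨?_, Complex.exp_ne_zero s⟩
  rw [mem_ball_zero_iff, Complex.norm_exp]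
  exact (Real.lt_log_iff_exp_lt hr).1 hs

/-- A holomorphic function on a half plane has a primitive. -/
theorem exists_primitive_halfPlane {g : ℂ → ℂ} {c : ℝ} (hg : DifferentiableOn ℂ g {s | s.re < c}) :
    ∃ F : ℂ → ℂ, ∀ s : ℂ, s.re < c → HasDerivAt F (g s) s := by
  -- A Möbius map of the unit disc onto the half plane, with inverse s ↦ (c − s − 1) / (c − s + 1).
  -- The primitive is found on the disc for the pulled back form g(m) dm.
  set m : ℂ → ℂ := fun u => c - (1 + u) / (1 - u) with hm
  have hne : ∀ u ∈ Metric.ball (0 : ℂ) 1, 1 - u ≠ 0 := by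
    intro u hu h
    rw [mem_ball_zero_iff, ← sub_eq_zero.1 h] at hu
    simp at hu
  have hmd : ∀ u ∈ Metric.ball (0 : ℂ) 1, HasDerivAt m (-(2 / (1 - u) ^ 2)) u := by
    intro u hu
    have h1 : HasDerivAt (fun u : ℂ => 1 + u) 1 u := (hasDerivAt_id u).const_add 1
    have h2 : HasDerivAt (fun u : ℂ => 1 - u) (-1) u := (hasDerivAt_id u).const_sub 1
    have h3 := (h1.div h2 (hne u hu)).const_sub (c : ℂ)
    refine h3.congr_deriv ?_
    have := hne u hu
    field_simp
    ring
  have hmaps : ∀ u ∈ Metric.ball (0 : ℂ) 1, (m u).re < c := by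
    intro u hu
    have h0 := hne u hu
    have h1 : 0 < Complex.normSq (1 - u) := Complex.normSq_pos.2 h0
    have h2 : u.re * u.re + u.im * u.im < 1 := by
      rw [mem_ball_zero_iff] at hu
      rw [← Complex.normSq_apply, Complex.normSq_eq_norm_sq]
      nlinarith [norm_nonneg u]
    have : 0 < ((1 + u) / (1 - u)).re := by
      rw [Complex.div_re, ← add_div]
      refine div_pos ?_ h1
      simp
      nlinarith
    simp only [hm, Complex.sub_re, Complex.ofReal_re]
    linarith
  have hgd : DifferentiableOn ℂ (fun u => g (m u) * -(2 / (1 - u) ^ 2)) (Metric.ball 0 1) := by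
    refine DifferentiableOn.mul (hg.comp (fun u hu => (hmd u hu).differentiableAt.differentiableWithinAt)
      hmaps) ?_
    refine DifferentiableOn.neg (DifferentiableOn.div (differentiableOn_const _) (by fun_prop) ?_)
    exact fun u hu => pow_ne_zero 2 (hne u hu)
  obtain ⟨G, hG⟩ := hgd.isExactOn_ball
  refine ⟨fun s => G ((c - s - 1) / (c - s + 1)), fun s hs => ?_⟩
  have hw : 0 < (c - s : ℂ).re := by simpa using hs
  have hne1 : (c - s + 1 : ℂ) ≠ 0 := by
    intro h
    have := congrArg Complex.re h
    simp only [Complex.add_re, Complex.one_re, Complex.zero_re] at this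
    linarith
  have hu : (c - s - 1) / (c - s + 1) ∈ Metric.ball (0 : ℂ) 1 := by
    rw [mem_ball_zero_iff, norm_div, div_lt_one (norm_pos_iff.2 hne1)]
    refine lt_of_pow_lt_pow_left₀ 2 (norm_nonneg _) ?_
    rw [← Complex.normSq_eq_norm_sq, ← Complex.normSq_eq_norm_sq, Complex.normSq_apply,
      Complex.normSq_apply]
    simp only [Complex.sub_re, Complex.ofReal_re, Complex.add_re, Complex.one_re, Complex.sub_im,
      Complex.ofReal_im, Complex.add_im, Complex.one_im] at hw ⊢
    nlinarith
  have h1 : HasDerivAt (fun s : ℂ => c - s - 1) (-1) s := ((hasDerivAt_id s).const_sub _).sub_const 1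
  have h2 : HasDerivAt (fun s : ℂ => c - s + 1) (-1) s := ((hasDerivAt_id s).const_sub _).add_const 1
  have h3 := (hG _ hu).comp s (h1.div h2 hne1)
  have hms : m ((c - s - 1) / (c - s + 1)) = s := by
    have h4 : (1 : ℂ) - (c - s - 1) / (c - s + 1) = 2 / (c - s + 1) := by field_simp; ring
    have h5 : (1 : ℂ) + (c - s - 1) / (c - s + 1) = 2 * (c - s) / (c - s + 1) := by field_simp; ring
    simp only [hm]
    rw [h4, h5]
    field_simp
    ring
  refine h3.congr_deriv ?_
  simp only
  rw [hms]
  have h4 : (1 : ℂ) - (c - s - 1) / (c - s + 1) = 2 / (c - s + 1) := by field_simp; ring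
  rw [h4]
  field_simp
  ring

/-- `σ` lifts the segment from `F s₀` to `F s₀ + T a` to the half plane. -/
structure IsSegmentLift (F : ℂ → ℂ) (c : ℝ) (s₀ a : ℂ) (T : ℝ) (σ : ℝ → ℂ) : Prop where
  cont : ContinuousOn σ (Icc 0 T)
  start : σ 0 = s₀
  mem : ∀ t ∈ Icc 0 T, (σ t).re < c
  lift : ∀ t ∈ Icc 0 T, F (σ t) = F s₀ + t * a

variable {F F' : ℂ → ℂ} {c : ℝ} {s₀ a : ℂ} {T : ℝ} {σ τ : ℝ → ℂ}

theorem IsSegmentLift.mono (h : IsSegmentLift F c s₀ a T σ) {T' : ℝ} (hT : T' ≤ T) :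
    IsSegmentLift F c s₀ a T' σ :=
  ⟨h.cont.mono (Icc_subset_Icc_right hT), h.start, fun t ht => h.mem t ⟨ht.1, ht.2.trans hT⟩,
    fun t ht => h.lift t ⟨ht.1, ht.2.trans hT⟩⟩

/-- The local inverse of a holomorphic function with nonvanishing derivative. -/
theorem exists_localInverse (hF : ∀ s : ℂ, s.re < c → HasDerivAt F (F' s) s)
    (hF' : ∀ s : ℂ, s.re < c → F' s ≠ 0) {s : ℂ} (hs : s.re < c) :
    ∃ g : ℂ → ℂ, HasDerivAt g (F' s)⁻¹ (F s) ∧ g (F s) = s ∧ (∀ᶠ w in 𝓝 s, g (F w) = w) ∧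
      ∀ᶠ y in 𝓝 (F s), F (g y) = y ∧ ContinuousAt g y := by
  have hopen : IsOpen {s : ℂ | s.re < c} := isOpen_lt Complex.continuous_re continuous_const
  have hdiff : DifferentiableOn ℂ F {s : ℂ | s.re < c} := fun s hs =>
    (hF s hs).differentiableAt.differentiableWithinAt
  have hstrict : HasStrictDerivAt F (F' s) s := by
    have h := ((hdiff.analyticAt (hopen.mem_nhds hs)).contDiffAt (n := 1)).hasStrictDerivAt
      (by norm_num)
    rwa [(hF s hs).deriv] at h
  refine ⟨hstrict.localInverse F (F' s) s (hF' s hs), (hstrict.to_localInverse (hF' s hs)).hasDerivAt, ?_,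
    ?_, ?_⟩
  · exact HasStrictFDerivAt.localInverse_apply_image _
  · exact HasStrictFDerivAt.eventually_left_inverse _
  · refine (HasStrictFDerivAt.eventually_right_inverse _).and ?_
    set e := (hstrict.hasStrictFDerivAt_equiv (hF' s hs)).toOpenPartialHomeomorph F
    filter_upwards [e.open_target.mem_nhds (hstrict.hasStrictFDerivAt_equiv
      (hF' s hs)).image_mem_toOpenPartialHomeomorph_target] with y hy
    exact e.continuousAt_symm hy

/-- Local injectivity of F makes the set of agreement of two lifts open, continuity makes it closed,
and it contains the starting point. -/
theorem IsSegmentLift.eqOn (hF : ∀ s : ℂ, s.re < c → HasDerivAt F (F' s) s)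
    (hF' : ∀ s : ℂ, s.re < c → F' s ≠ 0) (h : IsSegmentLift F c s₀ a T σ)
    (h' : IsSegmentLift F c s₀ a T τ) : EqOn σ τ (Icc 0 T) := by
  intro t ht
  have h0 : (0 : ℝ) ∈ Icc 0 T := ⟨le_rfl, ht.1.trans ht.2⟩
  have key := eq_of_locally_eq_of_isPreconnected (g := fun t => (σ t = τ t)) isPreconnected_Icc ?_ h0 ht
  · simp only [h.start, h'.start, eq_iff_iff, true_iff] at key
    exact key
  · intro x hx
    by_cases hxe : σ x = τ x
    · obtain ⟨g, -, -, hg, -⟩ := exists_localInverse hF hF' (h.mem x hx)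
      filter_upwards [(h.cont x hx).eventually hg, (h'.cont x hx).eventually (hxe ▸ hg),
        self_mem_nhdsWithin] with y hy1 hy2 hy
      simp only [hxe, eq_iff_iff, iff_true]
      rw [← hy1, ← hy2, h.lift y hy, h'.lift y hy]
    · filter_upwards [((h.cont x hx).sub (h'.cont x hx)).eventually
        (isOpen_ne.mem_nhds (sub_ne_zero.2 hxe))] with y hy
      simp only [hxe, eq_iff_iff, iff_false]
      exact sub_ne_zero.1 hy

theorem IsSegmentLift.hasDerivWithinAt (hF : ∀ s : ℂ, s.re < c → HasDerivAt F (F' s) s)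
    (hF' : ∀ s : ℂ, s.re < c → F' s ≠ 0) (h : IsSegmentLift F c s₀ a T σ) {t : ℝ}
    (ht : t ∈ Icc 0 T) : HasDerivWithinAt σ (a / F' (σ t)) (Icc 0 T) t := by
  obtain ⟨g, hg, hg0, hgl, -⟩ := exists_localInverse hF hF' (h.mem t ht)
  have h1 : HasDerivAt (fun t : ℝ => F s₀ + t * a) a t := by
    simpa using ((hasDerivAt_id t).ofReal_comp.mul_const a).const_add (F s₀)
  rw [h.lift t ht] at hg
  have h2 := (HasDerivAt.scomp t hg h1).hasDerivWithinAt (s := Icc 0 T)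
  have heq : σ =ᶠ[𝓝[Icc 0 T] t] g ∘ fun t : ℝ => F s₀ + t * a := by
    filter_upwards [(h.cont t ht).eventually hgl, self_mem_nhdsWithin] with y hy hyT
    rw [Function.comp_apply, ← h.lift y hyT, hy]
  have h3 := h2.congr_of_eventuallyEq heq (heq.self_of_nhdsWithin ht)
  rwa [smul_eq_mul, ← div_eq_mul_inv] at h3

/-- Segments can be lifted a little further. -/
theorem IsSegmentLift.extend (hF : ∀ s : ℂ, s.re < c → HasDerivAt F (F' s) s)
    (hF' : ∀ s : ℂ, s.re < c → F' s ≠ 0) (h : IsSegmentLift F c s₀ a T σ) (hT : 0 ≤ T) :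
    ∃ T' > T, ∃ σ', IsSegmentLift F c s₀ a T' σ' := by
  have hTm : T ∈ Icc 0 T := right_mem_Icc.2 hT
  obtain ⟨g, hg, hg0, -, hgr⟩ := exists_localInverse hF hF' (h.mem T hTm)
  set ℓ : ℝ → ℂ := fun t : ℝ => F s₀ + t * a with hℓ
  have hℓc : Continuous ℓ := by fun_prop
  rw [h.lift T hTm] at hg hg0 hgr
  change HasDerivAt g _ (ℓ T) at hg
  change g (ℓ T) = _ at hg0
  have e1 : ∀ᶠ t in 𝓝 T, F (g (ℓ t)) = ℓ t ∧ ContinuousAt g (ℓ t) :=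
    hℓc.continuousAt.eventually hgr
  have e2 : ∀ᶠ t in 𝓝 T, (g (ℓ t)).re < c := by
    have : ContinuousAt (fun t => (g (ℓ t)).re) T :=
      Complex.continuous_re.continuousAt.comp (hg.continuousAt.comp hℓc.continuousAt)
    exact this.eventually (gt_mem_nhds (by simpa only [hg0] using h.mem T hTm))
  obtain ⟨ε, hε, hball⟩ := Metric.eventually_nhds_iff.1 (e1.and e2)
  have hgood : ∀ t ∈ Icc T (T + ε / 2), (F (g (ℓ t)) = ℓ t ∧ ContinuousAt g (ℓ t)) ∧
      (g (ℓ t)).re < c := by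
    intro t ht
    refine hball ?_
    rw [Real.dist_eq, abs_of_nonneg (by linarith [ht.1])]
    linarith [ht.2]
  -- Beyond T the lift is continued by the local inverse of F at its end point.
  refine ⟨T + ε / 2, by linarith, fun t => if t ≤ T then σ t else g (ℓ t), ?_, ?_, ?_, ?_⟩
  · rw [← Icc_union_Icc_eq_Icc hT (by linarith : T ≤ T + ε / 2)]
    refine ContinuousOn.union_of_isClosed ?_ ?_ isClosed_Icc isClosed_Icc
    · exact h.cont.congr fun t ht => if_pos ht.2
    · have : ContinuousOn (fun t => g (ℓ t)) (Icc T (T + ε / 2)) := fun t ht =>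
        ((hgood t ht).1.2.comp hℓc.continuousAt).continuousWithinAt
      refine this.congr fun t ht => ?_
      rcases ht.1.eq_or_lt with rfl | hlt
      · simp [hg0]
      · simp [hlt]
  · simp [hT, h.start]
  · intro t ht
    by_cases htT : t ≤ T
    · simpa [htT] using h.mem t ⟨ht.1, htT⟩
    · simpa [htT] using (hgood t ⟨(not_le.1 htT).le, ht.2⟩).2
  · intro t ht
    by_cases htT : t ≤ T
    · simpa [htT] using h.lift t ⟨ht.1, htT⟩
    · simpa [htT] using (hgood t ⟨(not_le.1 htT).le, ht.2⟩).1.1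

theorem IsSegmentLift.congr (h : IsSegmentLift F c s₀ a T σ) (hT : 0 ≤ T)
    (heq : EqOn σ τ (Icc 0 T)) : IsSegmentLift F c s₀ a T τ :=
  ⟨h.cont.congr heq.symm, by rw [← heq ⟨le_rfl, hT⟩, h.start],
    fun t ht => by rw [← heq ht]; exact h.mem t ht, fun t ht => by rw [← heq ht]; exact h.lift t ht⟩

/-- If half-open lifts converge, then all segments lift. -/
theorem exists_isSegmentLift_one (hF : ∀ s : ℂ, s.re < c → HasDerivAt F (F' s) s)
    (hF' : ∀ s : ℂ, s.re < c → F' s ≠ 0) (hs₀ : s₀.re < c)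
    (hlim : ∀ (T : ℝ) (σ : ℝ → ℂ), 0 < T → T ≤ 1 → (∀ T' < T, 0 ≤ T' → IsSegmentLift F c s₀ a T' σ) →
      ∃ s : ℂ, s.re < c ∧ Tendsto σ (𝓝[<] T) (𝓝 s)) :
    ∃ σ, IsSegmentLift F c s₀ a 1 σ := by
  classical
  -- Continuity method: the times up to which a lift exists form an interval from 0, whose supremum
  -- is attained by `hlim` and cannot be less than 1 by `extend`.
  set S : Set ℝ := {T | T ∈ Icc 0 1 ∧ ∃ σ, IsSegmentLift F c s₀ a T σ} with hS
  have h0 : (0 : ℝ) ∈ S := ⟨⟨le_rfl, zero_le_one⟩, fun _ => s₀, by simp, rfl, fun _ _ => hs₀, by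
    intro t ht
    have : t = 0 := le_antisymm ht.2 ht.1
    simp [this]⟩
  have hdown : ∀ T ∈ S, ∀ T', 0 ≤ T' → T' ≤ T → T' ∈ S := fun T hT T' h1 h2 =>
    ⟨⟨h1, h2.trans hT.1.2⟩, hT.2.imp fun σ hσ => hσ.mono h2⟩
  -- The value at t is taken from some lift over [0, t]; by uniqueness these values form a single
  -- lift.
  set G : ℝ → ℂ := fun t => if h : t ∈ S then h.2.choose t else 0 with hG
  have hGS : ∀ T ∈ S, IsSegmentLift F c s₀ a T G := by
    intro T hT
    obtain ⟨σ, hσ⟩ := hT.2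
    refine hσ.congr hT.1.1 fun t ht => ?_
    have htS := hdown T hT t ht.1 ht.2
    simp only [hG, dif_pos htS]
    exact (hσ.mono ht.2).eqOn hF hF' htS.2.choose_spec ⟨ht.1, le_rfl⟩
  have hbdd : BddAbove S := ⟨1, fun t ht => ht.1.2⟩
  set T₀ := sSup S with hT₀
  have hT₀0 : 0 ≤ T₀ := le_csSup hbdd h0
  have hT₀1 : T₀ ≤ 1 := csSup_le ⟨0, h0⟩ fun t ht => ht.1.2
  have hlt : ∀ t, 0 ≤ t → t < T₀ → t ∈ S := fun t h1 h2 => by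
    obtain ⟨u, hu, htu⟩ := exists_lt_of_lt_csSup ⟨0, h0⟩ h2
    exact hdown u hu t h1 htu.le
  have hT₀S : T₀ ∈ S := by
    rcases hT₀0.eq_or_lt with he | hpos
    · rwa [← he]
    obtain ⟨s, hs, hts⟩ := hlim T₀ G hpos hT₀1 fun T' h1 h2 => hGS T' (hlt T' h2 h1)
    refine ⟨⟨hT₀0, hT₀1⟩, Function.update G T₀ s, ?_, ?_, ?_, ?_⟩
    · intro t ht
      rcases ht.2.eq_or_lt with rfl | htlt
      · rw [continuousWithinAt_update_same]
        refine hts.mono_left (nhdsWithin_mono _ ?_)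
        rintro u ⟨hu1, hu2⟩
        exact lt_of_le_of_ne hu1.2 hu2
      · rw [continuousWithinAt_update_of_ne htlt.ne]
        obtain ⟨u, hu1, hu2⟩ := exists_between htlt
        have := (hGS u (hlt u (ht.1.trans hu1.le) hu2)).cont t ⟨ht.1, hu1.le⟩
        refine this.mono_of_mem_nhdsWithin ?_
        filter_upwards [self_mem_nhdsWithin, mem_nhdsWithin_of_mem_nhds (Iio_mem_nhds hu1)]
          with v hv1 hv2 using ⟨hv1.1, le_of_lt hv2⟩
    · rw [Function.update_of_ne hpos.ne, (hGS 0 h0).start]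
    · intro t ht
      rcases ht.2.eq_or_lt with rfl | htlt
      · simpa using hs
      · rw [Function.update_of_ne htlt.ne]
        exact (hGS t (hlt t ht.1 htlt)).mem t ⟨ht.1, le_rfl⟩
    · intro t ht
      rcases ht.2.eq_or_lt with rfl | htlt
      · rw [Function.update_self]
        have h1 : Tendsto (fun t => F (G t)) (𝓝[<] T₀) (𝓝 (F s)) :=
          (hF s hs).continuousAt.tendsto.comp hts
        have h2 : Tendsto (fun t : ℝ => F s₀ + t * a) (𝓝[<] T₀) (𝓝 (F s₀ + T₀ * a)) := by
          have : Continuous fun t : ℝ => F s₀ + t * a := by fun_prop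
          exact this.continuousAt.tendsto.mono_left nhdsWithin_le_nhds
        refine tendsto_nhds_unique_of_eventuallyEq h1 h2 ?_
        filter_upwards [Ioo_mem_nhdsLT hpos] with t ht'
        exact (hGS t (hlt t ht'.1.le ht'.2)).lift t ⟨ht'.1.le, le_rfl⟩
      · rw [Function.update_of_ne htlt.ne]
        exact (hGS t (hlt t ht.1 htlt)).lift t ⟨ht.1, le_rfl⟩
  rcases hT₀1.eq_or_lt with h1 | h1
  · exact h1 ▸ hT₀S.2
  · exfalso
    obtain ⟨σ, hσ⟩ := hT₀S.2
    obtain ⟨T', hT', σ', hσ'⟩ := hσ.extend hF hF' hT₀0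
    have : min T' 1 ∈ S := ⟨⟨le_min (hT₀0.trans hT'.le) zero_le_one, min_le_right _ _⟩, σ',
      hσ'.mono (min_le_left _ _)⟩
    exact absurd (le_csSup hbdd this) (not_le.2 (lt_min hT' h1))

end CompleteEnds

/-! ### A complete metric |f| |dz| on a punctured disc forces a pole or a nonzero limit of f -/

section CompleteEndPole

variable {f F : ℂ → ℂ} {r m : ℝ} {s₀ a : ℂ} {T : ℝ} {σ : ℝ → ℂ}

theorem norm_exp_lt_of_re_lt (hr : 0 < r) {s : ℂ} : s.re < Real.log r ↔ ‖Complex.exp s‖ < r := by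
  rw [Complex.norm_exp, Real.lt_log_iff_exp_lt hr]

theorem IsCompleteEnd.deriv_ne_zero (hf : IsCompleteEnd f r) (s : ℂ) (hs : s.re < Real.log r) :
    f (Complex.exp s) * Complex.exp s ≠ 0 :=
  mul_ne_zero (hf.ne_zero _ (exp_mem_puncturedBall hf.pos hs)) (Complex.exp_ne_zero s)

/-- In the disc the lift has velocity a / f(z), hence constant speed |a| in the metric |f| |dz|. -/
theorem IsSegmentLift.hasDerivWithinAt_exp (hf : IsCompleteEnd f r)
    (hF : ∀ s : ℂ, s.re < Real.log r → HasDerivAt F (f (Complex.exp s) * Complex.exp s) s)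
    (h : IsSegmentLift F (Real.log r) s₀ a T σ) {t : ℝ} (ht : t ∈ Icc 0 T) :
    HasDerivWithinAt (fun t => Complex.exp (σ t)) (a / f (Complex.exp (σ t))) (Icc 0 T) t := by
  refine (h.hasDerivWithinAt hF hf.deriv_ne_zero ht).cexp.congr_deriv ?_
  have h1 := hf.deriv_ne_zero _ (h.mem t ht)
  have h2 := left_ne_zero_of_mul h1
  have h3 := right_ne_zero_of_mul h1
  field_simp

theorem HasDerivWithinAt.Ici_of_Icc {g : ℝ → ℂ} {g' : ℂ} {u v t : ℝ}
    (h : HasDerivWithinAt g g' (Icc u v) t) (ht : t ∈ Ico u v) : HasDerivWithinAt g g' (Ici t) t := by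
  refine h.mono_of_mem_nhdsWithin ?_
  filter_upwards [self_mem_nhdsWithin, mem_nhdsWithin_of_mem_nhds (Iio_mem_nhds ht.2)] with x h1 h2
  exact ⟨ht.1.trans h1, le_of_lt h2⟩

/-- Lifts of short segments that start close to the puncture stay in the disc. -/
theorem IsSegmentLift.norm_exp_le (hf : IsCompleteEnd f r)
    (hF : ∀ s : ℂ, s.re < Real.log r → HasDerivAt F (f (Complex.exp s) * Complex.exp s) s)
    (hm : 0 < m) (hfm : ∀ z : ℂ, r / 2 ≤ ‖z‖ → ‖z‖ ≤ 3 * r / 4 → m ≤ ‖f z‖)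
    (hs₀ : ‖Complex.exp s₀‖ ≤ r / 2) (ha : ‖a‖ < m * (r / 4))
    (h : IsSegmentLift F (Real.log r) s₀ a T σ) (hT : T ≤ 1) {t : ℝ} (ht : t ∈ Icc 0 T) :
    ‖Complex.exp (σ t)‖ ≤ 3 * r / 4 := by
  have hr := hf.pos
  -- A fence argument with the barrier r / 2 + t r / 4: a lift that touches it is in the annulus
  -- where |f| ≥ m, so it moves with speed at most |a| / m < r / 4 and cannot cross.
  have key := image_norm_le_of_norm_deriv_right_lt_deriv_boundary'
    (f := fun t => Complex.exp (σ t)) (f' := fun t => a / f (Complex.exp (σ t)))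
    (B := fun t => r / 2 + t * (r / 4)) (B' := fun _ => r / 4) (a := 0) (b := T)
    h.cont.cexp (fun t ht => (h.hasDerivWithinAt_exp hf hF ⟨ht.1, ht.2.le⟩).Ici_of_Icc ht)
    (by simpa [h.start] using hs₀) (by fun_prop)
    (fun t _ => by
      simpa using (((hasDerivAt_id t).mul_const (r / 4)).const_add (r / 2)).hasDerivWithinAt) ?_ ht
  · refine key.trans ?_
    have : t ≤ 1 := ht.2.trans hT
    nlinarith
  · intro x hx hxe
    have hx1 : x ≤ 1 := hx.2.le.trans hT
    have h1 := hfm (Complex.exp (σ x)) (by rw [hxe]; nlinarith [hx.1]) (by rw [hxe]; nlinarith)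
    rw [norm_div, div_lt_iff₀ (hm.trans_le h1)]
    nlinarith

/-- Half-open lifts that do not approach the puncture converge. -/
theorem tendsto_of_not_tendsto_exp (hf : IsCompleteEnd f r)
    (hF : ∀ s : ℂ, s.re < Real.log r → HasDerivAt F (f (Complex.exp s) * Complex.exp s) s)
    (hT : 0 < T) (h : ∀ T' < T, 0 ≤ T' → IsSegmentLift F (Real.log r) s₀ a T' σ)
    (hle : ∀ t ∈ Ico 0 T, ‖Complex.exp (σ t)‖ ≤ 3 * r / 4)
    (hn : ¬ Tendsto (fun t => Complex.exp (σ t)) (𝓝[<] T) (𝓝 0)) :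
    ∃ s : ℂ, Tendsto σ (𝓝[<] T) (𝓝 s) := by
  have hr := hf.pos
  obtain ⟨ε, hε, hfreq⟩ : ∃ ε > 0, ∃ᶠ t in 𝓝[<] T, ε ≤ ‖Complex.exp (σ t)‖ := by
    rw [Metric.tendsto_nhds] at hn
    push Not at hn
    obtain ⟨ε, hε, h⟩ := hn
    exact ⟨ε, hε, by simpa using h⟩
  obtain ⟨m, hm, hfm⟩ : ∃ m > 0, ∀ z : ℂ, ε / 2 ≤ ‖z‖ → ‖z‖ ≤ 3 * r / 4 → m ≤ ‖f z‖ := by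
    set K : Set ℂ := Metric.closedBall 0 (3 * r / 4) \ Metric.ball 0 (ε / 2) with hK
    have hKc : IsCompact K := (isCompact_closedBall _ _).diff Metric.isOpen_ball
    have hKs : K ⊆ Metric.ball 0 r \ {0} := by
      rintro z ⟨h1, h2⟩
      rw [mem_closedBall_zero_iff] at h1
      rw [mem_ball_zero_iff] at h2
      refine ⟨by rw [mem_ball_zero_iff]; linarith, ?_⟩
      rintro rfl
      simp at h2
      linarith
    rcases K.eq_empty_or_nonempty with he | hne
    · refine ⟨1, one_pos, fun z h1 h2 => ?_⟩
      have : z ∈ K := ⟨by simpa using h2, by simpa using h1⟩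
      simp [he] at this
    · obtain ⟨w, hw, hmin⟩ := hKc.exists_isMinOn hne (hf.diff.continuousOn.mono hKs).norm
      exact ⟨‖f w‖, norm_pos_iff.2 (hf.ne_zero w (hKs hw)), fun z h1 h2 =>
        hmin (show z ∈ K from ⟨by simpa using h2, by simpa using h1⟩)⟩
  -- As long as ε / 2 ≤ |z| ≤ 3r / 4, the derivative −z' / z² of 1 / z has modulus at most L − 1;
  -- the summand 1 makes the inequality strict.
  set L : ℝ := ‖a‖ / m * (4 / ε ^ 2) + 1 with hL
  have hLpos : 0 < L := by positivity
  obtain ⟨t₀, ht₀ε, ht₀T, ht₀L, ht₀0⟩ : ∃ t₀, ε ≤ ‖Complex.exp (σ t₀)‖ ∧ t₀ < T ∧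
      T - t₀ < 1 / (ε * L) ∧ 0 < t₀ := by
    have : ∀ᶠ t in 𝓝[<] T, t < T ∧ T - t < 1 / (ε * L) ∧ 0 < t := by
      have h1 : 0 < 1 / (ε * L) := by positivity
      filter_upwards [self_mem_nhdsWithin, mem_nhdsWithin_of_mem_nhds (Ioi_mem_nhds hT),
        mem_nhdsWithin_of_mem_nhds (Ioi_mem_nhds (sub_lt_self T h1))] with t h2 h3 h4
      exact ⟨h2, by simp only [mem_Ioi] at h4; linarith, h3⟩
    exact (hfreq.and_eventually this).exists
  -- A second fence argument, for 1 / z. At t₀ one has |z| ≥ ε, and the remaining time is less than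
  -- 1 / (ε L), so |1 / z| grows from at most 1 / ε to at most 2 / ε.
  have hlow : ∀ t ∈ Ico t₀ T, ε / 2 ≤ ‖Complex.exp (σ t)‖ := by
    intro t₁ ht₁
    have hlift := h t₁ ht₁.2 (ht₀0.le.trans ht₁.1)
    have hsub : Icc t₀ t₁ ⊆ Icc 0 t₁ := Icc_subset_Icc_left ht₀0.le
    have hB : ∀ x ∈ Icc t₀ t₁, 1 / ε + (x - t₀) * L ≤ 2 / ε := by
      intro x hx
      have h1 : (x - t₀) * L ≤ 1 / (ε * L) * L :=
        mul_le_mul_of_nonneg_right (by linarith [hx.2, ht₁.2]) hLpos.le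
      have h2 : 1 / (ε * L) * L = 1 / ε := by field_simp
      have h3 : 2 / ε = 1 / ε + 1 / ε := by ring
      linarith
    have key := image_norm_le_of_norm_deriv_right_lt_deriv_boundary'
      (f := fun t => (Complex.exp (σ t))⁻¹)
      (f' := fun t => -(a / f (Complex.exp (σ t))) / Complex.exp (σ t) ^ 2)
      (B := fun t => 1 / ε + (t - t₀) * L) (B' := fun _ => L) (a := t₀) (b := t₁)
      ((hlift.cont.mono hsub).cexp.inv₀ fun _ _ => Complex.exp_ne_zero _)
      (fun t ht => ((hlift.hasDerivWithinAt_exp hf hF ⟨ht₀0.le.trans ht.1, ht.2.le⟩).Ici_of_Icc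
        ⟨ht₀0.le.trans ht.1, ht.2⟩).fun_inv (Complex.exp_ne_zero _))
      (by simpa using inv_anti₀ hε ht₀ε) (by fun_prop)
      (fun t _ => by
        simpa using ((((hasDerivAt_id t).sub_const t₀).mul_const L).const_add (1 / ε)).hasDerivWithinAt)
      ?_ (right_mem_Icc.2 ht₁.1)
    · have h1 : ‖(Complex.exp (σ t₁))⁻¹‖ ≤ 2 / ε := key.trans (hB t₁ (right_mem_Icc.2 ht₁.1))
      rw [norm_inv] at h1
      have hpos : 0 < ‖Complex.exp (σ t₁)‖ := norm_pos_iff.2 (Complex.exp_ne_zero _)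
      rw [inv_le_iff_one_le_mul₀ hpos] at h1
      rw [div_mul_eq_mul_div, le_div_iff₀ hε] at h1
      linarith
    · intro x hx hxe
      have hpos : 0 < ‖Complex.exp (σ x)‖ := norm_pos_iff.2 (Complex.exp_ne_zero _)
      have h1 : ‖Complex.exp (σ x)‖⁻¹ ≤ 2 / ε := by
        rw [← norm_inv]
        exact hxe.le.trans (hB x ⟨hx.1, hx.2.le⟩)
      have h2 : ε / 2 ≤ ‖Complex.exp (σ x)‖ := by
        rw [inv_le_iff_one_le_mul₀ hpos, div_mul_eq_mul_div, le_div_iff₀ hε] at h1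
        linarith
      have h3 := hfm _ h2 (hle x ⟨ht₀0.le.trans hx.1, hx.2.trans ht₁.2⟩)
      have h4 : ‖-(a / f (Complex.exp (σ x))) / Complex.exp (σ x) ^ 2‖ ≤ ‖a‖ / m * (4 / ε ^ 2) := by
        rw [norm_div, norm_neg, norm_div, norm_pow, div_eq_mul_inv _ (‖Complex.exp (σ x)‖ ^ 2)]
        refine mul_le_mul (div_le_div_of_nonneg_left (norm_nonneg _) hm h3) ?_ (by positivity)
          (by positivity)
        rw [← inv_pow]
        calc ‖Complex.exp (σ x)‖⁻¹ ^ 2 ≤ (2 / ε) ^ 2 := by gcongr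
          _ = 4 / ε ^ 2 := by ring
      exact h4.trans_lt (by rw [hL]; linarith)
  have hderiv : ∀ t ∈ Ico t₀ T, HasDerivWithinAt σ (a / (f (Complex.exp (σ t)) * Complex.exp (σ t)))
      (Ico t₀ T) t := by
    intro t ht
    obtain ⟨t₁, h1, h2⟩ := exists_between ht.2
    refine ((h t₁ h2 (ht₀0.le.trans (ht.1.trans h1.le))).hasDerivWithinAt hF hf.deriv_ne_zero
      ⟨ht₀0.le.trans ht.1, h1.le⟩).mono_of_mem_nhdsWithin ?_
    filter_upwards [self_mem_nhdsWithin, mem_nhdsWithin_of_mem_nhds (Iio_mem_nhds h1)] with x h3 h4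
    exact ⟨ht₀0.le.trans h3.1, le_of_lt h4⟩
  -- Away from the puncture f is bounded below, so σ is Lipschitz on the last stretch and therefore
  -- has a limit.
  have hlip : LipschitzOnWith (‖a‖ / (m * (ε / 2))).toNNReal σ (Ico t₀ T) := by
    refine (convex_Ico t₀ T).lipschitzOnWith_of_nnnorm_hasDerivWithin_le hderiv fun t ht => ?_
    rw [← norm_toNNReal]
    refine Real.toNNReal_le_toNNReal ?_
    rw [norm_div, norm_mul]
    have h2 := hlow t ht
    have h3 := hfm _ h2 (hle t ⟨ht₀0.le.trans ht.1, ht.2⟩)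
    gcongr
  obtain ⟨g, hg, hgeq⟩ := hlip.extend_finite_dimension
  refine ⟨g T, (hg.continuous.continuousAt.tendsto.mono_left nhdsWithin_le_nhds).congr' ?_⟩
  filter_upwards [Ico_mem_nhdsLT ht₀T] with t ht using (hgeq ht).symm

/-- A half-open lift either runs into the puncture or converges. The first case would be a curve of
finite length, at most T |a|, towards the puncture, contrary to completeness. -/
theorem IsCompleteEnd.exists_segmentLift (hf : IsCompleteEnd f r)
    (hF : ∀ s : ℂ, s.re < Real.log r → HasDerivAt F (f (Complex.exp s) * Complex.exp s) s)
    (hm : 0 < m) (hfm : ∀ z : ℂ, r / 2 ≤ ‖z‖ → ‖z‖ ≤ 3 * r / 4 → m ≤ ‖f z‖)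
    (hs₀ : ‖Complex.exp s₀‖ ≤ r / 2) (ha : ‖a‖ < m * (r / 4)) :
    ∃ σ, IsSegmentLift F (Real.log r) s₀ a 1 σ := by
  have hr := hf.pos
  refine exists_isSegmentLift_one hF hf.deriv_ne_zero
    ((norm_exp_lt_of_re_lt hr).2 (by linarith)) fun T σ hT hT1 h => ?_
  have hle : ∀ t ∈ Ico 0 T, ‖Complex.exp (σ t)‖ ≤ 3 * r / 4 := fun t ht =>
    (h t ht.2 ht.1).norm_exp_le hf hF hm hfm hs₀ ha (ht.2.le.trans hT1) ⟨ht.1, le_rfl⟩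
  by_cases hn : Tendsto (fun t => Complex.exp (σ t)) (𝓝[<] T) (𝓝 0)
  · exfalso
    have hmem : ∀ u ∈ Ico (0 : ℝ) 1, T * u ∈ Ico 0 T := fun u hu =>
      ⟨mul_nonneg hT.le hu.1, by nlinarith [hu.2]⟩
    have hdisc : ∀ u ∈ Ico (0 : ℝ) 1, Complex.exp (σ (T * u)) ∈ Metric.ball (0 : ℂ) r \ {0} :=
      fun u hu => exp_mem_puncturedBall hr
        ((h _ (hmem u hu).2 (hmem u hu).1).mem _ ⟨(hmem u hu).1, le_rfl⟩)
    have hd : ∀ u ∈ Ico (0 : ℝ) 1, HasDerivWithinAt (fun u => Complex.exp (σ (T * u)))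
        (T * (a / f (Complex.exp (σ (T * u))))) (Ico 0 1) u := by
      intro u hu
      obtain ⟨t₁, h1, h2⟩ := exists_between (hmem u hu).2
      have h3 := (h t₁ h2 ((hmem u hu).1.trans h1.le)).hasDerivWithinAt_exp hf hF
        (t := T * u) ⟨(hmem u hu).1, h1.le⟩
      have h4 : HasDerivWithinAt (fun t => Complex.exp (σ t)) (a / f (Complex.exp (σ (T * u))))
          (Ico 0 T) (T * u) := by
        refine h3.mono_of_mem_nhdsWithin ?_
        filter_upwards [self_mem_nhdsWithin, mem_nhdsWithin_of_mem_nhds (Iio_mem_nhds h1)]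
          with x h5 h6 using ⟨h5.1, le_of_lt h6⟩
      have h5 : HasDerivWithinAt (fun u : ℝ => T * u) T (Ico 0 1) u := by
        simpa using ((hasDerivAt_id u).const_mul T).hasDerivWithinAt
      have h6 := h4.scomp u h5 hmem
      rw [Complex.real_smul] at h6
      exact h6
    refine hf.complete (fun u => Complex.exp (σ (T * u))) _ (T * ‖a‖) hd ?_ hdisc ?_ ?_
    · have h1 : ContinuousOn (fun u => Complex.exp (σ (T * u))) (Ico 0 1) :=
        fun u hu => (hd u hu).continuousWithinAt
      refine continuousOn_const.mul (continuousOn_const.div (hf.diff.continuousOn.comp h1 hdisc) ?_)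
      exact fun u hu => hf.ne_zero _ (hdisc u hu)
    · intro u hu
      have h1 := hf.ne_zero _ (hdisc u hu)
      have h2 : f (Complex.exp (σ (T * u))) * (T * (a / f (Complex.exp (σ (T * u))))) = T * a := by
        field_simp
      rw [h2, norm_mul, Complex.norm_real, Real.norm_of_nonneg hT.le]
    · have h1 : Tendsto (fun u : ℝ => T * u) (𝓝[<] 1) (𝓝[<] T) := by
        refine tendsto_nhdsWithin_iff.2 ⟨?_, ?_⟩
        · have : Continuous fun u : ℝ => T * u := by fun_prop
          simpa using (this.tendsto 1).mono_left nhdsWithin_le_nhds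
        · filter_upwards [self_mem_nhdsWithin] with u hu
          simp only [mem_Iio] at hu ⊢
          nlinarith
      exact hn.comp h1
  · obtain ⟨s, hs⟩ := tendsto_of_not_tendsto_exp hf hF hT h hle hn
    refine ⟨s, (norm_exp_lt_of_re_lt hr).2 ?_, hs⟩
    have h1 : ‖Complex.exp s‖ ≤ 3 * r / 4 := by
      refine le_of_tendsto ((Complex.continuous_exp.tendsto s).comp hs).norm ?_
      filter_upwards [Ioo_mem_nhdsLT hT] with t ht using hle t ⟨ht.1.le, ht.2⟩
    linarith

/-- A complete metric `|f| |dz|` on a punctured disc is bounded from below near the puncture. -/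
theorem IsCompleteEnd.exists_norm_inv_le (hf : IsCompleteEnd f r) :
    ∃ C : ℝ, ∀ z : ℂ, z ≠ 0 → ‖z‖ ≤ r / 2 → ‖(f z)⁻¹‖ ≤ C := by
  have hr := hf.pos
  set c := Real.log r with hc
  -- The developing map ∫ f dz on the universal covering of the punctured disc, which is a half
  -- plane covering by the exponential.
  obtain ⟨F, hF⟩ : ∃ F : ℂ → ℂ, ∀ s : ℂ, s.re < c →
      HasDerivAt F (f (Complex.exp s) * Complex.exp s) s := by
    refine exists_primitive_halfPlane (DifferentiableOn.mul ?_ Complex.differentiable_exp.differentiableOn)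
    exact hf.diff.comp Complex.differentiable_exp.differentiableOn
      fun s hs => exp_mem_puncturedBall hr hs
  obtain ⟨m, hm, hfm⟩ : ∃ m > 0, ∀ z : ℂ, r / 2 ≤ ‖z‖ → ‖z‖ ≤ 3 * r / 4 → m ≤ ‖f z‖ := by
    set K : Set ℂ := Metric.closedBall 0 (3 * r / 4) \ Metric.ball 0 (r / 2) with hK
    have hKc : IsCompact K := (isCompact_closedBall _ _).diff Metric.isOpen_ball
    have hKs : K ⊆ Metric.ball 0 r \ {0} := by
      rintro z ⟨h1, h2⟩
      rw [mem_closedBall_zero_iff] at h1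
      rw [mem_ball_zero_iff] at h2
      refine ⟨by rw [mem_ball_zero_iff]; linarith, ?_⟩
      rintro rfl
      simp at h2
      linarith
    have hne : K.Nonempty := ⟨((r / 2 : ℝ) : ℂ), by
      simp only [hK, Set.mem_sdiff, mem_closedBall_zero_iff, mem_ball_zero_iff, Complex.norm_real,
        Real.norm_of_nonneg (half_pos hr).le]
      constructor <;> linarith⟩
    obtain ⟨w, hw, hmin⟩ := hKc.exists_isMinOn hne (hf.diff.continuousOn.mono hKs).norm
    exact ⟨‖f w‖, norm_pos_iff.2 (hf.ne_zero w (hKs hw)), fun z h1 h2 =>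
      hmin (show z ∈ K from ⟨by simpa using h2, by simpa using h1⟩)⟩
  -- The radius up to which all segments lift. It does not depend on z, which is what makes the
  -- final bound uniform.
  set d : ℝ := m * (r / 4) with hd
  have hdpos : 0 < d := by positivity
  refine ⟨2 * r / d, fun z hz hzr => ?_⟩
  classical
  set s₀ := Complex.log z with hs₀
  have hes₀ : Complex.exp s₀ = z := Complex.exp_log hz
  have hs₀c : s₀.re < c := (norm_exp_lt_of_re_lt hr).2 (by rw [hes₀]; linarith)
  have hlift : ∀ a : Metric.ball (0 : ℂ) d, ∃ σ, IsSegmentLift F c s₀ a 1 σ := fun a =>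
    hf.exists_segmentLift hF hm hfm (by rwa [hes₀]) (mem_ball_zero_iff.1 a.2)
  choose σ hσ using hlift
  let p : {s : ℂ // s.re < c} → ℂ := fun s => F s
  have hopen : IsOpen {s : ℂ | s.re < c} := isOpen_lt Complex.continuous_re continuous_const
  have hp : IsLocalHomeomorph p := by
    have h1 : IsLocalHomeomorphOn F {s : ℂ | s.re < c} := by
      refine IsLocalHomeomorphOn.mk _ _ fun s hs => ?_
      have hdiff : DifferentiableOn ℂ F {s : ℂ | s.re < c} := fun s hs =>
        (hF s hs).differentiableAt.differentiableWithinAt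
      have hstrict : HasStrictDerivAt F (f (Complex.exp s) * Complex.exp s) s := by
        have h := ((hdiff.analyticAt (hopen.mem_nhds hs)).contDiffAt (n := 1)).hasStrictDerivAt
          (by norm_num)
        rwa [(hF s hs).deriv] at h
      have he := hstrict.hasStrictFDerivAt_equiv (hf.deriv_ne_zero s hs)
      exact ⟨he.toOpenPartialHomeomorph F, he.mem_toOpenPartialHomeomorph_source, fun _ _ => rfl⟩
    have h2 : IsLocalHomeomorph (Subtype.val : {s : ℂ // s.re < c} → ℂ) :=
      (hopen.isOpenEmbedding_subtypeVal).isLocalHomeomorph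
    exact isLocalHomeomorph_iff_isLocalHomeomorphOn_univ.2
      (h1.comp h2.isLocalHomeomorphOn fun s _ => s.2)
  have hsep : IsSeparatedMap p := T2Space.isSeparatedMap p
  -- Lifts of a continuous family of paths with a common starting point vary continuously, since `p`
  -- is a separated local homeomorphism. Their end points define an inverse branch E of F on a disc
  -- of radius d around F(s₀).
  have hcont := hp.continuous_lift hsep
    (⟨fun x : unitInterval × Metric.ball (0 : ℂ) d => F s₀ + ((x.1 : ℝ) : ℂ) * (x.2 : ℂ), by fun_prop⟩)
    (g := fun x => ⟨σ x.2 x.1, (hσ x.2).mem _ x.1.2⟩)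
    (by ext x; exact (hσ x.2).lift _ x.1.2)
    (by
      refine Continuous.subtype_mk ?_ _
      exact (continuous_const (y := s₀)).congr fun a => ((hσ a).start).symm)
    (fun a => Continuous.subtype_mk ((hσ a).cont.comp_continuous (by fun_prop) fun x => x.2) _)
  have hE1 : Continuous fun a : Metric.ball (0 : ℂ) d => σ a 1 :=
    continuous_subtype_val.comp (hcont.comp (Continuous.prodMk_right (1 : unitInterval)))
  set E : ℂ → ℂ := fun a => if h : a ∈ Metric.ball (0 : ℂ) d then σ ⟨a, h⟩ 1 else 0 with hE
  have hEv : ∀ a (h : a ∈ Metric.ball (0 : ℂ) d), E a = σ ⟨a, h⟩ 1 := fun a h => dif_pos h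
  have hEc : ContinuousOn E (Metric.ball 0 d) := by
    rw [continuousOn_iff_continuous_domRestrict]
    exact hE1.congr fun a => (hEv a a.2).symm
  have one_mem : (1 : ℝ) ∈ Icc (0 : ℝ) 1 := ⟨zero_le_one, le_rfl⟩
  have hEre : ∀ a ∈ Metric.ball (0 : ℂ) d, (E a).re < c := fun a h => by
    rw [hEv a h]; exact (hσ _).mem 1 one_mem
  have hEF : ∀ a ∈ Metric.ball (0 : ℂ) d, F (E a) - F s₀ = a := fun a h => by
    rw [hEv a h, (hσ _).lift 1 one_mem]; simp
  have h0 : (0 : ℂ) ∈ Metric.ball (0 : ℂ) d := Metric.mem_ball_self hdpos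
  have hE0 : E 0 = s₀ := by
    rw [hEv 0 h0]
    refine (hσ ⟨0, h0⟩).eqOn hF hf.deriv_ne_zero (τ := fun _ => s₀)
      ⟨continuousOn_const, rfl, fun _ _ => hs₀c, fun t _ => by simp⟩ one_mem
  have hEd : ∀ a ∈ Metric.ball (0 : ℂ) d,
      HasDerivAt E (f (Complex.exp (E a)) * Complex.exp (E a))⁻¹ a := by
    intro a ha
    have hnhds : Metric.ball (0 : ℂ) d ∈ 𝓝 a := Metric.isOpen_ball.mem_nhds ha
    refine HasDerivAt.of_local_left_inverse (f := fun s => F s - F s₀) (hEc.continuousAt hnhds)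
      ((hF _ (hEre a ha)).sub_const _) (hf.deriv_ne_zero _ (hEre a ha)) ?_
    filter_upwards [hnhds] with b hb using hEF b hb
  have hexp : ∀ a ∈ Metric.ball (0 : ℂ) d,
      HasDerivAt (fun a => Complex.exp (E a)) (f (Complex.exp (E a)))⁻¹ a := by
    intro a ha
    refine (hEd a ha).cexp.congr_deriv ?_
    rw [mul_inv, mul_comm, mul_assoc, inv_mul_cancel₀ (Complex.exp_ne_zero _), mul_one]
  -- Schwarz lemma: exp ∘ E maps a disc of radius d into a disc of radius 2r around z and has the
  -- derivative 1 / f(z) at the centre.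
  have hbound := Complex.norm_deriv_le_div_of_mapsTo_ball (f := fun a => Complex.exp (E a)) (c := 0)
    (R₁ := d) (R₂ := 2 * r) (fun a ha => (hexp a ha).differentiableAt.differentiableWithinAt) ?_ hdpos
  · rwa [(hexp 0 h0).deriv, hE0, hes₀] at hbound
  · intro a ha
    have h1 := (norm_exp_lt_of_re_lt hr).1 (hEre a ha)
    rw [mem_closedBall_iff_norm]
    refine (norm_sub_le _ _).trans ?_
    rw [hE0, hes₀]
    linarith

/-- A complete metric `|f| |dz|` on a punctured disc has a pole, or a nonzero limit, at the
puncture. -/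
theorem IsCompleteEnd.exists_eq_zpow_mul (hf : IsCompleteEnd f r) :
    ∃ (n : ℕ) (k : ℂ → ℂ), AnalyticAt ℂ k 0 ∧ k 0 ≠ 0 ∧ ∀ᶠ z in 𝓝[≠] 0, f z = (z ^ n)⁻¹ * k z := by
  obtain ⟨C, hC⟩ := hf.exists_norm_inv_le
  have hball : Metric.ball (0 : ℂ) (r / 2) ∈ 𝓝 0 := Metric.ball_mem_nhds _ (half_pos hf.pos)
  have hd : DifferentiableOn ℂ (fun z => (f z)⁻¹) (Metric.ball 0 (r / 2) \ {0}) :=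
    (hf.diff.mono (sdiff_subset_sdiff_left (Metric.ball_subset_ball (by linarith [hf.pos])))).inv
      fun z hz => hf.ne_zero z ⟨Metric.ball_subset_ball (by linarith [hf.pos]) hz.1, hz.2⟩
  -- The singularity of 1 / f is removable; the order n of its zero, possibly 0, is the order of the
  -- pole of f.
  have hu := Complex.differentiableOn_update_limUnder_of_bddAbove hball hd
    ⟨C, by rintro _ ⟨z, hz, rfl⟩; exact hC z hz.2 (mem_ball_zero_iff.1 hz.1).le⟩
  set h := Function.update (fun z => (f z)⁻¹) 0 (limUnder (𝓝[≠] 0) fun z => (f z)⁻¹)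
  have ha : AnalyticAt ℂ h 0 := hu.analyticAt hball
  have heq : ∀ᶠ z in 𝓝[≠] 0, h z = (f z)⁻¹ ∧ f z ≠ 0 := by
    filter_upwards [self_mem_nhdsWithin, mem_nhdsWithin_of_mem_nhds hball] with z h1 h2
    exact ⟨Function.update_of_ne h1 _ _,
      hf.ne_zero z ⟨Metric.ball_subset_ball (by linarith [hf.pos]) h2, h1⟩⟩
  obtain ⟨n, g, hg, hg0, hgeq⟩ := ha.exists_eventuallyEq_pow_smul_nonzero_iff.2 fun h0 => by
    obtain ⟨z, h1, h2, h3⟩ := ((h0.filter_mono nhdsWithin_le_nhds).and heq).exists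
    rw [h1] at h2
    exact h3 (inv_eq_zero.1 h2.symm)
  refine ⟨n, fun z => (g z)⁻¹, hg.inv hg0, inv_ne_zero hg0, ?_⟩
  filter_upwards [heq, hgeq.filter_mono nhdsWithin_le_nhds] with z h1 h2
  rw [← inv_inv (f z), ← h1.1, h2, sub_zero, smul_eq_mul, mul_inv]

end CompleteEndPole

/-! ### Primitives at the puncture and expansion of the coordinates -/

section EndExpansion

open scoped ComplexConjugate

theorem AnalyticAt.analyticAt_dslope {k : ℂ → ℂ} {z : ℂ} (hk : AnalyticAt ℂ k z) :
    AnalyticAt ℂ (dslope k z) z :=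
  let ⟨_, hp⟩ := hk
  ⟨_, hp.has_fpower_series_dslope_fslope⟩

/-- Laurent primitives up to the residue. -/
theorem exists_laurent_primitive (n : ℕ) {k : ℂ → ℂ} (hk : AnalyticAt ℂ k 0) :
    ∃ (c : ℂ) (K : ℂ → ℂ), AnalyticAt ℂ K 0 ∧ (n = 0 → c = k 0) ∧ (n ≠ 0 → K 0 = -k 0 / n) ∧
      ∀ᶠ z in 𝓝[≠] 0, HasDerivAt (fun z => (z ^ n)⁻¹ * K z) ((z ^ (n + 1))⁻¹ * k z - c / z) z := by
  -- Each step splits off the leading coefficient by k = k(0) + z `dslope k 0`. A power other than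
  -- z⁻¹ is integrated; at n = 0 the remaining k(0) / z is the residue term.
  induction n generalizing k with
  | zero =>
    obtain ⟨ε, hε, hball⟩ := Metric.eventually_nhds_iff_ball.1 hk.analyticAt_dslope.eventually_analyticAt
    obtain ⟨K, hK⟩ := DifferentiableOn.isExactOn_ball (f := dslope k 0) (c := 0) (r := ε)
      fun z hz => (hball z hz).differentiableAt.differentiableWithinAt
    have hKa : AnalyticAt ℂ K 0 := DifferentiableOn.analyticAt (s := Metric.ball 0 ε)
      (fun z hz => (hK z hz).differentiableAt.differentiableWithinAt) (Metric.ball_mem_nhds _ hε)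
    refine ⟨k 0, K, hKa, fun _ => rfl, fun h => absurd rfl h, ?_⟩
    filter_upwards [self_mem_nhdsWithin, mem_nhdsWithin_of_mem_nhds (Metric.ball_mem_nhds _ hε)]
      with z hz hzε
    simp only [pow_zero, inv_one, one_mul]
    refine (hK z hzε).congr_deriv ?_
    rw [dslope_of_ne _ hz, slope_def_field]
    have : z ≠ 0 := hz
    field_simp
    ring
  | succ n ih =>
    obtain ⟨c, K, hK, -, -, hd⟩ := ih hk.analyticAt_dslope
    refine ⟨c, fun z => -k 0 / (n + 1 : ℕ) + z * K z, by fun_prop, fun h => absurd h (by simp),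
      fun _ => by simp, ?_⟩
    filter_upwards [hd, self_mem_nhdsWithin] with z hz hz0
    have hz0' : z ≠ 0 := hz0
    have hn : ((n + 1 : ℕ) : ℂ) ≠ 0 := Nat.cast_ne_zero.2 n.succ_ne_zero
    have h1 : HasDerivAt (fun z : ℂ => (z ^ (n + 1))⁻¹ * (-k 0 / (n + 1 : ℕ)))
        ((z ^ (n + 2))⁻¹ * k 0) z := by
      refine (((hasDerivAt_pow (n + 1) z).fun_inv (pow_ne_zero _ hz0')).mul_const _).congr_deriv ?_
      simp only [Nat.add_sub_cancel]
      field_simp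
      ring
    have h2 := (h1.add hz).congr_deriv (f' := _)
      (g' := (z ^ (n + 1 + 1))⁻¹ * k z - c / z) (by
        rw [dslope_of_ne _ hz0, slope_def_field]
        field_simp
        ring)
    refine h2.congr_of_eventuallyEq ?_
    filter_upwards [isOpen_ne.mem_nhds hz0'] with w hw
    simp only [Pi.add_apply]
    have hw' : w ≠ 0 := hw
    field_simp
    try ring

theorem isPreconnected_puncturedBall {r : ℝ} (hr : 0 < r) :
    IsPreconnected (Metric.ball (0 : ℂ) r \ {0}) := by
  have : Metric.ball (0 : ℂ) r \ {0} = Complex.exp '' {s : ℂ | s.re < Real.log r} := by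
    ext z
    constructor
    · rintro ⟨h1, h2⟩
      refine ⟨Complex.log z, ?_, Complex.exp_log h2⟩
      rw [mem_ofPred_eq, norm_exp_lt_of_re_lt hr, Complex.exp_log h2]
      exact mem_ball_zero_iff.1 h1
    · rintro ⟨s, hs, rfl⟩
      exact exp_mem_puncturedBall hr hs
  rw [this]
  refine IsPreconnected.image ?_ _ Complex.continuous_exp.continuousOn
  have : Convex ℝ {s : ℂ | s.re < Real.log r} := convex_halfSpace_re_lt _
  exact this.isPreconnected

theorem eq_of_hasFDerivAt_zero {E : Type*} [NormedAddCommGroup E] [NormedSpace ℝ E] {V : ℂ → E}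
    {r : ℝ} (hr : 0 < r)
    (hV : ∀ z ∈ Metric.ball (0 : ℂ) r \ {0}, HasFDerivAt V (0 : ℂ →L[ℝ] E) z) :
    ∃ C, ∀ z ∈ Metric.ball (0 : ℂ) r \ {0}, V z = C :=
  (isOpen_puncturedBall r).exists_is_const_of_fderiv_eq_zero (isPreconnected_puncturedBall hr)
    (fun z hz => (hV z hz).differentiableAt.differentiableWithinAt) fun z hz => (hV z hz).fderiv

/-- A single-valued function has no period around the puncture. -/
theorem apply_I_eq_zero_of_hasFDerivAt {E : Type*} [NormedAddCommGroup E] [NormedSpace ℝ E]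
    {V : ℂ → E} {A : ℂ →L[ℝ] E} {r : ℝ} (hr : 0 < r)
    (hV : ∀ z ∈ Metric.ball (0 : ℂ) r \ {0}, HasFDerivAt V (A ∘L (z⁻¹ • (1 : ℂ →L[ℝ] ℂ))) z) :
    A Complex.I = 0 := by
  set ε := r / 2 with hε
  have hmem : ∀ θ : ℝ, circleMap 0 ε θ ∈ Metric.ball (0 : ℂ) r \ {0} := by
    intro θ
    refine ⟨?_, ?_⟩
    · rw [mem_ball_zero_iff, norm_circleMap_zero, abs_of_pos (half_pos hr)]
      linarith
    · simp [hε, hr.ne']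
  -- On a circle dz / z = i dθ, so V grows by A(i) per unit of angle, while V returns to its value
  -- after a full turn.
  have hd : ∀ θ : ℝ, HasDerivAt (fun θ : ℝ => V (circleMap 0 ε θ) - θ • A Complex.I) 0 θ := by
    intro θ
    have h1 := (hV _ (hmem θ)).comp_hasDerivAt θ (hasDerivAt_circleMap 0 ε θ)
    have h2 := (hasDerivAt_id θ).smul_const (A Complex.I)
    refine (h1.sub h2).congr_deriv ?_
    have h3 : circleMap 0 ε θ ≠ 0 := (hmem θ).2
    simp only [ContinuousLinearMap.comp_apply, _root_.smul_apply,
      one_apply_eq_self, smul_eq_mul, one_smul, inv_mul_cancel_left₀ h3, sub_self]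
  have h := is_const_of_deriv_eq_zero (fun θ => (hd θ).differentiableAt) (fun θ => (hd θ).deriv) 0
    (2 * Real.pi)
  have h2 : circleMap 0 ε (2 * Real.pi) = circleMap 0 ε 0 := by
    simpa using (periodic_circleMap 0 ε) 0
  simp only [h2, zero_smul, sub_zero] at h
  rw [eq_comm, sub_eq_self] at h
  exact (smul_eq_zero.1 h).resolve_left (by positivity)

/-- d log |w| = Re d log(w / z); dividing by z moves the point to 1, away from the cut of the
logarithm. -/
theorem hasFDerivAt_log_norm {z : ℂ} (hz : z ≠ 0) :
    HasFDerivAt (fun z : ℂ => Real.log ‖z‖) (Complex.reCLM ∘L (z⁻¹ • (1 : ℂ →L[ℝ] ℂ))) z := by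
  have h1 : HasDerivAt (fun w : ℂ => Complex.log (w / z)) z⁻¹ z := by
    have := ((hasDerivAt_id z).div_const z).clog (by simp [hz, Complex.one_mem_slitPlane])
    simpa [hz] using this
  have h2 := (Complex.reCLM.hasFDerivAt.comp z h1.complexToReal_fderiv).add_const (Real.log ‖z‖)
  refine h2.congr_of_eventuallyEq ?_
  filter_upwards [isOpen_ne.mem_nhds hz] with w hw
  have hw' : w ≠ 0 := hw
  simp [Complex.log_re, Real.log_div, norm_eq_zero, hz, hw']

/-- The data of an end with vertical limiting normal: `W` is the horizontal coordinate, with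
`2 dW = f dz - conj (f g² dz)`, and `y` is the height, with `dy = Re (f g dz)`. -/
structure IsMinimalEnd (W : ℂ → ℂ) (y : ℂ → ℝ) (f g : ℂ → ℂ) (r : ℝ) : Prop where
  complete : IsCompleteEnd f r
  diff_g : DifferentiableOn ℂ g (Metric.ball 0 r)
  g_zero : g 0 = 0
  deriv_W : ∀ z ∈ Metric.ball (0 : ℂ) r \ {0}, HasFDerivAt W ((f z / 2) • (1 : ℂ →L[ℝ] ℂ) -
    (conj (f z * g z ^ 2) / 2) • (Complex.conjCLE : ℂ →L[ℝ] ℂ)) z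
  deriv_y : ∀ z ∈ Metric.ball (0 : ℂ) r \ {0},
    HasFDerivAt y (Complex.reCLM ∘L ((f z * g z) • (1 : ℂ →L[ℝ] ℂ))) z

theorem IsCompleteEnd.mono {f : ℂ → ℂ} {r ε : ℝ} (h : IsCompleteEnd f r) (hε : 0 < ε) (hεr : ε ≤ r) :
    IsCompleteEnd f ε := by
  have hs : Metric.ball (0 : ℂ) ε \ {0} ⊆ Metric.ball (0 : ℂ) r \ {0} :=
    sdiff_subset_sdiff_left (Metric.ball_subset_ball hεr)
  exact ⟨hε, h.diff.mono hs, fun z hz => h.ne_zero z (hs hz), fun δ δ' B h1 h2 h3 h4 =>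
    h.complete δ δ' B h1 h2 (h3.mono_right hs) h4⟩

variable {W : ℂ → ℂ} {y : ℂ → ℝ} {f g : ℂ → ℂ} {r : ℝ}

theorem IsMinimalEnd.mono {ε : ℝ} (h : IsMinimalEnd W y f g r) (hε : 0 < ε) (hεr : ε ≤ r) :
    IsMinimalEnd W y f g ε := by
  have hs : Metric.ball (0 : ℂ) ε \ {0} ⊆ Metric.ball (0 : ℂ) r \ {0} :=
    sdiff_subset_sdiff_left (Metric.ball_subset_ball hεr)
  exact ⟨h.complete.mono hε hεr, h.diff_g.mono (Metric.ball_subset_ball hεr), h.g_zero,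
    fun z hz => h.deriv_W z (hs hz), fun z hz => h.deriv_y z (hs hz)⟩

theorem exists_radius_of_eventually {P : ℂ → Prop} (hP : ∀ᶠ z in 𝓝[≠] (0 : ℂ), P z) {r : ℝ}
    (hr : 0 < r) : ∃ ε, 0 < ε ∧ ε ≤ r ∧ ∀ z ∈ Metric.ball (0 : ℂ) ε \ {0}, P z := by
  rw [eventually_nhdsWithin_iff, Metric.eventually_nhds_iff_ball] at hP
  obtain ⟨ε, hε, h⟩ := hP
  exact ⟨min ε r, lt_min hε hr, min_le_right _ _, fun z hz =>
    h z (Metric.ball_subset_ball (min_le_left _ _) hz.1) hz.2⟩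

/-- A complete metric is unbounded along radii. -/
theorem IsCompleteEnd.not_bounded (hf : IsCompleteEnd f r) (B : ℝ) :
    ¬ ∀ᶠ z in 𝓝[≠] 0, ‖f z‖ ≤ B := by
  intro h
  obtain ⟨ε, hε, hεr, hb⟩ := exists_radius_of_eventually h hf.pos
  have hmem : ∀ t ∈ Ico (0 : ℝ) 1, (1 - t : ℂ) * (ε / 2 : ℝ) ∈ Metric.ball (0 : ℂ) ε \ {0} := by
    intro t ht
    have h1 : (0 : ℝ) < 1 - t := by linarith [ht.2]
    have h2 : (1 - t : ℂ) * (ε / 2 : ℝ) = (((1 - t) * (ε / 2) : ℝ) : ℂ) := by push_cast; ring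
    have h3 : 0 < (1 - t) * (ε / 2) := by positivity
    rw [h2]
    refine ⟨?_, ?_⟩
    · rw [mem_ball_zero_iff, Complex.norm_real, Real.norm_of_nonneg h3.le]
      nlinarith [ht.1]
    · rw [mem_singleton_iff, Complex.ofReal_eq_zero]
      exact h3.ne'
  refine hf.complete (fun t => (1 - t) * (ε / 2 : ℝ)) (fun _ => -(ε / 2 : ℝ)) (B * (ε / 2)) ?_
    continuousOn_const (fun t ht => ?_) ?_ ?_
  · intro t _
    have := (((hasDerivAt_id t).ofReal_comp.const_sub 1).mul_const ((ε / 2 : ℝ) : ℂ)).hasDerivWithinAt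
      (s := Ico (0 : ℝ) 1)
    simpa using this
  · exact sdiff_subset_sdiff_left (Metric.ball_subset_ball hεr) (hmem t ht)
  · intro t ht
    rw [norm_mul, norm_neg, Complex.norm_real, Real.norm_of_nonneg (half_pos hε).le]
    exact mul_le_mul_of_nonneg_right (hb _ (hmem t ht)) (half_pos hε).le
  · have : Continuous fun t : ℝ => (1 - t : ℂ) * (ε / 2 : ℝ) := by fun_prop
    simpa using (this.tendsto 1).mono_left (nhdsWithin_le_nhds (s := Iio 1))

/-- The horizontal coordinate in terms of primitives. -/
theorem IsMinimalEnd.eq_of_primitives (h : IsMinimalEnd W y f g r) {F G : ℂ → ℂ} {c c' : ℂ}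
    (hF : ∀ z ∈ Metric.ball (0 : ℂ) r \ {0}, HasDerivAt F (f z - c / z) z)
    (hG : ∀ z ∈ Metric.ball (0 : ℂ) r \ {0}, HasDerivAt G (f z * g z ^ 2 - c' / z) z) :
    c + conj c' = 0 ∧ ∃ C₀, ∀ z ∈ Metric.ball (0 : ℂ) r \ {0},
      2 * W z = F z + 2 * c * Real.log ‖z‖ - conj (G z) + C₀ := by
  have hr := h.complete.pos
  -- With 2 d log |z| = dz / z + conj(dz / z), all that remains of the differential is −(c + conj
  -- c') conj(dz / z). A single-valued function has no such period, so this coefficient is zero.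
  have hVd : ∀ z ∈ Metric.ball (0 : ℂ) r \ {0}, HasFDerivAt
      (fun z => 2 * W z - (F z + 2 * c * Real.log ‖z‖ - conj (G z)))
      (((-(c + conj c')) • (Complex.conjCLE : ℂ →L[ℝ] ℂ)) ∘L (z⁻¹ • (1 : ℂ →L[ℝ] ℂ))) z := by
    intro z hz
    have hz0 : z ≠ 0 := hz.2
    have d1 := (h.deriv_W z hz).const_mul (2 : ℂ)
    have d2 := (hF z hz).complexToReal_fderiv
    have d3 := ((Complex.ofRealCLM.hasFDerivAt).comp z (hasFDerivAt_log_norm hz0)).const_mul (2 * c)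
    have d4 := (Complex.conjCLE : ℂ →L[ℝ] ℂ).hasFDerivAt.comp z (hG z hz).complexToReal_fderiv
    refine (d1.sub ((d2.add d3).sub d4)).congr_fderiv ?_
    ext v
    have hre : ∀ w : ℂ, ((w.re : ℝ) : ℂ) = (w + conj w) / 2 := fun w => by
      rw [Complex.add_conj]; push_cast; ring
    simp only [_root_.sub_apply, _root_.add_apply,
      _root_.smul_apply, ContinuousLinearMap.comp_apply, one_apply_eq_self,
      smul_eq_mul, Complex.reCLM_apply, Complex.ofRealCLM_apply, ContinuousLinearEquiv.coe_coe,
      Complex.conjCLE_apply, hre, map_mul, map_sub, map_inv₀,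
      map_pow, map_div₀]
    have hz0' : conj z ≠ 0 := by simpa using hz0
    field_simp
    ring
  have hcc := apply_I_eq_zero_of_hasFDerivAt hr hVd
  have hcc' : c + conj c' = 0 := by
    simp at hcc
    linear_combination -hcc
  have hA : (-(c + conj c')) • (Complex.conjCLE : ℂ →L[ℝ] ℂ) = 0 := by
    ext v
    simp [hcc']
  obtain ⟨C₀, hC₀⟩ := eq_of_hasFDerivAt_zero hr fun z hz => (hVd z hz).congr_fderiv (by
    rw [hA, ContinuousLinearMap.zero_comp])
  exact ⟨hcc', C₀, fun z hz => by linear_combination hC₀ z hz⟩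

/-- The height in terms of a primitive. -/
theorem IsMinimalEnd.height_eq_of_primitive (h : IsMinimalEnd W y f g r) {H : ℂ → ℂ} {c : ℂ}
    (hH : ∀ z ∈ Metric.ball (0 : ℂ) r \ {0}, HasDerivAt H (f z * g z - c / z) z) :
    c.im = 0 ∧ ∃ C₀, ∀ z ∈ Metric.ball (0 : ℂ) r \ {0},
      y z = (H z).re + c.re * Real.log ‖z‖ + C₀ := by
  have hr := h.complete.pos
  -- Here the remainder is −Im(c) Im(dz / z), so single-valuedness of the height makes the residue
  -- real.
  have hVd : ∀ z ∈ Metric.ball (0 : ℂ) r \ {0}, HasFDerivAt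
      (fun z => y z - ((H z).re + c.re * Real.log ‖z‖))
      (((-c.im) • Complex.imCLM) ∘L (z⁻¹ • (1 : ℂ →L[ℝ] ℂ))) z := by
    intro z hz
    have hz0 : z ≠ 0 := hz.2
    have d2 := Complex.reCLM.hasFDerivAt.comp z (hH z hz).complexToReal_fderiv
    have d3 := (hasFDerivAt_log_norm hz0).const_mul c.re
    refine ((h.deriv_y z hz).sub (d2.add d3)).congr_fderiv ?_
    ext v
    simp only [_root_.sub_apply, _root_.add_apply,
      _root_.smul_apply, ContinuousLinearMap.comp_apply, one_apply_eq_self,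
      smul_eq_mul, Complex.reCLM_apply, Complex.imCLM_apply, sub_mul, Complex.sub_re,
      div_eq_mul_inv, mul_assoc, Complex.mul_re c]
    ring
  have hcc := apply_I_eq_zero_of_hasFDerivAt hr hVd
  have hcc' : c.im = 0 := by simpa using hcc
  obtain ⟨C₀, hC₀⟩ := eq_of_hasFDerivAt_zero hr fun z hz => (hVd z hz).congr_fderiv (by
    rw [hcc', neg_zero, zero_smul, ContinuousLinearMap.zero_comp])
  exact ⟨hcc', C₀, fun z hz => by linear_combination hC₀ z hz⟩

theorem eventually_mem_puncturedBall {ε : ℝ} (hε : 0 < ε) :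
    ∀ᶠ z in 𝓝[≠] (0 : ℂ), z ∈ Metric.ball (0 : ℂ) ε \ {0} := by
  filter_upwards [self_mem_nhdsWithin, mem_nhdsWithin_of_mem_nhds (Metric.ball_mem_nhds _ hε)]
    with z h1 h2 using ⟨h2, h1⟩

/-- The expansion of the horizontal coordinate. -/
theorem IsMinimalEnd.exists_expansion (h : IsMinimalEnd W y f g r) :
    ∃ (n : ℕ) (k K L : ℂ → ℂ) (c C₀ : ℂ), n ≠ 0 ∧ AnalyticAt ℂ k 0 ∧ AnalyticAt ℂ K 0 ∧
      AnalyticAt ℂ L 0 ∧ k 0 ≠ 0 ∧ K 0 = -k 0 / n ∧ L 0 = 0 ∧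
      ∀ᶠ z in 𝓝[≠] 0, f z = (z ^ (n + 1))⁻¹ * k z ∧
        2 * W z = (z ^ n)⁻¹ * K z + 2 * c * Real.log ‖z‖ - conj ((z ^ n)⁻¹ * L z) + C₀ := by
  obtain ⟨m, k, hk, hk0, hfk⟩ := h.complete.exists_eq_zpow_mul
  have hr := h.complete.pos
  have hga : AnalyticAt ℂ g 0 := h.diff_g.analyticAt (Metric.ball_mem_nhds _ hr)
  -- Without a pole f would be bounded, and a radius would have finite length.
  rcases m with _ | n
  · exfalso
    have h1 : ∀ᶠ z in 𝓝 (0 : ℂ), ‖k z‖ < ‖k 0‖ + 1 :=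
      hk.continuousAt.norm.eventually (gt_mem_nhds (by linarith))
    refine h.complete.not_bounded (‖k 0‖ + 1) ?_
    filter_upwards [hfk, h1.filter_mono nhdsWithin_le_nhds] with z h2 h3
    rw [h2]
    simpa using h3.le
  obtain ⟨c, K, hK, hc0, hK0, hKd⟩ := exists_laurent_primitive n hk
  obtain ⟨c', L, hL, hc0', hL0, hLd⟩ := exists_laurent_primitive n (hk.mul (hga.pow 2))
  obtain ⟨ε, hε, hεr, hall⟩ := exists_radius_of_eventually (hfk.and (hKd.and hLd)) hr
  obtain ⟨hcc', C₀, hC₀⟩ := (h.mono hε hεr).eq_of_primitives (c' := c')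
    (fun z hz => (hall z hz).2.1.congr_deriv (by rw [(hall z hz).1]))
    (fun z hz => (hall z hz).2.2.congr_deriv (by
      simp only [Pi.mul_apply, Pi.pow_apply, (hall z hz).1, mul_assoc]))
  -- For a simple pole c = k(0), whereas c' = k(0) g(0)² = 0; then c + conj c' = 0 contradicts k(0)
  -- ≠ 0.
  have hn : n ≠ 0 := by
    intro hn
    have h1 := hc0' hn
    rw [hc0 hn, h1] at hcc'
    simp [h.g_zero] at hcc'
    exact hk0 hcc'
  refine ⟨n, k, K, L, c, C₀, hn, hk, hK, hL, hk0, hK0 hn, by simp [hL0 hn, h.g_zero], ?_⟩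
  filter_upwards [eventually_mem_puncturedBall hε] with z hz using ⟨(hall z hz).1, hC₀ z hz⟩

end EndExpansion

/-! ### A coordinate in which the horizontal part is κ s⁻ⁿ -/

section EndCoordinate

open scoped ComplexConjugate

variable {W : ℂ → ℂ} {y : ℂ → ℝ} {f g : ℂ → ℂ} {r : ℝ}

theorem tendsto_pow_mul_log_norm {n : ℕ} (hn : n ≠ 0) :
    Tendsto (fun z : ℂ => z ^ n * (Real.log ‖z‖ : ℂ)) (𝓝[≠] 0) (𝓝 0) := by
  rw [tendsto_zero_iff_norm_tendsto_zero]
  have h1 : Tendsto (fun x : ℝ => |Real.log x * x ^ n|) (𝓝[>] 0) (𝓝 0) := by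
    have := (tendsto_log_mul_rpow_nhdsGT_zero (r := n) (by positivity)).abs
    simpa using this
  have h2 : Tendsto (fun z : ℂ => ‖z‖) (𝓝[≠] 0) (𝓝[>] 0) := by
    refine tendsto_nhdsWithin_iff.2 ⟨?_, ?_⟩
    · simpa using (continuous_norm.tendsto (0 : ℂ)).mono_left nhdsWithin_le_nhds
    · filter_upwards [self_mem_nhdsWithin] with z hz using norm_pos_iff.2 hz
  refine (h1.comp h2).congr fun z => ?_
  simp [abs_mul, mul_comm]

/-- An `n`-th root near a point. -/
theorem exists_root {K₀ : ℂ} (hK : K₀ ≠ 0) {n : ℕ} (hn : n ≠ 0) :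
    ∃ ψ : ℂ → ℂ, ψ K₀ = 1 ∧ ContinuousAt ψ K₀ ∧
      ∀ᶠ q in 𝓝 K₀, q ≠ 0 ∧ ψ q ^ n = K₀ / q ∧ HasDerivAt ψ (-ψ q / (n * q)) q := by
  have h1 : Tendsto (fun q : ℂ => K₀ / q) (𝓝 K₀) (𝓝 1) := by
    have : ContinuousAt (fun q : ℂ => K₀ / q) K₀ := continuousAt_const.div continuousAt_id hK
    simpa [ContinuousAt, hK] using this
  have hn' : (n : ℂ) ≠ 0 := Nat.cast_ne_zero.2 hn
  have hd : ∀ᶠ q in 𝓝 K₀, q ≠ 0 ∧ ((K₀ / q) ^ ((n : ℂ)⁻¹)) ^ n = K₀ / q ∧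
      HasDerivAt (fun q => (K₀ / q) ^ ((n : ℂ)⁻¹)) (-(K₀ / q) ^ ((n : ℂ)⁻¹) / (n * q)) q := by
    filter_upwards [isOpen_ne.mem_nhds hK,
      h1.eventually (Complex.isOpen_slitPlane.mem_nhds Complex.one_mem_slitPlane)] with q hq hs
    have hq' : q ≠ 0 := hq
    refine ⟨hq, Complex.cpow_nat_inv_pow _ hn, ?_⟩
    have h2 := (((hasDerivAt_id q).fun_inv hq').const_mul K₀).cpow_const (c := (n : ℂ)⁻¹)
      (by rw [id, ← div_eq_mul_inv]; exact hs)
    simp only [id, ← div_eq_mul_inv] at h2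
    refine h2.congr_deriv ?_
    have hne : K₀ / q ≠ 0 := div_ne_zero hK hq'
    rw [Complex.cpow_sub _ _ hne, Complex.cpow_one]
    field_simp
  refine ⟨fun q => (K₀ / q) ^ ((n : ℂ)⁻¹), by simp [hK], ?_, hd⟩
  exact hd.self_of_nhds.2.2.continuousAt

/-- Near the puncture the horizontal coordinate is `κ s⁻ⁿ` in a suitable coordinate `s`. -/
theorem IsMinimalEnd.exists_coordinate (h : IsMinimalEnd W y f g r) {n : ℕ} {k K L : ℂ → ℂ} {c C₀ : ℂ}
    (hn : n ≠ 0) (hk : AnalyticAt ℂ k 0) (hK : AnalyticAt ℂ K 0) (hL : AnalyticAt ℂ L 0) (hk0 : k 0 ≠ 0)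
    (hK0 : K 0 = -k 0 / n) (hL0 : L 0 = 0)
    (hev : ∀ᶠ z in 𝓝[≠] 0, f z = (z ^ (n + 1))⁻¹ * k z ∧
        2 * W z = (z ^ n)⁻¹ * K z + 2 * c * Real.log ‖z‖ - conj ((z ^ n)⁻¹ * L z) + C₀) :
    ∃ e : OpenPartialHomeomorph ℂ ℂ, 0 ∈ e.source ∧ e 0 = 0 ∧ e.source ⊆ Metric.ball 0 r ∧
      HasFDerivAt e (1 : ℂ →L[ℝ] ℂ) 0 ∧
      ∀ z ∈ e.source, z ≠ 0 → W z = K 0 / 2 * (e z ^ n)⁻¹ := by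
  have hr := h.complete.pos
  have hn' : (n : ℂ) ≠ 0 := Nat.cast_ne_zero.2 hn
  have hK00 : K 0 ≠ 0 := by
    rw [hK0]
    exact div_ne_zero (neg_ne_zero.2 hk0) hn'
  -- Q tends to K(0): the factor zⁿ suppresses the logarithm and the constant, and L(0) = 0 takes
  -- care of the conjugate term.
  set Q : ℂ → ℂ := fun z => 2 * W z * z ^ n with hQ
  have hne0 : ∀ᶠ z : ℂ in 𝓝[≠] 0, z ≠ 0 := self_mem_nhdsWithin
  have hle : 𝓝[≠] (0 : ℂ) ≤ 𝓝 0 := nhdsWithin_le_nhds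
  have hunit : ∀ u : ℂ → ℂ, Tendsto u (𝓝[≠] 0) (𝓝 0) → ∀ v : ℂ → ℂ, (∀ᶠ z in 𝓝[≠] 0, ‖v z‖ = ‖u z‖) →
      Tendsto v (𝓝[≠] 0) (𝓝 0) := fun u hu v hv => by
    rw [tendsto_zero_iff_norm_tendsto_zero] at hu ⊢
    exact hu.congr' (hv.mono fun z hz => hz.symm)
  have hQlim : Tendsto Q (𝓝[≠] 0) (𝓝 (K 0)) := by
    have e1 : Tendsto K (𝓝[≠] 0) (𝓝 (K 0)) := hK.continuousAt.tendsto.mono_left hle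
    have e2 := (tendsto_pow_mul_log_norm hn).const_mul (2 * c)
    have e3 : Tendsto (fun z => z ^ n * conj ((z ^ n)⁻¹ * L z)) (𝓝[≠] 0) (𝓝 0) := by
      have hL' := hL.continuousAt.tendsto
      rw [hL0] at hL'
      refine hunit L (hL'.mono_left hle) _ ?_
      filter_upwards [hne0] with z hz
      have : ‖z‖ ≠ 0 := norm_ne_zero_iff.2 hz
      simp only [norm_mul, RCLike.norm_conj, norm_inv, norm_pow]
      field_simp
    have e4 : Tendsto (fun z : ℂ => z ^ n * C₀) (𝓝[≠] 0) (𝓝 0) := by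
      have : Continuous fun z : ℂ => z ^ n * C₀ := by fun_prop
      simpa [hn] using (this.tendsto 0).mono_left hle
    have e5 := ((e1.add e2).sub e3).add e4
    simp only [mul_zero, add_zero, sub_zero] at e5
    refine e5.congr' ?_
    filter_upwards [hev, hne0] with z hz hz0
    simp only [hQ, hz.2]
    field_simp
    try ring
  obtain ⟨ψ, hψ1, hψc, hψ⟩ := exists_root hK00 hn
  have hψQ : Tendsto (fun z => ψ (Q z)) (𝓝[≠] 0) (𝓝 1) := hψ1 ▸ hψc.tendsto.comp hQlim
  -- ζ = z (K(0) / Q)^{1/n}, so that ζⁿ = K(0) / (2 W).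
  set ζ : ℂ → ℂ := Function.update (fun z => z * ψ (Q z)) 0 0 with hζ
  have hζ0 : ζ 0 = 0 := Function.update_self _ _ _
  have hζz : ∀ z, z ≠ 0 → ζ z = z * ψ (Q z) := fun z hz => Function.update_of_ne hz _ _
  -- The derivative of ζ, computed from dW, so that no derivative of the logarithm occurs. The
  -- coefficient of dz tends to −k(0) / (n K(0)) = 1; that of the conjugate has the modulus of ψ(Q)
  -- k g² / (n Q), which tends to 0.
  set D : ℂ → ℂ →L[ℝ] ℂ := Function.update (fun z =>
    (-(ψ (Q z) * k z) / (n * Q z)) • (1 : ℂ →L[ℝ] ℂ) +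
      (ψ (Q z) * (z ^ (n + 1) * conj (f z * g z ^ 2)) / (n * Q z)) • (Complex.conjCLE : ℂ →L[ℝ] ℂ)) 0 1
    with hD
  have hD0 : D 0 = 1 := Function.update_self _ _ _
  have hga : ContinuousAt g 0 :=
    (h.diff_g.analyticAt (Metric.ball_mem_nhds _ hr)).continuousAt
  have hDc : ContinuousAt D 0 := by
    rw [continuousAt_update_same]
    have e0 : (n : ℂ) * K 0 ≠ 0 := mul_ne_zero hn' hK00
    have e1 : Tendsto (fun z => -(ψ (Q z) * k z) / (n * Q z)) (𝓝[≠] 0) (𝓝 1) := by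
      have := ((hψQ.mul (hk.continuousAt.tendsto.mono_left hle)).neg).div (hQlim.const_mul (n : ℂ)) e0
      have e : -(1 * k 0) / (n * K 0) = 1 := by
        rw [hK0, one_mul, mul_div_cancel₀ _ hn', div_self (neg_ne_zero.2 hk0)]
      rwa [e] at this
    have e2 : Tendsto (fun z => z ^ (n + 1) * conj (f z * g z ^ 2)) (𝓝[≠] 0) (𝓝 0) := by
      have e3 : Tendsto (fun z => k z * g z ^ 2) (𝓝[≠] 0) (𝓝 0) := by
        have : ContinuousAt (fun z => k z * g z ^ 2) 0 := hk.continuousAt.mul (hga.pow 2)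
        simpa [ContinuousAt, h.g_zero] using this.tendsto.mono_left hle
      refine hunit _ e3 _ ?_
      filter_upwards [hev, hne0] with z hz hz0
      have : ‖z‖ ≠ 0 := norm_ne_zero_iff.2 hz0
      simp only [norm_mul, RCLike.norm_conj, norm_inv, norm_pow, hz.1]
      field_simp
    have e3 := (hψQ.mul e2).div (hQlim.const_mul (n : ℂ)) e0
    simp only [mul_zero, zero_div] at e3
    have e4 := (e1.smul_const (1 : ℂ →L[ℝ] ℂ)).add (e3.smul_const (Complex.conjCLE : ℂ →L[ℝ] ℂ))
    have e5 : (1 : ℂ) • (1 : ℂ →L[ℝ] ℂ) + (0 : ℂ) • (Complex.conjCLE : ℂ →L[ℝ] ℂ) = 1 := by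
      ext v; simp
    rw [e5] at e4
    exact e4
  have hζd0 : HasFDerivAt ζ (1 : ℂ →L[ℝ] ℂ) 0 := by
    rw [hasFDerivAt_iff_isLittleO_nhds_zero]
    simp only [zero_add, hζ0, sub_zero, one_apply_eq_self]
    rw [Asymptotics.isLittleO_iff]
    intro ε hε
    have e1 := (Metric.tendsto_nhds.1 hψQ) ε hε
    rw [eventually_nhdsWithin_iff] at e1
    filter_upwards [e1] with z hz
    by_cases hz0 : z = 0
    · simp [hz0, hζ0]
    · rw [hζz z hz0]
      have := hz hz0
      rw [dist_eq_norm] at this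
      calc ‖z * ψ (Q z) - z‖ = ‖ψ (Q z) - 1‖ * ‖z‖ := by rw [← norm_mul]; congr 1; ring
        _ ≤ ε * ‖z‖ := by gcongr
  have hball : ∀ᶠ z in 𝓝[≠] (0 : ℂ), z ∈ Metric.ball (0 : ℂ) r \ {0} := by
    filter_upwards [self_mem_nhdsWithin, mem_nhdsWithin_of_mem_nhds (Metric.ball_mem_nhds _ hr)]
      with z h1 h2 using ⟨h2, h1⟩
  have hζd : ∀ᶠ z in 𝓝[≠] (0 : ℂ), HasFDerivAt ζ (D z) z := by
    filter_upwards [hball, hQlim.eventually hψ, hev] with z hz hq hz2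
    have hz0 : z ≠ 0 := hz.2
    have d1 := (h.deriv_W z hz).const_mul (2 : ℂ)
    have d2 : HasFDerivAt (fun z : ℂ => z ^ n) ((n * z ^ (n - 1)) • (1 : ℂ →L[ℝ] ℂ)) z :=
      (hasDerivAt_pow n z).complexToReal_fderiv
    have d3 : HasFDerivAt Q _ z := d1.mul d2
    have d4 := hq.2.2.complexToReal_fderiv.comp z d3
    have d5 := (hasFDerivAt_id (𝕜 := ℝ) z).mul d4
    have d6 : HasFDerivAt ζ _ z := d5.congr_of_eventuallyEq (by
      filter_upwards [isOpen_ne.mem_nhds hz0] with w hw using hζz w hw)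
    refine d6.congr_fderiv ?_
    rw [hD, Function.update_of_ne hz0]
    ext v
    have hn1 : z * z ^ (n - 1) = z ^ n := by rw [← pow_succ', Nat.sub_add_cancel (Nat.pos_of_ne_zero hn)]
    have hqn : Q z ≠ 0 := hq.1
    simp only [_root_.sub_apply, _root_.add_apply, _root_.smul_apply, ContinuousLinearMap.comp_apply,
      one_apply_eq_self, smul_eq_mul, ContinuousLinearEquiv.coe_coe, Complex.conjCLE_apply, id,
      ContinuousLinearMap.id_apply, Function.comp_apply]
    have hkz : k z = z ^ (n + 1) * f z := by rw [hz2.1]; field_simp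
    rw [hkz]
    have hWz : 2 * W z * z ^ n = Q z := rfl
    field_simp
    linear_combination (-ψ (Q z)) * n * 2 * W z * v * hn1 - ψ (Q z) * n * v * hWz
  -- In general ζ is not holomorphic. It is differentiable near 0 with derivative continuous at 0,
  -- hence strictly differentiable there, and the real inverse function theorem applies.
  have hstrict : HasStrictFDerivAt ζ (1 : ℂ →L[ℝ] ℂ) 0 := by
    rw [← hD0]
    refine hasStrictFDerivAt_of_hasFDerivAt_of_continuousAt ?_ hDc
    rw [eventually_nhdsWithin_iff] at hζd
    filter_upwards [hζd] with z hz
    by_cases hz0 : z = 0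
    · rw [hz0, hD0]
      exact hζd0
    · exact hz hz0
  have hstrict' : HasStrictFDerivAt ζ ((ContinuousLinearEquiv.refl ℝ ℂ : ℂ ≃L[ℝ] ℂ) : ℂ →L[ℝ] ℂ) 0 :=
    hstrict
  have hgood : ∀ᶠ z in 𝓝 (0 : ℂ), z ∈ Metric.ball (0 : ℂ) r ∧
      (z ≠ 0 → Q z ≠ 0 ∧ ψ (Q z) ^ n = K 0 / Q z) := by
    have e1 := hQlim.eventually hψ
    rw [eventually_nhdsWithin_iff] at e1
    filter_upwards [e1, Metric.ball_mem_nhds _ hr] with z h1 h2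
    exact ⟨h2, fun h3 => ⟨(h1 h3).1, (h1 h3).2.1⟩⟩
  obtain ⟨S, hSsub, hSo, hS0⟩ := eventually_nhds_iff.1 hgood
  refine ⟨(hstrict'.toOpenPartialHomeomorph ζ).restrOpen S hSo,
    ⟨hstrict'.mem_toOpenPartialHomeomorph_source, hS0⟩, hζ0, fun z hz => (hSsub z hz.2).1, hζd0,
    fun z hz hz0 => ?_⟩
  obtain ⟨h1, h2⟩ := (hSsub z hz.2).2 hz0
  change W z = K 0 / 2 * (ζ z ^ n)⁻¹
  rw [hζz z hz0, mul_pow, h2]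
  have hW0 : W z ≠ 0 := by
    intro h3
    simp [hQ, h3] at h1
  simp only [hQ]
  field_simp

end EndCoordinate

/-! ### Embedded ends have a double pole and are graphs -/

section EmbeddedEnds

open scoped ComplexConjugate

variable {W : ℂ → ℂ} {y : ℂ → ℝ} {f g : ℂ → ℂ} {r : ℝ}

/-- A continuous function on the circle takes the same value at two points that differ by a rotation
of order `n`. -/
theorem exists_eq_of_periodic {H : ℝ → ℝ} (hH : Continuous H) {T : ℝ} {n : ℕ} (hn : n ≠ 0)
    (hT : H (n * T) = H 0) : ∃ θ, H (θ + T) = H θ := by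
  -- The n differences along the rotation orbit add up to zero, so one is nonnegative and one
  -- nonpositive; the intermediate value theorem gives a zero in between.
  have hsum : ∑ j ∈ Finset.range n, (H (j * T + T) - H (j * T)) = 0 := by
    have := Finset.sum_range_sub (fun j : ℕ => H (j * T)) n
    simp only [Nat.cast_add, Nat.cast_one, add_mul, one_mul, Nat.cast_zero, zero_mul, hT, sub_self] at this
    exact this
  have hne : (Finset.range n).Nonempty := Finset.nonempty_range_iff.2 hn
  obtain ⟨i, -, hi⟩ := Finset.exists_le_of_sum_le hne (f := fun j : ℕ => H (j * T + T) - H (j * T))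
    (g := fun _ => 0) (by simp [hsum])
  obtain ⟨j, -, hj⟩ := Finset.exists_le_of_sum_le hne (g := fun j : ℕ => H (j * T + T) - H (j * T))
    (f := fun _ => 0) (by simp [hsum])
  obtain ⟨θ, hθ⟩ := mem_range_of_exists_le_of_exists_ge
    (f := fun θ => H (θ + T) - H θ) (by fun_prop) ⟨_, hi⟩ ⟨_, hj⟩
  exact ⟨θ, sub_eq_zero.1 hθ⟩

/-- An embedded end has a double pole. -/
theorem IsMinimalEnd.exists_double_pole (h : IsMinimalEnd W y f g r)
    (hinj : InjOn (fun z => (W z, y z)) (Metric.ball 0 r \ {0})) :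
    ∃ k : ℂ → ℂ, AnalyticAt ℂ k 0 ∧ k 0 ≠ 0 ∧ ∀ᶠ z in 𝓝[≠] 0, f z = (z ^ 2)⁻¹ * k z := by
  obtain ⟨n, k, K, L, c, C₀, hn, hk, hK, hL, hk0, hK0, hL0, hev⟩ := h.exists_expansion
  obtain ⟨e, he0, hee, her, -, heW⟩ := h.exists_coordinate hn hk hK hL hk0 hK0 hL0 hev
  suffices hn1 : n = 1 by
    subst hn1
    exact ⟨k, hk, hk0, hev.mono fun z hz => hz.1⟩
  by_contra hn1
  have hn2 : 1 < n := by omega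
  have ht0 : (0 : ℂ) ∈ e.target := hee ▸ e.map_source he0
  obtain ⟨ε', hε', hball⟩ := Metric.isOpen_iff.1 e.open_target 0 ht0
  set ε := ε' / 2 with hε
  have hεpos : 0 < ε := half_pos hε'
  have hcm : ∀ θ, circleMap 0 ε θ ∈ e.target := fun θ => hball (by
    rw [mem_ball_zero_iff, norm_circleMap_zero, abs_of_pos hεpos]
    linarith)
  have hcm0 : ∀ θ, circleMap 0 ε θ ≠ 0 := fun θ => by simp [hεpos.ne']
  set Z : ℝ → ℂ := fun θ => e.symm (circleMap 0 ε θ) with hZ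
  have hZs : ∀ θ, Z θ ∈ e.source := fun θ => e.map_target (hcm θ)
  have heZ : ∀ θ, e (Z θ) = circleMap 0 ε θ := fun θ => e.right_inv (hcm θ)
  have hZ0 : ∀ θ, Z θ ≠ 0 := fun θ h0 => hcm0 θ (by rw [← heZ, h0, hee])
  have hZD : ∀ θ, Z θ ∈ Metric.ball (0 : ℂ) r \ {0} := fun θ => ⟨her (hZs θ), hZ0 θ⟩
  have hZc : Continuous Z := e.continuousOn_symm.comp_continuous (continuous_circleMap 0 ε) hcm
  have hyc : ContinuousOn y (Metric.ball (0 : ℂ) r \ {0}) := fun z hz =>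
    (h.deriv_y z hz).continuousAt.continuousWithinAt
  have hn' : (n : ℂ) ≠ 0 := Nat.cast_ne_zero.2 hn
  have hnr : (n : ℝ) ≠ 0 := Nat.cast_ne_zero.2 hn
  -- Rotating s by 2π / n leaves W = κ s⁻ⁿ unchanged, and on the circle some pair of points related
  -- by this rotation has equal heights. For n > 1 this is a double point.
  obtain ⟨θ, hθ⟩ := exists_eq_of_periodic (H := fun θ => y (Z θ)) (hyc.comp_continuous hZc hZD)
    (T := 2 * Real.pi / n) hn (by
      have : circleMap 0 ε (2 * Real.pi) = circleMap 0 ε 0 := by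
        simpa using (periodic_circleMap 0 ε) 0
      rw [mul_div_cancel₀ _ hnr]
      simp only [hZ, this])
  have hrot : circleMap 0 ε (θ + 2 * Real.pi / n) =
      circleMap 0 ε θ * Complex.exp (2 * Real.pi * Complex.I / n) := by
    simp only [circleMap_zero]
    rw [mul_assoc, ← Complex.exp_add]
    congr 2
    push_cast
    ring
  have hprim := Complex.isPrimitiveRoot_exp n hn
  have hWeq : W (Z (θ + 2 * Real.pi / n)) = W (Z θ) := by
    rw [heW _ (hZs _) (hZ0 _), heW _ (hZs _) (hZ0 _), heZ, heZ, hrot, mul_pow, hprim.pow_eq_one, mul_one]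
  have hZeq := hinj (hZD _) (hZD _) (Prod.ext hWeq hθ)
  have h1 : circleMap 0 ε (θ + 2 * Real.pi / n) = circleMap 0 ε θ := by rw [← heZ, ← heZ, hZeq]
  rw [hrot] at h1
  exact hprim.ne_one hn2 (mul_left_cancel₀ (hcm0 θ) (by rw [h1, mul_one]))

theorem AnalyticAt.exists_eq_add_mul {k : ℂ → ℂ} (hk : AnalyticAt ℂ k 0) :
    ∃ k₁, AnalyticAt ℂ k₁ 0 ∧ ∀ z, k z = k 0 + z * k₁ z :=
  ⟨dslope k 0, hk.analyticAt_dslope, fun z => by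
    have := sub_smul_dslope k 0 z
    rw [sub_zero, smul_eq_mul] at this
    rw [this]
    ring⟩

/-- The second order expansion of `log (1 + b z + O(z²))`. -/
theorem log_norm_one_add_isBigO {u : ℂ → ℂ} {b : ℂ} {l : Filter ℂ} (hl : l ≤ 𝓝 0)
    (hu : (fun z => u z - b * z) =O[l] fun z => z ^ 2) :
    (fun z => Real.log ‖1 + u z‖ - (b * z).re) =O[l] fun z => z ^ 2 := by
  have hz : Tendsto (fun z : ℂ => z) l (𝓝 0) := hl
  have h1 : u =O[l] fun z => z := by
    have e1 : (fun z => u z - b * z) =O[l] fun z => z := by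
      refine hu.trans ?_
      simp only [pow_two]
      simpa using (Asymptotics.isBigO_refl (fun z : ℂ => z) l).mul (hz.isBigO_one ℂ)
    have e2 : (fun z : ℂ => b * z) =O[l] fun z => z := Asymptotics.isBigO_const_mul_self b _ _
    simpa using e1.add e2
  have hu0 : Tendsto u l (𝓝 0) := h1.trans_tendsto hz
  have h2 : (fun z => Complex.log (1 + u z) - u z) =O[l] fun z => z ^ 2 := by
    have e1 : (fun z => Complex.log (1 + u z) - u z) =O[l] fun z => u z ^ 2 := by
      refine Asymptotics.IsBigO.of_bound 1 ?_
      have := hu0.norm.eventually (gt_mem_nhds (show ‖(0 : ℂ)‖ < 1 / 2 by norm_num))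
      filter_upwards [this] with z hz
      refine (Complex.norm_log_one_add_sub_self_le (by linarith)).trans ?_
      rw [one_mul, norm_pow, mul_div_assoc]
      refine mul_le_of_le_one_right (by positivity) ?_
      have h3 : (1 - ‖u z‖)⁻¹ ≤ 2 := by
        rw [inv_le_comm₀ (by linarith) two_pos]
        linarith
      linarith
    exact e1.trans (h1.pow 2)
  have h3 := h2.add hu
  refine Asymptotics.IsBigO.trans (Asymptotics.IsBigO.of_norm_left (f' := fun z =>
    Real.log ‖1 + u z‖ - (b * z).re) (Asymptotics.IsBigO.of_bound 1 ?_)) h3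
  refine Eventually.of_forall fun z => ?_
  rw [one_mul, norm_norm, Real.norm_eq_abs]
  have e1 : Real.log ‖1 + u z‖ - (b * z).re =
      (Complex.log (1 + u z) - u z + (u z - b * z)).re := by
    simp [Complex.log_re]
  rw [e1]
  exact Complex.abs_re_le_norm _

/-- The description of an embedded end in the coordinate `s` in which the horizontal coordinate is
`κ / s`. -/
theorem IsMinimalEnd.exists_graph (h : IsMinimalEnd W y f g r)
    (hinj : InjOn (fun z => (W z, y z)) (Metric.ball 0 r \ {0})) :
    ∃ (e : OpenPartialHomeomorph ℂ ℂ) (κ b : ℂ) (a β C : ℝ) (F G H : ℂ → ℂ), κ ≠ 0 ∧ 0 ∈ e.source ∧ e 0 = 0 ∧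
      e.source ⊆ Metric.ball 0 r ∧
      (∀ z ∈ e.source, z ≠ 0 → W z = κ / e z ∧
        |y z - (a * Real.log ‖e z‖ + β + (b * e z).re)| ≤ C * ‖e z‖ ^ 2) ∧
      ∀ᶠ z in 𝓝[≠] 0, HasDerivAt F (f z) z ∧ HasDerivAt G (f z * g z ^ 2) z ∧
        HasDerivAt H (f z * g z - a / z) z := by
  have hr := h.complete.pos
  obtain ⟨k, hk, hk0, hfk⟩ := h.exists_double_pole hinj
  have hga : AnalyticAt ℂ g 0 := h.diff_g.analyticAt (Metric.ball_mem_nhds _ hr)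
  obtain ⟨g₁, hg₁, hgg⟩ := hga.exists_eq_add_mul
  rw [h.g_zero] at hgg
  simp only [zero_add] at hgg
  obtain ⟨c, K, hK, -, hK0, hKd⟩ := exists_laurent_primitive 1 hk
  obtain ⟨a, H, hH, -, -, hHd⟩ := exists_laurent_primitive 0 (hk.mul hg₁)
  -- f g² = k g₁² is holomorphic. It is written as z⁻¹ (z k g₁²) to fit the lemma, with residue c' =
  -- 0.
  obtain ⟨c', G, hG, hc', -, hGd⟩ := exists_laurent_primitive 0
    ((analyticAt_id (𝕜 := ℂ) (z := 0)).mul (hk.mul (hg₁.pow 2)))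
  have hc'0 : c' = 0 := by simpa using hc' rfl
  subst hc'0
  obtain ⟨ε, hε, hεr, hall⟩ := exists_radius_of_eventually (hfk.and (hKd.and (hHd.and hGd))) hr
  have dH : ∀ z ∈ Metric.ball (0 : ℂ) ε \ {0}, HasDerivAt H (f z * g z - a / z) z := by
    intro z hz
    have hz0 : z ≠ 0 := hz.2
    have := (hall z hz).2.2.1
    simp only [pow_zero, inv_one, one_mul] at this
    refine this.congr_deriv ?_
    rw [(hall z hz).1, hgg z, Pi.mul_apply]
    field_simp
    try ring
  have dG : ∀ z ∈ Metric.ball (0 : ℂ) ε \ {0}, HasDerivAt G (f z * g z ^ 2 - 0 / z) z := by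
    intro z hz
    have hz0 : z ≠ 0 := hz.2
    have := (hall z hz).2.2.2
    simp only [pow_zero, inv_one, one_mul] at this
    refine this.congr_deriv ?_
    rw [(hall z hz).1, hgg z]
    simp only [Pi.mul_apply, Pi.pow_apply, id]
    field_simp
    try ring
  obtain ⟨hcc, C₀, hW⟩ := (h.mono hε hεr).eq_of_primitives
    (fun z hz => (hall z hz).2.1.congr_deriv (by rw [(hall z hz).1])) dG
  -- Now c + conj c' = 0 leaves no logarithm in the horizontal coordinate.
  have hc : c = 0 := by simpa using hcc
  subst hc
  obtain ⟨haim, C₁, hy⟩ := (h.mono hε hεr).height_eq_of_primitive dH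
  have hK0' : K 0 = -k 0 := by simpa using hK0 one_ne_zero
  have hK00 : K 0 ≠ 0 := by rw [hK0']; exact neg_ne_zero.2 hk0
  obtain ⟨e, he0, hee, her, hed, heW⟩ := h.exists_coordinate (n := 1) (k := k) (K := K)
    (L := fun z => z * G z) (c := 0) (C₀ := C₀) one_ne_zero hk hK
    ((analyticAt_id (𝕜 := ℂ) (z := 0)).mul hG) hk0 (by simpa using hK0') (by simp) (by
      filter_upwards [eventually_mem_puncturedBall hε] with z hz
      have hz0 : z ≠ 0 := hz.2
      refine ⟨(hall z hz).1, ?_⟩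
      rw [hW z hz, pow_one, inv_mul_cancel_left₀ hz0])
  -- the expansion
  have hle : 𝓝[≠] (0 : ℂ) ≤ 𝓝 0 := nhdsWithin_le_nhds
  have hne0 : ∀ᶠ z : ℂ in 𝓝[≠] 0, z ≠ 0 := self_mem_nhdsWithin
  have hz : Tendsto (fun z : ℂ => z) (𝓝[≠] 0) (𝓝 0) := hle
  obtain ⟨K₁, hK₁, hKK⟩ := hK.exists_eq_add_mul
  obtain ⟨K₂, hK₂, hKK₁⟩ := hK₁.exists_eq_add_mul
  obtain ⟨G₁, hG₁, hGG⟩ := hG.exists_eq_add_mul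
  obtain ⟨H₁, hH₁, hHH⟩ := hH.exists_eq_add_mul
  obtain ⟨H₂, hH₂, hHH₁⟩ := hH₁.exists_eq_add_mul
  have hO : ∀ {q : ℂ → ℂ}, AnalyticAt ℂ q 0 → q =O[𝓝[≠] 0] fun _ => (1 : ℂ) := fun hq =>
    (hq.continuousAt.tendsto.mono_left hle).isBigO_one ℂ
  -- 1 + u compares z with s = e z. By s = K(0) / (2W) it equals (K(z) − z conj G(z) + C₀ z) / K(0),
  -- whose linear coefficient is b₁; the conjugate contributes to it only through G(0).
  set u : ℂ → ℂ := fun z => z / e z - 1 with hu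
  set b₁ : ℂ := (K₁ 0 - conj (G 0) + C₀) / K 0 with hb₁
  have heD : ∀ᶠ z in 𝓝[≠] (0 : ℂ), z ∈ e.source :=
    hle (e.open_source.mem_nhds he0)
  have he0' : ∀ z ∈ e.source, z ≠ 0 → e z ≠ 0 := fun z hz hz0 h0 =>
    hz0 (e.injOn hz he0 (by rw [h0, hee]))
  have huO : (fun z => u z - b₁ * z) =O[𝓝[≠] 0] fun z => z ^ 2 := by
    have e1 : ∀ᶠ z in 𝓝[≠] (0 : ℂ), u z - b₁ * z = (K₂ z * z ^ 2 - z * conj (G₁ z * z)) / K 0 := by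
      filter_upwards [heD, eventually_mem_puncturedBall hε] with z hz1 hz2
      have hz0 : z ≠ 0 := hz2.2
      have hez := he0' z hz1 hz0
      have h1 := heW z hz1 hz0
      have h2 := hW z hz2
      rw [h1, hGG z] at h2
      simp only [pow_one] at h2
      have h3 : z / e z = (K z - z * (conj (G 0 + z * G₁ z)) + C₀ * z) / K 0 := by
        rw [eq_div_iff hK00]
        have : z / e z * K 0 = z * (2 * (K 0 / 2 * (e z)⁻¹)) := by field_simp
        rw [this, h2]
        field_simp
        ring
      simp only [hu, hb₁]
      rw [h3, hKK z, hKK₁ z]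
      field_simp
      simp only [map_add, map_mul]
      ring
    refine Asymptotics.IsBigO.congr' ?_ (e1.mono fun z hz => hz.symm) (EventuallyEq.refl _ _)
    have e2 : (fun z => K₂ z * z ^ 2) =O[𝓝[≠] 0] fun z => z ^ 2 := by
      simpa using (hO hK₂).mul (Asymptotics.isBigO_refl (fun z : ℂ => z ^ 2) _)
    have e3 : (fun z => z * conj (G₁ z * z)) =O[𝓝[≠] 0] fun z => z ^ 2 := by
      have e4 : (fun z => z * (G₁ z * z)) =O[𝓝[≠] 0] fun z => z ^ 2 := by
        have := (hO hG₁).mul (Asymptotics.isBigO_refl (fun z : ℂ => z ^ 2) (𝓝[≠] 0))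
        simp only [one_mul] at this
        exact this.congr_left fun z => by ring
      refine (Asymptotics.IsBigO.of_norm_left ?_)
      exact e4.norm_left.congr_left fun z => by simp
    simpa [div_eq_inv_mul] using (e2.sub e3).const_mul_left (K 0)⁻¹
  have hlog := log_norm_one_add_isBigO hle huO
  have hu1 : u =O[𝓝[≠] 0] fun z => z := by
    have e1 : (fun z => u z - b₁ * z) =O[𝓝[≠] 0] fun z => z := by
      refine huO.trans ?_
      simp only [pow_two]
      simpa using (Asymptotics.isBigO_refl (fun z : ℂ => z) (𝓝[≠] 0)).mul (hz.isBigO_one ℂ)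
    simpa using e1.add (Asymptotics.isBigO_const_mul_self b₁ (fun z : ℂ => z) (𝓝[≠] 0))
  have hez : (fun z => e z) =O[𝓝[≠] 0] fun z => z := by
    have := hed.isBigO_sub.mono hle
    simpa [hee] using this
  -- z and s are of the same order, so error terms may be estimated by either of them.
  have hze : (fun z => z) =O[𝓝[≠] 0] fun z => e z := by
    have e1 : (fun z => (1 + u z) * e z) =O[𝓝[≠] 0] fun z => e z := by
      have e2 : (fun z => 1 + u z) =O[𝓝[≠] 0] fun _ => (1 : ℂ) :=
        (Asymptotics.isBigO_refl _ _).add (hu1.trans (hz.isBigO_one ℂ))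
      simpa using e2.mul (Asymptotics.isBigO_refl (fun z => e z) (𝓝[≠] 0))
    refine e1.congr' ?_ (EventuallyEq.refl _ _)
    filter_upwards [heD, hne0] with z h1 h2
    have := he0' z h1 h2
    simp only [hu]
    field_simp
    ring
  have hsub : (fun z => z - e z) =O[𝓝[≠] 0] fun z => z ^ 2 := by
    have e1 : (fun z => u z * e z) =O[𝓝[≠] 0] fun z => z * z := hu1.mul hez
    refine e1.congr' ?_ (Eventually.of_forall fun z => (pow_two z).symm)
    filter_upwards [heD, hne0] with z h1 h2
    have := he0' z h1 h2
    simp only [hu]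
    field_simp
  -- The linear term of the height collects that of H and that of a log |z / s|, which is a Re(b₁ z)
  -- up to second order.
  set b : ℂ := H₁ 0 + a.re * b₁ with hb
  have hfin : (fun z => y z - (a.re * Real.log ‖e z‖ + ((H 0).re + C₁) + (b * e z).re))
      =O[𝓝[≠] 0] fun z => e z ^ 2 := by
    refine Asymptotics.IsBigO.trans ?_ (hze.pow 2)
    have e1 : (fun z => (H₂ z * z ^ 2).re) =O[𝓝[≠] 0] fun z => z ^ 2 := by
      have : (fun z => H₂ z * z ^ 2) =O[𝓝[≠] 0] fun z => z ^ 2 := by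
        simpa using (hO hH₂).mul (Asymptotics.isBigO_refl (fun z : ℂ => z ^ 2) _)
      exact (Asymptotics.IsBigO.of_bound 1 (Eventually.of_forall fun z => by
        rw [one_mul, Real.norm_eq_abs]; exact Complex.abs_re_le_norm _)).trans this
    have e2 : (fun z => (b * (z - e z)).re) =O[𝓝[≠] 0] fun z => z ^ 2 :=
      (Asymptotics.IsBigO.of_bound 1 (Eventually.of_forall fun z => by
        simpa using Complex.abs_re_le_norm (b * (z - e z)))).trans (hsub.const_mul_left b)
    refine ((hlog.const_mul_left a.re).add (e1.add e2)).congr' ?_ (EventuallyEq.refl _ _)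
    filter_upwards [heD, eventually_mem_puncturedBall hε] with z hz1 hz2
    have hz0 : z ≠ 0 := hz2.2
    have hez0 := he0' z hz1 hz0
    have h1 : Real.log ‖1 + u z‖ = Real.log ‖z‖ - Real.log ‖e z‖ := by
      simp only [hu]
      rw [add_sub_cancel, norm_div, Real.log_div (norm_ne_zero_iff.2 hz0) (norm_ne_zero_iff.2 hez0)]
    rw [hy z hz2, h1, hHH z, hHH₁ z]
    simp only [hb, Complex.add_re, Complex.mul_re, Complex.add_im, Complex.mul_im, Complex.ofReal_re,
      Complex.ofReal_im, Complex.sub_re, Complex.sub_im, pow_two]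
    ring
  obtain ⟨C, hC⟩ := hfin.bound
  rw [eventually_nhdsWithin_iff] at hC
  obtain ⟨S, hS, hSo, hS0⟩ := eventually_nhds_iff.1 hC
  refine ⟨e.restrOpen S hSo, K 0 / 2, b, a.re, (H 0).re + C₁, C, fun z => (z ^ 1)⁻¹ * K z, G, H,
    div_ne_zero hK00 two_ne_zero,
    ⟨he0, hS0⟩, hee, fun z hz => her hz.1, fun z hz hz0 => ⟨?_, ?_⟩, ?_⟩
  · simpa [div_eq_mul_inv] using heW z hz.1 hz0
  · simpa using hS z hz.2 hz0
  · filter_upwards [eventually_mem_puncturedBall hε] with z hz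
    refine ⟨(hall z hz).2.1.congr_deriv (by rw [(hall z hz).1]; simp), by simpa using dG z hz, ?_⟩
    have : ((a.re : ℝ) : ℂ) = a := Complex.ext (by simp) (by simp [haim])
    rw [this]
    exact dH z hz

end EmbeddedEnds

/-! ### From complete minimal punctured discs to Weierstrass data -/

section PlaneEnds

open scoped ComplexConjugate

/-- A complete minimal conformal immersion `x = Re ∫ φ dz` of a punctured disc. -/
structure IsPlaneEnd (x : ℂ → E3) (φ : ℂ → Fin 3 → ℂ) (r : ℝ) : Prop where
  pos : 0 < r
  hol : ∀ j, DifferentiableOn ℂ (fun z => φ z j) (Metric.ball 0 r \ {0})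
  diff : ∀ z ∈ Metric.ball (0 : ℂ) r \ {0}, DifferentiableAt ℝ x z
  deriv : ∀ z ∈ Metric.ball (0 : ℂ) r \ {0}, ∀ v j, fderiv ℝ x z v j = (φ z j * v).re
  sq : ∀ z ∈ Metric.ball (0 : ℂ) r \ {0}, φ z 0 ^ 2 + φ z 1 ^ 2 + φ z 2 ^ 2 = 0
  ne : ∀ z ∈ Metric.ball (0 : ℂ) r \ {0}, φ z ≠ 0
  complete : ∀ (δ δ' : ℝ → ℂ) (B : ℝ), (∀ t ∈ Ico (0 : ℝ) 1, HasDerivWithinAt δ (δ' t) (Ico 0 1) t) →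
    ContinuousOn δ' (Ico 0 1) → MapsTo δ (Ico 0 1) (Metric.ball 0 r \ {0}) →
    (∀ t ∈ Ico (0 : ℝ) 1, ‖φ (δ t)‖ * ‖δ' t‖ ≤ B) → ¬ Tendsto δ (𝓝[<] 1) (𝓝 0)

variable {x : ℂ → E3} {φ : ℂ → Fin 3 → ℂ} {r : ℝ}

theorem puncturedBall_subset {ε r : ℝ} (hεr : ε ≤ r) :
    Metric.ball (0 : ℂ) ε \ {0} ⊆ Metric.ball (0 : ℂ) r \ {0} :=
  sdiff_subset_sdiff_left (Metric.ball_subset_ball hεr)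

theorem IsPlaneEnd.mono (h : IsPlaneEnd x φ r) {ε : ℝ} (hε : 0 < ε) (hεr : ε ≤ r) :
    IsPlaneEnd x φ ε := by
  have hs := puncturedBall_subset hεr
  exact ⟨hε, fun j => (h.hol j).mono hs, fun z hz => h.diff z (hs hz), fun z hz => h.deriv z (hs hz),
    fun z hz => h.sq z (hs hz), fun z hz => h.ne z (hs hz), fun δ δ' B h1 h2 h3 h4 =>
    h.complete δ δ' B h1 h2 (h3.mono_right hs) h4⟩

theorem IsPlaneEnd.hasFDerivAt_apply (h : IsPlaneEnd x φ r) {z : ℂ}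
    (hz : z ∈ Metric.ball (0 : ℂ) r \ {0}) (j : Fin 3) :
    HasFDerivAt (fun z => x z j) (Complex.reCLM ∘L (φ z j • (1 : ℂ →L[ℝ] ℂ))) z := by
  have h1 := (EuclideanSpace.proj (𝕜 := ℝ) j : E3 →L[ℝ] ℝ).hasFDerivAt.comp z (h.diff z hz).hasFDerivAt
  refine h1.congr_fderiv ?_
  ext v
  simpa using h.deriv z hz v j

/-- The area element of a minimal immersion. -/
theorem IsPlaneEnd.norm_planeNormal (h : IsPlaneEnd x φ r) {z : ℂ}
    (hz : z ∈ Metric.ball (0 : ℂ) r \ {0}) : ‖planeNormal x z‖ =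
      (Complex.normSq (φ z 0) + Complex.normSq (φ z 1) + Complex.normSq (φ z 2)) / 2 := by
  have hd := h.deriv z hz
  have e1 : ‖planeNormal x z‖ ^ 2 = ((Complex.normSq (φ z 0) + Complex.normSq (φ z 1)
      + Complex.normSq (φ z 2)) / 2) ^ 2 := by
    rw [← real_inner_self_eq_norm_sq, planeNormal, inner_cross_cross]
    simp only [inner_E3, hd]
    have hs := h.sq z hz
    have hre := congrArg Complex.re hs
    have him := congrArg Complex.im hs
    simp only [pow_two, Complex.add_re, Complex.add_im, Complex.mul_re, Complex.mul_im,
      Complex.zero_re, Complex.zero_im] at hre him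
    simp only [Complex.mul_re, Complex.I_re, Complex.I_im, Complex.one_re,
      Complex.one_im, Complex.normSq_apply]
    generalize (φ z 0).re = a0 at *
    generalize (φ z 0).im = b0 at *
    generalize (φ z 1).re = a1 at *
    generalize (φ z 1).im = b1 at *
    generalize (φ z 2).re = a2 at *
    generalize (φ z 2).im = b2 at *
    linear_combination (-(1 / 4 : ℝ)) * (a0 * a0 - b0 * b0 + (a1 * a1 - b1 * b1) + (a2 * a2 - b2 * b2)) * hre
      - (1 / 4 : ℝ) * (a0 * b0 + b0 * a0 + (a1 * b1 + b1 * a1) + (a2 * b2 + b2 * a2)) * him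
  have h0 := Complex.normSq_nonneg (φ z 0)
  have h1 := Complex.normSq_nonneg (φ z 1)
  have h2 := Complex.normSq_nonneg (φ z 2)
  exact (pow_left_inj₀ (norm_nonneg _) (by positivity) two_ne_zero).1 e1

/-- The third component of the Gauss map in terms of the form. -/
theorem IsPlaneEnd.planeGauss_apply_two (h : IsPlaneEnd x φ r) {z : ℂ}
    (hz : z ∈ Metric.ball (0 : ℂ) r \ {0}) {σ : ℝ} (hσ : σ ^ 2 = 1) :
    planeGauss x z 2 = σ * (‖φ z 0 + Complex.I * σ * φ z 1‖ - ‖φ z 0 - Complex.I * σ * φ z 1‖) /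
      (‖φ z 0 + Complex.I * σ * φ z 1‖ + ‖φ z 0 - Complex.I * σ * φ z 1‖) ∧
    0 < ‖φ z 0 + Complex.I * σ * φ z 1‖ + ‖φ z 0 - Complex.I * σ * φ z 1‖ := by
  -- Σ φ_j² = 0 factors as φ₂² = −f q. The sign σ is an orientation of the horizontal plane and
  -- allows the limits (0, 0, 1) and (0, 0, −1) to be treated together.
  set f := φ z 0 - Complex.I * σ * φ z 1 with hf
  set q := φ z 0 + Complex.I * σ * φ z 1 with hq
  have hσc : (σ : ℂ) ^ 2 = 1 := by exact_mod_cast hσ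
  have hfq : φ z 2 ^ 2 = -(f * q) := by
    have := h.sq z hz
    simp only [hf, hq]
    linear_combination this + (φ z 1) ^ 2 * (hσc - (σ : ℂ) ^ 2 * Complex.I_sq)
  have hnn : ‖φ z 2‖ ^ 2 = ‖f‖ * ‖q‖ := by
    rw [← norm_pow, hfq, norm_neg, norm_mul]
  have hpos : 0 < ‖q‖ + ‖f‖ := by
    by_contra hle
    have hf0 : f = 0 := norm_eq_zero.1 (by linarith [norm_nonneg f, norm_nonneg q])
    have hq0 : q = 0 := norm_eq_zero.1 (by linarith [norm_nonneg f, norm_nonneg q])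
    have h2 : φ z 2 = 0 := by
      rw [hf0, zero_mul, neg_zero] at hfq
      exact pow_eq_zero_iff two_ne_zero |>.1 hfq
    have h0 : φ z 0 = 0 := by linear_combination (hf0 + hq0) / 2
    have h1 : φ z 1 = 0 := by
      linear_combination (Complex.I * σ / 2) * (hf0 - hq0) + φ z 1 * (σ ^ 2 * Complex.I_sq - hσc)
    apply h.ne z hz
    ext j
    fin_cases j
    exacts [h0, h1, h2]
  have hd := h.deriv z hz
  have hN2 : planeNormal x z 2 = σ * (‖q‖ ^ 2 - ‖f‖ ^ 2) / 4 := by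
    rw [planeNormal, cross_apply_two, hd, hd, hd, hd, ← Complex.normSq_eq_norm_sq,
      ← Complex.normSq_eq_norm_sq, Complex.normSq_apply, Complex.normSq_apply]
    simp only [hf, hq, Complex.add_re, Complex.add_im, Complex.mul_re, Complex.mul_im, Complex.I_re,
      Complex.I_im, Complex.sub_re, Complex.sub_im, Complex.ofReal_re, Complex.ofReal_im,
      Complex.one_re, Complex.one_im]
    linear_combination ((φ z 0).im * (φ z 1).re - (φ z 0).re * (φ z 1).im) * (1 - hσ)
  have hNn : ‖planeNormal x z‖ = (‖q‖ + ‖f‖) ^ 2 / 4 := by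
    rw [h.norm_planeNormal hz, Complex.normSq_eq_norm_sq (φ z 2), hnn]
    have : ‖q‖ ^ 2 + ‖f‖ ^ 2 = 2 * (Complex.normSq (φ z 0) + Complex.normSq (φ z 1)) := by
      rw [← Complex.normSq_eq_norm_sq, ← Complex.normSq_eq_norm_sq]
      simp only [hf, hq, Complex.normSq_apply, Complex.add_re, Complex.add_im, Complex.mul_re,
        Complex.mul_im, Complex.sub_re, Complex.sub_im, Complex.I_re, Complex.I_im,
        Complex.ofReal_re, Complex.ofReal_im]
      linear_combination 2 * ((φ z 1).re ^ 2 + (φ z 1).im ^ 2) * hσ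
    linear_combination -this / 4
  refine ⟨?_, hpos⟩
  rw [planeGauss, PiLp.smul_apply, smul_eq_mul, hN2, hNn]
  field_simp
  ring

/-- An end with vertical limiting normal in terms of the Weierstrass data. -/
theorem IsPlaneEnd.exists_isMinimalEnd (h : IsPlaneEnd x φ r) {σ : ℝ} (hσ : σ ^ 2 = 1)
    (hN : Tendsto (fun z => planeGauss x z 2) (𝓝[≠] 0) (𝓝 (-σ))) :
    ∃ (g : ℂ → ℂ) (ε : ℝ), ε ≤ r ∧ IsMinimalEnd (fun z => (x z 0 : ℂ) - Complex.I * σ * x z 1)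
      (fun z => x z 2) (fun z => φ z 0 - Complex.I * σ * φ z 1) g ε ∧
      ∀ z ∈ Metric.ball (0 : ℂ) ε \ {0},
        (φ z 0 - Complex.I * σ * φ z 1) * g z = φ z 2 ∧
        (φ z 0 - Complex.I * σ * φ z 1) * g z ^ 2 = -(φ z 0 + Complex.I * σ * φ z 1) := by
  set f : ℂ → ℂ := fun z => φ z 0 - Complex.I * σ * φ z 1 with hf
  set q : ℂ → ℂ := fun z => φ z 0 + Complex.I * σ * φ z 1 with hq
  have hσc : (σ : ℂ) ^ 2 = 1 := by exact_mod_cast hσ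
  have hball := eventually_mem_puncturedBall h.pos
  -- σ N₃ = (|q| − |f|) / (|q| + |f|) tends to −σ² = −1, so q becomes negligible against f.
  have hlim : Tendsto (fun z => (‖q z‖ - ‖f z‖) / (‖q z‖ + ‖f z‖)) (𝓝[≠] 0) (𝓝 (-1)) := by
    have h1 := hN.const_mul σ
    have h2 : σ * -σ = -1 := by linear_combination -hσ
    rw [h2] at h1
    refine h1.congr' ?_
    filter_upwards [hball] with z hz
    rw [(h.planeGauss_apply_two hz hσ).1]
    simp only [hf, hq]
    rw [mul_div_assoc, ← mul_assoc, ← pow_two, hσ, one_mul]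
  -- `u = |q| / (|q| + |f|) → 0`
  have hu : Tendsto (fun z => ‖q z‖ / (‖q z‖ + ‖f z‖)) (𝓝[≠] 0) (𝓝 0) := by
    have h1 := (hlim.add_const 1).div_const 2
    norm_num at h1
    refine h1.congr' ?_
    filter_upwards [hball] with z hz
    have hp : 0 < ‖q z‖ + ‖f z‖ := (h.planeGauss_apply_two hz hσ).2
    field_simp
    ring
  have hfne : ∀ᶠ z in 𝓝[≠] 0, f z ≠ 0 := by
    filter_upwards [hball, hu.eventually (gt_mem_nhds one_pos)] with z hz h1 h0
    have hp : 0 < ‖q z‖ + ‖f z‖ := (h.planeGauss_apply_two hz hσ).2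
    rw [h0, norm_zero, add_zero] at hp h1
    rw [div_self hp.ne'] at h1
    exact lt_irrefl _ h1
  have hgq : ∀ z ∈ Metric.ball (0 : ℂ) r \ {0}, φ z 2 ^ 2 = -(f z * q z) := by
    intro z hz
    have := h.sq z hz
    simp only [hf, hq]
    linear_combination this + (φ z 1) ^ 2 * (hσc - (σ : ℂ) ^ 2 * Complex.I_sq)
  -- |g|² = |q| / |f|, which in terms of u = |q| / (|q| + |f|) is u / (1 − u).
  have hg0 : Tendsto (fun z => φ z 2 / f z) (𝓝[≠] 0) (𝓝 0) := by
    rw [tendsto_zero_iff_norm_tendsto_zero]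
    have h1 : Tendsto (fun z => √((‖q z‖ / (‖q z‖ + ‖f z‖)) / (1 - ‖q z‖ / (‖q z‖ + ‖f z‖)))) (𝓝[≠] 0)
        (𝓝 0) := by
      have := (hu.div (hu.const_sub 1) (by norm_num)).sqrt
      simpa using this
    refine h1.congr' ?_
    filter_upwards [hball, hfne] with z hz hf0
    have hp : 0 < ‖q z‖ + ‖f z‖ := (h.planeGauss_apply_two hz hσ).2
    have hfn : ‖f z‖ ≠ 0 := norm_ne_zero_iff.2 hf0
    rw [norm_div, ← Real.sqrt_sq (by positivity : 0 ≤ ‖φ z 2‖ / ‖f z‖), div_pow, ← norm_pow,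
      hgq z hz, norm_neg, norm_mul]
    congr 1
    have : 1 - ‖q z‖ / (‖q z‖ + ‖f z‖) = ‖f z‖ / (‖q z‖ + ‖f z‖) := by field_simp; ring
    rw [this]
    field_simp
  have hgle : ∀ᶠ z in 𝓝[≠] 0, ‖φ z 2 / f z‖ < 1 := by
    have := hg0.norm.eventually (gt_mem_nhds (show ‖(0 : ℂ)‖ < 1 by simp))
    exact this
  obtain ⟨ε, hε, hεr, hall⟩ := exists_radius_of_eventually (hfne.and hgle) h.pos
  have hs := puncturedBall_subset hεr
  set g : ℂ → ℂ := Function.update (fun z => φ z 2 / f z) 0 0 with hg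
  have hgz : ∀ z ∈ Metric.ball (0 : ℂ) ε \ {0}, g z = φ z 2 / f z := fun z hz =>
    Function.update_of_ne hz.2 _ _
  have hfd : DifferentiableOn ℂ f (Metric.ball 0 ε \ {0}) :=
    (((h.hol 0).sub ((h.hol 1).const_mul (Complex.I * σ)))).mono hs
  have hfg : ∀ z ∈ Metric.ball (0 : ℂ) ε \ {0}, f z * g z = φ z 2 := fun z hz => by
    rw [hgz z hz, mul_div_cancel₀ _ (hall z hz).1]
  have hfgg : ∀ z ∈ Metric.ball (0 : ℂ) ε \ {0}, f z * g z ^ 2 = -q z := fun z hz => by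
    rw [hgz z hz, div_pow, hgq z (hs hz)]
    have := (hall z hz).1
    field_simp
  refine ⟨g, ε, hεr, ⟨⟨hε, hfd, fun z hz => (hall z hz).1, fun δ δ' B h1 h2 h3 h4 => ?_⟩, ?_,
    Function.update_self _ _ _, fun z hz => ?_, fun z hz => ?_⟩, fun z hz => ⟨hfg z hz, hfgg z hz⟩⟩
  -- As |g| ≤ 1 on the smaller disc, every component of φ is bounded by |f|. A curve of bounded
  -- speed for |f| |dz| thus has bounded speed for φ as well.
  · refine h.complete δ δ' B h1 h2 (h3.mono_right hs) fun t ht => ?_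
    refine le_trans ?_ (h4 t ht)
    rw [norm_mul]
    refine mul_le_mul_of_nonneg_right ?_ (norm_nonneg _)
    have hz := h3 ht
    have hg1 : ‖g (δ t)‖ ≤ 1 := by rw [hgz _ hz]; exact (hall _ hz).2.le
    have hq1 : ‖q (δ t)‖ ≤ ‖f (δ t)‖ := by
      have : q (δ t) = -(f (δ t) * g (δ t) ^ 2) := by rw [hfgg _ hz, neg_neg]
      rw [this, norm_neg, norm_mul, norm_pow]
      exact mul_le_of_le_one_right (norm_nonneg _) (pow_le_one₀ (norm_nonneg _) hg1)
    have e0 : φ (δ t) 0 = (f (δ t) + q (δ t)) / 2 := by simp only [hf, hq]; ring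
    have e1 : φ (δ t) 1 = Complex.I * σ * (f (δ t) - q (δ t)) / 2 := by
      simp only [hf, hq]
      linear_combination φ (δ t) 1 * (σ ^ 2 * Complex.I_sq - hσc)
    have hσn : ‖(σ : ℂ)‖ = 1 := by
      have : ‖(σ : ℂ)‖ ^ 2 = 1 := by rw [← norm_pow, hσc, norm_one]
      exact (pow_eq_one_iff_of_nonneg (norm_nonneg _) two_ne_zero).1 this
    rw [pi_norm_le_iff_of_nonneg (norm_nonneg _)]
    intro j
    fin_cases j
    · change ‖φ (δ t) 0‖ ≤ _
      rw [e0, norm_div, Complex.norm_two]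
      linarith [norm_add_le (f (δ t)) (q (δ t))]
    · change ‖φ (δ t) 1‖ ≤ _
      rw [e1, norm_div, Complex.norm_two, norm_mul, norm_mul, Complex.norm_I, hσn, one_mul, one_mul]
      linarith [norm_sub_le (f (δ t)) (q (δ t))]
    · change ‖φ (δ t) 2‖ ≤ _
      rw [← hfg _ hz, norm_mul]
      exact mul_le_of_le_one_right (norm_nonneg _) hg1
  · refine (Complex.differentiableOn_compl_singleton_and_continuousAt_iff
      (Metric.ball_mem_nhds (0 : ℂ) hε)).1 ⟨?_, ?_⟩
    · exact (((h.hol 2).mono hs).div hfd fun z hz => (hall z hz).1).congr hgz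
    · rw [hg, continuousAt_update_same]
      exact hg0
  · have d0 := Complex.ofRealCLM.hasFDerivAt.comp z (h.hasFDerivAt_apply (hs hz) 0)
    have d1 := (Complex.ofRealCLM.hasFDerivAt.comp z (h.hasFDerivAt_apply (hs hz) 1)).const_mul
      (Complex.I * σ)
    refine (d0.sub d1).congr_fderiv ?_
    ext v
    have hre : ∀ w : ℂ, ((w.re : ℝ) : ℂ) = (w + conj w) / 2 := fun w => by
      rw [Complex.add_conj]; push_cast; ring
    rw [hfgg z hz]
    simp only [_root_.sub_apply, _root_.smul_apply, ContinuousLinearMap.comp_apply, one_apply_eq_self,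
      smul_eq_mul, Complex.reCLM_apply, Complex.ofRealCLM_apply, ContinuousLinearEquiv.coe_coe,
      Complex.conjCLE_apply, hre, map_mul, map_add, map_neg, Complex.conj_I,
      Complex.conj_ofReal, hf, hq]
    ring
  · refine (h.hasFDerivAt_apply (hs hz) 2).congr_fderiv ?_
    change _ = Complex.reCLM ∘L ((f z * g z) • (1 : ℂ →L[ℝ] ℂ))
    rw [hfg z hz]

/-- An embedded end with vertical limiting normal is a graph. -/
theorem IsPlaneEnd.exists_graph (h : IsPlaneEnd x φ r) (hinj : InjOn x (Metric.ball 0 r \ {0}))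
    {σ : ℝ} (hσ : σ ^ 2 = 1) (hN : Tendsto (fun z => planeGauss x z 2) (𝓝[≠] 0) (𝓝 (-σ))) :
    ∃ (e : OpenPartialHomeomorph ℂ ℂ) (κ b : ℂ) (a β C : ℝ) (P : Fin 3 → ℂ → ℂ), κ ≠ 0 ∧ 0 ∈ e.source ∧
      e 0 = 0 ∧ e.source ⊆ Metric.ball 0 r ∧
      (∀ z ∈ e.source, z ≠ 0 → (x z 0 : ℂ) - Complex.I * σ * x z 1 = κ / e z ∧
        |x z 2 - (a * Real.log ‖e z‖ + β + (b * e z).re)| ≤ C * ‖e z‖ ^ 2) ∧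
      ∀ᶠ z in 𝓝[≠] 0, HasDerivAt (P 0) (φ z 0) z ∧ HasDerivAt (P 1) (φ z 1) z ∧
        HasDerivAt (P 2) (φ z 2 - a / z) z := by
  have hσc : (σ : ℂ) ^ 2 = 1 := by exact_mod_cast hσ
  obtain ⟨g, ε, hεr, hm, hfg⟩ := h.exists_isMinimalEnd hσ hN
  have hs := puncturedBall_subset hεr
  obtain ⟨e, κ, b, a, β, C, F, G, H, hκ, he0, hee, her, hex, hprim⟩ := hm.exists_graph (by
    intro z hz w hw hzw
    refine hinj (hs hz) (hs hw) ?_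
    obtain ⟨h1, h2⟩ := Prod.ext_iff.1 hzw
    have hre := congrArg Complex.re h1
    have him := congrArg Complex.im h1
    simp at hre him h2
    have hσ0 : σ ≠ 0 := by rintro rfl; norm_num at hσ
    exact E3.ext hre (him.resolve_right hσ0) h2)
  -- The primitives come from φ₀ = (f − f g²) / 2, φ₁ = iσ (f + f g²) / 2 and φ₂ = f g.
  refine ⟨e, κ, b, a, β, C, ![fun z => (F z - G z) / 2, fun z => Complex.I * σ * (F z + G z) / 2, H],
    hκ, he0, hee, her.trans (Metric.ball_subset_ball hεr), hex, ?_⟩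
  filter_upwards [hprim, eventually_mem_puncturedBall hm.complete.pos] with z ⟨h1, h2, h3⟩ hz
  obtain ⟨e1, e2⟩ := hfg z hz
  rw [e2] at h2
  rw [e1] at h3
  refine ⟨((h1.sub h2).div_const 2).congr_deriv (by ring),
    (((h1.add h2).const_mul (Complex.I * σ)).div_const 2).congr_deriv ?_, h3⟩
  linear_combination φ z 1 * (hσc - σ ^ 2 * Complex.I_sq)

end PlaneEnds

/-! ### Residues and the existence of primitives -/

section Residues

theorem exists_radius_of_eventually_center {P : ℂ → Prop} {z₀ : ℂ} (hP : ∀ᶠ z in 𝓝[≠] z₀, P z) {r : ℝ}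
    (hr : 0 < r) : ∃ ε, 0 < ε ∧ ε ≤ r ∧ ∀ z ∈ Metric.ball z₀ ε \ {z₀}, P z := by
  rw [eventually_nhdsWithin_iff, Metric.eventually_nhds_iff_ball] at hP
  obtain ⟨ε, hε, h⟩ := hP
  exact ⟨min ε r, lt_min hε hr, min_le_right _ _, fun z hz =>
    h z (Metric.ball_subset_ball (min_le_left _ _) hz.1) hz.2⟩

/-- The residue is the obstruction to the existence of a primitive. -/
theorem IsResidue.eq_of_hasDerivAt {f F : ℂ → ℂ} {z₀ a c : ℂ} (h : IsResidue f z₀ c)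
    (hf : ∀ᶠ z in 𝓝[≠] z₀, ContinuousAt f z)
    (hF : ∀ᶠ z in 𝓝[≠] z₀, HasDerivAt F (f z - a / (z - z₀)) z) : c = a := by
  obtain ⟨r, hr, hc⟩ := h.circleIntegral_eq
  obtain ⟨ε, hε, hεr, hall⟩ := exists_radius_of_eventually_center (hf.and hF) hr
  have hs : Metric.sphere z₀ (ε / 2) ⊆ Metric.ball z₀ ε \ {z₀} := by
    intro z hz
    rw [mem_sphere_iff_norm] at hz
    refine ⟨by rw [mem_ball_iff_norm, hz]; linarith, ?_⟩
    rintro rfl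
    simp at hz
    linarith
  have h1 : (∮ z in C(z₀, ε / 2), (f z - a / (z - z₀))) = 0 :=
    circleIntegral.integral_eq_zero_of_hasDerivWithinAt (half_pos hε).le fun z hz =>
      (hall z (hs hz)).2.hasDerivWithinAt
  have hne : ∀ z ∈ Metric.sphere z₀ (ε / 2), z - z₀ ≠ 0 := fun z hz =>
    sub_ne_zero.2 (hs hz).2
  rw [circleIntegral.integral_sub] at h1
  · simp only [div_eq_mul_inv] at h1
    rw [circleIntegral.integral_const_mul, ← div_eq_mul_inv ε 2,
      circleIntegral.integral_sub_center_inv z₀ (half_pos hε).ne',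
      hc _ (half_pos hε) (by linarith)] at h1
    have h2 : 2 * (Real.pi : ℂ) * Complex.I * (c - a) = 0 := by linear_combination h1
    exact sub_eq_zero.1 ((mul_eq_zero.1 h2).resolve_left Complex.two_pi_I_ne_zero)
  · exact ContinuousOn.circleIntegrable (half_pos hε).le fun z hz =>
      (hall z (hs hz)).1.continuousWithinAt
  · refine ContinuousOn.circleIntegrable (half_pos hε).le (ContinuousOn.div continuousOn_const ?_ hne)
    fun_prop

end Residues

/-! ### Punctures of the surface as complete punctured discs -/

section SurfaceEnds

variable {R : Type*} [TopologicalSpace R] [ChartedSpace ℂ R]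

/-- The surface near `p` in a coordinate centred at `p`. -/
def endMap (X : R → E3) (p : R) (z : ℂ) : E3 := X ((chartAt ℂ p).symm (chartAt ℂ p p + z))

/-- The form near `p` in a coordinate centred at `p`. -/
def endForm (Φ : R → ℂ →L[ℂ] (Fin 3 → ℂ)) (p : R) (z : ℂ) : Fin 3 → ℂ :=
  formCoeff Φ (chartAt ℂ p) (chartAt ℂ p p + z)

/-- The set `M` contains the punctured coordinate disc of radius `r` around `p`. -/
def ContainsPuncturedDisc (M : Set R) (p : R) (r : ℝ) : Prop :=
  ∀ z ∈ Metric.ball (0 : ℂ) r, chartAt ℂ p p + z ∈ (chartAt ℂ p).target ∧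
    (z ≠ 0 → (chartAt ℂ p).symm (chartAt ℂ p p + z) ∈ M)

variable {M : Set R} {p : R} {X : R → E3} {Φ : R → ℂ →L[ℂ] (Fin 3 → ℂ)} {r : ℝ}

theorem ContainsPuncturedDisc.mono (h : ContainsPuncturedDisc M p r) {ε : ℝ} (hε : ε ≤ r) :
    ContainsPuncturedDisc M p ε := fun z hz => h z (Metric.ball_subset_ball hε hz)

theorem tendsto_chart_symm_add (p : R) :
    Tendsto (fun z => (chartAt ℂ p).symm (chartAt ℂ p p + z)) (𝓝[≠] 0) (𝓝[≠] p) := by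
  set e := chartAt ℂ p with he
  have h1 : e.symm (e p) = p := e.left_inv (mem_chart_source ℂ p)
  have hadd : Continuous fun z : ℂ => e p + z := by fun_prop
  have hadd0 : Tendsto (fun z : ℂ => e p + z) (𝓝 0) (𝓝 (e p)) := by simpa using hadd.tendsto 0
  refine tendsto_nhdsWithin_iff.2 ⟨?_, ?_⟩
  · have h2 : Tendsto e.symm (𝓝 (e p)) (𝓝 p) := by
      have := e.continuousAt_symm (mem_chart_target ℂ p)
      rwa [ContinuousAt, h1] at this
    exact (h2.comp hadd0).mono_left nhdsWithin_le_nhds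
  · have h3 : ∀ᶠ z : ℂ in 𝓝 0, e p + z ∈ e.target :=
      hadd0.eventually (e.open_target.mem_nhds (mem_chart_target ℂ p))
    filter_upwards [self_mem_nhdsWithin, h3.filter_mono nhdsWithin_le_nhds] with z hz hzt h0
    have h4 : e p + z = e p := e.symm.injOn hzt (mem_chart_target ℂ p) (by rw [h1]; exact h0)
    exact hz (by simpa using h4)

variable [IsManifold 𝓘(ℂ, ℂ) ω R]

theorem IsPuncture.exists_containsPuncturedDisc (hp : IsPuncture M p) :
    ∃ r > 0, ContainsPuncturedDisc M p r := by
  obtain ⟨r, hr, h1, h2⟩ := hp.exists_ball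
  have hmem : ∀ z ∈ Metric.ball (0 : ℂ) r, chartAt ℂ p p + z ∈ Metric.ball (chartAt ℂ p p) r := by
    intro z hz
    simpa using hz
  exact ⟨r, hr, fun z hz => ⟨h1 (hmem z hz), fun hz0 => (h2 ⟨hmem z hz, by simpa using hz0⟩).2⟩⟩

theorem IsConformalImmersionOn.gaussMap_endMap (hX : IsConformalImmersionOn X M) (hM : IsOpen M)
    (hr : ContainsPuncturedDisc M p r) {z : ℂ} (hz : z ∈ Metric.ball (0 : ℂ) r \ {0}) :
    gaussMap X ((chartAt ℂ p).symm (chartAt ℂ p p + z)) = planeGauss (endMap X p) z := by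
  have hd : chartAt ℂ p p + z ∈ chartDomain M p := ⟨(hr z hz.1).1, (hr z hz.1).2 hz.2⟩
  rw [hX.gaussMap_chart hM p hd]
  have : fderiv ℝ (endMap X p) z = fderiv ℝ (X ∘ (chartAt ℂ p).symm) (chartAt ℂ p p + z) :=
    fderiv_comp_add_left (f := X ∘ (chartAt ℂ p).symm) (chartAt ℂ p p)
  simp only [planeGauss, planeNormal, this]

/-- The factor 2 stands for √3. -/
theorem E3.norm_le_of_forall_abs_le {a : E3} {B : ℝ} (h : ∀ j, |a j| ≤ B) : ‖a‖ ≤ 2 * B := by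
  have hB : 0 ≤ B := (abs_nonneg _).trans (h 0)
  rw [EuclideanSpace.norm_eq, Real.sqrt_le_left (by positivity)]
  simp only [Fin.sum_univ_three, Real.norm_eq_abs]
  have := fun j => pow_le_pow_left₀ (abs_nonneg _) (h j) 2
  nlinarith [this 0, this 1, this 2]

/-- A puncture of a complete minimal surface. -/
theorem IsConformalImmersionOn.isPlaneEnd [T2Space R] (hX : IsConformalImmersionOn X M) (hM : IsOpen M)
    (hmin : IsMinimalOn X M) (hcomplete : IsCompleteOn X M) (hΦ : IsRealPartOfIntegralOn X Φ M)
    (hp : p ∉ M) (hr0 : 0 < r) (hr : ContainsPuncturedDisc M p r) :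
    IsPlaneEnd (endMap X p) (endForm Φ p) r := by
  set e := chartAt ℂ p with he
  have hd : ∀ z ∈ Metric.ball (0 : ℂ) r \ {0}, e p + z ∈ chartDomain M p := fun z hz =>
    ⟨(hr z hz.1).1, (hr z hz.1).2 hz.2⟩
  have hfd : ∀ z, fderiv ℝ (endMap X p) z = fderiv ℝ (X ∘ e.symm) (e p + z) := fun z =>
    fderiv_comp_add_left (f := X ∘ e.symm) (e p)
  refine ⟨hr0, fun j => ?_, fun z hz => ?_, fun z hz v j => ?_, fun z hz => ?_, fun z hz => ?_,
    fun δ δ' B h1 h2 h3 h4 h5 => ?_⟩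
  · exact (hX.differentiableOn_formCoeff hM hmin hΦ p j).comp (by fun_prop) hd
  · exact (hΦ.differentiableAt_chart p (hd z hz)).comp z
      (f := fun z => e p + z) (by fun_prop)
  · rw [hfd, hΦ.fderiv_chart p (hd z hz)]
    rfl
  · exact hX.sum_formCoeff_sq hM hΦ p (hd z hz)
  · exact hX.formCoeff_ne_zero hM hΦ p (hd z hz)
  · -- completeness
    set c : ℝ → ℂ := fun t => e p + δ t with hc
    have hcd : ∀ t ∈ Ico (0 : ℝ) 1, c t ∈ chartDomain M p := fun t ht => hd _ (h3 ht)
    have hδ1 : ContDiffOn ℝ 1 δ (Ico 0 1) := by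
      rw [contDiffOn_one_iff_derivWithin (uniqueDiffOn_Ico 0 1)]
      refine ⟨fun t ht => (h1 t ht).differentiableWithinAt, h2.congr fun t ht => ?_⟩
      exact (h1 t ht).derivWithin (uniqueDiffOn_Ico 0 1 t ht)
    have hmd : ContMDiffOn 𝓘(ℝ, ℝ) 𝓘(ℝ, ℂ) 1 (e.symm ∘ c) (Ico 0 1) := by
      have : IsManifold 𝓘(ℝ, ℂ) 1 R := isManifold_real 1
      exact (contMDiffOn_chart_symm (I := 𝓘(ℝ, ℂ)) (n := 1) (x := p)).comp
        (contDiffOn_const.add hδ1).contMDiffOn fun t ht => (hcd t ht).1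
    have hlim : Tendsto (e.symm ∘ c) (𝓝[<] 1) (𝓝 p) := by
      have e1 : e.symm (e p) = p := e.left_inv (mem_chart_source ℂ p)
      have e2 : Tendsto e.symm (𝓝 (e p)) (𝓝 p) := by
        have := e.continuousAt_symm (mem_chart_target ℂ p)
        rwa [ContinuousAt, e1] at this
      refine e2.comp ?_
      simpa using h5.const_add (e p)
    -- The curve tends to p, which is not in M; a compact K ⊆ M is closed, so its complement is a
    -- neighbourhood of p and the curve leaves K.
    have htop := hcomplete (e.symm ∘ c) hmd (fun t ht => (hcd t ht).2) fun K hK hKM =>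
      hlim.eventually (hK.isClosed.isOpen_compl.mem_nhds fun h => hp (hKM h))
    have hle : ∫⁻ t in Ico (0 : ℝ) 1, ‖differential X ((e.symm ∘ c) t) (velocity (e.symm ∘ c) t)‖ₑ ≤
        ENNReal.ofReal (2 * B) := by
      rw [setLIntegral_congr Ioo_ae_eq_Ico.symm]
      calc ∫⁻ t in Ioo (0 : ℝ) 1, ‖differential X ((e.symm ∘ c) t) (velocity (e.symm ∘ c) t)‖ₑ
          ≤ ∫⁻ _ in Ioo (0 : ℝ) 1, ENNReal.ofReal (2 * B) := by
            refine setLIntegral_mono measurable_const fun t ht => ?_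
            have ht' : t ∈ Ico (0 : ℝ) 1 := ⟨ht.1.le, ht.2⟩
            have hct : HasDerivAt c (δ' t) t :=
              ((h1 t ht').hasDerivAt (Ico_mem_nhds ht.1 ht.2)).const_add (e p)
            rw [(mdifferentiableAt_chart_symm_comp p hct.differentiableAt (hcd t ht').1).2, hct.deriv,
              ← ofReal_norm]
            refine ENNReal.ofReal_le_ofReal ?_
            rw [Function.comp_apply, ← hX.fderiv_chart hM p (hcd t ht')]
            refine E3.norm_le_of_forall_abs_le fun j => ?_
            rw [hΦ.fderiv_chart p (hcd t ht')]
            refine (Complex.abs_re_le_norm _).trans ?_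
            rw [norm_mul]
            exact (mul_le_mul_of_nonneg_right (norm_le_pi_norm (endForm Φ p (δ t)) j)
              (norm_nonneg _)).trans (h4 t ht')
        _ = ENNReal.ofReal (2 * B) := by simp
    exact absurd htop (hle.trans_lt ENNReal.ofReal_lt_top).ne

end SurfaceEnds

/-! ### Logarithmic growth of graphical ends -/

section EndGraphs

open scoped ComplexConjugate

/-- Near the puncture the surface is a graph over the horizontal plane: in the coordinate `e z`,
the horizontal coordinate is `κ / e z` and the height has a logarithmic expansion. -/
structure IsEndGraph (x : ℂ → E3) (σ : ℝ) (r : ℝ) (e : OpenPartialHomeomorph ℂ ℂ) (κ b : ℂ) (a β C : ℝ) :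
    Prop where
  sign : σ ^ 2 = 1
  ne_zero : κ ≠ 0
  zero_mem : 0 ∈ e.source
  map_zero : e 0 = 0
  subset : e.source ⊆ Metric.ball 0 r
  horizontal : ∀ z ∈ e.source, z ≠ 0 → (x z 0 : ℂ) - Complex.I * σ * x z 1 = κ / e z
  vertical : ∀ z ∈ e.source, z ≠ 0 →
    |x z 2 - (a * Real.log ‖e z‖ + β + (b * e z).re)| ≤ C * ‖e z‖ ^ 2

theorem normSq_sub_I_mul {σ : ℝ} (hσ : σ ^ 2 = 1) (s t : ℝ) :
    Complex.normSq ((s : ℂ) - Complex.I * σ * t) = s ^ 2 + t ^ 2 := by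
  simp [Complex.normSq_apply]
  linear_combination t ^ 2 * hσ

theorem norm_sub_I_mul {σ : ℝ} (hσ : σ ^ 2 = 1) (s t : ℝ) :
    ‖(s : ℂ) - Complex.I * σ * t‖ = √(s ^ 2 + t ^ 2) := by
  rw [Complex.norm_def, normSq_sub_I_mul hσ]

variable {x : ℂ → E3} {σ r : ℝ} {e : OpenPartialHomeomorph ℂ ℂ} {κ b : ℂ} {a β C : ℝ}

theorem IsEndGraph.map_ne_zero (h : IsEndGraph x σ r e κ b a β C) {z : ℂ} (hz : z ∈ e.source)
    (hz0 : z ≠ 0) : e z ≠ 0 := fun h0 =>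
  hz0 (e.injOn hz h.zero_mem (by rw [h0, h.map_zero]))

theorem IsEndGraph.symm_ne_zero (h : IsEndGraph x σ r e κ b a β C) {s : ℂ} (hs : s ∈ e.target)
    (hs0 : s ≠ 0) : e.symm s ≠ 0 := fun h0 => hs0 (by
  rw [← e.right_inv hs, h0, h.map_zero])

theorem IsEndGraph.sqrt_eq (h : IsEndGraph x σ r e κ b a β C) {z : ℂ} (hz : z ∈ e.source)
    (hz0 : z ≠ 0) : √(x z 0 ^ 2 + x z 1 ^ 2) = ‖κ‖ / ‖e z‖ := by
  rw [← norm_sub_I_mul h.sign, h.horizontal z hz hz0, norm_div]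

theorem IsEndGraph.exists_radius (h : IsEndGraph x σ r e κ b a β C) :
    ∃ ε > 0, Metric.ball 0 ε ⊆ e.target :=
  Metric.isOpen_iff.1 e.open_target 0 (h.map_zero ▸ e.map_source h.zero_mem)

/-- The point of the end over a given point of the horizontal plane. -/
theorem IsEndGraph.symm_apply (h : IsEndGraph x σ r e κ b a β C) {y₀ y₁ : ℝ}
    (hs : κ / ((y₀ : ℂ) - Complex.I * σ * y₁) ∈ e.target) (hy : (y₀ : ℂ) - Complex.I * σ * y₁ ≠ 0) :
    x (e.symm (κ / ((y₀ : ℂ) - Complex.I * σ * y₁))) 0 = y₀ ∧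
    x (e.symm (κ / ((y₀ : ℂ) - Complex.I * σ * y₁))) 1 = y₁ := by
  have h0 : κ / ((y₀ : ℂ) - Complex.I * σ * y₁) ≠ 0 := div_ne_zero h.ne_zero hy
  have h1 := h.horizontal _ (e.map_target hs) (h.symm_ne_zero hs h0)
  rw [e.right_inv hs, div_div_cancel₀ h.ne_zero] at h1
  have hre := congrArg Complex.re h1
  have him := congrArg Complex.im h1
  simp at hre him
  have hσ0 : σ ≠ 0 := by rintro rfl; have := h.sign; norm_num at this
  exact ⟨hre, him.resolve_right hσ0⟩

theorem IsEndGraph.tendsto_sqrt (h : IsEndGraph x σ r e κ b a β C) :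
    Tendsto (fun z => √(x z 0 ^ 2 + x z 1 ^ 2)) (𝓝[≠] 0) atTop := by
  have h1 : Tendsto (fun z => ‖e z‖) (𝓝[≠] 0) (𝓝[>] 0) := by
    refine tendsto_nhdsWithin_iff.2 ⟨?_, ?_⟩
    · have := (e.continuousAt h.zero_mem).norm.tendsto
      rw [h.map_zero, norm_zero] at this
      exact this.mono_left nhdsWithin_le_nhds
    · filter_upwards [self_mem_nhdsWithin,
        mem_nhdsWithin_of_mem_nhds (e.open_source.mem_nhds h.zero_mem)] with z h2 h3
      exact norm_pos_iff.2 (h.map_ne_zero h3 h2)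
  refine ((tendsto_inv_nhdsGT_zero.comp h1).const_mul_atTop (norm_pos_iff.2 h.ne_zero)).congr' ?_
  filter_upwards [self_mem_nhdsWithin,
    mem_nhdsWithin_of_mem_nhds (e.open_source.mem_nhds h.zero_mem)] with z h2 h3
  rw [h.sqrt_eq h3 h2, Function.comp_apply, div_eq_mul_inv]

/-- The height is logarithmic in the horizontal distance. -/
theorem IsEndGraph.exists_bound (h : IsEndGraph x σ r e κ b a β C) :
    ∃ B, ∀ᶠ z in 𝓝[≠] 0, |x z 2 + a * Real.log √(x z 0 ^ 2 + x z 1 ^ 2)| ≤ B := by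
  refine ⟨|C| + |a * Real.log ‖κ‖ + β| + ‖b‖, ?_⟩
  have h1 : ∀ᶠ z in 𝓝 (0 : ℂ), ‖e z‖ < 1 := by
    have := (e.continuousAt h.zero_mem).norm
    exact this.eventually (gt_mem_nhds (by simp [h.map_zero]))
  filter_upwards [self_mem_nhdsWithin, mem_nhdsWithin_of_mem_nhds h1,
    mem_nhdsWithin_of_mem_nhds (e.open_source.mem_nhds h.zero_mem)] with z h2 h3 h4
  have h5 := h.vertical z h4 h2
  have hez := norm_pos_iff.2 (h.map_ne_zero h4 h2)
  rw [h.sqrt_eq h4 h2, Real.log_div (norm_ne_zero_iff.2 h.ne_zero) hez.ne']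
  have e1 : x z 2 + a * (Real.log ‖κ‖ - Real.log ‖e z‖) =
      (x z 2 - (a * Real.log ‖e z‖ + β + (b * e z).re)) + (a * Real.log ‖κ‖ + β) + (b * e z).re := by
    ring
  rw [e1]
  refine (abs_add_three _ _ _).trans (add_le_add (add_le_add ?_ le_rfl) ?_)
  · refine h5.trans ?_
    have : C * ‖e z‖ ^ 2 ≤ |C| * 1 :=
      mul_le_mul (le_abs_self C) (pow_le_one₀ hez.le h3.le) (by positivity) (abs_nonneg _)
    linarith
  · refine (Complex.abs_re_le_norm _).trans ?_
    rw [norm_mul]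
    exact mul_le_of_le_one_right (norm_nonneg _) h3.le

variable {R : Type*} [TopologicalSpace R] [ChartedSpace ℂ R] {M : Set R} {p : R} {Y : R → E3}

/-- A graphical end has a logarithmic growth. -/
theorem IsEndGraph.hasLogGrowth (h : IsEndGraph (endMap Y p) σ r e κ b a β C)
    (hr : ContainsPuncturedDisc M p r) : HasLogGrowth Y M p (-a) := by
  obtain ⟨ε, hε, hball⟩ := h.exists_radius
  set c := chartAt ℂ p with hc
  have hr' : ∀ z ∈ Metric.ball (0 : ℂ) r, c p + z ∈ c.target ∧ (z ≠ 0 → c.symm (c p + z) ∈ M) := hr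
  have hκ := norm_pos_iff.2 h.ne_zero
  -- The disc |s| < ε corresponds to the exterior domain ρ > |κ| / ε, because ρ = |κ| / |s|.
  set U : Set ℂ := e.source ∩ e ⁻¹' Metric.ball 0 ε with hU
  have hUo : IsOpen U := e.isOpen_inter_preimage Metric.isOpen_ball
  have hU0 : (0 : ℂ) ∈ U := ⟨h.zero_mem, by simp [h.map_zero, hε]⟩
  have hWn : c.source ∩ c ⁻¹' ((fun w => w - c p) ⁻¹' U) ∈ 𝓝 p := by
    refine (c.isOpen_inter_preimage (hUo.preimage (by fun_prop))).mem_nhds ⟨mem_chart_source ℂ p, ?_⟩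
    simpa using hU0
  have hsmall : ∀ y₀ y₁ : ℝ, ‖κ‖ / ε < √(y₀ ^ 2 + y₁ ^ 2) →
      (y₀ : ℂ) - Complex.I * σ * y₁ ≠ 0 ∧
      κ / ((y₀ : ℂ) - Complex.I * σ * y₁) ∈ Metric.ball (0 : ℂ) ε := by
    intro y₀ y₁ hy
    rw [← norm_sub_I_mul h.sign] at hy
    have hpos : 0 < ‖(y₀ : ℂ) - Complex.I * σ * y₁‖ := (by positivity : 0 < ‖κ‖ / ε).trans hy
    refine ⟨norm_pos_iff.1 hpos, ?_⟩
    rw [mem_ball_zero_iff, norm_div, div_lt_iff₀ hpos]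
    rwa [div_lt_iff₀' hε] at hy
  -- log |s| = log |κ| − log ρ reverses the sign of the logarithmic coefficient and adds a log |κ|
  -- to the constant. The term Re(b s) = Re(b κ / (x₁ − iσ x₂)) supplies the two coefficients of
  -- order ρ⁻¹.
  refine ⟨_, ‖κ‖ / ε, fun y₀ y₁ => endMap Y p (e.symm (κ / ((y₀ : ℂ) - Complex.I * σ * y₁))) 2,
    β + a * Real.log ‖κ‖, (b * κ).re, -σ * (b * κ).im, C * ‖κ‖ ^ 2, hWn, ?_, by positivity, ?_, ?_⟩
  · rintro q ⟨⟨h1, h2⟩, h3⟩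
    have h4 : c q - c p ≠ 0 := fun h0 => h3 (c.injOn h1 (mem_chart_source ℂ p) (sub_eq_zero.1 h0))
    have := (hr' _ (h.subset h2.1)).2 h4
    rwa [add_sub_cancel, c.left_inv h1] at this
  · ext y
    constructor
    · rintro ⟨q, ⟨⟨h1, h2⟩, h3⟩, rfl⟩
      have h4 : c q - c p ≠ 0 := fun h0 => h3 (c.injOn h1 (mem_chart_source ℂ p) (sub_eq_zero.1 h0))
      have h5 : Y q = endMap Y p (c q - c p) := by
        rw [endMap, add_sub_cancel, c.left_inv h1]
      have h8 : c q - c p ∈ e.source := h2.1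
      have h6 := norm_pos_iff.2 (h.map_ne_zero h8 h4)
      have h7 : ‖e (c q - c p)‖ < ε := mem_ball_zero_iff.1 h2.2
      refine ⟨?_, ?_⟩
      · rw [h5, h.sqrt_eq h8 h4]
        exact div_lt_div_of_pos_left hκ h6 h7
      · simp only [h5]
        rw [h.horizontal _ h8 h4, div_div_cancel₀ h.ne_zero, e.left_inv h8]
    · rintro ⟨h1, h2⟩
      obtain ⟨h3, h4⟩ := hsmall _ _ h1
      set s := κ / ((y 0 : ℂ) - Complex.I * σ * y 1) with hs
      have hs0 : s ≠ 0 := div_ne_zero h.ne_zero h3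
      have hst := hball h4
      have h5 := hr' _ (h.subset (e.map_target hst))
      refine ⟨c.symm (c p + e.symm s), ⟨⟨c.map_target h5.1, ?_⟩, ?_⟩, ?_⟩
      · rw [mem_preimage, c.right_inv h5.1]
        refine ⟨by simpa using e.map_target hst, ?_⟩
        simpa [e.right_inv hst] using h4
      · intro h6
        have h7 := congrArg c h6
        rw [c.right_inv h5.1] at h7
        exact h.symm_ne_zero hst hs0 (by simpa using h7)
      · obtain ⟨e1, e2⟩ := h.symm_apply hst h3
        exact E3.ext e1 e2 h2.symm
  · intro y₀ y₁ hy
    obtain ⟨h3, h4⟩ := hsmall _ _ hy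
    have hst := hball h4
    set s := κ / ((y₀ : ℂ) - Complex.I * σ * y₁) with hs
    have hs0 : s ≠ 0 := div_ne_zero h.ne_zero h3
    have hv := h.vertical _ (e.map_target hst) (h.symm_ne_zero hst hs0)
    rw [e.right_inv hst] at hv
    have hpos : 0 < √(y₀ ^ 2 + y₁ ^ 2) := (by positivity : 0 < ‖κ‖ / ε).trans hy
    have hn : ‖s‖ = ‖κ‖ / √(y₀ ^ 2 + y₁ ^ 2) := by rw [hs, norm_div, norm_sub_I_mul h.sign]
    have hsq : 0 < y₀ ^ 2 + y₁ ^ 2 := Real.sqrt_pos.1 hpos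
    have hre : (b * s).re = ((b * κ).re * y₀ + -σ * (b * κ).im * y₁) / (y₀ ^ 2 + y₁ ^ 2) := by
      have e1 : b * s = (b * κ) / ((y₀ : ℂ) - Complex.I * σ * y₁) := by rw [hs, mul_div_assoc]
      rw [e1, Complex.div_re, normSq_sub_I_mul h.sign]
      simp
      ring
    rw [hn, Real.log_div hκ.ne' hpos.ne', div_pow, Real.sq_sqrt hsq.le, hre] at hv
    have e2 : C * (‖κ‖ ^ 2 / (y₀ ^ 2 + y₁ ^ 2)) = C * ‖κ‖ ^ 2 / (y₀ ^ 2 + y₁ ^ 2) := by ring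
    rw [e2] at hv
    refine le_trans (le_of_eq ?_) hv
    congr 1
    ring

omit [ChartedSpace ℂ R] in
-- On ρ > r the constant, the term of order ρ⁻¹ and the error are all bounded. This weaker form is
-- all that uniqueness of the growth and verticality of the normal require.
theorem HasLogGrowth.exists_bound {α : ℝ} (h : HasLogGrowth Y M p α) :
    ∃ r > 0, ∃ B, ∀ᶠ q in 𝓝[≠] p, r < √(Y q 0 ^ 2 + Y q 1 ^ 2) ∧
      |Y q 2 - α * Real.log √(Y q 0 ^ 2 + Y q 1 ^ 2)| ≤ B := by
  obtain ⟨W, r, u, β, γ₁, γ₂, C, hW, -, hr, himg, hu⟩ := h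
  refine ⟨r, hr, |C| / r ^ 2 + |β| + (|γ₁| + |γ₂|) / r, ?_⟩
  filter_upwards [self_mem_nhdsWithin, mem_nhdsWithin_of_mem_nhds hW] with q h1 h2
  have h3 : Y q ∈ Y '' (W \ {p}) := mem_image_of_mem _ ⟨h2, h1⟩
  rw [himg] at h3
  obtain ⟨h4, h5⟩ := h3
  refine ⟨h4, ?_⟩
  have h6 := hu _ _ h4
  rw [← h5] at h6
  set ρ := √(Y q 0 ^ 2 + Y q 1 ^ 2) with hρ
  have hρ0 : 0 < ρ := hr.trans h4
  have hsq : Y q 0 ^ 2 + Y q 1 ^ 2 = ρ ^ 2 := by rw [hρ, Real.sq_sqrt (by positivity)]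
  rw [hsq] at h6
  have e1 : Y q 2 - α * Real.log ρ = (Y q 2 - (α * Real.log ρ + β + (γ₁ * Y q 0 + γ₂ * Y q 1) / ρ ^ 2))
      + β + (γ₁ * Y q 0 + γ₂ * Y q 1) / ρ ^ 2 := by ring
  rw [e1]
  have a0 : |Y q 0| ≤ ρ := Real.abs_le_sqrt (by nlinarith [sq_nonneg (Y q 1)])
  have a1 : |Y q 1| ≤ ρ := Real.abs_le_sqrt (by nlinarith [sq_nonneg (Y q 0)])
  refine (abs_add_three _ _ _).trans (add_le_add (add_le_add ?_ le_rfl) ?_)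
  · refine h6.trans ((div_le_div_of_nonneg_right (le_abs_self C) (by positivity)).trans ?_)
    exact div_le_div_of_nonneg_left (abs_nonneg _) (by positivity) (by gcongr)
  · rw [abs_div, abs_of_pos (by positivity : 0 < ρ ^ 2)]
    have : |γ₁ * Y q 0 + γ₂ * Y q 1| ≤ (|γ₁| + |γ₂|) * ρ := by
      refine (abs_add_le _ _).trans ?_
      rw [abs_mul, abs_mul, add_mul]
      gcongr
    calc |γ₁ * Y q 0 + γ₂ * Y q 1| / ρ ^ 2 ≤ ((|γ₁| + |γ₂|) * ρ) / ρ ^ 2 := by gcongr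
      _ = (|γ₁| + |γ₂|) / ρ := by field_simp
      _ ≤ (|γ₁| + |γ₂|) / r := by gcongr

/-- The logarithmic growth of a graphical end is determined by the surface. -/
theorem IsEndGraph.logGrowth_eq (h : IsEndGraph (endMap Y p) σ r e κ b a β C) {α : ℝ}
    (hα : HasLogGrowth Y M p α) : α = -a := by
  obtain ⟨r', -, B, hB⟩ := hα.exists_bound
  obtain ⟨B', hB'⟩ := h.exists_bound
  by_contra hne
  have hne' : 0 < |α + a| := abs_pos.2 fun h0 => hne (by linarith)
  have h1 := (tendsto_chart_symm_add p).eventually hB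
  -- Two different growths would leave |α + a| log ρ bounded, although ρ → ∞ at the puncture.
  have h2 : Tendsto (fun z => |α + a| * Real.log √(endMap Y p z 0 ^ 2 + endMap Y p z 1 ^ 2)) (𝓝[≠] 0)
      atTop := (Real.tendsto_log_atTop.comp h.tendsto_sqrt).const_mul_atTop hne'
  obtain ⟨z, h3, h4, h5⟩ := (h1.and (hB'.and (h2.eventually (eventually_gt_atTop (B + B'))))).exists
  have h6 : |endMap Y p z 2 - α * Real.log √(endMap Y p z 0 ^ 2 + endMap Y p z 1 ^ 2)| ≤ B := h3.2
  set L := Real.log √(endMap Y p z 0 ^ 2 + endMap Y p z 1 ^ 2) with hL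
  have h7 : |(α + a) * L| ≤ B + B' := by
    have : (α + a) * L = (endMap Y p z 2 + a * L) - (endMap Y p z 2 - α * L) := by ring
    rw [this]
    refine (abs_sub _ _).trans ?_
    linarith
  rw [abs_mul] at h7
  have : |α + a| * L ≤ |α + a| * |L| := mul_le_mul_of_nonneg_left (le_abs_self L) (abs_nonneg _)
  linarith

/-- Embedded ends with vertical limiting normal: the logarithmic growth is minus the residue. -/
theorem IsPlaneEnd.exists_logGrowth {φ : ℂ → Fin 3 → ℂ} (h : IsPlaneEnd (endMap Y p) φ r)
    (hr : ContainsPuncturedDisc M p r) (hinj : InjOn (endMap Y p) (Metric.ball 0 r \ {0}))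
    (hσ : σ ^ 2 = 1) (hN : Tendsto (fun z => planeGauss (endMap Y p) z 2) (𝓝[≠] 0) (𝓝 (-σ))) :
    ∃ a : ℝ, HasLogGrowth Y M p (-a) ∧ (∀ α, HasLogGrowth Y M p α → α = -a) ∧
      ∀ c : Fin 3 → ℂ, (∀ j, IsResidue (fun z => φ (z - chartAt ℂ p p) j) (chartAt ℂ p p) (c j)) →
        c 0 = 0 ∧ c 1 = 0 ∧ c 2 = a := by
  obtain ⟨e, κ, b, a, β, C, P, hκ, he0, hee, her, hx, hP⟩ := h.exists_graph hinj hσ hN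
  have hg : IsEndGraph (endMap Y p) σ r e κ b a β C :=
    ⟨hσ, hκ, he0, hee, her, fun z h1 h2 => (hx z h1 h2).1, fun z h1 h2 => (hx z h1 h2).2⟩
  refine ⟨a, hg.hasLogGrowth hr, fun α hα => hg.logGrowth_eq hα, fun c hc => ?_⟩
  set z₀ := chartAt ℂ p p with hz₀
  have htr : Tendsto (fun z => z - z₀) (𝓝[≠] z₀) (𝓝[≠] 0) := by
    refine tendsto_nhdsWithin_iff.2 ⟨?_, ?_⟩
    · have : Continuous fun z : ℂ => z - z₀ := by fun_prop
      simpa using (this.tendsto z₀).mono_left nhdsWithin_le_nhds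
    · filter_upwards [self_mem_nhdsWithin] with z hz using sub_ne_zero.2 hz
  have hcont : ∀ j, ∀ᶠ z in 𝓝[≠] z₀, ContinuousAt (fun z => φ (z - z₀) j) z := by
    intro j
    filter_upwards [htr.eventually (eventually_mem_puncturedBall h.pos)] with z hz
    have h1 : ContinuousAt (fun z => φ z j) (z - z₀) :=
      ((h.hol j).continuousOn.continuousAt ((isOpen_puncturedBall r).mem_nhds hz))
    exact h1.comp (f := fun z => z - z₀) (by fun_prop)
  have hP' := htr.eventually hP
  have hsub : ∀ (F : ℂ → ℂ) (d z : ℂ), HasDerivAt F d (z - z₀) → HasDerivAt (fun z => F (z - z₀)) d z :=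
    fun F d z hd => HasDerivAt.comp_sub_const z z₀ hd
  -- The horizontal components of φ have single-valued primitives, and the vertical one has a
  -- primitive after subtraction of a / z; this determines all residues.
  refine ⟨(hc 0).eq_of_hasDerivAt (F := fun z => P 0 (z - z₀)) (a := 0) (hcont 0) (hP'.mono fun z hz => ?_),
    (hc 1).eq_of_hasDerivAt (F := fun z => P 1 (z - z₀)) (a := 0) (hcont 1) (hP'.mono fun z hz => ?_),
    (hc 2).eq_of_hasDerivAt (F := fun z => P 2 (z - z₀)) (hcont 2) (hP'.mono fun z hz => ?_)⟩
  · exact (hsub _ _ _ hz.1).congr_deriv (by simp)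
  · exact (hsub _ _ _ hz.2.1).congr_deriv (by simp)
  · exact hsub _ _ _ hz.2.2

end EndGraphs

/-! ### Rotations of space acting on ends -/

section Rotations

/-- The matrix of a linear isometry of `E3`. -/
def rotationEntry (A : E3 ≃ₗᵢ[ℝ] E3) (i j : Fin 3) : ℝ := A (EuclideanSpace.single j 1) i

theorem isometry_apply_eq_sum (A : E3 ≃ₗᵢ[ℝ] E3) (a : E3) (i : Fin 3) :
    A a i = ∑ j, rotationEntry A i j * a j := by
  have h1 : a = ∑ j, a j • (EuclideanSpace.single j (1 : ℝ) : E3) := by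
    ext i
    fin_cases i <;> simp [Fin.sum_univ_three]
  conv_lhs => rw [h1]
  rw [map_sum]
  simp only [map_smul, WithLp.ofLp_sum, Finset.sum_apply, PiLp.smul_apply, smul_eq_mul, rotationEntry]
  exact Finset.sum_congr rfl fun j _ => mul_comm _ _

theorem sum_rotationEntry_mul (A : E3 ≃ₗᵢ[ℝ] E3) (j k : Fin 3) :
    ∑ i, rotationEntry A i j * rotationEntry A i k = if j = k then 1 else 0 := by
  have h := A.inner_map_map (EuclideanSpace.single j (1 : ℝ)) (EuclideanSpace.single k (1 : ℝ))
  rw [EuclideanSpace.inner_single_left, inner_E3] at h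
  simp only [Fin.sum_univ_three, rotationEntry]
  rw [h]
  simp

theorem det_isometry_eq (A : E3 ≃ₗᵢ[ℝ] E3) :
    LinearMap.det (A.toLinearEquiv : E3 →ₗ[ℝ] E3) = (Matrix.of (rotationEntry A)).det := by
  rw [← LinearMap.det_toMatrix (EuclideanSpace.basisFun (Fin 3) ℝ).toBasis]
  congr 1

/-- Paired with A c, both sides are triple products, and the determinant of the triple (A a, A b, A
c) is det A times that of (a, b, c). -/
theorem cross_map_map (A : E3 ≃ₗᵢ[ℝ] E3) (a b : E3) :
    cross (A a) (A b) = LinearMap.det (A.toLinearEquiv : E3 →ₗ[ℝ] E3) • A (cross a b) := by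
  refine ext_inner_right ℝ fun c => ?_
  obtain ⟨d, rfl⟩ := A.surjective c
  rw [real_inner_smul_left, A.inner_map_map, det_isometry_eq, Matrix.det_fin_three]
  simp only [inner_E3, cross_apply_zero, cross_apply_one, cross_apply_two, isometry_apply_eq_sum,
    Fin.sum_univ_three, Matrix.of_apply]
  ring

/-- The form of a rotated surface. -/
def rotateForm (A : E3 ≃ₗᵢ[ℝ] E3) (φ : ℂ → Fin 3 → ℂ) (z : ℂ) : Fin 3 → ℂ :=
  fun i => ∑ j, (rotationEntry A i j : ℂ) * φ z j

theorem sum_rotationEntry_mul_complex (A : E3 ≃ₗᵢ[ℝ] E3) (j k : Fin 3) :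
    ∑ i, (rotationEntry A i j : ℂ) * rotationEntry A i k = if j = k then 1 else 0 := by
  have := congrArg (Complex.ofReal) (sum_rotationEntry_mul A j k)
  push_cast at this
  rw [this]
  split_ifs <;> simp

theorem sum_rotationEntry_mul_rotateForm (A : E3 ≃ₗᵢ[ℝ] E3) (φ : ℂ → Fin 3 → ℂ) (z : ℂ) (k : Fin 3) :
    ∑ i, (rotationEntry A i k : ℂ) * rotateForm A φ z i = φ z k := by
  simp only [rotateForm, Finset.mul_sum]
  rw [Finset.sum_comm]
  have : ∀ j, ∑ i, (rotationEntry A i k : ℂ) * ((rotationEntry A i j : ℂ) * φ z j) =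
      (if k = j then 1 else 0) * φ z j := fun j => by
    rw [← sum_rotationEntry_mul_complex A k j, Finset.sum_mul]
    exact Finset.sum_congr rfl fun i _ => (mul_assoc _ _ _).symm
  simp [this]

variable {x : ℂ → E3} {φ : ℂ → Fin 3 → ℂ} {r : ℝ}

theorem fderiv_rotate (A : E3 ≃ₗᵢ[ℝ] E3) (z : ℂ) (v : ℂ) :
    fderiv ℝ (fun z => A (x z)) z v = A (fderiv ℝ x z v) := by
  have := A.toContinuousLinearEquiv.comp_fderiv (f := x) (x := z)
  exact congrArg (fun L => L v) this

theorem planeGauss_rotate (A : E3 ≃ₗᵢ[ℝ] E3)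
    (hA : LinearMap.det (A.toLinearEquiv : E3 →ₗ[ℝ] E3) = 1) (x : ℂ → E3) (z : ℂ) :
    planeGauss (fun z => A (x z)) z = A (planeGauss x z) := by
  have h : planeNormal (fun z => A (x z)) z = A (planeNormal x z) := by
    rw [planeNormal, fderiv_rotate, fderiv_rotate, cross_map_map, hA, one_smul]
    rfl
  rw [planeGauss, planeGauss, h, A.norm_map, map_smul]

theorem abs_rotationEntry_le (A : E3 ≃ₗᵢ[ℝ] E3) (i j : Fin 3) : |rotationEntry A i j| ≤ 1 := by
  have h := sum_rotationEntry_mul A j j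
  rw [if_pos rfl] at h
  have h2 : rotationEntry A i j * rotationEntry A i j ≤ 1 := by
    rw [← h]
    exact Finset.single_le_sum (f := fun i => rotationEntry A i j * rotationEntry A i j)
      (fun i _ => mul_self_nonneg _) (Finset.mem_univ i)
  exact abs_le_one_iff_mul_self_le_one.2 h2

/-- A real orthogonal matrix preserves Σ φ_j² also over the complex numbers. Its entries and those
of its inverse are at most 1 in modulus, so the maximum norms of the forms are comparable with
factor 3, and completeness persists. -/
theorem IsPlaneEnd.rotate (h : IsPlaneEnd x φ r) (A : E3 ≃ₗᵢ[ℝ] E3) :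
    IsPlaneEnd (fun z => A (x z)) (rotateForm A φ) r := by
  have hnorm : ∀ z, ‖φ z‖ ≤ 3 * ‖rotateForm A φ z‖ := by
    intro z
    rw [pi_norm_le_iff_of_nonneg (by positivity)]
    intro k
    rw [← sum_rotationEntry_mul_rotateForm A φ z k]
    refine (norm_sum_le _ _).trans ?_
    have : ∀ i ∈ Finset.univ, ‖(rotationEntry A i k : ℂ) * rotateForm A φ z i‖ ≤ ‖rotateForm A φ z‖ := by
      intro i _
      rw [norm_mul, Complex.norm_real, Real.norm_eq_abs]
      exact (mul_le_of_le_one_left (norm_nonneg _) (abs_rotationEntry_le A i k)).trans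
        (norm_le_pi_norm _ i)
    simpa using Finset.sum_le_card_nsmul _ _ _ this
  refine ⟨h.pos, fun j => ?_, fun z hz => ?_, fun z hz v j => ?_, fun z hz => ?_, fun z hz h0 => ?_,
    fun δ δ' B h1 h2 h3 h4 => ?_⟩
  · exact DifferentiableOn.fun_sum fun i _ => (h.hol i).const_mul _
  · exact A.toContinuousLinearEquiv.differentiableAt.comp z (h.diff z hz)
  · rw [fderiv_rotate, isometry_apply_eq_sum]
    simp only [h.deriv z hz, rotateForm, Finset.sum_mul, Complex.re_sum, mul_assoc,
      Complex.re_ofReal_mul]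
  · have hs := h.sq z hz
    have := fun j k => sum_rotationEntry_mul_complex A j k
    simp only [Fin.sum_univ_three] at this
    have h00 := this 0 0
    have h01 := this 0 1
    have h02 := this 0 2
    have h11 := this 1 1
    have h12 := this 1 2
    have h22 := this 2 2
    simp at h00 h01 h02 h11 h12 h22
    simp only [rotateForm, Fin.sum_univ_three]
    linear_combination hs + (φ z 0) ^ 2 * h00 + (φ z 1) ^ 2 * h11 + (φ z 2) ^ 2 * h22 +
      2 * φ z 0 * φ z 1 * h01 + 2 * φ z 0 * φ z 2 * h02 + 2 * φ z 1 * φ z 2 * h12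
  · apply h.ne z hz
    rw [← norm_le_zero_iff]
    refine (hnorm z).trans ?_
    rw [h0]
    simp
  · refine h.complete δ δ' (3 * B) h1 h2 h3 fun t ht => ?_
    calc ‖φ (δ t)‖ * ‖δ' t‖ ≤ 3 * ‖rotateForm A φ (δ t)‖ * ‖δ' t‖ := by gcongr; exact hnorm _
      _ ≤ 3 * B := by rw [mul_assoc]; gcongr; exact h4 t ht

theorem det_isometry_trans (A B : E3 ≃ₗᵢ[ℝ] E3) :
    LinearMap.det ((A.trans B).toLinearEquiv : E3 →ₗ[ℝ] E3) =
      LinearMap.det (B.toLinearEquiv : E3 →ₗ[ℝ] E3) * LinearMap.det (A.toLinearEquiv : E3 →ₗ[ℝ] E3) := by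
  rw [← LinearMap.det_comp]
  rfl

/-- The reflection in the plane orthogonal to a vector. -/
theorem det_reflection_span {v : E3} (hv : v ≠ 0) :
    LinearMap.det (((ℝ ∙ v)ᗮ.reflection).toLinearEquiv : E3 →ₗ[ℝ] E3) = -1 := by
  have := Submodule.det_reflection (ℝ ∙ v)ᗮ
  rw [Submodule.orthogonal_orthogonal, finrank_span_singleton hv, pow_one] at this
  exact this

/-- Every unit vector can be rotated to the vertical. -/
theorem exists_rotation {ν : E3} (hν : ‖ν‖ = 1) :
    ∃ A : E3 ≃ₗᵢ[ℝ] E3, LinearMap.det (A.toLinearEquiv : E3 →ₗ[ℝ] E3) = 1 ∧ A ν = !₂[0, 0, 1] := by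
  set e₃ : E3 := !₂[0, 0, 1] with he₃
  have he : ‖e₃‖ = 1 := by simp [he₃, EuclideanSpace.norm_eq, Fin.sum_univ_three]
  by_cases hne : ν = e₃
  · refine ⟨LinearIsometryEquiv.refl ℝ E3, ?_, by simpa using hne⟩
    have : ((LinearIsometryEquiv.refl ℝ E3).toLinearEquiv : E3 →ₗ[ℝ] E3) = LinearMap.id := rfl
    rw [this, LinearMap.det_id]
  · set e₁ : E3 := !₂[1, 0, 0] with he₁
    have he₁0 : e₁ ≠ 0 := by
      intro h
      have := congrArg (fun a : E3 => a 0) h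
      simp [he₁] at this
    -- The first reflection takes ν to e₃, the second fixes e₃ and restores the determinant 1.
    refine ⟨((ℝ ∙ (ν - e₃))ᗮ.reflection).trans ((ℝ ∙ e₁)ᗮ.reflection), ?_, ?_⟩
    · rw [det_isometry_trans, det_reflection_span (sub_ne_zero.2 hne), det_reflection_span he₁0]
      norm_num
    · rw [LinearIsometryEquiv.trans_apply, Submodule.reflection_sub (by rw [hν, he])]
      refine Submodule.reflection_mem_subspace_eq_self ?_
      rw [Submodule.mem_orthogonal_singleton_iff_inner_right, inner_E3]
      simp [he₁, he₃]

end Rotations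

/-! ### Vertical embedded ends of the surface -/

section VerticalEnds

variable {R : Type*} [TopologicalSpace R] [ChartedSpace ℂ R] {M : Set R} {p : R} {X : R → E3}
  {Φ : R → ℂ →L[ℂ] (Fin 3 → ℂ)} {r : ℝ}

/-- The end map is injective if the surface is. -/
theorem ContainsPuncturedDisc.injOn_endMap (hr : ContainsPuncturedDisc M p r) {S : Set R}
    (hS : InjOn X S) (hrS : ∀ z ∈ Metric.ball (0 : ℂ) r, z ≠ 0 →
      (chartAt ℂ p).symm (chartAt ℂ p p + z) ∈ S) :
    InjOn (endMap X p) (Metric.ball 0 r \ {0}) := by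
  intro z hz w hw hzw
  have h1 := hS (hrS z hz.1 hz.2) (hrS w hw.1 hw.2) hzw
  have h2 := (chartAt ℂ p).symm.injOn (hr z hz.1).1 (hr w hw.1).1 h1
  exact add_left_cancel h2

theorem exists_radius_chart {D : Set R} (hD : IsOpen D) (hp : p ∈ D) :
    ∃ ε > 0, ∀ z ∈ Metric.ball (0 : ℂ) ε, (chartAt ℂ p).symm (chartAt ℂ p p + z) ∈ D := by
  set e := chartAt ℂ p with he
  have h1 : e.symm (e p) = p := e.left_inv (mem_chart_source ℂ p)
  have h2 : Tendsto (fun z : ℂ => e.symm (e p + z)) (𝓝 0) (𝓝 p) := by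
    have h3 := e.continuousAt_symm (mem_chart_target ℂ p)
    rw [ContinuousAt, h1] at h3
    refine h3.comp ?_
    have : Continuous fun z : ℂ => e p + z := by fun_prop
    simpa using this.tendsto 0
  exact Metric.eventually_nhds_iff_ball.1 (h2.eventually (hD.mem_nhds hp))

theorem endForm_sub (z : ℂ) (j : Fin 3) : endForm Φ p (z - chartAt ℂ p p) j =
    formCoeff Φ (chartAt ℂ p) z j := by
  rw [endForm, add_sub_cancel]

theorem tendsto_apply_two {l : Filter ℂ} {N : ℂ → E3} {ν : E3} (h : Tendsto N l (𝓝 ν)) :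
    Tendsto (fun z => N z 2) l (𝓝 (ν 2)) :=
  ((EuclideanSpace.proj (𝕜 := ℝ) 2 : E3 →L[ℝ] ℝ).continuous.tendsto ν).comp h

variable [IsManifold 𝓘(ℂ, ℂ) ω R]

theorem IsConformalImmersionOn.tendsto_planeGauss (hX : IsConformalImmersionOn X M) (hM : IsOpen M)
    (hr0 : 0 < r) (hr : ContainsPuncturedDisc M p r) {ν : E3}
    (hν : Tendsto (gaussMap X) (𝓝[≠] p) (𝓝 ν)) :
    Tendsto (planeGauss (endMap X p)) (𝓝[≠] 0) (𝓝 ν) := by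
  refine (hν.comp (tendsto_chart_symm_add p)).congr' ?_
  filter_upwards [eventually_mem_puncturedBall hr0] with z hz
  exact hX.gaussMap_endMap hM hr hz

/-- The flux of a vertical embedded end. -/
theorem IsVerticalEmbeddedEnd.exists_logGrowth [T2Space R] (hX : IsConformalImmersionOn X M)
    (hM : IsOpen M) (hmin : IsMinimalOn X M) (hcomplete : IsCompleteOn X M)
    (hΦ : IsRealPartOfIntegralOn X Φ M) (hp : IsVerticalEmbeddedEnd X M p) :
    ∃ a : ℝ, HasLogGrowth X M p (-a) ∧ (∀ α, HasLogGrowth X M p α → α = -a) ∧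
      ∀ c : Fin 3 → ℂ, IsFormResidue Φ p c → c 0 = 0 ∧ c 1 = 0 ∧ c 2 = a := by
  obtain ⟨hpunc, ⟨D, hD, hpD, hDM, hinj, -⟩, hN⟩ := hp
  obtain ⟨r₁, hr₁, hr⟩ := hpunc.exists_containsPuncturedDisc
  obtain ⟨r₂, hr₂, hrD⟩ := exists_radius_chart hD hpD
  have hr' := hr.mono (min_le_left r₁ r₂)
  have hpos : 0 < min r₁ r₂ := lt_min hr₁ hr₂
  have hend := hX.isPlaneEnd hM hmin hcomplete hΦ hpunc.1 hpos hr'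
  have hinj' := hr'.injOn_endMap hinj fun z hz hz0 =>
    ⟨hrD z (Metric.ball_subset_ball (min_le_right _ _) hz), fun h =>
      hpunc.1 (h ▸ (hr' z hz).2 hz0)⟩
  -- σ is minus the third component of the limit normal, the sign for which g vanishes at the
  -- puncture.
  obtain ⟨σ, hσ, hlim⟩ : ∃ σ : ℝ, σ ^ 2 = 1 ∧
      Tendsto (fun z => planeGauss (endMap X p) z 2) (𝓝[≠] 0) (𝓝 (-σ)) := by
    rcases hN with h | h
    · refine ⟨-1, by norm_num, ?_⟩
      simpa using tendsto_apply_two (hX.tendsto_planeGauss hM hpos hr' h)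
    · refine ⟨1, by norm_num, ?_⟩
      simpa using tendsto_apply_two (hX.tendsto_planeGauss hM hpos hr' h)
  obtain ⟨a, h1, h2, h3⟩ := hend.exists_logGrowth hr' hinj' hσ hlim
  refine ⟨a, h1, h2, fun c hc => h3 c fun j => ?_⟩
  simp only [endForm_sub]
  exact hc j

end VerticalEnds

/-! ### Functions that omit a set of positive area have a limit -/

section CauchyTransform

/-- The Cauchy transform of a plane set. -/
def cauchyTransform (K : Set ℂ) (w : ℂ) : ℂ := ∫ t in K, (t - w)⁻¹

variable {K : Set ℂ}

theorem continuousOn_inv_sub {w : ℂ} (hw : w ∉ K) : ContinuousOn (fun t : ℂ => (t - w)⁻¹) K :=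
  ContinuousOn.inv₀ (by fun_prop) fun t ht => sub_ne_zero.2 fun h => hw (h ▸ ht)

/-- Differentiation under the integral: near a point outside K the denominators stay away from zero.
-/
theorem IsCompact.differentiableAt_cauchyTransform (hK : IsCompact K) {w : ℂ} (hw : w ∉ K) :
    DifferentiableAt ℂ (cauchyTransform K) w := by
  obtain ⟨ε, hε, hball⟩ := Metric.isOpen_iff.1 hK.isClosed.isOpen_compl w hw
  have hfar : ∀ t ∈ K, ∀ v ∈ Metric.ball w (ε / 2), ε / 2 ≤ ‖t - v‖ := by
    intro t ht v hv
    by_contra! h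
    refine hball ?_ ht
    rw [Metric.mem_ball] at hv ⊢
    have := dist_triangle t v w
    rw [dist_eq_norm t v] at this
    linarith
  have hvK : ∀ v ∈ Metric.ball w (ε / 2), v ∉ K := fun v hv hvK => by
    have := hfar v hvK v hv
    rw [sub_self, norm_zero] at this
    linarith
  have hmeas := hK.measurableSet
  have : IsFiniteMeasure (volume.restrict K) := ⟨by
    rw [Measure.restrict_apply_univ]; exact hK.measure_lt_top⟩
  have hb := half_pos hε
  refine (hasDerivAt_integral_of_dominated_loc_of_deriv_le (μ := volume.restrict K)
    (F := fun v t => (t - v)⁻¹) (F' := fun v t => ((t - v) ^ 2)⁻¹) (bound := fun _ => ((ε / 2) ^ 2)⁻¹)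
    (Metric.ball_mem_nhds w hb) ?_ ?_ ?_ ?_ (integrable_const _) ?_).2.differentiableAt
  · filter_upwards [Metric.ball_mem_nhds w hb] with v hv
    exact (continuousOn_inv_sub (hvK v hv)).aestronglyMeasurable hmeas
  · exact (continuousOn_inv_sub hw).integrableOn_compact hK
  · have : ContinuousOn (fun t : ℂ => ((t - w) ^ 2)⁻¹) K :=
      ((continuousOn_inv_sub hw).pow 2).congr fun t _ => by simp
    exact this.aestronglyMeasurable hmeas
  · refine (ae_restrict_iff' hmeas).2 (ae_of_all _ fun t ht v hv => ?_)
    rw [norm_inv, norm_pow]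
    have := hfar t ht v hv
    gcongr
  · refine (ae_restrict_iff' hmeas).2 (ae_of_all _ fun t ht v hv => ?_)
    have hne : t - v ≠ 0 := sub_ne_zero.2 fun h => hvK v hv (h ▸ ht)
    refine ((hasDerivAt_id v).const_sub t).fun_inv hne |>.congr_deriv ?_
    simp

/-- In polar coordinates the area element r dr dθ cancels the singularity. -/
theorem integrableOn_norm_inv_ball : IntegrableOn (fun t : ℂ => ‖t‖⁻¹) (Metric.ball 0 1) := by
  rw [integrableOn_fun_norm_addHaar volume (f := fun y : ℝ => y⁻¹), Complex.finrank_real_complex]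
  refine (integrableOn_const (C := (1 : ℝ)) (by simp) (by simp)).congr_fun (fun y hy => ?_)
    measurableSet_Ioo
  simp [hy.1.ne']

/-- 1 / |t − w| is at most 1 outside the unit disc around w, and its integral over that disc does
not depend on w by translation invariance. -/
theorem IsCompact.exists_norm_cauchyTransform_le (hK : IsCompact K) :
    ∃ C, ∀ w ∉ K, ‖cauchyTransform K w‖ ≤ C := by
  refine ⟨(∫ t in Metric.ball (0 : ℂ) 1, ‖t‖⁻¹) + volume.real K, fun w hw => ?_⟩
  have hshift : Integrable (fun t => (Metric.ball (0 : ℂ) 1).indicator (fun t => ‖t‖⁻¹) (t - w)) :=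
    (integrableOn_norm_inv_ball.integrable_indicator measurableSet_ball).comp_sub_right w
  have hint : IntegrableOn (fun t => (Metric.ball (0 : ℂ) 1).indicator (fun t => ‖t‖⁻¹) (t - w) + 1) K :=
    hshift.integrableOn.add (integrableOn_const hK.measure_lt_top.ne)
  calc ‖cauchyTransform K w‖ ≤ ∫ t in K, ‖(t - w)⁻¹‖ := norm_integral_le_integral_norm _
    _ ≤ ∫ t in K, ((Metric.ball (0 : ℂ) 1).indicator (fun t => ‖t‖⁻¹) (t - w) + 1) := by
      refine integral_mono ((continuousOn_inv_sub hw).integrableOn_compact hK).norm hint fun t => ?_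
      by_cases ht : t - w ∈ Metric.ball (0 : ℂ) 1
      · simp [indicator_of_mem ht]
      · simp only [indicator_of_notMem ht, zero_add, norm_inv]
        rw [mem_ball_zero_iff, not_lt] at ht
        exact inv_le_one_of_one_le₀ ht
    _ = (∫ t in K, (Metric.ball (0 : ℂ) 1).indicator (fun t => ‖t‖⁻¹) (t - w)) + volume.real K := by
      rw [integral_add hshift.integrableOn (integrableOn_const hK.measure_lt_top.ne)]
      simp
    _ ≤ (∫ t, (Metric.ball (0 : ℂ) 1).indicator (fun t => ‖t‖⁻¹) (t - w)) + volume.real K := by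
      refine add_le_add ?_ le_rfl
      refine setIntegral_le_integral hshift (ae_of_all volume fun t => ?_)
      exact indicator_nonneg (f := fun t : ℂ => ‖t‖⁻¹) (fun t _ => inv_nonneg.2 (norm_nonneg t)) (t - w)
    _ = _ := by
      rw [integral_sub_right_eq_self (fun t => (Metric.ball (0 : ℂ) 1).indicator (fun t => ‖t‖⁻¹) t) w,
        integral_indicator measurableSet_ball]

/-- The transform decays at infinity, so a constant value would be 0. But Re 1 / (t + 2) ≥ 1 / 9 for
|t| ≤ 1, so that at w = −2 the real part is positive. -/
theorem IsCompact.exists_cauchyTransform_ne (hK : IsCompact K) (hK1 : K ⊆ Metric.closedBall 0 1)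
    (hpos : volume K ≠ 0) (L : ℂ) : ∃ w ∉ K, cauchyTransform K w ≠ L := by
  by_contra! h
  have hmeas := hK.measurableSet
  have hnot : ∀ T : ℝ, 1 < T → -(T : ℂ) ∉ K := fun T hT hm => by
    have := hK1 hm
    rw [mem_closedBall_zero_iff, norm_neg, Complex.norm_real, Real.norm_eq_abs,
      abs_of_pos (by linarith)] at this
    linarith
  have hle : ∀ t ∈ K, ‖t‖ ≤ 1 := fun t ht => mem_closedBall_zero_iff.1 (hK1 ht)
  have hvol : 0 < volume.real K := ENNReal.toReal_pos hpos hK.measure_lt_top.ne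
  have hL : ∀ T : ℝ, 1 < T → ‖L‖ * (T - 1) ≤ volume.real K := by
    intro T hT
    rw [← h _ (hnot T hT), ← le_div_iff₀ (by linarith), div_eq_inv_mul]
    refine norm_setIntegral_le_of_norm_le_const hK.measure_lt_top fun t ht => ?_
    rw [norm_inv, sub_neg_eq_add]
    have h1 := norm_sub_le (t + T) t
    rw [add_sub_cancel_left, Complex.norm_real, Real.norm_eq_abs, abs_of_pos (by linarith)] at h1
    have h2 := hle t ht
    exact inv_anti₀ (by linarith) (by linarith)
  have hL0 : L = 0 := by
    rw [← norm_le_zero_iff]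
    by_contra! hpos'
    have h1 := hL (volume.real K / ‖L‖ + 2) (by have : 0 < volume.real K / ‖L‖ := by positivity
                                                linarith)
    have h2 : ‖L‖ * (volume.real K / ‖L‖ + 2 - 1) = volume.real K + ‖L‖ := by field_simp; ring
    linarith
  have h2 := h _ (hnot 2 (by norm_num))
  have hint : IntegrableOn (fun t : ℂ => (t - (-((2 : ℝ) : ℂ)))⁻¹) K :=
    (continuousOn_inv_sub (hnot 2 (by norm_num))).integrableOn_compact hK
  have h3 : (∫ t in K, ((t - (-((2 : ℝ) : ℂ)))⁻¹).re) = 0 := by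
    have e : (∫ t in K, ((t - (-((2 : ℝ) : ℂ)))⁻¹).re) = (cauchyTransform K (-((2 : ℝ) : ℂ))).re :=
      integral_re hint
    rw [e, h2, hL0, Complex.zero_re]
  have h4 : ∫ t in K, (1 / 9 : ℝ) ≤ ∫ t in K, ((t - (-((2 : ℝ) : ℂ)))⁻¹).re := by
    refine setIntegral_mono_on (integrableOn_const hK.measure_lt_top.ne) hint.re hmeas fun t ht => ?_
    have h5 := hle t ht
    have h6 : ‖t‖ ^ 2 = t.re ^ 2 + t.im ^ 2 := by
      rw [← Complex.normSq_eq_norm_sq, Complex.normSq_apply]; ring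
    have h7 : t.re ^ 2 + t.im ^ 2 ≤ 1 := by
      rw [← h6]; exact pow_le_one₀ (norm_nonneg _) h5
    have h8 : -1 ≤ t.re := by nlinarith [sq_nonneg t.im]
    simp only [Complex.inv_re, Complex.normSq_apply, sub_neg_eq_add, Complex.add_re, Complex.add_im,
      Complex.ofReal_re, Complex.ofReal_im, add_zero]
    rw [le_div_iff₀ (by nlinarith [sq_nonneg t.im])]
    nlinarith
  rw [h3] at h4
  simp at h4
  linarith

theorem exists_tendsto_of_bounded {h : ℂ → ℂ} (hd : ∀ᶠ z in 𝓝[≠] (0 : ℂ), DifferentiableAt ℂ h z)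
    {C : ℝ} (hC : ∀ᶠ z in 𝓝[≠] (0 : ℂ), ‖h z‖ ≤ C) : ∃ L, Tendsto h (𝓝[≠] 0) (𝓝 L) := by
  refine ⟨_, Complex.tendsto_limUnder_of_differentiable_on_punctured_nhds_of_bounded_under hd ?_⟩
  refine ⟨C + ‖h 0‖, eventually_map.2 ?_⟩
  filter_upwards [hC] with z hz
  exact norm_sub_le_of_le hz le_rfl

/-- A holomorphic function on a punctured disc that omits a set of positive measure has a limit. -/
theorem exists_tendsto_of_omits {r : ℝ} (hr : 0 < r) (hK : IsCompact K)
    (hK1 : K ⊆ Metric.closedBall 0 1) (hpos : volume K ≠ 0) {g : ℂ → ℂ}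
    (hg : DifferentiableOn ℂ g (Metric.ball 0 r \ {0}))
    (hgK : ∀ z ∈ Metric.ball (0 : ℂ) r \ {0}, g z ∉ K) :
    (∃ w, Tendsto g (𝓝[≠] 0) (𝓝 w)) ∨ Tendsto (fun z => ‖g z‖) (𝓝[≠] 0) atTop := by
  have hball := eventually_mem_puncturedBall hr
  have hgd : ∀ z ∈ Metric.ball (0 : ℂ) r \ {0}, DifferentiableAt ℂ g z := fun z hz =>
    hg.differentiableAt ((isOpen_puncturedBall r).mem_nhds hz)
  obtain ⟨C, hC⟩ := hK.exists_norm_cauchyTransform_le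
  -- The composition with g is bounded and holomorphic, so the singularity at the puncture is
  -- removable.
  obtain ⟨L, hL⟩ := exists_tendsto_of_bounded (h := fun z => cauchyTransform K (g z)) (C := C)
    (hball.mono fun z hz => (hK.differentiableAt_cauchyTransform (hgK z hz)).comp z (hgd z hz))
    (hball.mono fun z hz => hC _ (hgK z hz))
  -- Where the transform of g is close to L, the value g cannot be close to w. Hence 1 / (g − w) is
  -- bounded and has a limit l; l = 0 means that g tends to infinity.
  obtain ⟨w, hw, hwL⟩ := hK.exists_cauchyTransform_ne hK1 hpos L
  obtain ⟨U, V, hU, hV, hwU, hLV, hUV⟩ := t2_separation hwL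
  have hUn : ∀ᶠ v in 𝓝 w, cauchyTransform K v ∈ U :=
    (hK.differentiableAt_cauchyTransform hw).continuousAt.eventually (hU.mem_nhds hwU)
  obtain ⟨ε, hε, hεU⟩ := Metric.eventually_nhds_iff_ball.1 hUn
  have hfar : ∀ᶠ z in 𝓝[≠] (0 : ℂ), ε ≤ ‖g z - w‖ := by
    filter_upwards [hL.eventually (hV.mem_nhds hLV)] with z hz
    by_contra! h
    exact disjoint_left.1 hUV (hεU (g z) (by rwa [mem_ball_iff_norm])) hz
  have hne : ∀ᶠ z in 𝓝[≠] (0 : ℂ), g z - w ≠ 0 := hfar.mono fun z hz => by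
    rw [← norm_pos_iff]; linarith
  obtain ⟨l, hl⟩ := exists_tendsto_of_bounded (h := fun z => (g z - w)⁻¹) (C := ε⁻¹)
    (by filter_upwards [hball, hne] with z hz hz0
        exact ((hgd z hz).sub_const w).inv hz0)
    (hfar.mono fun z hz => by rw [norm_inv]; gcongr)
  by_cases hl0 : l = 0
  · right
    have h1 : Tendsto (fun z => (g z - w)⁻¹) (𝓝[≠] 0) (𝓝[≠] 0) :=
      tendsto_nhdsWithin_iff.2 ⟨hl0 ▸ hl, hne.mono fun z hz => inv_ne_zero hz⟩
    have h2 := (tendsto_norm_inv_nhdsNE_zero_atTop (α := ℂ)).comp h1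
    refine tendsto_atTop_mono' _ ?_ (tendsto_atTop_add_const_right _ (-‖w‖) h2)
    filter_upwards with z
    simp only [Function.comp_apply, inv_inv]
    linarith [norm_sub_le (g z) w]
  · left
    refine ⟨l⁻¹ + w, ((hl.inv₀ hl0).add_const w).congr fun z => by simp⟩

end CauchyTransform

/-! ### The Gauss map has a limit at an end of finite total curvature -/

section GaussMapLimit

variable {x : ℂ → E3} {φ : ℂ → Fin 3 → ℂ} {r : ℝ}

/-- The area density of the Gauss map. -/
def gaussArea (x : ℂ → E3) (z : ℂ) : ℝ :=
  |⟪cross (fderiv ℝ (planeGauss x) z 1) (fderiv ℝ (planeGauss x) z Complex.I), planeGauss x z⟫|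

theorem gaussArea_rotate (A : E3 ≃ₗᵢ[ℝ] E3)
    (hA : LinearMap.det (A.toLinearEquiv : E3 →ₗ[ℝ] E3) = 1) (x : ℂ → E3) (z : ℂ) :
    gaussArea (fun z => A (x z)) z = gaussArea x z := by
  have h : planeGauss (fun z => A (x z)) = fun z => A (planeGauss x z) :=
    funext (planeGauss_rotate A hA x)
  rw [gaussArea, h, fderiv_rotate, fderiv_rotate, cross_map_map, hA, one_smul, A.inner_map_map,
    gaussArea]

theorem IsPlaneEnd.planeNormal_ne_zero (h : IsPlaneEnd x φ r) {z : ℂ}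
    (hz : z ∈ Metric.ball (0 : ℂ) r \ {0}) : planeNormal x z ≠ 0 := by
  rw [← norm_pos_iff, h.norm_planeNormal hz]
  have h0 := Complex.normSq_nonneg (φ z 0)
  have h1 := Complex.normSq_nonneg (φ z 1)
  have h2 := Complex.normSq_nonneg (φ z 2)
  by_contra hle
  refine h.ne z hz (funext fun j => ?_)
  rw [Pi.zero_apply, ← Complex.normSq_eq_zero]
  fin_cases j
  · change Complex.normSq (φ z 0) = 0
    linarith
  · change Complex.normSq (φ z 1) = 0
    linarith
  · change Complex.normSq (φ z 2) = 0
    linarith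

theorem IsPlaneEnd.norm_planeGauss (h : IsPlaneEnd x φ r) {z : ℂ}
    (hz : z ∈ Metric.ball (0 : ℂ) r \ {0}) : ‖planeGauss x z‖ = 1 := by
  rw [planeGauss, norm_smul, norm_inv, norm_norm, inv_mul_cancel₀]
  exact norm_ne_zero_iff.2 (h.planeNormal_ne_zero hz)

theorem IsPlaneEnd.differentiableAt_planeGauss (h : IsPlaneEnd x φ r) {z : ℂ}
    (hz : z ∈ Metric.ball (0 : ℂ) r \ {0}) : DifferentiableAt ℝ (planeGauss x) z := by
  have hn := (isOpen_puncturedBall r).mem_nhds hz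
  have hφ : ∀ j, DifferentiableAt ℝ (fun w => φ w j) z := fun j =>
    ((h.hol j).differentiableAt hn).restrictScalars ℝ
  have hre : ∀ j, DifferentiableAt ℝ (fun w => (φ w j * 1).re) z := fun j =>
    Complex.reCLM.differentiableAt.comp z ((hφ j).mul_const 1)
  have him : ∀ j, DifferentiableAt ℝ (fun w => (φ w j * Complex.I).re) z := fun j =>
    Complex.reCLM.differentiableAt.comp z ((hφ j).mul_const Complex.I)
  have hcomp : ∀ j v, (fun w => fderiv ℝ x w v j) =ᶠ[𝓝 z] fun w => (φ w j * v).re := fun j v =>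
    eventually_of_mem hn fun w hw => h.deriv w hw v j
  have h1 : ∀ j, DifferentiableAt ℝ (fun w => fderiv ℝ x w 1 j) z := fun j =>
    (hre j).congr_of_eventuallyEq (hcomp j 1)
  have h2 : ∀ j, DifferentiableAt ℝ (fun w => fderiv ℝ x w Complex.I j) z := fun j =>
    (him j).congr_of_eventuallyEq (hcomp j Complex.I)
  have hN : DifferentiableAt ℝ (planeNormal x) z := by
    rw [differentiableAt_euclidean]
    intro i
    fin_cases i
    · exact ((h1 1).mul (h2 2)).sub ((h1 2).mul (h2 1))
    · exact ((h1 2).mul (h2 0)).sub ((h1 0).mul (h2 2))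
    · exact ((h1 0).mul (h2 1)).sub ((h1 1).mul (h2 0))
  exact ((hN.norm ℝ (h.planeNormal_ne_zero hz)).inv
    (norm_ne_zero_iff.2 (h.planeNormal_ne_zero hz))).smul hN

/-- The horizontal part of the Gauss map. -/
def horizontalGauss (x : ℂ → E3) (z : ℂ) : ℂ := ⟨planeGauss x z 0, planeGauss x z 1⟩

theorem det_complex (L : ℂ →L[ℝ] ℂ) :
    L.det = (L 1).re * (L Complex.I).im - (L Complex.I).re * (L 1).im := by
  rw [ContinuousLinearMap.det, ← LinearMap.det_toMatrix Complex.basisOneI, Matrix.det_fin_two]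
  simp [LinearMap.toMatrix_apply]

/-- N_u × N_v is a multiple of N, since the derivative of a unit vector field is tangent to the
sphere. Vertical projection multiplies area on the sphere by N₃, and |N₃| ≤ 1. -/
theorem IsPlaneEnd.hasFDerivAt_horizontalGauss (h : IsPlaneEnd x φ r) {z : ℂ}
    (hz : z ∈ Metric.ball (0 : ℂ) r \ {0}) :
    ∃ L : ℂ →L[ℝ] ℂ, HasFDerivAt (horizontalGauss x) L z ∧ |L.det| ≤ gaussArea x z := by
  have hN := (h.differentiableAt_planeGauss hz).hasFDerivAt
  set N' := fderiv ℝ (planeGauss x) z with hN'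
  have hcomp : ∀ j : Fin 3, HasFDerivAt (fun w => planeGauss x w j)
      ((EuclideanSpace.proj (𝕜 := ℝ) j : E3 →L[ℝ] ℝ) ∘L N') z := fun j =>
    (EuclideanSpace.proj (𝕜 := ℝ) j : E3 →L[ℝ] ℝ).hasFDerivAt.comp z hN
  have hperp : ∀ v, ⟪planeGauss x z, N' v⟫ = 0 := by
    intro v
    have h1 := hN.inner ℝ hN
    have h2 : (fun w => ⟪planeGauss x w, planeGauss x w⟫) =ᶠ[𝓝 z] fun _ => 1 :=
      eventually_of_mem ((isOpen_puncturedBall r).mem_nhds hz) fun w hw => by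
        simp [h.norm_planeGauss hw]
    have h3 := congrArg (fun L => L v) (h1.unique ((hasFDerivAt_const (1 : ℝ) z).congr_of_eventuallyEq h2))
    simp [real_inner_comm] at h3
    linarith [real_inner_comm (planeGauss x z) (N' v)]
  refine ⟨_, ((Complex.ofRealCLM.hasFDerivAt.comp z (hcomp 0)).add
    ((Complex.ofRealCLM.hasFDerivAt.comp z (hcomp 1)).const_mul Complex.I)).congr_of_eventuallyEq ?_, ?_⟩
  · filter_upwards with w
    apply Complex.ext <;> simp [horizontalGauss]
  · set n := planeGauss x z with hn
    have hn1 : ⟪n, n⟫ = 1 := by simp [h.norm_planeGauss hz, hn]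
    have h1 := hperp 1
    have h2 := hperp Complex.I
    have hproj : ∀ (j : Fin 3) (v : E3), (EuclideanSpace.proj (𝕜 := ℝ) j : E3 →L[ℝ] ℝ) v = v j :=
      fun _ _ => rfl
    rw [gaussArea, ← hn, ← hN', det_complex]
    simp only [_root_.add_apply, _root_.smul_apply, ContinuousLinearMap.comp_apply,
      hproj, Complex.ofRealCLM_apply, smul_eq_mul, Complex.add_re, Complex.add_im,
      Complex.mul_re, Complex.mul_im, Complex.I_re, Complex.I_im, Complex.ofReal_re, Complex.ofReal_im,
      zero_mul, one_mul, mul_zero, sub_zero, add_zero, zero_add]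
    rw [inner_E3] at h1 h2 hn1
    set D := ⟪cross (N' 1) (N' Complex.I), n⟫ with hD
    have hD' : D * n 2 = N' 1 0 * N' Complex.I 1 - N' 1 1 * N' Complex.I 0 := by
      rw [hD, inner_E3, cross_apply_zero, cross_apply_one, cross_apply_two]
      linear_combination (N' 1 0 * N' Complex.I 1 - N' 1 1 * N' Complex.I 0) * hn1 +
        (N' Complex.I 0 * n 1 - N' Complex.I 1 * n 0) * h1 +
        (N' 1 1 * n 0 - N' 1 0 * n 1) * h2
    have hle : |n 2| ≤ 1 := by
      rw [abs_le_one_iff_mul_self_le_one]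
      nlinarith [mul_self_nonneg (n 0), mul_self_nonneg (n 1)]
    calc _ = |D * n 2| := by rw [hD']; congr 1; ring
      _ ≤ |D| := by rw [abs_mul]; exact mul_le_of_le_one_right (abs_nonneg _) hle

/-- The Gauss map omits many values near an end of finite total curvature. -/
theorem IsPlaneEnd.exists_omitted (h : IsPlaneEnd x φ r)
    (hfin : ∫⁻ z in Metric.ball (0 : ℂ) r \ {0}, ENNReal.ofReal (gaussArea x z) ≠ ⊤) :
    ∃ ε, 0 < ε ∧ ε ≤ r ∧
      volume (Metric.ball (0 : ℂ) 1 \ horizontalGauss x '' (Metric.ball 0 ε \ {0})) ≠ 0 := by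
  -- By absolute continuity of the integral, the horizontal Gauss image of a small punctured disc
  -- has area at most 1, less than the area π of the unit disc.
  obtain ⟨δ, hδ, hsmall⟩ := exists_pos_setLIntegral_lt_of_measure_lt hfin one_ne_zero
  have hvol : ∃ ε, 0 < ε ∧ ε ≤ r ∧ volume (Metric.ball (0 : ℂ) ε) < δ := by
    have h1 : Tendsto (fun ε : ℝ => volume (Metric.ball (0 : ℂ) ε)) (𝓝 0) (𝓝 0) := by
      simp only [Complex.volume_ball]
      have : Tendsto (fun ε : ℝ => ENNReal.ofReal ε ^ 2 * (NNReal.pi : ℝ≥0∞)) (𝓝 0)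
          (𝓝 (ENNReal.ofReal 0 ^ 2 * (NNReal.pi : ℝ≥0∞))) :=
        ENNReal.Tendsto.mul_const ((ENNReal.continuous_pow 2).tendsto _ |>.comp
          (ENNReal.continuous_ofReal.tendsto 0)) (Or.inr ENNReal.coe_ne_top)
      simpa using this
    have h2 := ((h1.eventually (gt_mem_nhds hδ)).filter_mono nhdsWithin_le_nhds).and
      (Ioo_mem_nhdsGT h.pos)
    obtain ⟨ε, hε1, hε2⟩ := h2.exists
    exact ⟨ε, hε2.1, hε2.2.le, hε1⟩
  obtain ⟨ε, hε, hεr, hvε⟩ := hvol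
  have hs := puncturedBall_subset hεr
  have hmeas : MeasurableSet (Metric.ball (0 : ℂ) ε \ {0}) := (isOpen_puncturedBall ε).measurableSet
  refine ⟨ε, hε, hεr, fun h0 => ?_⟩
  have himg : volume (horizontalGauss x '' (Metric.ball 0 ε \ {0})) ≤ 1 := by
    choose! L hL hLa using fun z hz => h.hasFDerivAt_horizontalGauss (z := z) hz
    refine (addHaar_image_le_lintegral_abs_det_fderiv volume hmeas
      fun z hz => (hL z (hs hz)).hasFDerivWithinAt).trans ?_
    refine (setLIntegral_mono' hmeas fun z hz => ENNReal.ofReal_le_ofReal (hLa z (hs hz))).trans ?_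
    have h1 := hsmall (Metric.ball (0 : ℂ) ε \ {0}) (by
      refine ((Measure.restrict_apply_le _ _).trans (measure_mono sdiff_subset)).trans_lt hvε)
    rw [Measure.restrict_restrict hmeas, inter_eq_left.2 hs] at h1
    exact h1.le
  have h1 := measure_le_inter_add_sdiff volume (Metric.ball (0 : ℂ) 1)
    (horizontalGauss x '' (Metric.ball 0 ε \ {0}))
  rw [h0, add_zero] at h1
  have h2 := (h1.trans (measure_mono inter_subset_right)).trans himg
  rw [Complex.volume_ball] at h2
  simp at h2
  have h3 : (NNReal.pi : ℝ) ≤ 1 := by exact_mod_cast h2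
  rw [NNReal.coe_real_pi] at h3
  linarith [Real.pi_gt_three]

/-- Weierstrass' formulas: with f g = φ₂, the relation Σ φ_j² = 0 becomes f g² = −(φ₀ + iφ₁), and
these are solved for φ₀ and φ₁. -/
theorem IsPlaneEnd.apply_zero_eq (h : IsPlaneEnd x φ r) {z : ℂ}
    (hz : z ∈ Metric.ball (0 : ℂ) r \ {0}) {g : ℂ} (hf : φ z 0 - Complex.I * φ z 1 ≠ 0)
    (hg : (φ z 0 - Complex.I * φ z 1) * g = φ z 2) :
    φ z 0 = (φ z 0 - Complex.I * φ z 1) * (1 - g ^ 2) / 2 ∧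
      φ z 1 = Complex.I * (φ z 0 - Complex.I * φ z 1) * (1 + g ^ 2) / 2 := by
  have hs := h.sq z hz
  have hq : (φ z 0 - Complex.I * φ z 1) * g ^ 2 = -(φ z 0 + Complex.I * φ z 1) := by
    refine mul_left_cancel₀ hf ?_
    linear_combination ((φ z 0 - Complex.I * φ z 1) * g + φ z 2) * hg + hs - (φ z 1) ^ 2 * Complex.I_sq
  constructor
  · linear_combination hq / 2
  · linear_combination -Complex.I / 2 * hq + φ z 1 * Complex.I_sq

/-- The Gauss map in stereographic coordinates. -/
theorem IsPlaneEnd.planeGauss_eq (h : IsPlaneEnd x φ r) {z : ℂ}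
    (hz : z ∈ Metric.ball (0 : ℂ) r \ {0}) {g : ℂ} (hf : φ z 0 - Complex.I * φ z 1 ≠ 0)
    (hg : (φ z 0 - Complex.I * φ z 1) * g = φ z 2) :
    planeGauss x z = (1 + Complex.normSq g)⁻¹ • !₂[2 * g.re, 2 * g.im, Complex.normSq g - 1] := by
  obtain ⟨h0, h1⟩ := h.apply_zero_eq hz hf hg
  have hn := h.norm_planeNormal hz
  have hd := h.deriv z hz
  set f := φ z 0 - Complex.I * φ z 1 with hfdef
  clear_value f
  have hfpos : 0 < Complex.normSq f := Complex.normSq_pos.2 hf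
  have hgnn := Complex.normSq_nonneg g
  have hn' : ‖planeNormal x z‖ = Complex.normSq f * (1 + Complex.normSq g) ^ 2 / 4 := by
    rw [hn, h0, h1, ← hg]
    simp only [Complex.normSq_apply, Complex.mul_re, Complex.mul_im, Complex.div_ofNat_re,
      Complex.div_ofNat_im, Complex.add_re, Complex.add_im, Complex.sub_re, Complex.sub_im,
      Complex.I_re, Complex.I_im, Complex.one_re, Complex.one_im, pow_two]
    ring
  have hN : planeNormal x z = (Complex.normSq f * (1 + Complex.normSq g) / 4) •
      !₂[2 * g.re, 2 * g.im, Complex.normSq g - 1] := by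
    have hc : ∀ v j, fderiv ℝ x z v j = (φ z j * v).re := hd
    refine E3.ext ?_ ?_ ?_
    · rw [planeNormal, cross_apply_zero, hc, hc, hc, hc]
      simp only [h1, ← hg]
      simp [Complex.normSq_apply, pow_two]
      ring
    · rw [planeNormal, cross_apply_one, hc, hc, hc, hc]
      simp only [h0, ← hg]
      simp [Complex.normSq_apply, pow_two]
      ring
    · rw [planeNormal, cross_apply_two, hc, hc, hc, hc]
      simp only [h0, h1]
      simp [Complex.normSq_apply, pow_two]
      ring
  rw [planeGauss, hn', hN, smul_smul]
  congr 1
  field_simp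

theorem E3.eq_north_of_apply_two {a : E3} (ha : ‖a‖ = 1) (h2 : a 2 = 1) : a = !₂[0, 0, 1] := by
  have h1 : ⟪a, a⟫ = 1 := by simp [ha]
  rw [inner_E3, h2] at h1
  have h0 : a 0 = 0 := by nlinarith [mul_self_nonneg (a 0), mul_self_nonneg (a 1)]
  have h1 : a 1 = 0 := by nlinarith [mul_self_nonneg (a 0), mul_self_nonneg (a 1)]
  exact E3.ext (by simpa using h0) (by simpa using h1) (by simpa using h2)

/-- The inverse of the vertical projection of a hemisphere in stereographic coordinates. -/
theorem exists_stereographic_eq {k : ℂ} (hk : ‖k‖ < 1) :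
    ∃ w : ℂ, ‖w‖ ≤ 1 ∧ ((1 + Complex.normSq w)⁻¹ : ℝ) • (2 * w) = k := by
  have hk2 : Complex.normSq k < 1 := by
    rw [Complex.normSq_eq_norm_sq]
    exact pow_lt_one₀ (norm_nonneg _) hk two_ne_zero
  set s := √(1 - Complex.normSq k) with hs
  have hs2 : s ^ 2 = 1 - Complex.normSq k := Real.sq_sqrt (by linarith)
  have hs0 : 0 ≤ s := Real.sqrt_nonneg _
  have hw : Complex.normSq (((1 + s)⁻¹ : ℝ) • k) = (1 - s) / (1 + s) := by
    rw [Complex.real_smul, Complex.normSq_mul, Complex.normSq_ofReal]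
    have : Complex.normSq k = (1 - s) * (1 + s) := by linear_combination hs2
    rw [this]
    field_simp
  refine ⟨((1 + s)⁻¹ : ℝ) • k, ?_, ?_⟩
  · rw [norm_smul, Real.norm_eq_abs, abs_of_pos (by positivity)]
    have : (1 + s)⁻¹ ≤ 1 := inv_le_one_of_one_le₀ (by linarith)
    exact mul_le_one₀ this (norm_nonneg _) hk.le
  · rw [hw]
    have : (1 + (1 - s) / (1 + s))⁻¹ * (2 * (1 + s)⁻¹) = 1 := by
      have h1 : 1 + (1 - s) / (1 + s) = 2 / (1 + s) := by field_simp; ring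
      rw [h1]
      field_simp
    calc _ = ((1 + (1 - s) / (1 + s))⁻¹ * (2 * (1 + s)⁻¹)) • k := by
          simp only [Complex.real_smul]
          push_cast
          ring
      _ = k := by rw [this, one_smul]

/-- If the Gauss map omits the pole and a set of positive measure, it has a limit. -/
theorem IsPlaneEnd.exists_tendsto_of_omits_pole (h : IsPlaneEnd x φ r)
    (hpole : ∀ z ∈ Metric.ball (0 : ℂ) r \ {0}, planeGauss x z 2 ≠ 1)
    (hvol : volume (Metric.ball (0 : ℂ) 1 \ horizontalGauss x '' (Metric.ball 0 r \ {0})) ≠ 0) :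
    ∃ ν, Tendsto (planeGauss x) (𝓝[≠] 0) (𝓝 ν) := by
  have hball := eventually_mem_puncturedBall h.pos
  set f : ℂ → ℂ := fun z => φ z 0 - Complex.I * φ z 1 with hf
  -- f vanishes only where N is the north pole, which is excluded. So the stereographic coordinate g
  -- = φ₂ / f is holomorphic, without poles.
  have hf0 : ∀ z ∈ Metric.ball (0 : ℂ) r \ {0}, f z ≠ 0 := by
    intro z hz h0
    refine hpole z hz ?_
    obtain ⟨h1, h2⟩ := h.planeGauss_apply_two hz (σ := 1) (by norm_num)
    simp only [Complex.ofReal_one, mul_one] at h1 h2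
    change φ z 0 - Complex.I * φ z 1 = 0 at h0
    rw [h0, norm_zero, add_zero] at h2
    rw [h1, h0, norm_zero, sub_zero, add_zero, one_mul, div_self h2.ne']
  set g : ℂ → ℂ := fun z => φ z 2 / f z with hg
  have hfg : ∀ z ∈ Metric.ball (0 : ℂ) r \ {0}, f z * g z = φ z 2 := fun z hz =>
    mul_div_cancel₀ _ (hf0 z hz)
  have hgd : DifferentiableOn ℂ g (Metric.ball 0 r \ {0}) :=
    (h.hol 2).div ((h.hol 0).sub ((h.hol 1).const_mul Complex.I)) hf0
  set S : ℂ → E3 := fun w => (1 + Complex.normSq w)⁻¹ • !₂[2 * w.re, 2 * w.im, Complex.normSq w - 1]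
    with hS
  have hNS : ∀ z ∈ Metric.ball (0 : ℂ) r \ {0}, planeGauss x z = S (g z) := fun z hz =>
    h.planeGauss_eq hz (hf0 z hz) (hfg z hz)
  have hpos : ∀ w, 1 + Complex.normSq w ≠ 0 := fun w => by
    have := Complex.normSq_nonneg w
    positivity
  have hSc : Continuous S := by
    refine (Continuous.inv₀ (by fun_prop) hpos).smul ?_
    refine (PiLp.continuous_toLp 2 _).comp (continuous_pi fun i => ?_)
    fin_cases i
    · exact Complex.continuous_re.const_mul 2
    · exact Complex.continuous_im.const_mul 2
    · exact Complex.continuous_normSq.sub continuous_const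
  have hlim : ∀ w, Tendsto g (𝓝[≠] 0) (𝓝 w) → ∃ ν, Tendsto (planeGauss x) (𝓝[≠] 0) (𝓝 ν) :=
    fun w hw => ⟨S w, ((hSc.tendsto w).comp hw).congr' (hball.mono fun z hz => (hNS z hz).symm)⟩
  -- A nonconstant g has an open image, so the set K of omitted values in the closed unit disc is
  -- compact.
  rcases (hgd.analyticOnNhd (isOpen_puncturedBall r)).is_constant_or_isOpen
    (isPreconnected_puncturedBall h.pos) with ⟨w, hw⟩ | hopen
  · exact hlim w (tendsto_const_nhds.congr' (hball.mono fun z hz => (hw z hz).symm))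
  set K : Set ℂ := Metric.closedBall 0 1 \ g '' (Metric.ball 0 r \ {0}) with hK
  have hKc : IsCompact K :=
    (isCompact_closedBall (0 : ℂ) 1).diff (hopen _ subset_rfl (isOpen_puncturedBall r))
  set ψ : ℂ → ℂ := fun w => ((1 + Complex.normSq w)⁻¹ : ℝ) • (2 * w) with hψ
  have hψd : Differentiable ℝ ψ := by
    have : Differentiable ℝ fun w : ℂ => 1 + Complex.normSq w := by
      simp only [Complex.normSq_apply]
      have h1 : Differentiable ℝ fun w : ℂ => w.re := Complex.reCLM.differentiable
      have h2 : Differentiable ℝ fun w : ℂ => w.im := Complex.imCLM.differentiable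
      fun_prop
    exact (this.inv hpos).smul (differentiable_id.const_mul (2 : ℂ))
  have hψg : ∀ z ∈ Metric.ball (0 : ℂ) r \ {0}, horizontalGauss x z = ψ (g z) := by
    intro z hz
    rw [horizontalGauss, hNS z hz]
    have : ∀ (c : ℝ) (w : ℂ), (⟨c * (2 * w.re), c * (2 * w.im)⟩ : ℂ) = c • (2 * w) := fun c w => by
      apply Complex.ext <;> simp
    exact this _ _
  -- ψ carries the unit disc, which represents the lower hemisphere, onto its vertical projection.
  -- It is differentiable and preserves null sets, so a null set K would leave only a null set of
  -- omitted horizontal values.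
  have hKvol : volume K ≠ 0 := by
    intro h0
    refine hvol (measure_mono_null ?_
      (addHaar_image_eq_zero_of_differentiableOn_of_addHaar_eq_zero volume hψd.differentiableOn h0))
    rintro k ⟨hk1, hk2⟩
    obtain ⟨w, hw1, hw2⟩ := exists_stereographic_eq (mem_ball_zero_iff.1 hk1)
    refine ⟨w, ⟨mem_closedBall_zero_iff.2 hw1, ?_⟩, hw2⟩
    rintro ⟨z, hz, rfl⟩
    exact hk2 ⟨z, hz, (hψg z hz).trans hw2⟩
  rcases exists_tendsto_of_omits h.pos hKc sdiff_subset hKvol hgd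
    (fun z hz hzK => hzK.2 ⟨z, hz, rfl⟩) with ⟨w, hw⟩ | hinf
  · exact hlim w hw
  · refine ⟨!₂[0, 0, 1], ?_⟩
    rw [tendsto_iff_norm_sub_tendsto_zero]
    have h1 : Tendsto (fun z => √(4 / (1 + ‖g z‖ ^ 2))) (𝓝[≠] 0) (𝓝 0) := by
      have h2 : Tendsto (fun z => 1 + ‖g z‖ ^ 2) (𝓝[≠] 0) atTop :=
        tendsto_atTop_add_const_left _ 1 ((tendsto_pow_atTop two_ne_zero).comp hinf)
      simpa using (h2.const_div_atTop 4).sqrt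
    refine h1.congr' (hball.mono fun z hz => ?_)
    change _ = ‖planeGauss x z - _‖
    rw [hNS z hz, EuclideanSpace.norm_eq, ← Complex.normSq_eq_norm_sq]
    congr 1
    have := hpos (g z)
    simp only [hS, Fin.sum_univ_three, Real.norm_eq_abs, sq_abs]
    simp
    rw [Complex.normSq_apply] at *
    field_simp
    ring

/-- The Gauss map has a limit at an end of finite total curvature. -/
theorem IsPlaneEnd.exists_tendsto_planeGauss (h : IsPlaneEnd x φ r)
    (hfin : ∫⁻ z in Metric.ball (0 : ℂ) r \ {0}, ENNReal.ofReal (gaussArea x z) ≠ ⊤) :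
    ∃ ν, ‖ν‖ = 1 ∧ Tendsto (planeGauss x) (𝓝[≠] 0) (𝓝 ν) := by
  suffices ∃ ν, Tendsto (planeGauss x) (𝓝[≠] 0) (𝓝 ν) by
    obtain ⟨ν, hν⟩ := this
    refine ⟨ν, ?_, hν⟩
    refine tendsto_nhds_unique hν.norm (tendsto_const_nhds.congr' ?_)
    exact (eventually_mem_puncturedBall h.pos).mono fun z hz => (h.norm_planeGauss hz).symm
  obtain ⟨ε, hε, hεr, hvol⟩ := h.exists_omitted hfin
  obtain ⟨k, hk1, hk2⟩ := nonempty_of_measure_ne_zero hvol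
  have hk : Complex.normSq k < 1 := by
    rw [Complex.normSq_eq_norm_sq]
    exact pow_lt_one₀ (norm_nonneg _) (mem_ball_zero_iff.1 hk1) two_ne_zero
  -- The Gauss map omits the point b of the upper hemisphere over an omitted horizontal value k.
  -- Rotating b to the north pole provides the omitted pole.
  set b : E3 := !₂[k.re, k.im, √(1 - Complex.normSq k)] with hb
  have hb1 : ‖b‖ = 1 := by
    rw [EuclideanSpace.norm_eq, Real.sqrt_eq_one]
    simp only [Fin.sum_univ_three, Real.norm_eq_abs, sq_abs]
    simp [hb, Real.sq_sqrt (by linarith : 0 ≤ 1 - Complex.normSq k)]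
    rw [Complex.normSq_apply]
    ring
  obtain ⟨A, hA, hAb⟩ := exists_rotation hb1
  have hε' := h.mono hε hεr
  have hrot := hε'.rotate A
  have hfin' : ∫⁻ z in Metric.ball (0 : ℂ) ε \ {0},
      ENNReal.ofReal (gaussArea (fun z => A (x z)) z) ≠ ⊤ := by
    simp only [gaussArea_rotate A hA]
    exact ((lintegral_mono_set (puncturedBall_subset hεr)).trans_lt (lt_top_iff_ne_top.2 hfin)).ne
  -- The horizontal projection changes with the rotation, so the area estimate is applied once more,
  -- on a smaller disc.
  obtain ⟨ε', hε'0, hε'ε, hvol'⟩ := hrot.exists_omitted hfin'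
  have hrot' := hrot.mono hε'0 hε'ε
  obtain ⟨ν, hν⟩ := hrot'.exists_tendsto_of_omits_pole (fun z hz h2 => by
    have hz' := puncturedBall_subset hε'ε hz
    have h3 := E3.eq_north_of_apply_two (hrot'.norm_planeGauss hz) h2
    rw [planeGauss_rotate A hA, ← hAb] at h3
    have h4 := A.injective h3
    refine hk2 ⟨z, hz', ?_⟩
    rw [horizontalGauss, h4]
    rfl) hvol'
  refine ⟨A.symm ν, ((A.symm.continuous.tendsto ν).comp hν).congr fun z => ?_⟩
  rw [Function.comp_apply, planeGauss_rotate A hA, A.symm_apply_apply]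

end GaussMapLimit

/-! ### Graphs of sublinear growth over different planes intersect -/

section SublinearGraphs

/-- The set `S` contains a graph of sublinear growth over the exterior of a disc in the plane
orthogonal to the unit vector `ν`. -/
def ContainsSublinearGraph (S : Set E3) (ν : E3) : Prop :=
  ‖ν‖ = 1 ∧ ∃ (r : ℝ) (h : E3 → ℝ), ContinuousOn h {v | ⟪v, ν⟫ = 0 ∧ r < ‖v‖} ∧
    (∀ v, ⟪v, ν⟫ = 0 → r < ‖v‖ → v + h v • ν ∈ S) ∧
    ∀ δ > 0, ∃ K, ∀ v, ⟪v, ν⟫ = 0 → r < ‖v‖ → |h v| ≤ δ * ‖v‖ + K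

theorem norm_sub_inner_smul_le {ν : E3} (hν : ‖ν‖ = 1) (P : E3) : ‖P - ⟪P, ν⟫ • ν‖ ≤ ‖P‖ := by
  refine (sq_le_sq₀ (norm_nonneg _) (norm_nonneg _)).1 ?_
  rw [norm_sub_sq_real, inner_smul_right, norm_smul, hν]
  simp only [Real.norm_eq_abs, mul_one, sq_abs]
  nlinarith [sq_nonneg ⟪P, ν⟫]

theorem exists_unit_orthogonal {ν ν' : E3} (h : cross ν ν' ≠ 0) :
    ∃ l : E3, ‖l‖ = 1 ∧ ⟪l, ν⟫ = 0 ∧ ⟪l, ν'⟫ = 0 := by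
  refine ⟨‖cross ν ν'‖⁻¹ • cross ν ν', ?_, ?_, ?_⟩
  · rw [norm_smul, norm_inv, norm_norm, inv_mul_cancel₀ (norm_ne_zero_iff.2 h)]
  · rw [real_inner_smul_left, inner_cross_self_left, mul_zero]
  · rw [real_inner_smul_left, inner_cross_self_right, mul_zero]

/-- Two graphs of sublinear growth over planes that are not parallel intersect. -/
theorem ContainsSublinearGraph.inter_nonempty {S S' : Set E3} {ν ν' : E3}
    (hS : ContainsSublinearGraph S ν) (hS' : ContainsSublinearGraph S' ν')
    (hνν' : ⟪ν, ν'⟫ ^ 2 < 1) : (S ∩ S').Nonempty := by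
  obtain ⟨hν, r, h, hc, hmem, hgrow⟩ := hS
  obtain ⟨hν', r', h', hc', hmem', hgrow'⟩ := hS'
  have hνn : ⟪ν, ν⟫ = 1 := by simp [hν]
  have hνn' : ⟪ν', ν'⟫ = 1 := by simp [hν']
  set c := ⟪ν, ν'⟫ with hcdef
  have hcross : cross ν ν' ≠ 0 := by
    intro h0
    have h1 := inner_cross_cross ν ν' ν ν'
    rw [h0, inner_zero_left, hνn, hνn', real_inner_comm ν ν', ← hcdef] at h1
    nlinarith
  obtain ⟨l, hl, hlν, hlν'⟩ := exists_unit_orthogonal hcross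
  have hln : ⟪l, l⟫ = 1 := by simp [hl]
  set m := 1 - c ^ 2 with hm
  have hm0 : 0 < m := by linarith
  set n : E3 := ν' - c • ν with hn
  have hnν : ⟪n, ν⟫ = 0 := by
    rw [hn, inner_sub_left, real_inner_smul_left, hνn, real_inner_comm, ← hcdef]; ring
  have hnν' : ⟪n, ν'⟫ = m := by
    rw [hn, inner_sub_left, real_inner_smul_left, hνn', ← hcdef]; ring
  have hln0 : ⟪n, l⟫ = 0 := by
    rw [hn, inner_sub_left, real_inner_smul_left, real_inner_comm, hlν', real_inner_comm, hlν]; ring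
  have hnn : ‖n‖ ≤ 1 := by
    have := norm_sub_inner_smul_le hν ν'
    rwa [real_inner_comm, hν'] at this
  set t := |r| + |r'| + 1 with ht
  have htr : r < t := by have := le_abs_self r; have := abs_nonneg r'; linarith
  have htr' : r' < t := by have := le_abs_self r'; have := abs_nonneg r; linarith
  have ht0 : 0 ≤ t := by positivity
  -- A line in the first plane. Its component t along l, a direction common to both planes, exceeds
  -- both radii and survives the projection to the second plane, so both graphs are defined along
  -- it.
  set v : ℝ → E3 := fun s => t • l + s • n with hv
  have hvν : ∀ s, ⟪v s, ν⟫ = 0 := fun s => by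
    simp [hv, inner_add_left, real_inner_smul_left, hlν, hnν]
  have hvl : ∀ s, ⟪v s, l⟫ = t := fun s => by
    rw [hv, inner_add_left, real_inner_smul_left, real_inner_smul_left, hln, hln0]; ring
  have hle : ∀ w : E3, ⟪w, l⟫ = t → t ≤ ‖w‖ := fun w hw => by
    have := real_inner_le_norm w l
    rwa [hw, hl, mul_one] at this
  have hvr : ∀ s, r < ‖v s‖ := fun s => htr.trans_le (hle _ (hvl s))
  have hvn : ∀ s, ‖v s‖ ≤ t + |s| := fun s => by
    refine (norm_add_le _ _).trans ?_
    rw [norm_smul, norm_smul, hl, Real.norm_eq_abs, Real.norm_eq_abs, abs_of_nonneg ht0, mul_one]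
    have := mul_le_of_le_one_right (abs_nonneg s) hnn
    linarith
  set P : ℝ → E3 := fun s => v s + h (v s) • ν with hP
  have hPν' : ∀ s, ⟪P s, ν'⟫ = s * m + h (v s) * c := fun s => by
    simp only [hP, hv, inner_add_left, real_inner_smul_left, hlν', hnν', ← hcdef]; ring
  set Q : ℝ → E3 := fun s => P s - ⟪P s, ν'⟫ • ν' with hQ
  have hQν' : ∀ s, ⟪Q s, ν'⟫ = 0 := fun s => by
    simp only [hQ, inner_sub_left, real_inner_smul_left, hνn']; ring
  have hQl : ∀ s, ⟪Q s, l⟫ = t := fun s => by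
    have e1 : ⟪P s, l⟫ = t := by
      simp only [hP]
      rw [inner_add_left, hvl, real_inner_smul_left, real_inner_comm, hlν]; ring
    simp only [hQ]
    rw [inner_sub_left, e1, real_inner_smul_left, real_inner_comm l ν', hlν']; ring
  have hQr : ∀ s, r' < ‖Q s‖ := fun s => htr'.trans_le (hle _ (hQl s))
  have hvc : Continuous v := by fun_prop
  have hhc : Continuous fun s => h (v s) :=
    hc.comp_continuous hvc fun s => ⟨hvν s, hvr s⟩
  have hPc : Continuous P := hvc.add (hhc.smul continuous_const)
  have hPi : Continuous fun s => ⟪P s, ν'⟫ := hPc.inner continuous_const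
  have hQc : Continuous Q := hPc.sub (hPi.smul continuous_const)
  have hhc' : Continuous fun s => h' (Q s) :=
    hc'.comp_continuous hQc fun s => ⟨hQν' s, hQr s⟩
  -- The errors below add up to 3δ |s| plus a constant, which is half of the main term m |s| up to a
  -- constant.
  set δ := m / 6 with hδ
  have hδ0 : 0 < δ := by positivity
  have hδ1 : δ ≤ 1 := by have := sq_nonneg c; linarith
  obtain ⟨K, hK⟩ := hgrow δ hδ0
  obtain ⟨K', hK'⟩ := hgrow' δ hδ0
  -- The height of the point P s of the first graph over the second plane, minus the height of the
  -- second graph at its projection Q s. It behaves like s m, changes sign, and vanishes at a common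
  -- point.
  set F : ℝ → ℝ := fun s => ⟪P s, ν'⟫ - h' (Q s) with hF
  have hFc : Continuous F := hPi.sub hhc'
  have hc1 : |c| ≤ 1 := by
    rw [abs_le_one_iff_mul_self_le_one]; nlinarith
  have hest : ∀ s, |F s - s * m| ≤ m / 2 * |s| + (3 * δ * t + 2 * K + K') := by
    intro s
    have h1 := hK _ (hvν s) (hvr s)
    have h2 := hK' _ (hQν' s) (hQr s)
    have h3 : ‖Q s‖ ≤ t + |s| + |h (v s)| := by
      refine (norm_sub_inner_smul_le hν' _).trans ((norm_add_le _ _).trans ?_)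
      rw [norm_smul, hν, mul_one, Real.norm_eq_abs]
      linarith [hvn s]
    have h4 : F s - s * m = h (v s) * c - h' (Q s) := by simp only [hF, hPν']; ring
    have h5 : |h (v s) * c| ≤ |h (v s)| := by
      rw [abs_mul]; exact mul_le_of_le_one_right (abs_nonneg _) hc1
    have h6 : |h (v s)| ≤ δ * (t + |s|) + K := h1.trans (by gcongr; exact hvn s)
    have h7 : |h' (Q s)| ≤ δ * (t + |s| + |h (v s)|) + K' := h2.trans (by gcongr)
    have h8 : δ * |h (v s)| ≤ |h (v s)| := mul_le_of_le_one_left (abs_nonneg _) hδ1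
    have h9 : m = 6 * δ := by rw [hδ]; ring
    rw [h4, h9]
    refine (abs_sub _ _).trans ?_
    linarith
  set C := 3 * δ * t + 2 * K + K' with hC
  set s₀ := 2 * (|C| + 1) / m with hs₀
  have hs₀0 : 0 < s₀ := by positivity
  have hs₀m : s₀ * m = 2 * (|C| + 1) := by rw [hs₀]; field_simp
  have hpos : 0 ≤ F s₀ := by
    have h1 := (abs_le.1 (hest s₀)).1
    rw [abs_of_pos hs₀0] at h1
    have := le_abs_self C
    linarith
  have hneg : F (-s₀) ≤ 0 := by
    have h1 := (abs_le.1 (hest (-s₀))).2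
    rw [abs_neg, abs_of_pos hs₀0] at h1
    have := le_abs_self C
    linarith
  obtain ⟨s, hs⟩ := mem_range_of_exists_le_of_exists_ge hFc ⟨_, hneg⟩ ⟨_, hpos⟩
  refine ⟨P s, hmem _ (hvν s) (hvr s), ?_⟩
  have h1 : P s = Q s + h' (Q s) • ν' := by
    have : h' (Q s) = ⟪P s, ν'⟫ := by simp only [hF] at hs; linarith
    rw [this]
    simp only [hQ, sub_add_cancel]
  rw [h1]
  exact hmem' _ (hQν' s) (hQr s)

/-- A direction in which a graph of sublinear growth has sublinear height is normal to the plane. -/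
theorem ContainsSublinearGraph.inner_sq_eq_one {S : Set E3} {ν m : E3}
    (hS : ContainsSublinearGraph S ν) (hm : ‖m‖ = 1)
    (hgrow' : ∀ δ > 0, ∃ K, ∀ y ∈ S, |⟪m, y⟫| ≤ δ * ‖y‖ + K) : ⟪m, ν⟫ ^ 2 = 1 := by
  obtain ⟨hν, r, h, -, hmem, hgrow⟩ := hS
  have hνn : ⟪ν, ν⟫ = 1 := by simp [hν]
  have hmn : ⟪m, m⟫ = 1 := by simp [hm]
  set c := ⟪m, ν⟫ with hc
  -- The tangential part of m. Along the ray t u the height ⟨m, ·⟩ has the main term t |u|², linear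
  -- in t, which contradicts sublinear growth unless u = 0.
  set u : E3 := m - c • ν with hu
  have huν : ⟪u, ν⟫ = 0 := by
    rw [hu, inner_sub_left, real_inner_smul_left, hνn, ← hc]; ring
  have hmu : ⟪m, u⟫ = 1 - c ^ 2 := by
    rw [hu, inner_sub_right, inner_smul_right, hmn, ← hc]; ring
  have huu : ‖u‖ ^ 2 = 1 - c ^ 2 := by
    rw [← real_inner_self_eq_norm_sq]
    nth_rewrite 1 [hu]
    rw [inner_sub_left, hmu, real_inner_smul_left, real_inner_comm, huν]; ring
  have hc1 : |c| ≤ 1 := by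
    rw [abs_le_one_iff_mul_self_le_one]; nlinarith [sq_nonneg ‖u‖]
  by_contra hne
  have hupos : 0 < ‖u‖ := by
    rw [norm_pos_iff]
    intro h0
    rw [h0, norm_zero] at huu
    exact hne (by linarith)
  set U := ‖u‖ with hU
  have hU1 : U ≤ 1 := by nlinarith [sq_nonneg c]
  set δ := U / 6 with hδ
  have hδ0 : 0 < δ := by positivity
  obtain ⟨K, hK⟩ := hgrow δ hδ0
  obtain ⟨K', hK'⟩ := hgrow' δ hδ0
  -- The first summand gives |t u| > r, the second makes t |u|² larger than twice the collected
  -- constants.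
  set t := (|r| + 1) / U + (2 * |2 * K + K'| + 1) / U ^ 2 with ht
  have ht0 : 0 < t := by positivity
  have htn : ‖t • u‖ = t * U := by rw [norm_smul, Real.norm_eq_abs, abs_of_pos ht0]
  have htr : r < ‖t • u‖ := by
    rw [htn, ht, add_mul, div_mul_cancel₀ _ hupos.ne']
    have := le_abs_self r
    have : 0 ≤ (2 * |2 * K + K'| + 1) / U ^ 2 * U := by positivity
    linarith
  have hv0 : ⟪t • u, ν⟫ = 0 := by rw [real_inner_smul_left, huν, mul_zero]
  have h1 := hK _ hv0 htr
  have h2 := hK' _ (hmem _ hv0 htr)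
  set H := h (t • u) with hH
  have h3 : ⟪m, t • u + H • ν⟫ = t * U ^ 2 + H * c := by
    rw [inner_add_right, inner_smul_right, inner_smul_right, hmu, huu, hc]
  have h4 : ‖t • u + H • ν‖ ≤ t * U + |H| := by
    refine (norm_add_le _ _).trans ?_
    rw [htn, norm_smul, hν, mul_one, Real.norm_eq_abs]
  rw [h3] at h2
  rw [htn] at h1
  have h5 : |H * c| ≤ |H| := by rw [abs_mul]; exact mul_le_of_le_one_right (abs_nonneg _) hc1
  have h6 : t * U ^ 2 ≤ |t * U ^ 2 + H * c| + |H * c| := by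
    have := abs_sub (t * U ^ 2 + H * c) (H * c)
    rw [add_sub_cancel_right] at this
    exact (le_abs_self _).trans this
  have h7 : δ * ‖t • u + H • ν‖ ≤ δ * (t * U + |H|) := by gcongr
  have h8 : δ * |H| ≤ |H| := mul_le_of_le_one_left (abs_nonneg _) (by linarith)
  have h9 : δ * (t * U) = t * U ^ 2 / 6 := by rw [hδ]; ring
  have h10 : t * U ^ 2 ≤ 2 * (2 * K + K') := by linarith
  have h11 : 2 * |2 * K + K'| + 1 ≤ t * U ^ 2 := by
    have : t * U ^ 2 = (|r| + 1) * U + (2 * |2 * K + K'| + 1) := by rw [ht]; field_simp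
    have h12 : 0 ≤ (|r| + 1) * U := by positivity
    linarith
  linarith [le_abs_self (2 * K + K')]

/-- The upper bound is log x ≤ x − 1 at x = δ t; below, the logarithm is at least log r₀. -/
theorem exists_abs_log_le {r₀ : ℝ} (hr₀ : 0 < r₀) {δ : ℝ} (hδ : 0 < δ) :
    ∃ K, ∀ t, r₀ < t → |Real.log t| ≤ δ * t + K := by
  refine ⟨|Real.log δ| + |Real.log r₀|, fun t ht => abs_le.2 ⟨?_, ?_⟩⟩
  · have h1 := Real.log_le_log hr₀ ht.le
    have h2 := neg_abs_le (Real.log r₀)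
    have h3 := abs_nonneg (Real.log δ)
    have h4 : 0 < δ * t := mul_pos hδ (hr₀.trans ht)
    linarith
  · have h1 := Real.log_le_sub_one_of_pos (mul_pos hδ (hr₀.trans ht))
    rw [Real.log_mul hδ.ne' (hr₀.trans ht).ne'] at h1
    have h2 := neg_abs_le (Real.log δ)
    have h3 := abs_nonneg (Real.log r₀)
    linarith

end SublinearGraphs

/-! ### Embedded ends as sublinear graphs over the limit tangent plane -/

section EndsAsGraphs

variable {x : ℂ → E3} {φ : ℂ → Fin 3 → ℂ} {r : ℝ}

/-- An embedded end contains a graph of sublinear growth over the plane orthogonal to its limiting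
normal. -/
theorem IsPlaneEnd.containsSublinearGraph (h : IsPlaneEnd x φ r)
    (hinj : InjOn x (Metric.ball 0 r \ {0})) {ν : E3} (hν : ‖ν‖ = 1)
    (hN : Tendsto (planeGauss x) (𝓝[≠] 0) (𝓝 ν)) :
    ContainsSublinearGraph (x '' (Metric.ball 0 r \ {0})) ν := by
  obtain ⟨A, hA, hAν⟩ := exists_rotation hν
  have hrot := h.rotate A
  have hσ : (-1 : ℝ) ^ 2 = 1 := by norm_num
  have hNr : Tendsto (fun z => planeGauss (fun z => A (x z)) z 2) (𝓝[≠] 0) (𝓝 (-(-1))) := by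
    have h1 := (A.continuous.tendsto ν).comp hN
    rw [hAν] at h1
    have h2 := tendsto_apply_two h1
    simp only [planeGauss_rotate A hA]
    simpa using h2
  obtain ⟨e, κ, b, a, β, C, -, hκ, he0, hee, her, hx, -⟩ :=
    hrot.exists_graph (fun z hz w hw hzw => hinj hz hw (A.injective hzw)) hσ hNr
  have hg : IsEndGraph (fun z => A (x z)) (-1) r e κ b a β C :=
    ⟨hσ, hκ, he0, hee, her, fun z h1 h2 => (hx z h1 h2).1, fun z h1 h2 => (hx z h1 h2).2⟩
  obtain ⟨B, hB⟩ := hg.exists_bound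
  have hB' : ∀ᶠ s in 𝓝 (0 : ℂ), s ∈ e.target ∧ (e.symm s ≠ 0 →
      |A (x (e.symm s)) 2 + a * Real.log √(A (x (e.symm s)) 0 ^ 2 + A (x (e.symm s)) 1 ^ 2)| ≤ B) := by
    have h0t : (0 : ℂ) ∈ e.target := hee ▸ e.map_source he0
    have hs0 : e.symm 0 = 0 := by rw [← hee, e.left_inv he0]; exact hee.symm
    refine (show ∀ᶠ s in 𝓝 (0 : ℂ), s ∈ e.target from e.open_target.mem_nhds h0t).and ?_
    have h1 := e.continuousAt_symm h0t
    rw [ContinuousAt, hs0] at h1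
    exact h1.eventually (eventually_nhdsWithin_iff.1 hB)
  obtain ⟨ε, hε, hball⟩ := Metric.eventually_nhds_iff_ball.1 hB'
  have hκ' := norm_pos_iff.2 hκ
  -- The horizontal coordinate after the rotation of ν to the vertical; on the plane orthogonal to ν
  -- it preserves length, and the point of the end over v is at s = κ / ζ(v).
  set ζ : E3 → ℂ := fun v => (A v 0 : ℂ) - Complex.I * ((-1 : ℝ) : ℂ) * A v 1 with hζ
  have hζn : ∀ v, ⟪v, ν⟫ = 0 → A v 2 = 0 ∧ ‖ζ v‖ = ‖v‖ := by
    intro v hv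
    rw [← A.inner_map_map, hAν, inner_E3] at hv
    have h2 : A v 2 = 0 := by simpa using hv
    refine ⟨h2, ?_⟩
    rw [hζ, norm_sub_I_mul hσ, ← A.norm_map v, EuclideanSpace.norm_eq]
    simp [Fin.sum_univ_three, h2]
  have hdom : ∀ v, ⟪v, ν⟫ = 0 → ‖κ‖ / ε + 1 < ‖v‖ → ζ v ≠ 0 ∧ κ / ζ v ∈ Metric.ball (0 : ℂ) ε := by
    intro v hv hr
    have h1 : 0 < ‖κ‖ / ε := by positivity
    rw [← (hζn v hv).2] at hr
    refine ⟨norm_pos_iff.1 (by linarith), ?_⟩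
    rw [mem_ball_zero_iff, norm_div, div_lt_iff₀ (by linarith), ← div_lt_iff₀' hε]
    linarith
  have hζc : Continuous ζ := by
    have h1 : ∀ j : Fin 3, Continuous fun v : E3 => A v j := fun j =>
      (EuclideanSpace.proj (𝕜 := ℝ) j : E3 →L[ℝ] ℝ).continuous.comp A.continuous
    exact (Complex.continuous_ofReal.comp (h1 0)).sub
      (continuous_const.mul (Complex.continuous_ofReal.comp (h1 1)))
  have hsrc : ∀ v, ⟪v, ν⟫ = 0 → ‖κ‖ / ε + 1 < ‖v‖ →
      e.symm (κ / ζ v) ∈ Metric.ball (0 : ℂ) r \ {0} := by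
    intro v hv hr
    obtain ⟨h1, h2⟩ := hdom v hv hr
    have h3 := (hball _ h2).1
    exact ⟨her (e.map_target h3), hg.symm_ne_zero h3 (div_ne_zero hκ h1)⟩
  refine ⟨hν, ‖κ‖ / ε + 1, fun v => A (x (e.symm (κ / ζ v))) 2, ?_, fun v hv hr => ?_,
    fun δ hδ => ?_⟩
  · have hxc : ContinuousOn (fun z => A (x z) 2) (Metric.ball (0 : ℂ) r \ {0}) := fun z hz =>
      ((EuclideanSpace.proj (𝕜 := ℝ) 2 : E3 →L[ℝ] ℝ).continuous.continuousAt.comp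
        (hrot.diff z hz).continuousAt).continuousWithinAt
    refine hxc.comp (e.continuousOn_symm.comp (ContinuousOn.div continuousOn_const hζc.continuousOn
      fun v hv => (hdom v hv.1 hv.2).1) fun v hv => (hball _ (hdom v hv.1 hv.2).2).1)
      fun v hv => hsrc v hv.1 hv.2
  · obtain ⟨h1, h2⟩ := hdom v hv hr
    obtain ⟨e1, e2⟩ := hg.symm_apply (hball _ h2).1 h1
    refine ⟨_, hsrc v hv hr, A.injective ?_⟩
    rw [map_add, map_smul, hAν]
    have h3 := (hζn v hv).1
    refine E3.ext ?_ ?_ ?_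
    · have : A (x (e.symm (κ / ζ v))) 0 = A v 0 := e1
      simp [this]
    · have : A (x (e.symm (κ / ζ v))) 1 = A v 1 := e2
      simp [this]
    · simp [h3]
  -- The denominator |a| + 1 instead of |a| includes the case a = 0.
  · obtain ⟨K, hK⟩ := exists_abs_log_le one_pos (δ := δ / (|a| + 1)) (by positivity)
    refine ⟨B + |a| * |K|, fun v hv hr => ?_⟩
    obtain ⟨h1, h2⟩ := hdom v hv hr
    obtain ⟨e1, e2⟩ := hg.symm_apply (hball _ h2).1 h1
    have h3 := (hball _ h2).2 (hsrc v hv hr).2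
    have h4 : √(A (x (e.symm (κ / ζ v))) 0 ^ 2 + A (x (e.symm (κ / ζ v))) 1 ^ 2) = ‖v‖ := by
      rw [← (hζn v hv).2, hζ, norm_sub_I_mul hσ, ← hζ, e1, e2]
    rw [h4] at h3
    have h5 := hK ‖v‖ (by have : 0 < ‖κ‖ / ε := by positivity
                          linarith)
    have h6 : |a * Real.log ‖v‖| ≤ δ * ‖v‖ + |a| * |K| := by
      rw [abs_mul]
      have h7 : |a| * (δ / (|a| + 1)) ≤ δ := by
        rw [mul_div_assoc', div_le_iff₀ (by positivity)]
        nlinarith [abs_nonneg a]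
      calc |a| * |Real.log ‖v‖| ≤ |a| * (δ / (|a| + 1) * ‖v‖ + |K|) := by
            gcongr
            exact h5.trans (by gcongr; exact le_abs_self K)
        _ = |a| * (δ / (|a| + 1)) * ‖v‖ + |a| * |K| := by ring
        _ ≤ _ := by gcongr
    have h8 := abs_sub (A (x (e.symm (κ / ζ v))) 2 + a * Real.log ‖v‖) (a * Real.log ‖v‖)
    rw [add_sub_cancel_right] at h8
    linarith

end EndsAsGraphs

/-! ### Stokes' theorem for ∂̄ with cutoff functions -/

section PlaneStokes

open scoped ComplexConjugate

/-- The derivative `∂u / ∂z̄`. -/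
def dbar (u : ℂ → ℂ) (z : ℂ) : ℂ := (fderiv ℝ u z 1 + Complex.I * fderiv ℝ u z Complex.I) / 2

theorem HasFDerivAt.dbar_eq {u : ℂ → ℂ} {z : ℂ} {L : ℂ →L[ℝ] ℂ} (h : HasFDerivAt u L z) :
    dbar u z = (L 1 + Complex.I * L Complex.I) / 2 := by
  rw [dbar, h.fderiv]

theorem dbar_mul_of_holomorphic {u F : ℂ → ℂ} {z : ℂ} (hu : DifferentiableAt ℝ u z)
    (hF : DifferentiableAt ℂ F z) : dbar (fun z => u z * F z) z = dbar u z * F z := by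
  refine (hu.hasFDerivAt.mul hF.hasDerivAt.complexToReal_fderiv).dbar_eq.trans ?_
  rw [dbar]
  simp
  linear_combination (u z * deriv F z / 2) * Complex.I_mul_I

theorem dbar_sub {u v : ℂ → ℂ} {z : ℂ} (hu : DifferentiableAt ℝ u z) (hv : DifferentiableAt ℝ v z) :
    dbar (fun z => u z - v z) z = dbar u z - dbar v z := by
  refine (hu.hasFDerivAt.sub hv.hasFDerivAt).dbar_eq.trans ?_
  rw [dbar, dbar]
  simp
  ring

theorem dbar_comp_holomorphic {u τ : ℂ → ℂ} {z τ' : ℂ} (hu : DifferentiableAt ℝ u (τ z))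
    (hτ : HasDerivAt τ τ' z) : dbar (fun z => u (τ z)) z = dbar u (τ z) * conj τ' := by
  refine (hu.hasFDerivAt.comp z hτ.complexToReal_fderiv).dbar_eq.trans ?_
  rw [dbar]
  have h1 : ∀ w : ℂ, fderiv ℝ u (τ z) w =
      w.re * fderiv ℝ u (τ z) 1 + w.im * fderiv ℝ u (τ z) Complex.I := by
    intro w
    conv_lhs => rw [show w = w.re • (1 : ℂ) + w.im • Complex.I by apply Complex.ext <;> simp]
    rw [map_add, map_smul, map_smul]
    simp
  have h2 : conj τ' = τ'.re - τ'.im * Complex.I := by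
    apply Complex.ext <;> simp
  simp only [ContinuousLinearMap.comp_apply, _root_.smul_apply, one_apply_eq_self, smul_eq_mul, mul_one]
  rw [h1 τ', h1 (τ' * Complex.I), h2]
  simp
  linear_combination ((τ'.im : ℂ) / 2 * fderiv ℝ u (τ z) Complex.I) * Complex.I_mul_I

theorem dbar_congr {u v : ℂ → ℂ} {z : ℂ} (h : u =ᶠ[𝓝 z] v) : dbar u z = dbar v z := by
  rw [dbar, dbar, h.fderiv_eq]

theorem dbar_const (c z : ℂ) : dbar (fun _ => c) z = 0 := by simp [dbar]

theorem ContDiffOn.continuousOn_dbar {u : ℂ → ℂ} {V : Set ℂ} (hV : IsOpen V)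
    (hu : ContDiffOn ℝ 1 u V) : ContinuousOn (dbar u) V := by
  have h := hu.continuousOn_fderiv_of_isOpen hV le_rfl
  exact ((h.clm_apply continuousOn_const).add
    (continuousOn_const.mul (h.clm_apply continuousOn_const))).div_const 2

/-- Integration by parts against the constant 1; the compact support leaves no boundary term. -/
theorem integral_dbar_eq_zero {w : ℂ → ℂ} (hw : ContDiff ℝ 1 w) (hc : HasCompactSupport w) :
    ∫ z, dbar w z = 0 := by
  have hd : ∀ v, Integrable fun z => fderiv ℝ w z v := fun v =>
    ((hw.continuous_fderiv one_ne_zero).clm_apply continuous_const).integrable_of_hasCompactSupport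
      (hc.fderiv_apply (𝕜 := ℝ) v)
  have hz : ∀ v, ∫ z, fderiv ℝ w z v = 0 := by
    intro v
    have h := integral_mul_fderiv_eq_neg_fderiv_mul_of_integrable (μ := (volume : Measure ℂ))
      (f := fun _ => (1 : ℂ)) (g := w) (v := v) (by simp) (by simpa using hd v)
      (by simpa using hw.continuous.integrable_of_hasCompactSupport hc)
      (fun _ _ => differentiableAt_const _) (fun z _ => hw.differentiable one_ne_zero z)
    simpa using h
  simp only [dbar]
  rw [integral_div, integral_add (hd 1) ((hd Complex.I).const_mul _), integral_const_mul, hz, hz]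
  simp

variable {V K : Set ℂ} {u F : ℂ → ℂ}

theorem ContinuousOn.integrableOn_of_eq_zero {g : ℂ → ℂ} (hV : IsOpen V) (hK : IsCompact K)
    (hKV : K ⊆ V) (hg : ContinuousOn g V) (h0 : ∀ z ∈ V, z ∉ K → g z = 0) : IntegrableOn g V :=
  ((hg.mono hKV).integrableOn_compact hK).of_forall_sdiff_eq_zero hV.measurableSet
    fun z hz => h0 z hz.1 hz.2

theorem dbar_eq_zero_of_notMem (hV : IsOpen V) (hK : IsCompact K) (hu0 : ∀ z ∈ V, z ∉ K → u z = 0)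
    {z : ℂ} (hz : z ∈ V) (hzK : z ∉ K) : dbar u z = 0 := by
  rw [dbar_congr (v := fun _ => 0), dbar_const]
  filter_upwards [hV.mem_nhds hz, hK.isClosed.isOpen_compl.mem_nhds hzK] with w h1 h2 using hu0 w h1 h2

/-- Stokes' theorem for a holomorphic form and a cutoff function. -/
theorem integral_dbar_mul_eq_zero (hV : IsOpen V) (hK : IsCompact K) (hKV : K ⊆ V)
    (hu : ContDiffOn ℝ 1 u V) (hu0 : ∀ z ∈ V, z ∉ K → u z = 0) (hF : DifferentiableOn ℂ F V) :
    ∫ z in V, dbar u z * F z = 0 := by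
  -- The product u F, extended by zero, is C¹ with compact support, and ∂̄(u F) = (∂̄u) F because F
  -- is holomorphic.
  set w : ℂ → ℂ := V.indicator fun z => u z * F z with hw
  have hwV : ∀ z ∈ V, w =ᶠ[𝓝 z] fun z => u z * F z := fun z hz =>
    eventually_of_mem (hV.mem_nhds hz) fun y hy => indicator_of_mem hy _
  have hwK : ∀ z ∉ K, w =ᶠ[𝓝 z] fun _ => 0 := fun z hz =>
    eventually_of_mem (hK.isClosed.isOpen_compl.mem_nhds hz) fun y hy => by
      by_cases hyV : y ∈ V
      · rw [hw, indicator_of_mem hyV, hu0 y hyV hy, zero_mul]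
      · exact indicator_of_notMem hyV _
  have hFr : ContDiffOn ℝ 1 F V := (hF.contDiffOn hV).restrict_scalars ℝ
  have hwc : ContDiff ℝ 1 w := contDiff_iff_contDiffAt.2 fun z => by
    by_cases hz : z ∈ K
    · exact ((hu.mul hFr).contDiffAt (hV.mem_nhds (hKV hz))).congr_of_eventuallyEq (hwV z (hKV hz))
    · exact contDiffAt_const.congr_of_eventuallyEq (hwK z hz)
  have hcs : HasCompactSupport w := HasCompactSupport.intro hK fun z hz => (hwK z hz).self_of_nhds
  rw [← integral_dbar_eq_zero hwc hcs, ← integral_indicator hV.measurableSet]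
  congr 1
  ext z
  by_cases hz : z ∈ V
  · rw [indicator_of_mem hz, dbar_congr (hwV z hz)]
    exact (dbar_mul_of_holomorphic ((hu.differentiableOn one_ne_zero).differentiableAt (hV.mem_nhds hz))
      (hF.differentiableAt (hV.mem_nhds hz))).symm
  · rw [indicator_of_notMem hz, dbar_congr (hwK z fun h => hz (hKV h)), dbar_const]

/-- A radial cutoff function around `p`, which is `1` near `p` and vanishes for `|z - p| ≥ exp t`. -/
def radialCutoff (p : ℂ) (t : ℝ) (z : ℂ) : ℂ := Real.smoothTransition (t - Real.log ‖z - p‖)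

theorem hasDerivAt_smoothTransition (t : ℝ) :
    HasDerivAt Real.smoothTransition (deriv Real.smoothTransition t) t :=
  ((Real.smoothTransition.contDiff (n := 1)).differentiable one_ne_zero t).hasDerivAt

theorem continuous_deriv_smoothTransition : Continuous (deriv Real.smoothTransition) :=
  (Real.smoothTransition.contDiff (n := 1)).continuous_deriv le_rfl

theorem contDiffOn_radialCutoff (p : ℂ) (t : ℝ) : ContDiffOn ℝ 1 (radialCutoff p t) {p}ᶜ := by
  intro z hz
  have h1 : z - p ≠ 0 := sub_ne_zero.2 hz
  have h2 : ContDiffAt ℝ 1 (fun z : ℂ => t - Real.log ‖z - p‖) z :=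
    contDiffAt_const.sub (((contDiffAt_id.sub contDiffAt_const).norm ℝ h1).log (norm_ne_zero_iff.2 h1))
  exact (Complex.ofRealCLM.contDiff.contDiffAt.comp z
    ((Real.smoothTransition.contDiffAt (n := 1)).comp z h2)).contDiffWithinAt

theorem radialCutoff_eq_one {p z : ℂ} {t : ℝ} (hz : z ≠ p) (h : ‖z - p‖ ≤ Real.exp (t - 1)) :
    radialCutoff p t z = 1 := by
  have h1 := (Real.log_le_iff_le_exp (norm_pos_iff.2 (sub_ne_zero.2 hz))).2 h
  rw [radialCutoff, Real.smoothTransition.one_of_one_le (by linarith), Complex.ofReal_one]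

theorem radialCutoff_eq_zero {p z : ℂ} {t : ℝ} (h : Real.exp t ≤ ‖z - p‖) :
    radialCutoff p t z = 0 := by
  have h1 := (Real.le_log_iff_exp_le ((Real.exp_pos t).trans_le h)).2 h
  rw [radialCutoff, Real.smoothTransition.zero_of_nonpos (by linarith), Complex.ofReal_zero]

theorem dbar_radialCutoff {p z : ℂ} {t : ℝ} (hz : z ≠ p) :
    dbar (radialCutoff p t) z =
      -((deriv Real.smoothTransition (t - Real.log ‖z - p‖) : ℝ) : ℂ) * conj (z - p)⁻¹ / 2 := by
  have h1 : HasFDerivAt (fun z : ℂ => Real.log ‖z - p‖)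
      (Complex.reCLM ∘L ((z - p)⁻¹ • (1 : ℂ →L[ℝ] ℂ))) z := by
    have := (hasFDerivAt_log_norm (sub_ne_zero.2 hz)).comp z ((hasFDerivAt_id z).sub_const p)
    refine this.congr_fderiv ?_
    ext v
    simp
  have h2 := Complex.ofRealCLM.hasFDerivAt.comp z
    ((hasDerivAt_smoothTransition _).comp_hasFDerivAt z (h1.const_sub t))
  have h3 : ∀ w : ℂ, conj w = w.re - w.im * Complex.I := fun w => by
    apply Complex.ext <;> simp
  refine h2.dbar_eq.trans ?_
  rw [h3]
  simp
  ring

/-- The integral of `∂u / ∂z̄ F` for a radial cutoff function `u` is given by the residue. -/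
theorem integral_dbar_radialCutoff {p c : ℂ} {t R₀ : ℝ} (hR : Real.exp t < R₀)
    (hF : ContinuousOn F (Metric.ball p R₀ \ {p}))
    (hc : ∀ ρ, 0 < ρ → ρ < R₀ → (∮ z in C(p, ρ), F z) = 2 * Real.pi * Complex.I * c) :
    ∫ z in Metric.ball p R₀ \ {p}, dbar (radialCutoff p t) z * F z = -Real.pi * c := by
  set χ : ℝ → ℝ := fun r => deriv Real.smoothTransition (t - Real.log r) with hχ
  have hexp := Real.exp_pos t
  have hexp' := Real.exp_pos (t - 1)
  have hmeas : MeasurableSet (Metric.ball p R₀ \ {p}) :=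
    measurableSet_ball.diff (measurableSet_singleton p)
  -- At these points the transition function attains its minimum or maximum, which includes the end
  -- points 0 and 1.
  have hderiv0 : ∀ s, s ≤ 0 ∨ 1 ≤ s → deriv Real.smoothTransition s = 0 := by
    intro s hs
    have hmin : IsLocalMin Real.smoothTransition s ∨ IsLocalMax Real.smoothTransition s := by
      rcases hs with hs | hs
      · left
        filter_upwards with y
        rw [Real.smoothTransition.zero_of_nonpos hs]
        exact Real.smoothTransition.nonneg y
      · right
        filter_upwards with y
        rw [Real.smoothTransition.one_of_one_le hs]
        exact Real.smoothTransition.le_one y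
    exact hmin.elim (fun h => h.deriv_eq_zero) fun h => h.deriv_eq_zero
  have hχ0 : ∀ r, 0 < r → r ∉ Icc (Real.exp (t - 1)) (Real.exp t) → χ r = 0 := by
    intro r hr h
    refine hderiv0 _ ?_
    by_cases h1 : r < Real.exp (t - 1)
    · right
      have := (Real.log_le_iff_le_exp hr).2 h1.le
      linarith
    · left
      have h2 : Real.exp t < r := by
        by_contra! h2
        exact h ⟨not_lt.1 h1, h2⟩
      have := (Real.le_log_iff_exp_le hr).2 h2.le
      linarith
  have hχc : ContinuousOn χ (Ioi 0) := continuous_deriv_smoothTransition.comp_continuousOn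
    (continuousOn_const.sub (Real.continuousOn_log.mono fun r hr => (ne_of_gt hr : r ≠ 0)))
  -- in polar coordinates
  set G : ℝ × ℝ → ℂ := fun q => -(χ q.1 : ℂ) / (2 * q.1) *
    (circleMap 0 q.1 q.2 * F (circleMap p q.1 q.2)) with hG
  have hpol : ∫ z in Metric.ball p R₀ \ {p}, dbar (radialCutoff p t) z * F z =
      ∫ q in Ioi (0 : ℝ) ×ˢ Ioo (-Real.pi) Real.pi, G q := by
    rw [← integral_indicator hmeas, ← integral_add_left_eq_self _ p,
      ← Complex.integral_comp_polarCoord_symm, polarCoord_target]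
    refine setIntegral_congr_fun (measurableSet_Ioi.prod measurableSet_Ioo) ?_
    rintro ⟨r, θ⟩ ⟨hr, -⟩
    have hr : 0 < r := hr
    have hcm : p + Complex.polarCoord.symm (r, θ) = circleMap p r θ := by
      rw [Complex.polarCoord_symm_apply, circleMap, Complex.exp_mul_I]
      push_cast
      rfl
    have hcm0 : circleMap p r θ - p = circleMap 0 r θ := by simp [circleMap]
    have hne : circleMap p r θ ≠ p := circleMap_ne_center hr.ne'
    have hn : ‖circleMap p r θ - p‖ = r := by simp [abs_of_pos hr]
    have hinv : conj (circleMap p r θ - p)⁻¹ = circleMap 0 r θ / r ^ 2 := by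
      rw [hcm0, ← hcm0, Complex.inv_def, map_mul, Complex.conj_conj, Complex.conj_ofReal,
        Complex.normSq_eq_norm_sq, hn]
      push_cast
      rw [div_eq_mul_inv]
    have hrc : (r : ℂ) ≠ 0 := Complex.ofReal_ne_zero.2 hr.ne'
    change r • (indicator (Metric.ball p R₀ \ {p}) (fun z => dbar (radialCutoff p t) z * F z)
      (p + Complex.polarCoord.symm (r, θ))) = G (r, θ)
    rw [hcm]
    by_cases hrR : r < R₀
    · rw [indicator_of_mem (by
        refine ⟨?_, hne⟩
        rwa [mem_ball_iff_norm, hn]), dbar_radialCutoff hne, hn, hinv]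
      simp only [hG, hχ, Complex.real_smul]
      field_simp
    · rw [indicator_of_notMem (by
        intro h
        rw [Set.mem_sdiff, mem_ball_iff_norm, hn] at h
        exact hrR h.1)]
      simp only [hG]
      rw [hχ0 r hr fun h => hrR (h.2.trans_lt hR)]
      simp
  have hGc : ContinuousOn G (Icc (Real.exp (t - 1)) (Real.exp t) ×ˢ Icc (-Real.pi) Real.pi) := by
    have hcirc : ∀ w : ℂ, Continuous fun q : ℝ × ℝ => circleMap w q.1 q.2 := fun w => by
      unfold circleMap
      fun_prop
    have hr0 : ∀ q ∈ Icc (Real.exp (t - 1)) (Real.exp t) ×ˢ Icc (-Real.pi) Real.pi, 0 < q.1 :=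
      fun q hq => hexp'.trans_le hq.1.1
    refine ContinuousOn.mul (ContinuousOn.div ?_ (by fun_prop) fun q hq => ?_)
      ((hcirc 0).continuousOn.mul (hF.comp (hcirc p).continuousOn fun q hq => ?_))
    · exact (Complex.continuous_ofReal.comp_continuousOn (hχc.comp continuousOn_fst hr0)).neg
    · exact mul_ne_zero two_ne_zero (Complex.ofReal_ne_zero.2 (hr0 q hq).ne')
    · refine ⟨?_, circleMap_ne_center (hr0 q hq).ne'⟩
      rw [mem_ball_iff_norm]
      simp only [circleMap_sub_center, norm_circleMap_zero, abs_of_pos (hr0 q hq)]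
      exact hq.1.2.trans_lt hR
  have hGi : IntegrableOn G (Ioi (0 : ℝ) ×ˢ Ioo (-Real.pi) Real.pi) := by
    refine IntegrableOn.of_forall_sdiff_eq_zero (hGc.integrableOn_compact
      (isCompact_Icc.prod isCompact_Icc)) (measurableSet_Ioi.prod measurableSet_Ioo) ?_
    rintro ⟨r, θ⟩ ⟨⟨hr, hθ⟩, h⟩
    have : χ r = 0 := hχ0 r hr fun h1 => h ⟨h1, Ioo_subset_Icc_self hθ⟩
    simp [hG, this]
  -- The angular integral of z F is the circle integral of F divided by i, that is 2πc, for each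
  -- radius less than R₀; beyond R₀ the factor χ vanishes.
  have hinner : ∀ r ∈ Ioi (0 : ℝ), ∫ θ in Ioo (-Real.pi) Real.pi, G (r, θ) =
      ((-(χ r) / r : ℝ) : ℂ) * (Real.pi * c) := by
    intro r hr
    have hr : 0 < r := hr
    have hrc : (r : ℂ) ≠ 0 := Complex.ofReal_ne_zero.2 hr.ne'
    simp only [hG]
    rw [integral_const_mul]
    by_cases hrR : r < R₀
    · have h1 := hc r hr hrR
      have hper : Function.Periodic (fun θ => circleMap 0 r θ * F (circleMap p r θ)) (2 * Real.pi) := by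
        intro θ
        simp only [periodic_circleMap 0 r θ, periodic_circleMap p r θ]
      have h2 : ∫ θ in Ioo (-Real.pi) Real.pi, circleMap 0 r θ * F (circleMap p r θ) =
          ∫ θ in (0 : ℝ)..2 * Real.pi, circleMap 0 r θ * F (circleMap p r θ) := by
        rw [← integral_Ioc_eq_integral_Ioo, ← intervalIntegral.integral_of_le (by linarith [Real.pi_pos])]
        have := hper.intervalIntegral_add_eq (-Real.pi) 0
        rw [zero_add] at this
        rw [← this]
        congr 1
        ring
      rw [circleIntegral] at h1
      simp only [deriv_circleMap, smul_eq_mul] at h1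
      have h3 : (∫ θ in (0 : ℝ)..2 * Real.pi, circleMap 0 r θ * Complex.I * F (circleMap p r θ)) =
          Complex.I * ∫ θ in (0 : ℝ)..2 * Real.pi, circleMap 0 r θ * F (circleMap p r θ) := by
        rw [← intervalIntegral.integral_const_mul]
        congr 1
        ext θ
        ring
      rw [h3] at h1
      rw [h2]
      have h4 : (∫ θ in (0 : ℝ)..2 * Real.pi, circleMap 0 r θ * F (circleMap p r θ)) = 2 * Real.pi * c :=
        mul_left_cancel₀ Complex.I_ne_zero (by rw [h1]; ring)
      rw [h4]
      push_cast
      field_simp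
    · have : χ r = 0 := hχ0 r hr fun h => hrR (h.2.trans_lt hR)
      simp [this]
  rw [hpol, Measure.volume_eq_prod, setIntegral_prod _ hGi, setIntegral_congr_fun measurableSet_Ioi hinner,
    integral_mul_const, integral_complex_ofReal]
  -- The integrand is the radial derivative of the cutoff, which falls from 1 to 0.
  have hint : ∫ r in Ioi (0 : ℝ), -(χ r) / r = -1 := by
    have hd : ∀ r ∈ Ioi (0 : ℝ), HasDerivAt (fun r => Real.smoothTransition (t - Real.log r)) (-(χ r) / r) r := by
      intro r hr
      refine ((hasDerivAt_smoothTransition _).comp r ((Real.hasDerivAt_log (ne_of_gt hr)).const_sub t)).congr_deriv ?_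
      simp only [hχ]
      ring
    have h1 : ∫ r in Ioi (0 : ℝ), -(χ r) / r = ∫ r in Ioc (Real.exp (t - 1)) (Real.exp t), -(χ r) / r := by
      refine (setIntegral_eq_of_subset_of_forall_sdiff_eq_zero (f := fun r => -(χ r) / r) measurableSet_Ioi
        (fun r (hr : r ∈ Ioc (Real.exp (t - 1)) (Real.exp t)) => hexp'.trans hr.1) fun r hr => ?_)
      by_cases hre : r = Real.exp (t - 1)
      · have : χ r = 0 := by
          simp only [hχ, hre, Real.log_exp]
          exact hderiv0 _ (Or.inr (by linarith))
        rw [this, neg_zero, zero_div]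
      · rw [hχ0 r hr.1 fun h => hr.2 ⟨lt_of_le_of_ne h.1 (Ne.symm hre), h.2⟩, neg_zero, zero_div]
    have hle : Real.exp (t - 1) ≤ Real.exp t := Real.exp_le_exp.2 (by linarith)
    have hpos : ∀ r ∈ uIcc (Real.exp (t - 1)) (Real.exp t), r ∈ Ioi (0 : ℝ) := fun r hr => by
      rw [uIcc_of_le hle] at hr
      exact hexp'.trans_le hr.1
    rw [h1, ← intervalIntegral.integral_of_le hle,
      intervalIntegral.integral_eq_sub_of_hasDerivAt (fun r hr => hd r (hpos r hr))]
    · rw [Real.log_exp, Real.log_exp, sub_self, Real.smoothTransition.zero,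
        Real.smoothTransition.one_of_one_le (by linarith), zero_sub]
    · refine ContinuousOn.intervalIntegrable (((hχc.mono hpos).neg).div continuousOn_id fun r hr => ?_)
      exact (ne_of_gt (hpos r hr) : r ≠ 0)
  rw [hint]
  push_cast
  ring

/-- Stokes' theorem for a form with a simple pole: a version of the residue theorem. -/
theorem integral_dbar_mul_eq_residue (hV : IsOpen V) (hK : IsCompact K) (hKV : K ⊆ V)
    (hu : ContDiffOn ℝ 1 u V) (hu0 : ∀ z ∈ V, z ∉ K → u z = 0) {p c : ℂ} (hp : p ∈ V)
    (hu1 : ∀ᶠ z in 𝓝 p, u z = 1) (hF : DifferentiableOn ℂ F (V \ {p})) (hc : IsResidue F p c) :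
    ∫ z in V, dbar u z * F z = -Real.pi * c := by
  obtain ⟨r₁, hr₁, hcirc⟩ := hc.circleIntegral_eq
  obtain ⟨r₂, hr₂, hballV⟩ := Metric.isOpen_iff.1 hV p hp
  obtain ⟨r₃, hr₃, hball1⟩ := Metric.eventually_nhds_iff_ball.1 hu1
  set R₀ := min r₁ r₂ with hR₀
  have hR₀0 : 0 < R₀ := lt_min hr₁ hr₂
  set t := Real.log (R₀ / 2) with ht
  have hexpt : Real.exp t = R₀ / 2 := Real.exp_log (by positivity)
  have hBV : Metric.ball p R₀ \ {p} ⊆ V \ {p} :=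
    sdiff_subset_sdiff_left ((Metric.ball_subset_ball (min_le_right _ _)).trans hballV)
  have hV' : IsOpen (V \ {p}) := hV.sdiff isClosed_singleton
  -- Near p both u and η are 1, so u − η is a cutoff on V \ {p}, where F is holomorphic. By Stokes u
  -- and η give the same integral, and for η it is known.
  set η := radialCutoff p t with hη
  have hηc : ContDiffOn ℝ 1 η (V \ {p}) := (contDiffOn_radialCutoff p t).mono fun z hz => hz.2
  have huc : ContDiffOn ℝ 1 u (V \ {p}) := hu.mono sdiff_subset
  set ε := min r₃ (Real.exp (t - 1)) with hε
  have hε0 : 0 < ε := lt_min hr₃ (Real.exp_pos _)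
  have hsmall : ∀ z ∈ Metric.ball p ε, z ≠ p → u z = 1 ∧ η z = 1 := fun z hz hzp =>
    ⟨hball1 z (Metric.ball_subset_ball (min_le_left _ _) hz), radialCutoff_eq_one hzp
      ((mem_ball_iff_norm.1 hz).le.trans (min_le_right _ _))⟩
  have hcb : Metric.closedBall p (R₀ / 2) ⊆ V := (Metric.closedBall_subset_ball (half_lt_self hR₀0)).trans
    ((Metric.ball_subset_ball (min_le_right _ _)).trans hballV)
  set K' := (K ∪ Metric.closedBall p (R₀ / 2)) \ Metric.ball p ε with hK'
  have hK'c : IsCompact K' := (hK.union (isCompact_closedBall _ _)).diff Metric.isOpen_ball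
  have hK'V : K' ⊆ V \ {p} := fun z hz =>
    ⟨hz.1.elim (fun h => hKV h) fun h => hcb h, fun h => hz.2 (by
      rw [mem_singleton_iff.1 h]; exact Metric.mem_ball_self hε0)⟩
  have hfar : ∀ z, z ∉ Metric.closedBall p (R₀ / 2) → η z = 0 := fun z hz => by
    refine radialCutoff_eq_zero ?_
    rw [mem_closedBall_iff_norm, not_le] at hz
    rw [hexpt]
    exact hz.le
  have hdiff := integral_dbar_mul_eq_zero (u := fun z => u z - η z) hV' hK'c hK'V (huc.sub hηc)
    (fun z hz hzK => by
      by_cases h1 : z ∈ Metric.ball p ε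
      · rw [(hsmall z h1 hz.2).1, (hsmall z h1 hz.2).2, sub_self]
      · have h2 : z ∉ K := fun h => hzK ⟨Or.inl h, h1⟩
        have h3 : z ∉ Metric.closedBall p (R₀ / 2) := fun h => hzK ⟨Or.inr h, h1⟩
        rw [hu0 z hz.1 h2, hfar z h3, sub_self]) hF
  have hη0 : ∀ z ∈ V \ {p}, z ∉ K' → dbar η z = 0 := by
    intro z hz hzK
    have hzp : {p}ᶜ ∈ 𝓝 z := isOpen_compl_singleton.mem_nhds hz.2
    by_cases h1 : z ∈ Metric.ball p ε
    · rw [dbar_congr (v := fun _ => 1), dbar_const]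
      filter_upwards [Metric.isOpen_ball.mem_nhds h1, hzp] with w hw hwp using (hsmall w hw hwp).2
    · rw [dbar_congr (v := fun _ => 0), dbar_const]
      filter_upwards [Metric.isClosed_closedBall.isOpen_compl.mem_nhds
        (show z ∈ (Metric.closedBall p (R₀ / 2))ᶜ from fun h => hzK ⟨Or.inr h, h1⟩)] with w hw
      exact hfar w hw
  have hu0' : ∀ z ∈ V \ {p}, z ∉ K' → dbar u z = 0 := by
    intro z hz hzK
    by_cases h1 : z ∈ Metric.ball p ε
    · rw [dbar_congr (v := fun _ => 1), dbar_const]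
      filter_upwards [Metric.isOpen_ball.mem_nhds h1] with w hw
      exact hball1 w (Metric.ball_subset_ball (min_le_left _ _) hw)
    · exact dbar_eq_zero_of_notMem hV hK hu0 hz.1 fun h => hzK ⟨Or.inl h, h1⟩
  have hηi : IntegrableOn (fun z => dbar η z * F z) (V \ {p}) :=
    ((hηc.continuousOn_dbar hV').mul hF.continuousOn).integrableOn_of_eq_zero hV' hK'c hK'V
      fun z hz hzK => by rw [hη0 z hz hzK, zero_mul]
  have hui : IntegrableOn (fun z => dbar u z * F z) (V \ {p}) :=
    ((huc.continuousOn_dbar hV').mul hF.continuousOn).integrableOn_of_eq_zero hV' hK'c hK'V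
      fun z hz hzK => by rw [hu0' z hz hzK, zero_mul]
  have hsplit : ∫ z in V \ {p}, dbar (fun z => u z - η z) z * F z =
      (∫ z in V \ {p}, dbar u z * F z) - ∫ z in V \ {p}, dbar η z * F z := by
    rw [← integral_sub hui hηi]
    refine setIntegral_congr_fun hV'.measurableSet fun z hz => ?_
    have hn := hV'.mem_nhds hz
    rw [dbar_sub ((huc.differentiableOn one_ne_zero).differentiableAt hn)
      ((hηc.differentiableOn one_ne_zero).differentiableAt hn), sub_mul]
  have hηV : ∫ z in V \ {p}, dbar η z * F z = ∫ z in Metric.ball p R₀ \ {p}, dbar η z * F z := by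
    refine setIntegral_eq_of_subset_of_forall_sdiff_eq_zero hV'.measurableSet hBV fun z hz => ?_
    have h1 : z ∉ Metric.closedBall p (R₀ / 2) := fun h =>
      hz.2 ⟨Metric.closedBall_subset_ball (by linarith) h, hz.1.2⟩
    rw [dbar_congr (v := fun _ => 0), dbar_const, zero_mul]
    filter_upwards [Metric.isClosed_closedBall.isOpen_compl.mem_nhds
      (show z ∈ (Metric.closedBall p (R₀ / 2))ᶜ from h1)] with w hw
    exact hfar w hw
  have hres := integral_dbar_radialCutoff (t := t) (R₀ := R₀) (by rw [hexpt]; linarith)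
    (hF.continuousOn.mono hBV) (fun ρ h1 h2 => hcirc ρ h1 (h2.trans_le (min_le_left _ _)))
  have hVp : ∫ z in V, dbar u z * F z = ∫ z in V \ {p}, dbar u z * F z :=
    setIntegral_congr_set (sdiff_null_ae_eq_self (measure_singleton p)).symm
  rw [hVp]
  rw [hsplit, hηV, hres] at hdiff
  linear_combination hdiff

end PlaneStokes

/-! ### The residue theorem on a compact Riemann surface -/

section ResidueTheorem

open scoped ComplexConjugate

variable {R : Type*} [TopologicalSpace R] [ChartedSpace ℂ R]

/-- A finite smooth partition of unity by functions supported in charts. Near a point of `P` only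
the function that belongs to this point does not vanish. -/
structure IsCutoffFamily (P S : Finset R) (ρ : R → R → ℂ) (C : R → Set R) : Prop where
  smooth : ∀ q k, ContDiffOn ℝ 1 (ρ q ∘ (chartAt ℂ k).symm) (chartAt ℂ k).target
  closed : ∀ q, IsClosed (C q)
  subset : ∀ q, C q ⊆ (chartAt ℂ q).source
  eq_zero : ∀ q, ∀ x ∉ C q, ρ q x = 0
  notMem : ∀ p ∈ P, ∀ q, p ≠ q → p ∉ C q
  sum : ∀ x, ∑ q ∈ S, ρ q x = 1
  mem : P ⊆ S

/-- A smooth partition of unity subordinate to the chart domains with all points of P removed except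
the index itself. Local finiteness and compactness leave finitely many functions that are not
identically zero. -/
theorem exists_isCutoffFamily [IsManifold 𝓘(ℂ, ℂ) ω R] [CompactSpace R] [T2Space R] (P : Finset R) :
    ∃ S ρ C, IsCutoffFamily P S ρ C := by
  classical
  have : IsManifold 𝓘(ℝ, ℂ) ∞ R := isManifold_real _
  set U : R → Set R := fun q => (chartAt ℂ q).source \ (↑(P.erase q) : Set R) with hU
  obtain ⟨f, hf⟩ := SmoothPartitionOfUnity.exists_isSubordinate 𝓘(ℝ, ℂ) (isClosed_univ (X := R)) U
    (fun q => (chartAt ℂ q).open_source.sdiff (P.erase q).finite_toSet.isClosed)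
    fun x _ => mem_iUnion.2 ⟨x, mem_chart_source ℂ x, by simp⟩
  have hfin : {q | (Function.support (f q)).Nonempty}.Finite :=
    f.locallyFinite.finite_nonempty_of_compact
  have hsub : ∀ x, Function.support (fun q => f q x) ⊆ (hfin.toFinset : Set R) := fun x q hq => by
    rw [Set.Finite.coe_toFinset]
    exact ⟨x, hq⟩
  have hsum : ∀ x, ∑ q ∈ hfin.toFinset, f q x = 1 := fun x => by
    rw [← finsum_eq_sum_of_support_subset _ (hsub x)]
    exact f.sum_eq_one (mem_univ x)
  have hnot : ∀ p ∈ P, ∀ q, p ≠ q → p ∉ tsupport (f q) := fun p hp q hpq h =>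
    (hf q h).2 (Finset.mem_coe.2 (Finset.mem_erase.2 ⟨hpq, hp⟩))
  refine ⟨hfin.toFinset, fun q x => f q x, fun q => tsupport (f q), fun q k => ?_,
    fun q => isClosed_tsupport _, fun q => (hf q).trans sdiff_subset, fun q x hx => ?_, hnot,
    fun x => by exact_mod_cast hsum x, fun p hp => ?_⟩
  · have h1 := (((f q).contMDiff.contMDiffOn (s := univ)).comp
      (contMDiffOn_chart_symm (I := 𝓘(ℝ, ℂ)) (n := ∞) (x := k)) (fun _ _ => mem_univ _)).contDiffOn
    exact (Complex.ofRealCLM.contDiff.comp_contDiffOn h1).of_le (by exact_mod_cast le_top)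
  · have : f q x = 0 := image_eq_zero_of_notMem_tsupport hx
    simp [this]
  · by_contra hpS
    have h1 := hsum p
    rw [Finset.sum_eq_zero] at h1
    · exact zero_ne_one h1
    · intro q hq
      refine image_eq_zero_of_notMem_tsupport (hnot p hp q ?_)
      rintro rfl
      exact hpS hq

variable {P S : Finset R} {ρ : R → R → ℂ} {C : R → Set R}

theorem IsCutoffFamily.eventually_eq_zero (h : IsCutoffFamily P S ρ C) {x q : R} (hx : x ∉ C q) :
    ∀ᶠ y in 𝓝 x, ρ q y = 0 :=
  eventually_of_mem ((h.closed q).isOpen_compl.mem_nhds hx) fun y hy => h.eq_zero q y hy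

/-- Near p all other functions vanish, and the sum is 1. -/
theorem IsCutoffFamily.eventually_eq_one (h : IsCutoffFamily P S ρ C) {p : R} (hp : p ∈ P) :
    ∀ᶠ y in 𝓝 p, ρ p y = 1 := by
  classical
  have h1 : ∀ᶠ y in 𝓝 p, ∀ q ∈ S.erase p, ρ q y = 0 := by
    rw [Finset.eventually_all]
    exact fun q hq => h.eventually_eq_zero (h.notMem p hp q (Finset.ne_of_mem_erase hq).symm)
  filter_upwards [h1] with y hy
  have h2 := h.sum y
  rw [← Finset.add_sum_erase S _ (h.mem hp), Finset.sum_eq_zero hy, add_zero] at h2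
  exact h2

theorem IsCutoffFamily.eventually_const (h : IsCutoffFamily P S ρ C) {p : R} (hp : p ∈ P) (q : R) :
    ∃ c : ℂ, ∀ᶠ y in 𝓝 p, ρ q y = c := by
  by_cases hpq : p = q
  · exact ⟨1, hpq ▸ h.eventually_eq_one hp⟩
  · exact ⟨0, h.eventually_eq_zero (h.notMem p hp q hpq)⟩

theorem dbar_chart_symm_eq_zero {v : R → ℂ} {c : ℂ} {k : R} {z : ℂ} (hz : z ∈ (chartAt ℂ k).target)
    (hv : ∀ᶠ y in 𝓝 ((chartAt ℂ k).symm z), v y = c) :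
    ∀ᶠ w in 𝓝 z, dbar (v ∘ (chartAt ℂ k).symm) w = 0 := by
  have h1 := ((chartAt ℂ k).continuousAt_symm hz).eventually hv
  filter_upwards [h1.eventually_nhds] with w hw
  exact (dbar_congr (v := fun _ => c) hw).trans (dbar_const c w)

theorem dbar_sum {ι : Type*} (s : Finset ι) {u : ι → ℂ → ℂ} {z : ℂ}
    (hu : ∀ i ∈ s, DifferentiableAt ℝ (u i) z) :
    dbar (fun z => ∑ i ∈ s, u i z) z = ∑ i ∈ s, dbar (u i) z := by
  simp only [dbar]
  rw [fderiv_fun_sum hu]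
  simp only [_root_.sum_apply, Finset.mul_sum, ← Finset.sum_add_distrib, Finset.sum_div]

variable [IsManifold 𝓘(ℂ, ℂ) ω R] {Φ : R → ℂ →L[ℂ] (Fin 3 → ℂ)}

/-- The transformation of the coefficient of a form under a change of charts. -/
theorem formCoeff_eq_mul (Φ : R → ℂ →L[ℂ] (Fin 3 → ℂ)) {q k : R} {z : ℂ}
    (hz : z ∈ (chartAt ℂ q).target) (hzk : (chartAt ℂ q).symm z ∈ (chartAt ℂ k).source) :
    ∃ m : ℂ, HasDerivAt (chartAt ℂ k ∘ (chartAt ℂ q).symm) m z ∧ ∀ j,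
      formCoeff Φ (chartAt ℂ q) z j = m * formCoeff Φ (chartAt ℂ k) (chartAt ℂ k ((chartAt ℂ q).symm z)) j := by
  have : IsManifold 𝓘(ℂ, ℂ) 1 R := IsManifold.of_le (n := ω) le_top
  set e := chartAt ℂ q with he
  set f := chartAt ℂ k with hf
  have hq := hasMFDerivAt_chart_symm q hz
  have hd : DifferentiableAt ℂ (f ∘ e.symm) z :=
    (((mdifferentiable_chart (I := 𝓘(ℂ, ℂ)) k).mdifferentiableAt hzk).comp z
      hq.mdifferentiableAt).differentiableAt
  have hτ := hd.hasDerivAt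
  refine ⟨deriv (f ∘ e.symm) z, hτ, fun j => ?_⟩
  have hfz : f.symm (f (e.symm z)) = e.symm z := f.left_inv hzk
  have h1 := (hasMFDerivAt_chart_symm k (z := (f ∘ e.symm) z) (f.map_source hzk)).comp z
    hτ.hasFDerivAt.hasMFDerivAt
  have h2 : e.symm =ᶠ[𝓝 z] f.symm ∘ (f ∘ e.symm) := by
    filter_upwards [(e.continuousAt_symm hz).eventually (f.open_source.mem_nhds hzk)] with w hw
    exact (f.left_inv hw).symm
  have h3 := (h1.congr_of_eventuallyEq h2).mfderiv
  rw [hq.mfderiv] at h3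
  have h4 := congrArg (fun L : ℂ →L[ℂ] ℂ => L 1) h3
  have h5 : coordScale e z = deriv (f ∘ e.symm) z * coordScale f (f (e.symm z)) := by
    have h6 : ContinuousLinearMap.toSpanSingleton ℂ (coordScale e z) 1 =
      ContinuousLinearMap.toSpanSingleton ℂ (coordScale f (f (e.symm z)))
        (ContinuousLinearMap.toSpanSingleton ℂ (deriv (f ∘ e.symm) z) 1) := h4
    simpa using h6
  rw [formCoeff, formCoeff, hfz, h5, ← smul_eq_mul, map_smul]
  rfl

/-- The integral of `ρ_k ∂ρ_q / ∂z̄ Φ` does not depend on the chart. -/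
theorem IsCutoffFamily.integral_eq (h : IsCutoffFamily P S ρ C) (Φ : R → ℂ →L[ℂ] (Fin 3 → ℂ))
    (j : Fin 3) (q k : R) :
    ∫ z in (chartAt ℂ q).target, ρ k ((chartAt ℂ q).symm z) *
        (dbar (ρ q ∘ (chartAt ℂ q).symm) z * formCoeff Φ (chartAt ℂ q) z j) =
      ∫ z in (chartAt ℂ k).target, ρ k ((chartAt ℂ k).symm z) *
        (dbar (ρ q ∘ (chartAt ℂ k).symm) z * formCoeff Φ (chartAt ℂ k) z j) := by
  have hs1 := h.subset q
  have hs2 := h.subset k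
  have hsm := h.smooth q k
  set s : Set ℂ := (chartAt ℂ q).target ∩ (chartAt ℂ q).symm ⁻¹' (chartAt ℂ k).source with hs
  have htr : ∀ z ∈ s, ∃ m : ℂ, HasDerivAt (chartAt ℂ k ∘ (chartAt ℂ q).symm) m z ∧ ∀ j,
      formCoeff Φ (chartAt ℂ q) z j = m * formCoeff Φ (chartAt ℂ k) (chartAt ℂ k ((chartAt ℂ q).symm z)) j :=
    fun z hz => formCoeff_eq_mul Φ hz.1 hz.2
  have hzero : ∀ z ∈ (chartAt ℂ k).target, (chartAt ℂ k).symm z ∉ C q →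
      dbar (ρ q ∘ (chartAt ℂ k).symm) z = 0 := fun z hz hzC =>
    (dbar_chart_symm_eq_zero hz (h.eventually_eq_zero hzC)).self_of_nhds
  set e := chartAt ℂ q with he
  set f := chartAt ℂ k with hf
  have hso : IsOpen s := e.isOpen_inter_preimage_symm f.open_source
  choose! m hm hmΦ using htr
  have himg : (f ∘ e.symm) '' s ⊆ f.target := by
    rintro _ ⟨z, hz, rfl⟩
    exact f.map_source hz.2
  -- Only the overlap of the two charts contributes: on one side ρ_k vanishes elsewhere, on the
  -- other side ∂̄ρ_q does.
  have hleft : ∫ z in e.target, ρ k (e.symm z) * (dbar (ρ q ∘ e.symm) z * formCoeff Φ e z j) =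
      ∫ z in s, ρ k (e.symm z) * (dbar (ρ q ∘ e.symm) z * formCoeff Φ e z j) := by
    refine setIntegral_eq_of_subset_of_forall_sdiff_eq_zero e.open_target.measurableSet
      inter_subset_left fun z hz => ?_
    rw [h.eq_zero k _ fun hC => hz.2 ⟨hz.1, hs2 hC⟩, zero_mul]
  have hright : ∫ z in f.target, ρ k (f.symm z) * (dbar (ρ q ∘ f.symm) z * formCoeff Φ f z j) =
      ∫ z in (f ∘ e.symm) '' s, ρ k (f.symm z) * (dbar (ρ q ∘ f.symm) z * formCoeff Φ f z j) := by
    refine setIntegral_eq_of_subset_of_forall_sdiff_eq_zero f.open_target.measurableSet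
      himg fun z hz => ?_
    rw [hzero z hz.1 fun hC => hz.2 ?_, zero_mul, mul_zero]
    have h1 := hs1 hC
    refine ⟨e (f.symm z), ⟨e.map_source h1, ?_⟩, ?_⟩
    · rw [mem_preimage, e.left_inv h1]
      exact f.map_target hz.1
    · rw [Function.comp_apply, e.left_inv h1, f.right_inv hz.1]
  rw [hleft, hright, integral_image_eq_integral_abs_det_fderiv_smul volume hso.measurableSet
    (fun z hz => (hm z hz).complexToReal_fderiv.hasFDerivWithinAt)
    (fun z hz w hw hzw => e.symm.injOn hz.1 hw.1 (f.injOn hz.2 hw.2 hzw))]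
  refine setIntegral_congr_fun hso.measurableSet fun z hz => ?_
  have hτ : f.symm ((f ∘ e.symm) z) = e.symm z := f.left_inv hz.2
  -- The Jacobian |m|² splits as m times its conjugate: one factor transforms the coefficient of the
  -- form, the other comes from the chain rule for ∂̄.
  have hdet : |(m z • (1 : ℂ →L[ℝ] ℂ)).det| = Complex.normSq (m z) := by
    rw [det_complex, Complex.normSq_apply]
    simp only [_root_.smul_apply, one_apply_eq_self, smul_eq_mul, mul_one, Complex.mul_re, Complex.mul_im,
      Complex.I_re, Complex.I_im, mul_zero, zero_sub, add_zero, neg_mul, sub_neg_eq_add]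
    exact abs_of_nonneg (by nlinarith [mul_self_nonneg (m z).re, mul_self_nonneg (m z).im])
  have hcomp : dbar (ρ q ∘ e.symm) z = dbar (ρ q ∘ f.symm) ((f ∘ e.symm) z) * conj (m z) := by
    rw [← dbar_comp_holomorphic (u := ρ q ∘ f.symm) ?_ (hm z hz)]
    · refine dbar_congr ?_
      filter_upwards [hso.mem_nhds hz] with w hw
      exact congrArg (ρ q) (f.left_inv hw.2).symm
    · exact (hsm.differentiableOn one_ne_zero).differentiableAt
        (f.open_target.mem_nhds (f.map_source hz.2))
  change _ = |(m z • (1 : ℂ →L[ℝ] ℂ)).det| • (ρ k (f.symm ((f ∘ e.symm) z)) *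
    (dbar (ρ q ∘ f.symm) ((f ∘ e.symm) z) * formCoeff Φ f ((f ∘ e.symm) z) j))
  rw [hdet, hτ, hcomp, hmΦ z hz, Complex.real_smul, Complex.normSq_eq_conj_mul_self]
  simp only [Function.comp_apply]
  ring

omit [IsManifold 𝓘(ℂ, ℂ) ω R] in
-- At a point of P the form may be singular, but ρ_q is locally constant there, so the product
-- vanishes in a neighbourhood.
theorem IsCutoffFamily.continuousOn_dbar_mul (h : IsCutoffFamily P S ρ C)
    (hhol : IsHolomorphicFormOn Φ (↑P : Set R)ᶜ) (hP : IsOpen ((↑P : Set R)ᶜ)) (j : Fin 3) (q k : R) :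
    ContinuousOn (fun z => dbar (ρ q ∘ (chartAt ℂ k).symm) z * formCoeff Φ (chartAt ℂ k) z j)
      (chartAt ℂ k).target := by
  intro z hz
  by_cases hzP : (chartAt ℂ k).symm z ∈ P
  · obtain ⟨c, hc⟩ := h.eventually_const hzP q
    refine ContinuousAt.continuousWithinAt ?_
    refine (continuousAt_const (y := (0 : ℂ))).congr ?_
    filter_upwards [dbar_chart_symm_eq_zero hz hc] with w hw
    rw [hw, zero_mul]
  · have h1 := ((h.smooth q k).continuousOn_dbar (chartAt ℂ k).open_target).continuousAt
      ((chartAt ℂ k).open_target.mem_nhds hz)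
    have h2 := (hhol k j).continuousOn.continuousAt
      ((isOpen_chartDomain hP k).mem_nhds (⟨hz, hzP⟩ : z ∈ chartDomain (↑P : Set R)ᶜ k))
    exact (h1.mul h2).continuousWithinAt

/-- The sum of the residues of a form on a compact Riemann surface vanishes. -/
theorem sum_residue_eq_zero [CompactSpace R] [T2Space R] (P : Finset R)
    (hhol : IsHolomorphicFormOn Φ (↑P : Set R)ᶜ) {c : R → Fin 3 → ℂ}
    (hc : ∀ p ∈ P, IsFormResidue Φ p (c p)) (j : Fin 3) : ∑ p ∈ P, c p j = 0 := by
  classical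
  obtain ⟨S, ρ, C, h⟩ := exists_isCutoffFamily P
  have hPo : IsOpen ((↑P : Set R)ᶜ) := P.finite_toSet.isClosed.isOpen_compl
  set B : R → R → ℂ → ℂ := fun q k z =>
    dbar (ρ q ∘ (chartAt ℂ k).symm) z * formCoeff Φ (chartAt ℂ k) z j with hB
  have hBc : ∀ q k, ContinuousOn (B q k) (chartAt ℂ k).target := fun q k =>
    h.continuousOn_dbar_mul hhol hPo j q k
  have hρc : ∀ q k, ContinuousOn (fun z => ρ q ((chartAt ℂ k).symm z)) (chartAt ℂ k).target :=
    fun q k => (h.smooth q k).continuousOn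
  set K : R → Set ℂ := fun k => chartAt ℂ k '' C k with hK
  have hKc : ∀ k, IsCompact (K k) := fun k =>
    (h.closed k).isCompact.image_of_continuousOn ((chartAt ℂ k).continuousOn.mono (h.subset k))
  have hKt : ∀ k, K k ⊆ (chartAt ℂ k).target := by
    rintro k _ ⟨x, hx, rfl⟩
    exact (chartAt ℂ k).map_source (h.subset k hx)
  have hnot : ∀ k, ∀ z ∈ (chartAt ℂ k).target, z ∉ K k → (chartAt ℂ k).symm z ∉ C k :=
    fun k z hz hzK hC => hzK ⟨_, hC, (chartAt ℂ k).right_inv hz⟩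
  have hρ0 : ∀ k, ∀ z ∈ (chartAt ℂ k).target, z ∉ K k → ρ k ((chartAt ℂ k).symm z) = 0 :=
    fun k z hz hzK => h.eq_zero k _ (hnot k z hz hzK)
  have hB0 : ∀ k, ∀ z ∈ (chartAt ℂ k).target, z ∉ K k → B k k z = 0 := fun k z hz hzK => by
    simp only [hB]
    rw [(dbar_chart_symm_eq_zero hz (h.eventually_eq_zero (hnot k z hz hzK))).self_of_nhds, zero_mul]
  have hint1 : ∀ q k, IntegrableOn (fun z => ρ k ((chartAt ℂ q).symm z) * B q q z) (chartAt ℂ q).target :=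
    fun q k => ((hρc k q).mul (hBc q q)).integrableOn_of_eq_zero (chartAt ℂ q).open_target (hKc q)
      (hKt q) fun z hz hzK => by rw [hB0 q z hz hzK, mul_zero]
  have hint2 : ∀ q k, IntegrableOn (fun z => ρ k ((chartAt ℂ k).symm z) * B q k z) (chartAt ℂ k).target :=
    fun q k => ((hρc k k).mul (hBc q k)).integrableOn_of_eq_zero (chartAt ℂ k).open_target (hKc k)
      (hKt k) fun z hz hzK => by rw [hρ0 k z hz hzK, zero_mul]
  -- the sum of the integrals over the charts
  have hsum : ∑ q ∈ S, ∫ z in (chartAt ℂ q).target, B q q z = 0 := by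
    -- Insert 1 = Σ ρ_k and carry the k-th term over to the chart at k.
    have h1 : ∀ q ∈ S, ∫ z in (chartAt ℂ q).target, B q q z =
        ∑ k ∈ S, ∫ z in (chartAt ℂ k).target, ρ k ((chartAt ℂ k).symm z) * B q k z := by
      intro q _
      rw [Finset.sum_congr rfl fun k _ => (h.integral_eq Φ j q k).symm,
        ← integral_finsetSum S fun k _ => hint1 q k]
      refine setIntegral_congr_fun (chartAt ℂ q).open_target.measurableSet fun z _ => ?_
      simp only [hB]
      rw [← Finset.sum_mul, h.sum, one_mul]
    rw [Finset.sum_congr rfl h1, Finset.sum_comm]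
    refine Finset.sum_eq_zero fun k _ => ?_
    rw [← integral_finsetSum S fun q _ => hint2 q k]
    refine setIntegral_eq_zero_of_forall_eq_zero fun z hz => ?_
    -- For fixed k all terms are in one chart, where Σ ∂̄ρ_q = ∂̄1 = 0.
    have h2 : ∑ q ∈ S, dbar (ρ q ∘ (chartAt ℂ k).symm) z = 0 := by
      rw [← dbar_sum S fun q _ => ((h.smooth q k).differentiableOn one_ne_zero).differentiableAt
        ((chartAt ℂ k).open_target.mem_nhds hz)]
      simp only [Function.comp_apply, h.sum, dbar_const]
    simp only [hB]
    rw [← Finset.mul_sum, ← Finset.sum_mul, h2, zero_mul, mul_zero]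
  -- each integral is computed by Stokes' theorem
  set V : R → Set ℂ := fun q => (chartAt ℂ q).target ∩ (chartAt ℂ q).symm ⁻¹' (↑(P.erase q) : Set R)ᶜ with hV
  have hVo : ∀ q, IsOpen (V q) := fun q =>
    (chartAt ℂ q).isOpen_inter_preimage_symm (P.erase q).finite_toSet.isClosed.isOpen_compl
  have hKV : ∀ q, K q ⊆ V q := by
    rintro q _ ⟨x, hx, rfl⟩
    refine ⟨(chartAt ℂ q).map_source (h.subset q hx), ?_⟩
    rw [mem_preimage, (chartAt ℂ q).left_inv (h.subset q hx)]
    intro hxP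
    have hxP' := Finset.mem_erase.1 (Finset.mem_coe.1 hxP)
    exact h.notMem x hxP'.2 q hxP'.1 hx
  have hVint : ∀ q, ∫ z in (chartAt ℂ q).target, B q q z = ∫ z in V q, B q q z := fun q =>
    setIntegral_eq_of_subset_of_forall_sdiff_eq_zero (chartAt ℂ q).open_target.measurableSet
      inter_subset_left fun z hz => hB0 q z hz.1 fun hzK => hz.2 (hKV q hzK)
  have hP0 : ∀ q ∈ S, q ∉ P → ∫ z in (chartAt ℂ q).target, B q q z = 0 := by
    intro q _ hq
    rw [hVint]
    refine integral_dbar_mul_eq_zero (hVo q) (hKc q) (hKV q) ((h.smooth q q).mono inter_subset_left)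
      (fun z hz hzK => hρ0 q z hz.1 hzK) ((hhol q j).mono fun z hz => ⟨hz.1, ?_⟩)
    have := hz.2
    rwa [Finset.erase_eq_of_notMem hq] at this
  have hPres : ∀ p ∈ P, ∫ z in (chartAt ℂ p).target, B p p z = -Real.pi * c p j := by
    intro p hp
    rw [hVint]
    have hpt := mem_chart_target ℂ p
    have hpp : (chartAt ℂ p).symm (chartAt ℂ p p) = p := (chartAt ℂ p).left_inv (mem_chart_source ℂ p)
    refine integral_dbar_mul_eq_residue (hVo p) (hKc p) (hKV p) ((h.smooth p p).mono inter_subset_left)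
      (fun z hz hzK => hρ0 p z hz.1 hzK) (p := chartAt ℂ p p) ⟨hpt, ?_⟩ ?_
      ((hhol p j).mono fun z hz => ⟨hz.1.1, ?_⟩) (hc p hp j)
    · rw [mem_preimage, hpp]
      simp
    · have := (chartAt ℂ p).continuousAt_symm hpt
      rw [ContinuousAt, hpp] at this
      exact this.eventually (h.eventually_eq_one hp)
    · intro hzP
      refine hz.1.2 (Finset.mem_coe.2 (Finset.mem_erase.2 ⟨fun h0 => hz.2 ?_, hzP⟩))
      have := congrArg (chartAt ℂ p) h0
      rwa [(chartAt ℂ p).right_inv hz.1.1] at this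
  rw [← Finset.sum_subset h.mem hP0, Finset.sum_congr rfl hPres, ← Finset.mul_sum] at hsum
  exact (mul_eq_zero.1 hsum).resolve_left (neg_ne_zero.2 (Complex.ofReal_ne_zero.2 Real.pi_ne_zero))

end ResidueTheorem

/-! ### Ends of embedded surfaces of finite total curvature -/

section EmbeddedEnds

/-- The residue of a linear combination. -/
theorem isResidue_sum_mul {f : Fin 3 → ℂ → ℂ} {z₀ : ℂ} {c : Fin 3 → ℂ}
    (h : ∀ j, IsResidue (f j) z₀ (c j)) (w : Fin 3 → ℂ) :
    IsResidue (fun z => ∑ j, w j * f j z) z₀ (∑ j, w j * c j) := by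
  choose a r hr ha hs using h
  refine ⟨fun n => ∑ j, w j * a j n, min (r 0) (min (r 1) (r 2)),
    lt_min (hr 0) (lt_min (hr 1) (hr 2)), by simp only [ha], fun z hz hzr => ?_⟩
  have hle : ∀ j, min (r 0) (min (r 1) (r 2)) ≤ r j := by
    intro j
    fin_cases j <;> simp
  have := hasSum_sum (s := Finset.univ) fun j (_ : j ∈ Finset.univ) =>
    (hs j z hz (hzr.trans_le (hle j))).mul_left (w j)
  simpa only [Finset.sum_mul, mul_assoc] using this

variable {R : Type*} [TopologicalSpace R] [ChartedSpace ℂ R] {M : Set R} {p : R} {X : R → E3}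
  {Φ : R → ℂ →L[ℂ] (Fin 3 → ℂ)} {φ : ℂ → Fin 3 → ℂ} {r : ℝ} {ν : E3}

theorem planeGauss_endMap (X : R → E3) (p : R) (z : ℂ) : planeGauss (endMap X p) z =
    planeGauss (X ∘ (chartAt ℂ p).symm) (chartAt ℂ p p + z) := by
  have h : fderiv ℝ (endMap X p) z = fderiv ℝ (X ∘ (chartAt ℂ p).symm) (chartAt ℂ p p + z) :=
    fderiv_comp_add_left (f := X ∘ (chartAt ℂ p).symm) (chartAt ℂ p p)
  rw [planeGauss, planeGauss, planeNormal, planeNormal, h]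

theorem gaussArea_endMap (X : R → E3) (p : R) (z : ℂ) : gaussArea (endMap X p) z =
    gaussArea (X ∘ (chartAt ℂ p).symm) (chartAt ℂ p p + z) := by
  have h : fderiv ℝ (planeGauss (endMap X p)) z =
      fderiv ℝ (planeGauss (X ∘ (chartAt ℂ p).symm)) (chartAt ℂ p p + z) := by
    rw [funext (planeGauss_endMap X p)]
    exact fderiv_comp_add_left (f := planeGauss (X ∘ (chartAt ℂ p).symm)) (chartAt ℂ p p)
  rw [gaussArea, gaussArea, h, planeGauss_endMap]

/-- The surface cannot be tilted against its limit tangent plane at an end of logarithmic growth. -/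
theorem HasLogGrowth.apply_two_sq_eq_one {A : E3 ≃ₗᵢ[ℝ] E3} {α : ℝ}
    (hα : HasLogGrowth (fun q => A (X q)) M p α) (h : IsPlaneEnd (endMap X p) φ r)
    (hinj : InjOn (endMap X p) (Metric.ball 0 r \ {0})) (hν : ‖ν‖ = 1)
    (hN : Tendsto (planeGauss (endMap X p)) (𝓝[≠] 0) (𝓝 ν)) : A ν 2 ^ 2 = 1 := by
  set e₃ : E3 := EuclideanSpace.single 2 1 with he₃
  -- The height of A ∘ X is the height of X in the direction A⁻¹ e₃. It grows at most
  -- logarithmically in the distance, so this direction is normal to the limit tangent plane.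
  have hinner : ∀ y, ⟪A.symm e₃, y⟫ = A y 2 := fun y => by
    rw [← A.inner_map_map, A.apply_symm_apply, he₃, EuclideanSpace.inner_single_left]
    simp
  obtain ⟨r₀, hr₀, B, hB⟩ := hα.exists_bound
  obtain ⟨ε, hε, hεr, hball⟩ := exists_radius_of_eventually
    ((tendsto_chart_symm_add p).eventually hB) h.pos
  have hgraph := (h.mono hε hεr).containsSublinearGraph
    (hinj.mono (puncturedBall_subset hεr)) hν hN
  have hm : ‖A.symm e₃‖ = 1 := by rw [A.symm.norm_map]; simp [he₃]
  rw [← hinner]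
  refine hgraph.inner_sq_eq_one hm fun δ hδ => ?_
  obtain ⟨K, hK⟩ := exists_abs_log_le hr₀ (δ := δ / (|α| + 1)) (by positivity)
  refine ⟨|α| * K + B, ?_⟩
  rintro _ ⟨z, hz, rfl⟩
  obtain ⟨h1, h2⟩ := hball z hz
  rw [hinner]
  change |A (endMap X p z) 2| ≤ _
  change r₀ < √(A (endMap X p z) 0 ^ 2 + A (endMap X p z) 1 ^ 2) at h1
  change |A (endMap X p z) 2 - α * Real.log √(A (endMap X p z) 0 ^ 2 + A (endMap X p z) 1 ^ 2)| ≤ B at h2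
  have h5 : √(A (endMap X p z) 0 ^ 2 + A (endMap X p z) 1 ^ 2) ≤ ‖endMap X p z‖ := by
    rw [← A.norm_map, EuclideanSpace.norm_eq]
    refine Real.sqrt_le_sqrt ?_
    simp only [Fin.sum_univ_three, Real.norm_eq_abs, sq_abs]
    linarith [sq_nonneg (A (endMap X p z) 2)]
  set ρ := √(A (endMap X p z) 0 ^ 2 + A (endMap X p z) 1 ^ 2) with hρ
  have h3 := hK ρ h1
  have hρ0 : 0 ≤ ρ := Real.sqrt_nonneg _
  have h4 : |α * Real.log ρ| ≤ |α| * (δ / (|α| + 1) * ρ + K) := by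
    rw [abs_mul]
    gcongr
  have h6 : |α| * (δ / (|α| + 1)) ≤ δ := by
    rw [mul_div_assoc', div_le_iff₀ (by positivity)]
    nlinarith [abs_nonneg α]
  have h7 : |α| * (δ / (|α| + 1)) * ρ ≤ δ * ‖endMap X p z‖ := mul_le_mul h6 h5 hρ0 hδ.le
  calc |A (endMap X p z) 2| = |(A (endMap X p z) 2 - α * Real.log ρ) + α * Real.log ρ| := by ring_nf
    _ ≤ B + |α| * (δ / (|α| + 1) * ρ + K) := (abs_add_le _ _).trans (add_le_add h2 h4)
    _ ≤ δ * ‖endMap X p z‖ + (|α| * K + B) := by linarith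

/-- The ends of disjoint embedded pieces are parallel. -/
theorem inner_sq_eq_one_of_disjoint {S S' : Set E3} {ν' : E3} (h : ContainsSublinearGraph S ν)
    (h' : ContainsSublinearGraph S' ν') (hd : Disjoint S S') : ⟪ν, ν'⟫ ^ 2 = 1 := by
  refine le_antisymm ?_ (not_lt.1 fun hlt => ?_)
  · rw [sq_le_one_iff_abs_le_one]
    refine (abs_real_inner_le_norm ν ν').trans ?_
    rw [h.1, h'.1, one_mul]
  · exact (h.inter_nonempty h' hlt).ne_empty hd.inter_eq

variable [IsManifold 𝓘(ℂ, ℂ) ω R]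

/-- The punctured disc in its single chart is one of the families over which the supremum
`totalAbsCurvature` is taken. -/
theorem IsConformalImmersionOn.lintegral_gaussArea_ne_top (hX : IsConformalImmersionOn X M)
    (hM : IsOpen M) (hr : ContainsPuncturedDisc M p r) (hfin : totalAbsCurvature X M < ⊤) :
    ∫⁻ z in Metric.ball (0 : ℂ) r \ {0}, ENNReal.ofReal (gaussArea (endMap X p) z) ≠ ⊤ := by
  set D : Set ℂ := Metric.ball (chartAt ℂ p p) r \ {chartAt ℂ p p} with hD
  have hDM : D ⊆ chartDomain M p := by
    intro z hz
    have h1 := hr (z - chartAt ℂ p p) (by simpa [dist_eq_norm] using hz.1)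
    rw [add_sub_cancel] at h1
    exact ⟨h1.1, h1.2 (sub_ne_zero.2 hz.2)⟩
  have hDm : MeasurableSet D := measurableSet_ball.diff (measurableSet_singleton _)
  have hpre : (fun z => chartAt ℂ p p + z) ⁻¹' D = Metric.ball (0 : ℂ) r \ {0} := by
    ext z
    simp [hD]
  have h1 : ∫⁻ z in Metric.ball (0 : ℂ) r \ {0}, ENNReal.ofReal (gaussArea (endMap X p) z) =
      ∫⁻ z in D, ENNReal.ofReal (gaussArea (X ∘ (chartAt ℂ p).symm) z) := by
    rw [← (measurePreserving_add_left volume (chartAt ℂ p p)).setLIntegral_comp_preimage_emb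
      (measurableEmbedding_addLeft _) _ D, hpre]
    simp only [gaussArea_endMap]
  have h2 : ∫⁻ z in D, ENNReal.ofReal (gaussArea (X ∘ (chartAt ℂ p).symm) z) =
      ∫⁻ z in D, ENNReal.ofReal
        (|gaussCurvature X ((chartAt ℂ p).symm z)| * areaDensity X (chartAt ℂ p) z) :=
    setLIntegral_congr_fun hDm fun z hz =>
      congrArg ENNReal.ofReal (hX.gaussCurvature_mul_areaDensity hM p (hDM hz)).symm
  rw [h1, h2]
  refine (lt_of_le_of_lt ?_ hfin).ne
  refine le_iSup_of_le 1 (le_iSup_of_le (fun _ => p) (le_iSup_of_le (fun _ => D)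
    (le_iSup_of_le ⟨fun _ => ⟨hDm, fun z hz => (hDM hz).1, ?_⟩,
      fun i j hij => (hij (Subsingleton.elim i j)).elim⟩ (by simp))))
  rintro _ ⟨z, hz, rfl⟩
  exact (hDM hz).2

/-- A small punctured disc at a puncture of an embedded surface. -/
theorem IsPuncture.exists_isPlaneEnd [T2Space R] (hp : IsPuncture M p)
    (hX : IsConformalImmersionOn X M) (hM : IsOpen M) (hmin : IsMinimalOn X M)
    (hcomplete : IsCompleteOn X M) (hΦ : IsRealPartOfIntegralOn X Φ M) (hinj : InjOn X M) {D : Set R}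
    (hD : IsOpen D) (hpD : p ∈ D) : ∃ r > 0, ContainsPuncturedDisc M p r ∧
      IsPlaneEnd (endMap X p) (endForm Φ p) r ∧ InjOn (endMap X p) (Metric.ball 0 r \ {0}) ∧
      endMap X p '' (Metric.ball 0 r \ {0}) ⊆ X '' (D ∩ M) := by
  obtain ⟨r₁, hr₁, hr⟩ := hp.exists_containsPuncturedDisc
  obtain ⟨r₂, hr₂, hrD⟩ := exists_radius_chart hD hpD
  have hr' := hr.mono (min_le_left r₁ r₂)
  have hpos : 0 < min r₁ r₂ := lt_min hr₁ hr₂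
  refine ⟨_, hpos, hr', hX.isPlaneEnd hM hmin hcomplete hΦ hp.1 hpos hr',
    hr'.injOn_endMap hinj fun z hz hz0 => (hr' z hz).2 hz0, ?_⟩
  rintro _ ⟨z, hz, rfl⟩
  exact ⟨_, ⟨hrD z (Metric.ball_subset_ball (min_le_right _ _) hz.1), (hr' z hz.1).2 hz.2⟩, rfl⟩

/-- The Gauss map extends to the punctures of an embedded surface of finite total curvature. -/
theorem IsPuncture.exists_tendsto_planeGauss [T2Space R] (hp : IsPuncture M p)
    (hX : IsConformalImmersionOn X M) (hM : IsOpen M) (hmin : IsMinimalOn X M)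
    (hcomplete : IsCompleteOn X M) (hΦ : IsRealPartOfIntegralOn X Φ M)
    (hfin : totalAbsCurvature X M < ⊤) :
    ∃ ν, ‖ν‖ = 1 ∧ Tendsto (planeGauss (endMap X p)) (𝓝[≠] 0) (𝓝 ν) := by
  obtain ⟨r, hr0, hr⟩ := hp.exists_containsPuncturedDisc
  exact (hX.isPlaneEnd hM hmin hcomplete hΦ hp.1 hr0 hr).exists_tendsto_planeGauss
    (hX.lintegral_gaussArea_ne_top hM hr hfin)

/-- The limit normals at two punctures of an embedded surface are parallel. -/
theorem IsPuncture.inner_sq_eq_one [T2Space R] {p' : R} {ν' : E3} (hp : IsPuncture M p)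
    (hp' : IsPuncture M p') (hX : IsConformalImmersionOn X M) (hM : IsOpen M)
    (hmin : IsMinimalOn X M) (hcomplete : IsCompleteOn X M) (hΦ : IsRealPartOfIntegralOn X Φ M)
    (hinj : InjOn X M) (hν : ‖ν‖ = 1) (hN : Tendsto (planeGauss (endMap X p)) (𝓝[≠] 0) (𝓝 ν))
    (hν' : ‖ν'‖ = 1) (hN' : Tendsto (planeGauss (endMap X p')) (𝓝[≠] 0) (𝓝 ν')) :
    ⟪ν, ν'⟫ ^ 2 = 1 := by
  by_cases hpp : p = p'
  · subst hpp
    have := tendsto_nhds_unique hN hN'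
    subst this
    simp [hν]
  -- Ends chosen in disjoint neighbourhoods have disjoint images by injectivity, so the two
  -- sublinear graphs cannot meet.
  · obtain ⟨D, D', hD, hD', hpD, hpD', hdisj⟩ := t2_separation hpp
    obtain ⟨r, -, -, h, hi, hsub⟩ := hp.exists_isPlaneEnd hX hM hmin hcomplete hΦ hinj hD hpD
    obtain ⟨r', -, -, h', hi', hsub'⟩ := hp'.exists_isPlaneEnd hX hM hmin hcomplete hΦ hinj hD' hpD'
    refine inner_sq_eq_one_of_disjoint (h.containsSublinearGraph hi hν hN)
      (h'.containsSublinearGraph hi' hν' hN') (Disjoint.mono hsub hsub' ?_)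
    refine Set.disjoint_left.2 ?_
    rintro _ ⟨x, hx, rfl⟩ ⟨y, hy, hxy⟩
    have := hinj hy.2 hx.2 hxy
    subst this
    exact Set.disjoint_left.1 hdisj hx.1 hy.1

/-- The logarithmic growth of a rotated embedded end with vertical limit normal. -/
theorem IsPuncture.exists_logGrowth [T2Space R] (hp : IsPuncture M p)
    (hX : IsConformalImmersionOn X M) (hM : IsOpen M) (hmin : IsMinimalOn X M)
    (hcomplete : IsCompleteOn X M) (hΦ : IsRealPartOfIntegralOn X Φ M) (hinj : InjOn X M)
    {A : E3 ≃ₗᵢ[ℝ] E3} (hA : LinearMap.det (A.toLinearEquiv : E3 →ₗ[ℝ] E3) = 1)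
    (hν : A ν 2 ^ 2 = 1) (hN : Tendsto (planeGauss (endMap X p)) (𝓝[≠] 0) (𝓝 ν)) :
    ∃ a : ℝ, HasLogGrowth (fun q => A (X q)) M p (-a) ∧
      (∀ α, HasLogGrowth (fun q => A (X q)) M p α → α = -a) ∧
      ∀ c : Fin 3 → ℂ, IsFormResidue Φ p c → ∑ j, (rotationEntry A 2 j : ℂ) * c j = a := by
  obtain ⟨r, hr0, hr, h, hi, -⟩ :=
    hp.exists_isPlaneEnd hX hM hmin hcomplete hΦ hinj isOpen_univ (mem_univ p)
  have hrot : IsPlaneEnd (endMap (fun q => A (X q)) p) (rotateForm A (endForm Φ p)) r := h.rotate A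
  -- The sign σ is −(A ν)₃, which covers both vertical directions.
  have hlim : Tendsto (fun z => planeGauss (endMap (fun q => A (X q)) p) z 2) (𝓝[≠] 0)
      (𝓝 (-(-A ν 2))) := by
    rw [neg_neg]
    refine tendsto_apply_two (((A.continuous.tendsto ν).comp hN).congr fun z => ?_)
    exact (planeGauss_rotate A hA (endMap X p) z).symm
  obtain ⟨a, h1, h2, h3⟩ := hrot.exists_logGrowth hr
    (A.injective.comp_injOn hi) (by rw [neg_sq, hν]) hlim
  refine ⟨a, h1, h2, fun c hc => (h3 (fun i => ∑ j, (rotationEntry A i j : ℂ) * c j) fun i => ?_).2.2⟩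
  simp only [rotateForm, endForm_sub]
  exact isResidue_sum_mul hc _

end EmbeddedEnds
end

/-! ### Assembly of the theorem -/

theorem proposition2p3 {R : Type*} [TopologicalSpace R] [T2Space R] [ChartedSpace ℂ R]
    [IsManifold 𝓘(ℂ, ℂ) ω R] (M : Set R) (hMo : IsOpen M) (hMc : IsConnected M)
    (X : R → E3) (hX : IsConformalImmersionOn X M) (hmin : IsMinimalOn X M)
    (hcomplete : IsCompleteOn X M)
    (Φ : R → ℂ →L[ℂ] (Fin 3 → ℂ)) (hΦ : IsRealPartOfIntegralOn X Φ M) :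
    -- the branches of the conjugate surface are conformal immersions
    (∀ (U : Set R) (F : R → E3), IsOpen U → U ⊆ M →
      IsRealPartOfIntegralOn F (conjugateForm Φ) U → IsConformalImmersionOn F U) ∧
    -- the flux is minus the period of the conjugate surface
    (∀ γ : ℝ → R, IsClosedCurveIn M γ →
      flux X γ = -period (conjugateForm Φ) γ ∧
      (∃ Y : ℝ → E3, IsContinuationAlong (conjugateForm Φ) M γ Y) ∧
      ∀ Y : ℝ → E3, IsContinuationAlong (conjugateForm Φ) M γ Y → flux X γ = -(Y 1 - Y 0)) ∧
    -- the flux around a puncture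
    (∀ p : R, IsPuncture M p →
      (∃ c : Fin 3 → ℂ, IsFormResidue Φ p c) ∧
      ∀ c : Fin 3 → ℂ, IsFormResidue Φ p c →
        ∀ γ : ℝ → R, IsClosedCurveIn M γ → InHomologyClassOfPuncture M p γ →
          ∀ j, ((flux X γ j : ℝ) : ℂ) = -2 * (Real.pi : ℂ) * c j) ∧
    -- the flux of a vertical embedded end of finite total curvature
    (∀ p : R, IsVerticalEmbeddedEnd X M p →
      (∃ α : ℝ, HasLogGrowth X M p α) ∧
      ∀ γ : ℝ → R, IsClosedCurveIn M γ → InHomologyClassOfPuncture M p γ →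
        (∀ α : ℝ, HasLogGrowth X M p α → flux X γ = !₂[0, 0, 2 * Real.pi * α]) ∧
        (flux X γ 0 = 0 ∧ flux X γ 1 = 0) ∧
        (flux X γ = 0 ↔ IsFlatEnd X M p)) ∧
    -- embedded surfaces of finite total curvature; `A` is a rotation that makes the ends vertical
    (CompactSpace R → ∀ P : Finset R, M = (↑P : Set R)ᶜ →
      IsEmbedding (fun q : M => X q) → totalAbsCurvature X M < ⊤ →
      (∃ A : E3 ≃ₗᵢ[ℝ] E3, LinearMap.det (A.toLinearEquiv : E3 →ₗ[ℝ] E3) = 1 ∧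
        ∀ p ∈ P, ∃ α : ℝ, HasLogGrowth (fun q => A (X q)) M p α) ∧
      ∀ A : E3 ≃ₗᵢ[ℝ] E3, LinearMap.det (A.toLinearEquiv : E3 →ₗ[ℝ] E3) = 1 →
        ∀ α : R → ℝ, (∀ p ∈ P, HasLogGrowth (fun q => A (X q)) M p (α p)) →
          ∑ p ∈ P, α p = 0) := by
  classical
  have hhol : IsHolomorphicFormOn Φ M := hX.differentiableOn_formCoeff hMo hmin hΦ
  refine ⟨fun U F hU hUM hF => hX.conjugate hMo hΦ hU hUM hF, fun γ hγ => ?_, fun p hp => ?_,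
    fun p hp => ?_, fun hcompact P hMP hemb hfin => ?_⟩
  · refine ⟨hX.flux_eq hMo hΦ hhol hγ, hhol.conjugateForm.exists_isContinuationAlong hMo hγ,
      fun Y hY => ?_⟩
    rw [hX.flux_eq hMo hΦ hhol hγ, hY.period_eq hMo hhol.conjugateForm hγ]
  · exact ⟨hp.exists_isFormResidue hhol, fun c hc γ hγ hhom j =>
      hX.flux_eq_residue hMo hΦ hhol hc hγ hhom j⟩
  · obtain ⟨a, ha, huniq, hres⟩ := hp.exists_logGrowth hX hMo hmin hcomplete hΦ
    refine ⟨⟨-a, ha⟩, fun γ hγ hhom => ?_⟩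
    obtain ⟨c, hc⟩ := hp.1.exists_isFormResidue hhol
    obtain ⟨hc0, hc1, hc2⟩ := hres c hc
    have hflux := hX.flux_eq_residue hMo hΦ hhol hc hγ hhom
    have h0 : flux X γ 0 = 0 := by simpa [hc0] using hflux 0
    have h1 : flux X γ 1 = 0 := by simpa [hc1] using hflux 1
    have h2 : flux X γ 2 = -2 * Real.pi * a := by
      have := hflux 2
      rw [hc2] at this
      exact Complex.ofReal_injective (by rw [this]; push_cast; ring)
    refine ⟨fun α hα => E3.ext (by simpa using h0) (by simpa using h1) ?_, ⟨h0, h1⟩,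
      fun hz => ?_, fun hz => E3.ext h0 h1 ?_⟩
    · rw [huniq α hα, h2]
      simp
    · have h3 : -2 * Real.pi * a = 0 := by rw [← h2, hz]; rfl
      have h4 : a = 0 := by simpa [Real.pi_ne_zero] using h3
      rw [h4, neg_zero] at ha
      exact ha
    · have h4 : a = 0 := by linarith [huniq 0 hz]
      rw [h2, h4, mul_zero]
      rfl
  · have hinj : InjOn X M := injOn_iff_injective.2 hemb.injective
    have hpunc : ∀ p ∈ P, IsPuncture M p := fun p hp => by
      refine ⟨fun h => (hMP ▸ h) (Finset.mem_coe.2 hp), ?_⟩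
      have h1 : ((↑(P.erase p) : Set R)ᶜ) ∈ 𝓝 p :=
        (P.erase p).finite_toSet.isClosed.isOpen_compl.mem_nhds (by simp)
      filter_upwards [self_mem_nhdsWithin, mem_nhdsWithin_of_mem_nhds h1] with q hq1 hq2
      rw [hMP]
      exact fun hq => hq2 (Finset.mem_coe.2 (Finset.mem_erase.2 ⟨hq1, Finset.mem_coe.1 hq⟩))
    choose! ν hν hN using fun p hp => (hpunc p hp).exists_tendsto_planeGauss hX hMo hmin hcomplete hΦ hfin
    constructor
    · rcases P.eq_empty_or_nonempty with rfl | ⟨p₀, hp₀⟩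
      · exact ⟨LinearIsometryEquiv.refl ℝ E3, LinearMap.det_id, fun p hp => absurd hp (by simp)⟩
      -- One limit normal is made vertical; the others are parallel to it and become vertical too.
      · obtain ⟨A, hA, hAν⟩ := exists_rotation (hν p₀ hp₀)
        refine ⟨A, hA, fun p hp => ?_⟩
        have h1 := (hpunc p₀ hp₀).inner_sq_eq_one (hpunc p hp) hX hMo hmin hcomplete hΦ hinj
          (hν p₀ hp₀) (hN p₀ hp₀) (hν p hp) (hN p hp)
        rw [← A.inner_map_map, hAν, inner_E3] at h1
        have h2 : A (ν p) 2 ^ 2 = 1 := by simpa using h1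
        obtain ⟨a, ha, -⟩ := (hpunc p hp).exists_logGrowth hX hMo hmin hcomplete hΦ hinj hA h2 (hN p hp)
        exact ⟨-a, ha⟩
    · intro A hA α hα
      choose! c hc using fun p hp => (hpunc p hp).exists_isFormResidue hhol
      -- For an arbitrary rotation A the assumed growth forces A ν to be vertical at each puncture.
      -- Then each α is minus the third component of the rotated residue, a fixed linear function of
      -- residues that sum to zero.
      have hαc : ∀ p ∈ P, (α p : ℂ) = -∑ j, (rotationEntry A 2 j : ℂ) * c p j := fun p hp => by
        obtain ⟨r, -, -, h, hi, -⟩ := (hpunc p hp).exists_isPlaneEnd hX hMo hmin hcomplete hΦ hinj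
          isOpen_univ (mem_univ p)
        have h2 := (hα p hp).apply_two_sq_eq_one h hi (hν p hp) (hN p hp)
        obtain ⟨a, -, huniq, hres⟩ :=
          (hpunc p hp).exists_logGrowth hX hMo hmin hcomplete hΦ hinj hA h2 (hN p hp)
        rw [huniq _ (hα p hp), hres _ (hc p hp), Complex.ofReal_neg]
      have hzero := sum_residue_eq_zero P (hMP ▸ hhol) hc
      have hsum : ((∑ p ∈ P, α p : ℝ) : ℂ) = 0 := by
        rw [Complex.ofReal_sum, Finset.sum_congr rfl hαc, Finset.sum_neg_distrib, Finset.sum_comm]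
        simp only [← Finset.mul_sum, hzero, mul_zero, Finset.sum_const_zero, neg_zero]
      exact_mod_cast hsum
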